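/- Write $\beta_1,\dots,\beta_{n-1}$ for the elementary generators of the braid group on $n$ strands. Put $\Gamma_r=\beta_r\beta_{r-1}\cdots\beta_2\beta_1\beta_1\beta_2\cdots\beta_{r-1}\beta_r$, and define words $\Phi_n,\Psi_n$ for $n\ge 4$ by $$\Phi_4=\beta_2^{-1}\beta_2^{-1}\beta_1\beta_2^{-1},\qquad \Phi_{n+1}=\beta_{n-2}\,\beta_{n-1}\,\Phi_n\,\beta_{n-1}^{-1},$$ $$\Psi_4=\beta_2\beta_2\beta_2\beta_1^{-1}\beta_2,\qquad \Psi_{n+1}=\beta_{n-1}^{-1}\,\Psi_n\,\beta_{n-1}.$$ For integers $n\ge4$ and $k\ge0$ let $$B_{n,k}=\Gamma_{n-2}^{-k}\,\Phi_n\,\Gamma_{n-2}^{k}\,\beta_{n-1}\,\Psi_n\,\beta_{n-1}^{-1},$$ and denote also by $B_{n,k}\subset S^3$ the corresponding closed braid, with unknotted braid axis $A\subset S^3\setminus B_{n,k}$. For $m\ge2$ and $k\ge0$, let $p\colon M\to S^3$ be the double cover of $S^3$ branched along the knot $B_{2m,k}$ (this knot is trivial, so that $M\cong S^3$), and let $L_{2m,k}=p^{-1}(A)\subset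 M$. **Corollary.** For all $m\ge2$ and $k\ge0$, $L_{2m,k}$ is a link with exactly two components, and the algebraic linking number of these two components is nonzero. More precisely, for any orientations of the components, its absolute value is $$(4m+132)k^2-(12m+150)k+(9m+36).$$ -/

import Mathlib

/-! ## Braid words and the braids `B_{n,k}` -/

/-- A braid word: `(j, true)` is the elementary braid `β_j` and `(j, false)` is its inverse. -/
abbrev BraidWord : Type := List (ℕ × Bool)

/-- The word `Φ_n`, for `n ≥ 4`:
`Φ_4 = β₂⁻¹ β₂⁻¹ β₁ β₂⁻¹` and `Φ_{n+1} = β_{n-2} β_{n-1} Φ_n β_{n-1}⁻¹`. -/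
def phiWord : ℕ → BraidWord
  | 4 => [(2, false), (2, false), (1, true), (2, false)]
  | n + 5 => [(n + 2, true), (n + 3, true)] ++ phiWord (n + 4) ++ [(n + 3, false)]
  | _ => []

/-- The word `Ψ_n`, for `n ≥ 4`:
`Ψ_4 = β₂ β₂ β₂ β₁⁻¹ β₂` and `Ψ_{n+1} = β_{n-1}⁻¹ Ψ_n β_{n-1}`. -/
def psiWord : ℕ → BraidWord
  | 4 => [(2, true), (2, true), (2, true), (1, false), (2, true)]
  | n + 5 => [(n + 3, false)] ++ psiWord (n + 4) ++ [(n + 3, true)]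
  | _ => []

/-- The word `Γ_r = β_r β_{r-1} ⋯ β₂ β₁ β₁ β₂ ⋯ β_{r-1} β_r`. -/
def gammaWord (r : ℕ) : BraidWord :=
  ((List.range r).reverse.map fun j => (j + 1, true)) ++
    ((List.range r).map fun j => (j + 1, true))

/-- The `k`-fold concatenation of a braid word with itself. -/
def wordPow (w : BraidWord) (k : ℕ) : BraidWord := (List.replicate k w).flatten

/-- The braid `B_{n,k} = Γ_{n-2}^{-k} Φ_n Γ_{n-2}^k β_{n-1} Ψ_n β_{n-1}⁻¹` on `n ≥ 4` strands. -/
def birmanMenascoWord (n k : ℕ) : BraidWord :=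
  FreeGroup.invRev (wordPow (gammaWord (n - 2)) k) ++ phiWord n ++ wordPow (gammaWord (n - 2)) k ++
    [(n - 1, true)] ++ psiWord n ++ [(n - 1, false)]

/-! ## Closed braids in the 3-sphere -/

/-- The 3-sphere, as the unit sphere of `ℂ²`. -/
abbrev Sphere3 : Type := Metric.sphere (0 : EuclideanSpace ℂ (Fin 2)) 1

/-- The braid axis: the unknotted circle `{(z, w) ∈ S³ : w = 0}`. Its complement is the open solid
torus `ℂ × S¹`, where `(c, u)` corresponds to the point of `S³` on the ray through `(c, u)`. -/
def braidAxis : Set Sphere3 := {x | x.1 1 = 0}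

/-- The motion of `q ∈ ℂ` during the time `s ∈ [0, 1]` in which one letter of a braid word is
performed: the letter `β_j` rotates the points `j` and `j + 1` by a half turn
about their midpoint, `β_j⁻¹` rotates them the other way, and all other points rest. -/
noncomputable def strandPoint (l : ℕ × Bool) (s : ℝ) (q : ℕ) : ℂ :=
  let rot : ℂ := Complex.exp ((if l.2 then 1 else -1) * Real.pi * s * Complex.I)
  if q = l.1 then (l.1 : ℂ) + 1 / 2 - rot / 2
  else if q = l.1 + 1 then (l.1 : ℂ) + 1 / 2 + rot / 2
  else (q : ℂ)

/-- The closed braid in `S³` on the strands `1, …, n` that a nonempty word `w` describes. If `w` has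
`N` letters, then its letter number `j` (counted from `0`) is performed while the angle around the
axis runs from `2πj/N` to `2π(j+1)/N`. -/
def closedBraid (n : ℕ) (w : BraidWord) : Set Sphere3 :=
  {x | ∃ j : Fin w.length, ∃ s ∈ Set.Icc (0 : ℝ) 1, ∃ q ∈ Finset.Icc 1 n, ∃ r : ℝ, 0 < r ∧
    x.1 0 = r * strandPoint (w.get j) s q ∧
    x.1 1 = r * Complex.exp (2 * Real.pi * ((j + s) / w.length) * Complex.I)}

/-! ## Double branched covers -/

/-- `p : M → N` is a double cover of the 3-manifold `N` branched along the curve `B`: it is a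
two-sheeted covering over the complement of `B`, and over a neighbourhood of each point of `B`
it is the map `(z, t) ↦ (z², t)` of `ℂ × ℝ`, where `B` corresponds to `{0} × ℝ`. -/
structure IsDoubleBranchedCover {M N : Type*} [TopologicalSpace M] [TopologicalSpace N]
    (p : M → N) (B : Set N) : Prop where
  continuous : Continuous p
  covering : ∀ x ∉ B, IsEvenlyCovered p x (Fin 2)
  branched : ∀ b ∈ B, ∃ (φ : ℂ × ℝ → N) (ψ : ℂ × ℝ → M),
    Topology.IsOpenEmbedding φ ∧ Topology.IsOpenEmbedding ψ ∧
    φ (0, 0) = b ∧ φ ⁻¹' B = {y | y.1 = 0} ∧ Set.range ψ = p ⁻¹' Set.range φ ∧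
    ∀ z t, p (ψ (z, t)) = φ (z ^ 2, t)

/-! ## Linking numbers -/

/-- The map `g : S¹ → S¹` is continuous of degree `n`: it has a continuous lift `θ : ℝ → ℝ`,
with respect to `t ↦ exp (2πit)`, that grows by `n` over a period. -/
def HasDegree (g : Circle → Circle) (n : ℤ) : Prop :=
  ∃ θ : ℝ → ℝ, Continuous θ ∧
    (∀ t, g (Circle.exp (2 * Real.pi * t)) = Circle.exp (2 * Real.pi * θ t)) ∧ θ 1 = θ 0 + n

/-- `μ` is a meridian of the (locally flat) curve `K` in the 3-manifold `M`: it is the boundary of a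
disk that crosses `K` exactly once, at the centre of a flat chart. -/
def IsMeridian {M : Type*} [TopologicalSpace M] (K : Set M) (μ : Circle → M) : Prop :=
  ∃ φ : ℂ × ℝ → M, Topology.IsOpenEmbedding φ ∧ φ ⁻¹' K = {y | y.1 = 0} ∧
    ∀ u : Circle, μ u = φ ((u : ℂ), 0)

/-- The algebraic linking number of the knot `K` and the loop `γ` in its complement is `n`, for the
orientation of `K` that makes some meridian `μ` of `K` positive (so that without a choice of
orientations `n` is determined up to sign). It is the pairing of `γ` with the class in
`H¹(M ∖ K; ℤ) = [M ∖ K, S¹]` that is `1` on `μ`: such a class exists, and every such class has the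
value `n` on `γ`. For a map `f : M ∖ K → S¹` in this class, a regular preimage of a point is a
Seifert surface of `K`, and `n` is the intersection number of `γ` with this surface. -/
def HasLinkingNumber {M : Type*} [TopologicalSpace M] (K : Set M) (γ : Circle → M) (n : ℤ) :
    Prop :=
  (∀ u, γ u ∉ K) ∧ ∃ μ : Circle → M, IsMeridian K μ ∧
    (∃ f : M → Circle, ContinuousOn f Kᶜ ∧ HasDegree (f ∘ μ) 1) ∧
    ∀ f : M → Circle, ContinuousOn f Kᶜ → HasDegree (f ∘ μ) 1 → HasDegree (f ∘ γ) n

open Set Filter Topology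

/-! ## Lifting through covering maps over star-shaped sets -/

/-! The cover `M` is the surface `y² = Q` over the sphere, where `Q` is `braidPoly`: at `(a, b)` it
multiplies the differences of `a` and the strands, taken at the time given by the argument of `b`
and scaled by `‖b‖`. It vanishes exactly on the braid and equals `a ^ (2m)` on the axis `b = 0`.
Hence the axis has two disjoint lifts `K₁ : y = a ^ m` and `K₂ : y = -a ^ m`.

The linking number is read off from a circle-valued function `f` on the complement of `K₁` that has
degree 1 on a meridian. A page of the axis is a plane, and over it the cover is the hyperelliptic
curve `y² = (z - 1) ⋯ (z - 2m)`. Over the closed lower half plane this curve consists of two sheets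
that meet at the branch points. The logarithms of `f` on the two sheets differ at the branch point
`i` by an integer, the label `A i`. Labels reduce the topology to linear algebra over ℤ: - A letter
of the braid reflects one of two adjacent labels in the other and exchanges the places, as in a Fox
colouring (`HasLabels.letter`). - During one turn around the axis the logarithm far out on the first
sheet grows by 1, because that circle is a meridian of `K₁`. On the second sheet it does not grow,
because that circle bounds a disk which meets `K₂` and not `K₁`. So the braid word must send `A` to
`A + 1`. - The degree of `f` on `K₂` is its degree on a large circle of the second sheet of a page.
Comparing the logarithms over the two half planes along the real line turns this degree into the
alternating sum of the labels (`HasLabels.circle`).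

All solutions of `wordAct w A = A + 1` have the same alternating sum. Indeed the action preserves a
skew form, which plays the role of the intersection form of the page, and shifting two labellings by
1 changes the form by the difference of their alternating sums (`altSum_eq_of_wordAct_eq_add_one`).
So every admissible `f` has the same degree on `K₂`, and it can be computed from any one solution
(`hasDegree_of_meridian`).

Conversely a solution yields an admissible `f` (`exists_cover_function`). A function with labels `A`
on one page is carried along an isotopy through a whole period. Its mismatch at the end has a real
logarithm, since all labels of the corrected ratio vanish (`HasLabels.exists_lift`), so it can be
absorbed by a Tietze extension. Near infinity on the second sheet the result is deformed to a power
of the phase, which extends over `K₂`.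

For the given braids an explicit solution is arithmetic in the middle strands, and its alternating
sum is the stated polynomial (`exists_wordAct_birmanMenascoWord`).

It remains to identify an abstract branched cover with `y² = Q`
(`IsDoubleBranchedCover.exists_homeomorph`). A square root of `Q ∘ p` that separates the sheets
exists locally, because `Q` has odd winding number around the braid. The local roots differ by
signs, and these can be matched because the sphere without a point is contractible. -/

theorem IsCoveringMap.exists_lift_of_starConvex {V E X : Type*} [AddCommGroup V] [Module ℝ V]
    [TopologicalSpace V] [IsTopologicalAddGroup V] [ContinuousSMul ℝ V] [TopologicalSpace E]
    [TopologicalSpace X] {p : E → X} (hp : IsCoveringMap p) {K : Set V} {x₀ : V}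
    (hK : StarConvex ℝ x₀ K) {f : V → X} (hf : ContinuousOn f K)
    {e₀ : E} (he : p e₀ = f x₀) :
    ∃ g : V → E, ContinuousOn g K ∧ ∀ x ∈ K, p (g x) = f x := by
  classical
  have hmem : ∀ (t : unitInterval) (x : K), x₀ + (t : ℝ) • ((x : V) - x₀) ∈ K := fun t x => by
    have := hK x.2 (sub_nonneg.2 t.2.2) t.2.1 (by ring)
    convert this using 1
    module
  -- The radial contraction of `K` is a homotopy that starts at a constant map. The constant map
  -- lifts to `e₀`, and the homotopy lifting property then gives the lift of `f` at time 1.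
  let H : C(unitInterval × K, X) :=
    ⟨fun q => f (x₀ + (q.1 : ℝ) • ((q.2 : V) - x₀)), by
      refine hf.comp_continuous (by fun_prop) fun q => hmem q.1 q.2⟩
  let G := hp.liftHomotopy H (ContinuousMap.const K e₀) (by
    intro a; simp [H, he])
  have hG : ∀ q, p (G q) = H q := fun q => congrFun (hp.liftHomotopy_lifts H _ _) q
  refine ⟨fun x => if hx : x ∈ K then G (1, ⟨x, hx⟩) else e₀, ?_, ?_⟩
  · rw [continuousOn_iff_continuous_domRestrict]
    have : K.domRestrict (fun x => if hx : x ∈ K then G (1, ⟨x, hx⟩) else e₀) =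
        fun x : K => G (1, x) := by
      ext x; simp [Set.domRestrict]
    rw [this]
    exact G.continuous.comp (by fun_prop)
  · intro x hx
    simp only [hx, dite_true, hG]
    simp [H]

/-- The point of the circle reached after `t` full turns. -/
noncomputable def turn (t : ℝ) : Circle := Circle.exp (2 * Real.pi * t)

@[fun_prop]
theorem continuous_turn : Continuous turn := by
  unfold turn; fun_prop

theorem turn_add (a b : ℝ) : turn (a + b) = turn a * turn b := by
  simp [turn, mul_add, Circle.exp_add]

theorem turn_neg (a : ℝ) : turn (-a) = (turn a)⁻¹ := by
  simp [turn, Circle.exp_neg]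

theorem turn_sub (a b : ℝ) : turn (a - b) = turn a / turn b := by
  simp [turn, mul_sub, Circle.exp_sub]

theorem turn_eq_turn_iff {a b : ℝ} : turn a = turn b ↔ ∃ n : ℤ, a = b + n := by
  unfold turn
  rw [Circle.exp_eq_exp]
  have h : (2 * Real.pi) ≠ 0 := by positivity
  refine exists_congr fun n => ⟨fun e => ?_, fun e => by rw [e]; ring⟩
  have : 2 * Real.pi * (a - b - n) = 0 := by linear_combination e
  have := (mul_eq_zero.1 this).resolve_left h
  linarith

@[simp] theorem turn_intCast (n : ℤ) : turn n = 1 := by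
  have : turn n = turn 0 := turn_eq_turn_iff.2 ⟨n, by simp⟩
  rw [this]; simp [turn]

@[simp] theorem turn_zero : turn 0 = 1 := by simp [turn]

theorem turn_add_intCast (a : ℝ) (n : ℤ) : turn (a + n) = turn a :=
  turn_eq_turn_iff.2 ⟨n, rfl⟩

theorem turn_surjective : Function.Surjective turn := fun u => by
  obtain ⟨t, ht⟩ := Circle.exp_surjective u
  refine ⟨t / (2 * Real.pi), ?_⟩
  rw [turn, ← ht]; congr 1; field_simp

theorem isCoveringMap_turn : IsCoveringMap turn := by
  have h : (2 * Real.pi) ≠ 0 := by positivity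
  exact Circle.isCoveringMap_exp.comp_homeomorph (Homeomorph.mulLeft₀ (2 * Real.pi) h)

theorem coe_turn (t : ℝ) : (turn t : ℂ) = Complex.exp (2 * Real.pi * t * Complex.I) := by
  simp [turn, Circle.coe_exp]

/-! ### Logarithms on star-shaped sets -/

section Lifts

variable {V : Type*} [AddCommGroup V] [Module ℝ V] [TopologicalSpace V] [IsTopologicalAddGroup V]
  [ContinuousSMul ℝ V] {K : Set V} {x₀ : V}

theorem exists_turn_lift (hK : StarConvex ℝ x₀ K) {f : V → Circle}
    (hf : ContinuousOn f K) :
    ∃ h : V → ℝ, ContinuousOn h K ∧ ∀ x ∈ K, turn (h x) = f x := by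
  obtain ⟨t, ht⟩ := turn_surjective (f x₀)
  exact isCoveringMap_turn.exists_lift_of_starConvex hK hf ht

theorem exists_log_lift (hK : StarConvex ℝ x₀ K) (hx₀ : x₀ ∈ K) {f : V → ℂ}
    (hf : ContinuousOn f K) (h0 : ∀ x ∈ K, f x ≠ 0) :
    ∃ h : V → ℂ, ContinuousOn h K ∧ ∀ x ∈ K, Complex.exp (h x) = f x := by
  classical
  let f' : V → {z : ℂ // z ≠ 0} := fun x => if hx : f x ≠ 0 then ⟨f x, hx⟩ else ⟨1, one_ne_zero⟩
  have e : ∀ x ∈ K, (f' x : ℂ) = f x := fun x hx => by simp [f', h0 x hx]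
  have hf' : ContinuousOn f' K := by
    refine (Topology.IsInducing.subtypeVal (t := {z : ℂ | z ≠ 0})).continuousOn_iff.2 ?_
    exact hf.congr e
  obtain ⟨h, hc, hh⟩ := Complex.isCoveringMap_exp.exists_lift_of_starConvex hK hf'
    (e₀ := Complex.log (f x₀)) (by
      apply Subtype.ext; simp [e x₀ hx₀, Complex.exp_log (h0 x₀ hx₀)])
  exact ⟨h, hc, fun x hx => by rw [← e x hx, ← hh x hx]⟩

end Lifts

/-! ## Continuous functions with discrete values -/

section Discrete

variable {X : Type*} [TopologicalSpace X] {K : Set X}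

theorem IsPreconnected.exists_int_eq (hK : IsPreconnected K) {h : X → ℝ} (hh : ContinuousOn h K)
    (hint : ∀ x ∈ K, ∃ n : ℤ, h x = n) : ∃ n : ℤ, ∀ x ∈ K, h x = n := by
  rcases K.eq_empty_or_nonempty with rfl | ⟨x₀, hx₀⟩
  · exact ⟨0, by simp⟩
  obtain ⟨n, hn⟩ := hint x₀ hx₀
  refine ⟨n, fun x hx => ?_⟩
  rw [← hn]
  have hr : ∀ y ∈ K, ((round (h y) : ℤ) : ℝ) = h y := fun y hy => by
    obtain ⟨k, hk⟩ := hint y hy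
    rw [hk, round_intCast]
  have hc : ContinuousOn (fun y => round (h y)) K := by
    rw [Int.isClosedEmbedding_coe_real.isEmbedding.continuousOn_iff]
    exact hh.congr hr
  have := hK.constant hc hx hx₀
  rw [← hr x hx, this, hr x₀ hx₀]

/-- The difference of two logarithms of one circle-valued function is continuous and integer-valued,
hence constant. Every comparison of labels, sheets and monodromies below is an instance of this. -/
theorem IsPreconnected.exists_int_sub_eq (hK : IsPreconnected K) {g h : X → ℝ}
    (hg : ContinuousOn g K) (hh : ContinuousOn h K) (e : ∀ x ∈ K, turn (g x) = turn (h x)) :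
    ∃ n : ℤ, ∀ x ∈ K, g x = h x + n := by
  obtain ⟨n, hn⟩ := hK.exists_int_eq (hg.sub hh) fun x hx => by
    obtain ⟨n, hn⟩ := turn_eq_turn_iff.1 (e x hx)
    exact ⟨n, by simp [hn]⟩
  exact ⟨n, fun x hx => by have := hn x hx; simp at this; linarith⟩

theorem IsPreconnected.eq_or_eq_neg_of_sq (hK : IsPreconnected K) {g h : X → ℂ}
    (hg : ContinuousOn g K) (hh : ContinuousOn h K) (e : ∀ x ∈ K, g x ^ 2 = h x ^ 2)
    (h0 : ∀ x ∈ K, h x ≠ 0) : (∀ x ∈ K, g x = h x) ∨ ∀ x ∈ K, g x = -h x :=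
  hK.eq_or_eq_neg_of_sq_eq hg hh e (h0 _)

end Discrete

/-! ## Degrees -/

theorem hasDegree_iff {g : Circle → Circle} {n : ℤ} :
    HasDegree g n ↔ ∃ θ : ℝ → ℝ, Continuous θ ∧ (∀ t, g (turn t) = turn (θ t)) ∧
      θ 1 = θ 0 + n := Iff.rfl

/-! ## The action of braid words on labels of the strands -/

/-- The effect of a letter of a braid word on labels of the strands: the label of the strand
that passes nearer to the viewer is kept, and the other label is reflected in it. -/
def letterAct (l : ℕ × Bool) (A : ℕ → ℤ) (i : ℕ) : ℤ :=
  if i = l.1 then (if l.2 then 2 * A l.1 - A (l.1 + 1) else A (l.1 + 1))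
  else if i = l.1 + 1 then (if l.2 then A l.1 else 2 * A (l.1 + 1) - A l.1)
  else A i

/-- The effect of a braid word on labels of the strands. -/
def wordAct (w : BraidWord) (A : ℕ → ℤ) : ℕ → ℤ := w.foldl (fun A l => letterAct l A) A

/-- The letter describes a crossing of two of the strands `1, …, n`. -/
def IsLetterOn (n : ℕ) (l : ℕ × Bool) : Prop := 1 ≤ l.1 ∧ l.1 + 1 ≤ n

@[simp] theorem wordAct_nil (A : ℕ → ℤ) : wordAct [] A = A := rfl

@[simp] theorem wordAct_cons (l : ℕ × Bool) (w : BraidWord) (A : ℕ → ℤ) :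
    wordAct (l :: w) A = wordAct w (letterAct l A) := rfl

@[simp] theorem wordAct_append (v w : BraidWord) (A : ℕ → ℤ) :
    wordAct (v ++ w) A = wordAct w (wordAct v A) := by
  simp [wordAct, List.foldl_append]

theorem letterAct_not (l : ℕ × Bool) (A : ℕ → ℤ) :
    letterAct (l.1, !l.2) (letterAct l A) = A := by
  obtain ⟨j, b⟩ := l
  funext i
  cases b <;> simp only [letterAct] <;> grind

theorem wordAct_invRev (w : BraidWord) (A : ℕ → ℤ) :
    wordAct (FreeGroup.invRev w) (wordAct w A) = A := by
  induction w generalizing A with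
  | nil => simp [FreeGroup.invRev]
  | cons l w ih =>
    have : FreeGroup.invRev (l :: w) = FreeGroup.invRev w ++ [(l.1, !l.2)] := by
      simp [FreeGroup.invRev]
    rw [this, wordAct_append, wordAct_cons, wordAct_nil, wordAct_cons l w, ih, letterAct_not]

theorem letterAct_congr {n : ℕ} {l : ℕ × Bool} (hl : IsLetterOn n l) {A C : ℕ → ℤ}
    (h : EqOn A C (Icc 1 n)) : EqOn (letterAct l A) (letterAct l C) (Icc 1 n) := by
  intro i hi
  obtain ⟨h1, h2⟩ := hl
  have a := h (x := l.1) ⟨h1, by omega⟩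
  have b := h (x := l.1 + 1) ⟨by omega, h2⟩
  simp only [letterAct, a, b, h hi]

/-! ## Invariants of the action -/

/-- The alternating sum `A 1 - A 2 + A 3 - …` of `n` labels. -/
def altSum : ℕ → (ℕ → ℤ) → ℤ
  | 0, _ => 0
  | n + 1, A => altSum n A + (-1) ^ n * A (n + 1)

/-- A skew-symmetric form on the labels of `n` strands. -/
def skewForm : ℕ → (ℕ → ℤ) → (ℕ → ℤ) → ℤ
  | 0, _, _ => 0
  | n + 1, A, C =>
    skewForm n A C + (-1) ^ n * (altSum n A * C (n + 1) - A (n + 1) * altSum n C)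

theorem altSum_congr {n : ℕ} {A C : ℕ → ℤ} (h : EqOn A C (Icc 1 n)) :
    altSum n A = altSum n C := by
  induction n with
  | zero => rfl
  | succ n ih =>
    simp only [altSum]
    rw [ih (h.mono (Icc_subset_Icc_right (by omega))), h (x := n + 1) ⟨by omega, le_rfl⟩]

theorem skewForm_congr {n : ℕ} {A C A' C' : ℕ → ℤ} (hA : EqOn A A' (Icc 1 n))
    (hC : EqOn C C' (Icc 1 n)) : skewForm n A C = skewForm n A' C' := by
  induction n with
  | zero => rfl
  | succ n ih =>
    have s : Icc 1 n ⊆ Icc 1 (n + 1) := Icc_subset_Icc_right (by omega)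
    simp only [skewForm]
    rw [ih (hA.mono s) (hC.mono s), hA (x := n + 1) ⟨by omega, le_rfl⟩,
      hC (x := n + 1) ⟨by omega, le_rfl⟩, altSum_congr (hA.mono s), altSum_congr (hC.mono s)]

theorem letterAct_eqOn_of_le {n j : ℕ} (b : Bool) (h : n < j) (A : ℕ → ℤ) :
    EqOn (letterAct (j, b) A) A (Icc 1 n) := by
  intro i hi
  obtain ⟨h1, h2⟩ := hi
  simp only [letterAct]
  rw [if_neg (by omega), if_neg (by omega)]

theorem letterAct_of_ne {j i : ℕ} (b : Bool) (A : ℕ → ℤ) (h : i ≠ j) (h' : i ≠ j + 1) :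
    letterAct (j, b) A i = A i := by
  simp [letterAct, h, h']

/-- The two labels involved carry opposite signs, and a reflection keeps their difference: `(2x - y)
- x = x - y`. -/
theorem altSum_letterAct {n : ℕ} {l : ℕ × Bool} (hl : IsLetterOn n l) (A : ℕ → ℤ) :
    altSum n (letterAct l A) = altSum n A := by
  obtain ⟨j, b⟩ := l
  obtain ⟨h1, h2⟩ := hl
  obtain ⟨j, rfl⟩ : ∃ i, j = i + 1 := ⟨j - 1, by simp at h1; omega⟩
  simp only at h2
  induction n, h2 using Nat.le_induction with
  | base =>
    simp only [altSum, altSum_congr (letterAct_eqOn_of_le b (Nat.lt_succ_self j) A)]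
    cases b <;> simp [letterAct, pow_succ] <;> ring
  | succ n hn ih =>
    simp only [altSum, ih]
    rw [letterAct_of_ne _ _ (by omega) (by omega)]

/-- The form is the sum over `i < j` of the minors `A i * C j - A j * C i` with the signs `(-1) ^ (i
+ j)`. A letter acts on the pair of adjacent labels by a matrix of determinant 1, which fixes the
minor of this pair, and it keeps their difference, which is all that enters the minors with the
other labels. -/
theorem skewForm_letterAct {n : ℕ} {l : ℕ × Bool} (hl : IsLetterOn n l) (A C : ℕ → ℤ) :
    skewForm n (letterAct l A) (letterAct l C) = skewForm n A C := by
  obtain ⟨j, b⟩ := l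
  obtain ⟨h1, h2⟩ := hl
  obtain ⟨j, rfl⟩ : ∃ i, j = i + 1 := ⟨j - 1, by simp at h1; omega⟩
  simp only at h2
  induction n, h2 using Nat.le_induction with
  | base =>
    have e := letterAct_eqOn_of_le (n := j) b (Nat.lt_succ_self j)
    have p : ((-1 : ℤ) ^ j) * (-1) ^ j = 1 := by rw [← mul_pow]; simp
    simp only [skewForm, altSum, altSum_congr (e _), skewForm_congr (e A) (e C)]
    cases b <;> simp [letterAct, pow_succ] <;> linear_combination 0 * p
  | succ n hn ih =>
    simp only [skewForm, ih]
    rw [letterAct_of_ne _ _ (by omega) (by omega), letterAct_of_ne _ _ (by omega) (by omega),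
      altSum_letterAct ⟨by simp, hn⟩, altSum_letterAct ⟨by simp, hn⟩]

theorem altSum_wordAct {n : ℕ} {w : BraidWord} (hw : ∀ l ∈ w, IsLetterOn n l) (A : ℕ → ℤ) :
    altSum n (wordAct w A) = altSum n A := by
  induction w generalizing A with
  | nil => rfl
  | cons l w ih =>
    rw [wordAct_cons, ih (fun x hx => hw x (List.mem_cons_of_mem _ hx)),
      altSum_letterAct (hw l (List.mem_cons_self ..))]

theorem skewForm_wordAct {n : ℕ} {w : BraidWord} (hw : ∀ l ∈ w, IsLetterOn n l) (A C : ℕ → ℤ) :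
    skewForm n (wordAct w A) (wordAct w C) = skewForm n A C := by
  induction w generalizing A C with
  | nil => rfl
  | cons l w ih =>
    rw [wordAct_cons, wordAct_cons, ih (fun x hx => hw x (List.mem_cons_of_mem _ hx)),
      skewForm_letterAct (hw l (List.mem_cons_self ..))]

theorem altSum_add_const (n : ℕ) (A : ℕ → ℤ) (c : ℤ) :
    altSum (2 * n) (fun i => A i + c) = altSum (2 * n) A := by
  induction n with
  | zero => rfl
  | succ n ih =>
    rw [show 2 * (n + 1) = 2 * n + 1 + 1 by ring]
    simp only [altSum, ih, pow_succ, pow_mul]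
    ring

/-- The shift by 1 is the only term not seen by a homogeneous invariant. For an even number of
strands it contributes exactly the difference of the alternating sums, which is what makes the
alternating sum of a solution unique. -/
theorem skewForm_add_one (n : ℕ) (A C : ℕ → ℤ) :
    skewForm (2 * n) (fun i => A i + 1) (fun i => C i + 1) =
      skewForm (2 * n) A C + altSum (2 * n) C - altSum (2 * n) A := by
  induction n with
  | zero => rfl
  | succ n ih =>
    rw [show 2 * (n + 1) = 2 * n + 1 + 1 by ring]
    simp only [skewForm, altSum, ih, altSum_add_const, pow_succ, pow_mul]
    ring

/-- All labels that a braid word with an even number of strands increases by `1` have the same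
alternating sum. -/
theorem altSum_eq_of_wordAct_eq_add_one {m : ℕ} {w : BraidWord}
    (hw : ∀ l ∈ w, IsLetterOn (2 * m) l) {A C : ℕ → ℤ}
    (hA : EqOn (wordAct w A) (fun i => A i + 1) (Icc 1 (2 * m)))
    (hC : EqOn (wordAct w C) (fun i => C i + 1) (Icc 1 (2 * m))) :
    altSum (2 * m) A = altSum (2 * m) C := by
  -- Invariance under the word and the effect of the shift by 1 compute the same value of the form,
  -- so the discrepancy `altSum C - altSum A` is zero.
  have h := skewForm_wordAct hw A C
  rw [skewForm_congr hA hC, skewForm_add_one] at h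
  linarith

/-! ## The action of the words `Γ_r`, `Φ_n`, `Ψ_n` and of the braids `B_{n,k}` -/

theorem gammaWord_succ (r : ℕ) :
    gammaWord (r + 1) = (r + 1, true) :: (gammaWord r ++ [(r + 1, true)]) := by
  simp [gammaWord, List.range_succ]

theorem isLetterOn_gammaWord {r : ℕ} : ∀ l ∈ gammaWord r, IsLetterOn (r + 1) l := by
  intro l hl
  simp [gammaWord, IsLetterOn] at hl ⊢
  obtain ⟨a, ha, rfl⟩ := hl
  simp; omega

/-- `Γ_r` carries the strand `r + 1` once around the strands before it: each of these labels is
reflected in the new label of the strand `r + 1`. The induction peels off the outermost pair of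
letters of `Γ_{r+1}`. -/
theorem wordAct_gammaWord (r : ℕ) (A : ℕ → ℤ) (i : ℕ) :
    wordAct (gammaWord r) A i =
      if i = 0 ∨ r + 1 < i then A i
      else if i = r + 1 then 2 * altSum (r + 1) A - (-1) ^ r * A (r + 1)
      else 4 * altSum (r + 1) A - 2 * (-1) ^ r * A (r + 1) - A i := by
  induction r generalizing A i with
  | zero =>
    have : gammaWord 0 = [] := rfl
    rw [this, wordAct_nil]
    by_cases h0 : i = 0
    · simp [h0]
    by_cases h1 : i = 1
    · subst h1; simp [altSum]; ring
    · rw [if_pos (by omega)]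
  | succ r ih =>
    have p : (-1 : ℤ) ^ r * (-1) ^ r = 1 := by rw [← mul_pow]; simp
    have e : altSum (r + 1) (letterAct (r + 1, true) A) =
        altSum r A + (-1) ^ r * (2 * A (r + 1) - A (r + 2)) := by
      simp only [altSum, altSum_congr (letterAct_eqOn_of_le true (Nat.lt_succ_self r) A)]
      simp [letterAct]
    rw [gammaWord_succ, wordAct_cons, wordAct_append]
    simp only [wordAct_cons, wordAct_nil]
    by_cases h1 : i = r + 1
    · subst h1
      rw [if_neg (by omega), if_neg (by omega)]
      simp only [letterAct, if_true, ih, e]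
      rw [if_neg (by omega), if_pos (by omega)]
      simp [altSum, pow_succ]
      ring
    by_cases h2 : i = r + 2
    · subst h2
      rw [if_neg (by omega), if_pos (by omega)]
      simp only [letterAct, ih, e]
      simp [altSum, pow_succ]
      ring
    rw [letterAct_of_ne _ _ h1 h2, ih]
    by_cases h3 : i = 0 ∨ r + 2 < i
    · rw [if_pos (by omega), if_pos (by omega), letterAct_of_ne _ _ h1 h2]
    · rw [if_neg (by omega), if_neg (by omega), if_neg (by omega), if_neg (by omega), e,
        letterAct_of_ne _ _ h1 h2]
      simp [altSum, pow_succ, letterAct]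
      ring

theorem wordPow_succ (w : BraidWord) (k : ℕ) : wordPow w (k + 1) = wordPow w k ++ w := by
  simp [wordPow, List.replicate_succ']

/-- Measured from the invariant alternating sum of the first `r + 1` labels, the last of these
labels, `t`, only changes its sign when `r` is even, while each other label `x` becomes `-x - 2t`.
Iterating gives the sign `(-1) ^ k` and a drift that is linear in `k`. -/
theorem wordAct_wordPow_gammaWord {r : ℕ} (hr : Even r) (k : ℕ) (A : ℕ → ℤ) (i : ℕ) :
    wordAct (wordPow (gammaWord r) k) A i =
      if i = 0 ∨ r + 1 < i then A i
      else if i = r + 1 then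
        altSum (r + 1) A + (-1) ^ k * (A (r + 1) - altSum (r + 1) A)
      else (-1) ^ k * (A i + 2 * k * (A (r + 1) - altSum (r + 1) A)) +
        altSum (r + 1) A * (1 - (-1) ^ k) := by
  induction k generalizing i with
  | zero =>
    simp only [wordPow, List.replicate_zero, List.flatten_nil, wordAct_nil]
    split_ifs with h1 h2
    · rfl
    · simp [h2]
    · simp
  | succ k ih =>
    have hl : ∀ l ∈ wordPow (gammaWord r) k, IsLetterOn (r + 1) l := by
      intro l hl
      simp only [wordPow, List.mem_flatten, List.mem_replicate] at hl
      obtain ⟨w, ⟨-, rfl⟩, hw⟩ := hl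
      exact isLetterOn_gammaWord l hw
    rw [wordPow_succ, wordAct_append, wordAct_gammaWord, altSum_wordAct hl, hr.neg_one_pow]
    split_ifs with h1 h2
    · rw [ih, if_pos h1]
    · rw [ih, if_neg (by omega), if_pos rfl, pow_succ]
      ring
    · rw [ih (r + 1), if_neg (by omega), if_pos rfl, ih, if_neg h1, if_neg h2, pow_succ]
      push_cast
      ring

theorem isLetterOn_phiWord (j : ℕ) : ∀ l ∈ phiWord (j + 4), IsLetterOn (j + 3) l := by
  induction j with
  | zero => intro l hl; simp [phiWord] at hl; rcases hl with rfl | rfl | rfl <;> simp [IsLetterOn]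
  | succ j ih =>
    intro l hl
    simp only [phiWord, List.mem_append, List.mem_cons, List.not_mem_nil, or_false] at hl
    rcases hl with ((rfl | rfl) | hl) | rfl
    · simp [IsLetterOn]
    · simp [IsLetterOn]
    · have := ih l hl
      exact ⟨this.1, this.2.trans (by omega)⟩
    · simp [IsLetterOn]

theorem isLetterOn_psiWord (j : ℕ) : ∀ l ∈ psiWord (j + 4), IsLetterOn (j + 3) l := by
  induction j with
  | zero => intro l hl; simp [psiWord] at hl; rcases hl with rfl | rfl | rfl <;> simp [IsLetterOn]
  | succ j ih =>
    intro l hl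
    simp only [psiWord, List.mem_append, List.mem_cons, List.not_mem_nil, or_false] at hl
    rcases hl with (rfl | hl) | rfl
    · simp [IsLetterOn]
    · have := ih l hl
      exact ⟨this.1, this.2.trans (by omega)⟩
    · simp [IsLetterOn]

/-- The recursion changes three adjacent labels, applies the shorter word, and adjusts two labels at
the end. Its net effect on the middle strands is a shift by one place; only the first two strands
and the strand `j + 3` see an alternating sum. -/
theorem wordAct_phiWord (j : ℕ) (A : ℕ → ℤ) (i : ℕ) :
    wordAct (phiWord (j + 4)) A i =
      if i = 1 then 2 * altSum (j + 2) A + (-1) ^ j * (3 * A (j + 2) - 2 * A (j + 3))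
      else if i = 2 then
        2 * (A 1 - altSum (j + 2) A) + (-1) ^ j * (3 * A (j + 3) - 4 * A (j + 2))
      else if i ≤ j + 2 then A (i - 1)
      else if i = j + 3 then
        (-1) ^ j * (A 1 - 2 * altSum (j + 2) A) - 6 * A (j + 2) + 6 * A (j + 3)
      else A i := by
  induction j generalizing A i with
  | zero =>
    simp only [phiWord, wordAct_cons, wordAct_nil, altSum]
    rcases (by omega : i = 0 ∨ i = 1 ∨ i = 2 ∨ i = 3 ∨ 3 < i) with rfl | rfl | rfl | rfl | h
    · simp [letterAct]
    · simp [letterAct]; ring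
    · simp [letterAct]; ring
    · simp [letterAct]; ring
    · rw [if_neg (by omega), if_neg (by omega), if_neg (by omega), if_neg (by omega)]
      simp only [letterAct]
      rw [if_neg (by omega), if_neg (by omega), if_neg (by omega), if_neg (by omega),
        if_neg (by omega), if_neg (by omega), if_neg (by omega), if_neg (by omega)]
  | succ j ih =>
    set C := letterAct (j + 3, true) (letterAct (j + 2, true) A) with hC
    have c1 : C (j + 2) = 2 * A (j + 2) - A (j + 3) := by simp [hC, letterAct]
    have c2 : C (j + 3) = 2 * A (j + 2) - A (j + 4) := by simp [hC, letterAct]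
    have c3 : C (j + 4) = A (j + 2) := by simp [hC, letterAct]
    have c4 : ∀ i, i ≠ j + 2 → i ≠ j + 3 → i ≠ j + 4 → C i = A i := by
      intro i h1 h2 h3; simp [hC, letterAct, h1, h2, h3]
    have ea : altSum (j + 1) C = altSum (j + 1) A :=
      altSum_congr fun i hi => by
        obtain ⟨h1, h2⟩ := hi
        exact c4 i (by omega) (by omega) (by omega)
    have e : wordAct (phiWord (j + 1 + 4)) A =
        letterAct (j + 3, false) (wordAct (phiWord (j + 4)) C) := by
      simp [phiWord, hC]
    rw [e]
    have s1 : altSum (j + 2) C = altSum (j + 1) A - (-1) ^ j * (2 * A (j + 2) - A (j + 3)) := by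
      rw [altSum, ea, c1, pow_succ]; ring
    have s2 : altSum (j + 1 + 2) A =
        altSum (j + 1) A - (-1) ^ j * A (j + 2) + (-1) ^ j * A (j + 3) := by
      rw [altSum, altSum, pow_succ, pow_succ]; ring
    have cc : C 1 = A 1 := c4 1 (by omega) (by omega) (by omega)
    have p : (-1 : ℤ) ^ j * (-1) ^ j = 1 := by rw [← mul_pow]; simp
    rw [show j + 1 + 3 = j + 4 by ring, show j + 1 + 2 = j + 3 by ring] at *
    have X4 : wordAct (phiWord (j + 4)) C (j + 4) = A (j + 2) := by
      rw [ih, if_neg (by omega), if_neg (by omega), if_neg (by omega), if_neg (by omega), c3]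
    rcases (by omega : i = 1 ∨ i = 2 ∨ i = j + 3 ∨ i = j + 4 ∨
      (i ≠ 1 ∧ i ≠ 2 ∧ i ≤ j + 2) ∨ j + 4 < i) with rfl | rfl | rfl | rfl | ⟨h1, h2, h3⟩ | h
    · rw [letterAct_of_ne _ _ (by omega) (by omega), ih, if_pos rfl, if_pos rfl, s1, s2, c1, c2,
        pow_succ]
      ring
    · rw [letterAct_of_ne _ _ (by omega) (by omega), ih, if_neg (by omega), if_pos rfl,
        if_neg (by omega), if_pos rfl, s1, s2, cc, c1, c2, pow_succ]
      ring
    · rw [if_neg (by omega), if_neg (by omega), if_pos (by omega)]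
      simpa [letterAct] using X4
    · rw [if_neg (by omega), if_neg (by omega), if_neg (by omega), if_pos (by omega)]
      have X3 : letterAct (j + 3, false) (wordAct (phiWord (j + 4)) C) (j + 4) =
          2 * wordAct (phiWord (j + 4)) C (j + 4) - wordAct (phiWord (j + 4)) C (j + 3) := by
        simp [letterAct]
      rw [X3, X4, ih, if_neg (by omega), if_neg (by omega), if_neg (by omega), if_pos rfl, s1, s2,
        cc, c1, c2, pow_succ]
      linear_combination (-2 * A (j + 2)) * p
    · rw [letterAct_of_ne _ _ (by omega) (by omega), ih, if_neg h1, if_neg h2, if_pos h3,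
        if_neg h1, if_neg h2, if_pos (by omega), c4 _ (by omega) (by omega) (by omega)]
    · rw [letterAct_of_ne _ _ (by omega) (by omega), ih, if_neg (by omega), if_neg (by omega),
        if_neg (by omega), if_neg (by omega), if_neg (by omega), if_neg (by omega),
        if_neg (by omega), if_neg (by omega), c4 _ (by omega) (by omega) (by omega)]

/-- Each step of the recursion conjugates by one letter. Thereby the new middle strand is translated
by the same amount as all earlier ones, so an arithmetic progression in the middle keeps its
difference. -/
theorem wordAct_psiWord (j : ℕ) (A : ℕ → ℤ) (i : ℕ) :
    wordAct (psiWord (j + 4)) A i =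
      if i = 0 ∨ j + 3 < i then A i
      else if i = 1 then 4 * A 2 - 3 * A (j + 3)
      else if i = j + 3 then 8 * A 2 - A 1 - 6 * A (j + 3)
      else if i = 2 then -2 * A 1 + 13 * A 2 - 10 * A (j + 3)
      else A i - 2 * A 1 + 16 * A 2 - 14 * A (j + 3) := by
  induction j generalizing A i with
  | zero =>
    simp only [psiWord, wordAct_cons, wordAct_nil]
    rcases (by omega : i = 0 ∨ i = 1 ∨ i = 2 ∨ i = 3 ∨ 3 < i) with rfl | rfl | rfl | rfl | h
    · simp [letterAct]
    · simp [letterAct]; ring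
    · simp [letterAct]; ring
    · simp [letterAct]; ring
    · rw [if_pos (by omega)]
      simp only [letterAct]
      rw [if_neg (by omega), if_neg (by omega), if_neg (by omega), if_neg (by omega),
        if_neg (by omega), if_neg (by omega), if_neg (by omega), if_neg (by omega),
        if_neg (by omega), if_neg (by omega)]
  | succ j ih =>
    have e : wordAct (psiWord (j + 1 + 4)) A =
        letterAct (j + 3, true) (wordAct (psiWord (j + 4)) (letterAct (j + 3, false) A)) := by
      simp [psiWord]
    set C := letterAct (j + 3, false) A with hC
    have c3 : C (j + 3) = A (j + 4) := by simp [hC, letterAct]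
    have c4 : C (j + 4) = 2 * A (j + 4) - A (j + 3) := by simp [hC, letterAct]
    have c : ∀ i, i ≠ j + 3 → i ≠ j + 4 → C i = A i := fun i => letterAct_of_ne _ _
    have c1 : C 1 = A 1 := c 1 (by omega) (by omega)
    have c2 : C 2 = A 2 := c 2 (by omega) (by omega)
    rw [e, show j + 1 + 3 = j + 4 by ring]
    have X3 : wordAct (psiWord (j + 4)) C (j + 3) = 8 * A 2 - A 1 - 6 * A (j + 4) := by
      rw [ih, if_neg (by omega), if_neg (by omega), if_pos rfl, c1, c2, c3]
    have X4 : wordAct (psiWord (j + 4)) C (j + 4) = 2 * A (j + 4) - A (j + 3) := by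
      rw [ih, if_pos (by omega), c4]
    rcases (by omega : (i = 0 ∨ j + 4 < i) ∨ i = j + 3 ∨ i = j + 4 ∨
      (i ≠ 0 ∧ i ≤ j + 2)) with h | rfl | rfl | ⟨h1, h2⟩
    · rw [letterAct_of_ne _ _ (by omega) (by omega), ih, if_pos (by omega), if_pos h,
        c _ (by omega) (by omega)]
    · rw [if_neg (by omega), if_neg (by omega), if_neg (by omega), if_neg (by omega)]
      simp only [letterAct, if_true, X3, X4]
      ring
    · rw [if_neg (by omega), if_neg (by omega), if_pos rfl]
      simp [letterAct, X3]
    · rw [letterAct_of_ne _ _ (by omega) (by omega), ih,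
        if_neg (by omega : ¬ (i = 0 ∨ j + 3 < i)), if_neg (by omega : ¬ (i = 0 ∨ j + 4 < i)),
        c1, c2, c3, c i (by omega) (by omega), if_neg (by omega : ¬ i = j + 3),
        if_neg (by omega : ¬ i = j + 4)]

theorem isLetterOn_birmanMenascoWord (j k : ℕ) :
    ∀ l ∈ birmanMenascoWord (j + 4) k, IsLetterOn (j + 4) l := by
  have hg : ∀ l ∈ wordPow (gammaWord (j + 2)) k, IsLetterOn (j + 4) l := by
    intro l hl
    simp only [wordPow, List.mem_flatten, List.mem_replicate] at hl
    obtain ⟨w, ⟨-, rfl⟩, hw⟩ := hl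
    have := isLetterOn_gammaWord l hw
    exact ⟨this.1, this.2.trans (by omega)⟩
  intro l hl
  simp only [birmanMenascoWord, List.mem_append, List.mem_cons, List.not_mem_nil, or_false] at hl
  rcases hl with ((((hl | hl) | hl) | rfl) | hl) | rfl
  · simp only [FreeGroup.invRev, List.mem_reverse, List.mem_map] at hl
    obtain ⟨x, hx, rfl⟩ := hl
    exact hg x hx
  · have := isLetterOn_phiWord j l hl
    exact ⟨this.1, this.2.trans (by omega)⟩
  · exact hg l hl
  · simp [IsLetterOn]
  · have := isLetterOn_psiWord j l hl
    exact ⟨this.1, this.2.trans (by omega)⟩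
  · simp [IsLetterOn]

/-- An alternating sum of an odd number of terms in arithmetic progression is the middle term; the
first label stands apart. -/
theorem altSum_arithmetic (s u d : ℤ) (A : ℕ → ℤ) (h1 : A 1 = s) (m : ℕ)
    (h : ∀ i ≤ 2 * m, A (i + 2) = u + i * d) :
    altSum (2 * m + 2) A = s - (u + m * d) := by
  induction m with
  | zero =>
    have := h 0 le_rfl
    simp only [zero_add, Nat.cast_zero, zero_mul, add_zero] at this
    simp [altSum, h1, this, sub_eq_add_neg]
  | succ m ih =>
    have e : (-1 : ℤ) ^ (2 * m) = 1 := (even_two_mul m).neg_one_pow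
    rw [show 2 * (m + 1) + 2 = 2 * m + 2 + 1 + 1 by ring, altSum, altSum,
      ih fun i hi => h i (by omega), h (2 * m + 1) (by omega), h (2 * m + 2) (by omega)]
    simp only [pow_succ, e]
    push_cast
    ring

/-- There are labels that the braid `B_{2m,k}` increases by `1`. -/
theorem exists_wordAct_birmanMenascoWord (m k : ℕ) (hm : 2 ≤ m) :
    ∃ A : ℕ → ℤ, EqOn (wordAct (birmanMenascoWord (2 * m) k) A) (fun i => A i + 1)
      (Icc 1 (2 * m)) ∧
      altSum (2 * m) A = (4 * m + 132) * k ^ 2 - (12 * m + 150) * k + (9 * m + 36) := by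
  obtain ⟨p, rfl⟩ : ∃ p, m = p + 2 := ⟨m - 2, by omega⟩
  have hn : 2 * (p + 2) = 2 * p + 4 := by ring
  have hl := isLetterOn_birmanMenascoWord (2 * p) k
  rw [hn]
  set ε : ℤ := (-1) ^ k with hε
  have hεε : ε * ε = 1 := by rw [hε, ← mul_pow]; simp
  set M : ℤ := ((p + 2 : ℕ) : ℤ) with hM
  have hp : (p : ℤ) = M - 2 := by simp [hM]
  set K : ℤ := (k : ℤ) with hK
  -- These values solve the linear system for the labels, normalised by the last label 0. The
  -- solution `A` has the first label `s₀`, then the progression that starts at `u₀` with difference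
  -- `2 * K - 3`, then `t₀` on the strand `2m - 1`; its alternating sum is `a`. The letters `s`,
  -- `u`, `t`, `d` denote the corresponding data after the initial `Γ ^ (-k)`.
  obtain ⟨a, ha⟩ : ∃ x : ℤ, x = (4 * M + 132) * K ^ 2 - (12 * M + 150) * K + (9 * M + 36) := ⟨_, rfl⟩
  obtain ⟨t₀, ht₀⟩ : ∃ x : ℤ, x = (4 * M + 132) * K ^ 2 - (10 * M + 84) * K + (6 * M - 2) := ⟨_, rfl⟩
  obtain ⟨s₀, hs₀⟩ : ∃ x : ℤ, x = (8 * M + 264) * K ^ 2 - (20 * M + 208) * K + (12 * M + 21) := ⟨_, rfl⟩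
  obtain ⟨u₀, hu₀⟩ : ∃ x : ℤ, x = (8 * M + 264) * K ^ 2 - (20 * M + 138) * K + (12 * M - 23) := ⟨_, rfl⟩
  obtain ⟨d, hd⟩ : ∃ x : ℤ, x = ε * (2 * K - 3) := ⟨_, rfl⟩
  obtain ⟨t, ht⟩ : ∃ x : ℤ, x = a + ε * (t₀ - a) := ⟨_, rfl⟩
  obtain ⟨s, hs⟩ : ∃ x : ℤ, x = ε * s₀ - a * (ε - 1) - 2 * K * ε * (t₀ - a) := ⟨_, rfl⟩
  obtain ⟨u, hu⟩ : ∃ x : ℤ, x = ε * u₀ - a * (ε - 1) - 2 * K * ε * (t₀ - a) := ⟨_, rfl⟩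
  -- The labels are prescribed after the initial segment `Γ ^ (-k)`, and `A` is obtained from them
  -- by `Γ ^ k`. Thus the inverse word never has to be evaluated.
  obtain ⟨V, hV⟩ : ∃ V : ℕ → ℤ, V = fun i : ℕ =>
    if i = 1 then s else if i = 2 * p + 3 then t else if i = 2 * p + 4 then 0
    else u + ((i : ℤ) - 2) * d := ⟨_, rfl⟩
  have v1 : V 1 = s := by simp [hV]
  have vt : V (2 * p + 3) = t := by simp [hV]
  have v0 : V (2 * p + 4) = 0 := by simp [hV]
  have vi : ∀ i, i ≠ 1 → i < 2 * p + 3 → V i = u + ((i : ℤ) - 2) * d := fun i h1 h2 => by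
    simp only [hV]; rw [if_neg (by omega), if_neg (by omega), if_neg (by omega)]
  have vl : V (2 * p + 2) = u + (2 * p : ℤ) * d := by
    rw [vi _ (by omega) (by omega)]; push_cast; ring
  have al2 : altSum (2 * p + 2) V = s - (u + p * d) :=
    altSum_arithmetic s u d V v1 p fun i hi => by
      rw [vi _ (by omega) (by omega)]; push_cast; ring
  have al3 : altSum (2 * p + 3) V = a := by
    rw [altSum, al2, vt, pow_add, pow_mul, hs, hu, ht, hd, hp]
    simp only [hs₀, hu₀, ht₀, ha]
    linear_combination 0 * hεε
  obtain ⟨A, hA⟩ : ∃ x, x = wordAct (wordPow (gammaWord (2 * p + 2)) k) V := ⟨_, rfl⟩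
  have hpow := wordAct_wordPow_gammaWord (r := 2 * p + 2) ⟨p + 1, by ring⟩ k
  have A1 : A 1 = ε * (s + 2 * K * (t - a)) + a * (1 - ε) := by
    rw [hA, hpow, if_neg (by omega), if_neg (by omega), al3, v1, vt]
  have Ai : ∀ i, i ≠ 0 → i < 2 * p + 3 → A i = ε * (V i + 2 * K * (t - a)) + a * (1 - ε) :=
    fun i h1 h2 => by rw [hA, hpow, if_neg (by omega), if_neg (by omega), al3, vt]
  have At : A (2 * p + 3) = a + ε * (t - a) := by
    rw [hA, hpow, if_neg (by omega), if_pos rfl, al3, vt]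
  have A0 : A (2 * p + 4) = 0 := by rw [hA, hpow, if_pos (by omega), v0]
  have alA : altSum (2 * p + 3) A = a := by
    rw [hA, altSum_wordAct, al3]
    intro l hl
    simp only [wordPow, List.mem_flatten, List.mem_replicate] at hl
    obtain ⟨w, ⟨-, rfl⟩, hw⟩ := hl
    exact isLetterOn_gammaWord l hw
  refine ⟨A, ?_, by rw [altSum, alA, A0, ha]; simp⟩
  have ep : (-1 : ℤ) ^ (2 * p) = 1 := (even_two_mul p).neg_one_pow
  obtain ⟨C, hC⟩ : ∃ x, x = wordAct (phiWord (2 * p + 4)) V := ⟨_, rfl⟩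
  obtain ⟨t₂, ht₂⟩ : ∃ x : ℤ, x = s - 2 * (s - (u + p * d)) - 6 * (u + 2 * p * d) + 6 * t := ⟨_, rfl⟩
  have C1 : C 1 = 2 * (s - (u + p * d)) + (3 * (u + 2 * p * d) - 2 * t) := by
    rw [hC, wordAct_phiWord, if_pos rfl, al2, vl, vt, ep]; ring
  have C2 : C 2 = 2 * (s - (s - (u + p * d))) + (3 * t - 4 * (u + 2 * p * d)) := by
    rw [hC, wordAct_phiWord, if_neg (by omega), if_pos rfl, al2, vl, vt, v1, ep]; ring
  have Ci : ∀ i, i ≠ 1 → i ≠ 2 → i ≤ 2 * p + 2 → C i = V (i - 1) := fun i h1 h2 h3 => by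
    rw [hC, wordAct_phiWord, if_neg h1, if_neg h2, if_pos h3]
  have Ct : C (2 * p + 3) = t₂ := by
    rw [hC, wordAct_phiWord, if_neg (by omega), if_neg (by omega), if_neg (by omega), if_pos rfl,
      al2, vl, vt, v1, ep, ht₂]; ring
  have C0 : C (2 * p + 4) = 0 := by
    rw [hC, wordAct_phiWord, if_neg (by omega), if_neg (by omega), if_neg (by omega),
      if_neg (by omega), v0]
  have alC : altSum (2 * p + 3) C = a := by rw [hC, altSum_wordAct (isLetterOn_phiWord _), al3]
  obtain ⟨D, hD⟩ : ∃ x, x = wordAct (wordPow (gammaWord (2 * p + 2)) k) C := ⟨_, rfl⟩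
  obtain ⟨t₃, ht₃⟩ : ∃ x : ℤ, x = a + ε * (t₂ - a) := ⟨_, rfl⟩
  have Di : ∀ i, i ≠ 0 → i < 2 * p + 3 → D i = ε * (C i + 2 * K * (t₂ - a)) + a * (1 - ε) :=
    fun i h1 h2 => by rw [hD, hpow, if_neg (by omega), if_neg (by omega), alC, Ct]
  have Dt : D (2 * p + 3) = t₃ := by
    rw [hD, hpow, if_neg (by omega), if_pos rfl, alC, Ct, ht₃]
  have D0 : D (2 * p + 4) = 0 := by rw [hD, hpow, if_pos (by omega), C0]
  obtain ⟨G, hG⟩ : ∃ x, x = letterAct (2 * p + 3, true) D := ⟨_, rfl⟩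
  have Gi : ∀ i, i < 2 * p + 3 → G i = D i :=
    fun i h => by rw [hG, letterAct_of_ne _ _ (by omega) (by omega)]
  have Gt : G (2 * p + 3) = 2 * t₃ := by simp [hG, letterAct, Dt, D0]
  have G0 : G (2 * p + 4) = t₃ := by simp [hG, letterAct, Dt]
  have e : wordAct (birmanMenascoWord (2 * p + 4) k) A =
      letterAct (2 * p + 3, false) (wordAct (psiWord (2 * p + 4)) G) := by
    simp only [birmanMenascoWord, wordAct_append, hA, wordAct_cons, wordAct_nil]
    rw [show 2 * p + 4 - 2 = 2 * p + 2 by omega, wordAct_invRev,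
      show 2 * p + 4 - 1 = 2 * p + 3 by omega, ← hC, ← hD, ← hG]
  -- Once the sign is fixed, the condition at each strand is a polynomial identity in `K`, `M` and
  -- possibly the index of the strand.
  have hcase : ε = 1 ∨ ε = -1 := by rw [hε]; exact neg_one_pow_eq_or ℤ k
  have D1' := Di 1 (by omega) (by omega)
  have D2' := Di 2 (by omega) (by omega)
  rw [C1] at D1'
  rw [C2] at D2'
  rw [← Gi 1 (by omega)] at D1'
  rw [← Gi 2 (by omega)] at D2'
  intro i hi
  obtain ⟨h1, h2⟩ := hi
  simp only [e]
  rcases (by omega : i = 1 ∨ i = 2 ∨ i = 2 * p + 3 ∨ i = 2 * p + 4 ∨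
    (i ≠ 1 ∧ i ≠ 2 ∧ i < 2 * p + 3)) with rfl | rfl | rfl | rfl | ⟨h3, h4, h5⟩
  · rw [letterAct_of_ne _ _ (by omega) (by omega), wordAct_psiWord, if_neg (by omega), if_pos rfl,
      D2', Gt, A1, ht₃, ht₂]
    simp only [hs, hu, ht, hd, hp]
    simp only [hs₀, hu₀, ht₀, ha]
    rcases hcase with h | h <;> rw [h] <;> ring
  · rw [letterAct_of_ne _ _ (by omega) (by omega), wordAct_psiWord, if_neg (by omega),
      if_neg (by omega), if_neg (by omega), if_pos rfl,
      D2', D1', Gt, Ai 2 (by omega) (by omega), vi 2 (by omega) (by omega), ht₃, ht₂]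
    simp only [hs, hu, ht, hd, hp]
    simp only [hs₀, hu₀, ht₀, ha]
    rcases hcase with h | h <;> rw [h] <;> push_cast <;> ring
  · have : letterAct (2 * p + 3, false) (wordAct (psiWord (2 * p + 4)) G) (2 * p + 3) =
        wordAct (psiWord (2 * p + 4)) G (2 * p + 4) := by simp [letterAct]
    rw [this, wordAct_psiWord, if_pos (by omega), G0, At, ht₃, ht₂]
    simp only [hs, hu, ht, hd, hp]
    simp only [hs₀, hu₀, ht₀, ha]
    rcases hcase with h | h <;> rw [h] <;> ring
  · have : letterAct (2 * p + 3, false) (wordAct (psiWord (2 * p + 4)) G) (2 * p + 4) =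
        2 * wordAct (psiWord (2 * p + 4)) G (2 * p + 4) -
          wordAct (psiWord (2 * p + 4)) G (2 * p + 3) := by simp [letterAct]
    rw [this, wordAct_psiWord, if_pos (by omega), wordAct_psiWord, if_neg (by omega),
      if_neg (by omega), if_pos rfl, G0, A0, D1', D2', Gt, ht₃, ht₂]
    simp only [hs, hu, ht, hd, hp]
    simp only [hs₀, hu₀, ht₀, ha]
    rcases hcase with h | h <;> rw [h] <;> ring
  · have c : ((i - 1 : ℕ) : ℤ) = (i : ℤ) - 1 := by push_cast [h1]; ring
    rw [letterAct_of_ne _ _ (by omega) (by omega), wordAct_psiWord, if_neg (by omega),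
      if_neg (by omega), if_neg (by omega), if_neg (by omega),
      D2', D1', Gt, Gi i h5, Di i (by omega) h5, Ci i h3 h4 (by omega),
      vi (i - 1) (by omega) (by omega), Ai i (by omega) h5, vi i h3 h5, c, ht₃, ht₂]
    simp only [hs, hu, ht, hd, hp]
    simp only [hs₀, hu₀, ht₀, ha]
    rcases hcase with h | h <;> rw [h] <;> ring

/-! ## A branch of the square root that is cut along the upper imaginary axis -/

/-- The branch of the square root that is continuous off the upper imaginary half-axis and
positive on positive reals. -/
noncomputable def sqrtDown (ζ : ℂ) : ℂ :=
  Complex.exp (-(Real.pi / 4) * Complex.I) * (Complex.I * ζ) ^ (2⁻¹ : ℂ)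

theorem exp_quarter_sq : Complex.exp (-(Real.pi / 4) * Complex.I) ^ 2 = -Complex.I := by
  rw [← Complex.exp_nat_mul, show ((2 : ℕ) : ℂ) * (-(Real.pi / 4) * Complex.I) =
    -(Real.pi / 2 * Complex.I) by push_cast; ring, Complex.exp_neg, Complex.exp_pi_div_two_mul_I]
  simp

theorem sqrtDown_sq (ζ : ℂ) : sqrtDown ζ ^ 2 = ζ := by
  rw [sqrtDown, mul_pow, exp_quarter_sq, Complex.cpow_ofNat_inv_pow]
  linear_combination (-ζ) * Complex.I_sq

theorem norm_sqrtDown_sq (ζ : ℂ) : ‖sqrtDown ζ‖ ^ 2 = ‖ζ‖ := by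
  rw [← norm_pow, sqrtDown_sq]

@[simp] theorem sqrtDown_zero : sqrtDown 0 = 0 := by
  have := sqrtDown_sq 0
  simpa using this

theorem sqrtDown_eq_zero {ζ : ℂ} : sqrtDown ζ = 0 ↔ ζ = 0 := by
  refine ⟨fun h => ?_, fun h => by rw [h, sqrtDown_zero]⟩
  rw [← sqrtDown_sq ζ, h]; simp

theorem exp_quarter : Complex.exp (-(Real.pi / 4) * Complex.I) =
    ((√2 / 2 : ℝ) : ℂ) * (1 - Complex.I) := by
  rw [show (-(Real.pi / 4) * Complex.I : ℂ) = ((-(Real.pi / 4) : ℝ) : ℂ) * Complex.I by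
    push_cast; ring, Complex.exp_mul_I, ← Complex.ofReal_cos, ← Complex.ofReal_sin, Real.cos_neg,
    Real.sin_neg, Real.cos_pi_div_four, Real.sin_pi_div_four]
  push_cast; ring

/-- Turning the closed fourth quadrant by 45 degrees puts it, apart from 0, in the open right half
plane, where the principal square root inverts squaring. -/
theorem sqrtDown_pow_two {w : ℂ} (h1 : 0 ≤ w.re) (h2 : w.im ≤ 0) : sqrtDown (w ^ 2) = w := by
  by_cases h0 : w = 0
  · simp [h0]
  have e : Complex.I * w ^ 2 = (((√2 / 2 : ℝ) : ℂ) * (1 + Complex.I) * w) ^ 2 := by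
    have : (((√2 / 2 : ℝ) : ℂ)) ^ 2 = 1 / 2 := by
      rw [← Complex.ofReal_pow, div_pow, Real.sq_sqrt (by norm_num)]; norm_num
    linear_combination (-(1 + Complex.I) ^ 2 * w ^ 2) * this - (1 / 2 : ℂ) * w ^ 2 * Complex.I_sq
  have hpos : 0 < (((√2 / 2 : ℝ) : ℂ) * (1 + Complex.I) * w).re := by
    have : (((√2 / 2 : ℝ) : ℂ) * (1 + Complex.I) * w).re = √2 / 2 * (w.re - w.im) := by
      simp [Complex.mul_re, Complex.mul_im]; ring
    rw [this]
    have : 0 < w.re - w.im := by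
      rcases h1.lt_or_eq with h | h
      · linarith
      · rcases h2.lt_or_eq with h' | h'
        · linarith
        · exact absurd (Complex.ext h.symm h') h0
    positivity
  rw [sqrtDown, e, Complex.sq_cpow_two_inv hpos, exp_quarter]
  have : (((√2 / 2 : ℝ) : ℂ)) ^ 2 = 1 / 2 := by
    rw [← Complex.ofReal_pow, div_pow, Real.sq_sqrt (by norm_num)]; norm_num
  linear_combination ((1 - Complex.I) * (1 + Complex.I) * w) * this - (1 / 2 : ℂ) * w * Complex.I_sq

/-- Away from 0 the condition keeps `I * ζ` off the cut of the principal power. At 0 the branch is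
continuous because its norm is the square root of `‖ζ‖`. -/
theorem continuousAt_sqrtDown {ζ : ℂ} (h : ζ.re ≠ 0 ∨ ζ.im ≤ 0) : ContinuousAt sqrtDown ζ := by
  by_cases h0 : ζ = 0
  · subst h0
    rw [ContinuousAt, sqrtDown_zero, tendsto_zero_iff_norm_tendsto_zero]
    have : (fun ζ => ‖sqrtDown ζ‖) = fun ζ => √‖ζ‖ := by
      funext ζ
      rw [← norm_sqrtDown_sq ζ, Real.sqrt_sq (norm_nonneg _)]
    rw [this]
    have : Continuous fun ζ : ℂ => √‖ζ‖ := by fun_prop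
    simpa using this.tendsto 0
  · refine continuousAt_const.mul (ContinuousAt.cpow (by fun_prop) continuousAt_const ?_)
    rw [Complex.mem_slitPlane_iff]
    simp only [Complex.mul_re, Complex.I_re, Complex.I_im, Complex.mul_im]
    rcases h with h | h
    · right; simpa using h
    · by_cases h' : ζ.re = 0
      · left
        have : ζ.im ≠ 0 := fun e => h0 (Complex.ext h' e)
        simpa using lt_of_le_of_ne h this
      · right; simpa using h'

theorem sqrtDown_of_pos {x : ℝ} (hx : 0 ≤ x) : sqrtDown x = √x := by
  have := sqrtDown_pow_two (w := (√x : ℂ)) (by simp) (by simp)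
  rwa [← Complex.ofReal_pow, Real.sq_sqrt hx] at this

theorem sqrtDown_of_neg {x : ℝ} (hx : x ≤ 0) : sqrtDown x = -Complex.I * √(-x) := by
  have := sqrtDown_pow_two (w := -Complex.I * (√(-x) : ℂ)) (by simp) (by simp)
  rwa [mul_pow, ← Complex.ofReal_pow, Real.sq_sqrt (by linarith), neg_sq, Complex.I_sq,
    Complex.ofReal_neg, neg_one_mul, neg_neg] at this

/-- The branch of the square root that is continuous off the lower imaginary half-axis and
positive on positive reals. -/
noncomputable def sqrtUp (ζ : ℂ) : ℂ := starRingEnd ℂ (sqrtDown (starRingEnd ℂ ζ))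

theorem sqrtUp_sq (ζ : ℂ) : sqrtUp ζ ^ 2 = ζ := by
  rw [sqrtUp, ← map_pow, sqrtDown_sq, Complex.conj_conj]

theorem continuousAt_sqrtUp {ζ : ℂ} (h : 0 ≤ ζ.im) : ContinuousAt sqrtUp ζ := by
  have h1 : ContinuousAt sqrtDown (starRingEnd ℂ ζ) :=
    continuousAt_sqrtDown (Or.inr (by simpa using h))
  exact Complex.continuous_conj.continuousAt.comp
    (ContinuousAt.comp (f := starRingEnd ℂ) h1 Complex.continuous_conj.continuousAt)

theorem sqrtUp_of_nonneg {x : ℝ} (hx : 0 ≤ x) : sqrtUp x = sqrtDown x := by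
  rw [sqrtUp, Complex.conj_ofReal, sqrtDown_of_pos hx, Complex.conj_ofReal]

/-- The two cuts lie on opposite sides of the real line, so the branches agree to the right of a
branch point and differ by a sign to the left. This is the source of the alternating signs in the
alternating sum. -/
theorem sqrtUp_of_nonpos {x : ℝ} (hx : x ≤ 0) : sqrtUp x = -sqrtDown x := by
  rw [sqrtUp, Complex.conj_ofReal, sqrtDown_of_neg hx]
  simp

/-! ## The strands during a letter of a braid word -/

/-- The monic polynomial in `z` whose roots are the strands `1, …, n` at the time `s` of the
letter `l`. -/
noncomputable def strandPoly (n : ℕ) (l : ℕ × Bool) (s : ℝ) (z : ℂ) : ℂ :=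
  ∏ i ∈ Finset.Icc 1 n, (z - strandPoint l s i)

/-- A square root of `strandPoly`, cut along the upward rays from the strands. -/
noncomputable def strandRoot (n : ℕ) (l : ℕ × Bool) (s : ℝ) (z : ℂ) : ℂ :=
  ∏ i ∈ Finset.Icc 1 n, sqrtDown (z - strandPoint l s i)

/-- The polynomial with the roots `1, …, n`. -/
noncomputable def pagePoly (n : ℕ) (z : ℂ) : ℂ := ∏ i ∈ Finset.Icc 1 n, (z - i)

/-- A square root of `pagePoly`, cut along the upward rays from `1, …, n`. -/
noncomputable def pageRoot (n : ℕ) (z : ℂ) : ℂ := ∏ i ∈ Finset.Icc 1 n, sqrtDown (z - i)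

/-- A square root of `pagePoly`, cut along the downward rays from `1, …, n`. -/
noncomputable def pageRootUp (n : ℕ) (z : ℂ) : ℂ := ∏ i ∈ Finset.Icc 1 n, sqrtUp (z - i)

theorem strandRoot_sq (n : ℕ) (l : ℕ × Bool) (s : ℝ) (z : ℂ) :
    strandRoot n l s z ^ 2 = strandPoly n l s z := by
  simp only [strandRoot, strandPoly, ← Finset.prod_pow, sqrtDown_sq]

theorem pageRoot_sq (n : ℕ) (z : ℂ) : pageRoot n z ^ 2 = pagePoly n z := by
  simp only [pageRoot, pagePoly, ← Finset.prod_pow, sqrtDown_sq]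

theorem pageRootUp_sq (n : ℕ) (z : ℂ) : pageRootUp n z ^ 2 = pagePoly n z := by
  simp only [pageRootUp, pagePoly, ← Finset.prod_pow, sqrtUp_sq]

theorem strandPoint_zero (l : ℕ × Bool) (i : ℕ) : strandPoint l 0 i = i := by
  simp only [strandPoint, Complex.ofReal_zero, mul_zero, zero_mul, Complex.exp_zero]
  by_cases h1 : i = l.1
  · rw [if_pos h1, h1]; ring
  by_cases h2 : i = l.1 + 1
  · rw [if_neg h1, if_pos h2, h2]; push_cast; ring
  · rw [if_neg h1, if_neg h2]

/-- A product over all strands does not see an exchange of the two moving ones. This closes up the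
polynomial and its root at the end of a letter, and it identifies an inverse letter with the letter
run backwards. -/
theorem prod_strandPoint_swap {n : ℕ} {l : ℕ × Bool} (hl : IsLetterOn n l) (g : ℂ → ℂ) {s t : ℝ}
    {l' : ℕ × Bool} (h1 : strandPoint l s l.1 = strandPoint l' t (l.1 + 1))
    (h2 : strandPoint l s (l.1 + 1) = strandPoint l' t l.1)
    (h : ∀ i, i ≠ l.1 → i ≠ l.1 + 1 → strandPoint l s i = strandPoint l' t i) :
    ∏ i ∈ Finset.Icc 1 n, g (strandPoint l s i) = ∏ i ∈ Finset.Icc 1 n, g (strandPoint l' t i) := by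
  refine Finset.prod_nbij' (Equiv.swap l.1 (l.1 + 1)) (Equiv.swap l.1 (l.1 + 1)) ?_ ?_ ?_ ?_ ?_
  · intro i hi
    obtain ⟨ha, hb⟩ := hl
    simp only [Finset.mem_Icc, Equiv.swap_apply_def] at hi ⊢
    split_ifs <;> omega
  · intro i hi
    obtain ⟨ha, hb⟩ := hl
    simp only [Finset.mem_Icc, Equiv.swap_apply_def] at hi ⊢
    split_ifs <;> omega
  · intro i _; simp
  · intro i _; simp
  · intro i _
    by_cases e1 : i = l.1
    · subst e1; rw [Equiv.swap_apply_left, h1]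
    by_cases e2 : i = l.1 + 1
    · subst e2; rw [Equiv.swap_apply_right, h2]
    · rw [Equiv.swap_apply_of_ne_of_ne e1 e2, h i e1 e2]

theorem prod_strandPoint_one {n : ℕ} {l : ℕ × Bool} (hl : IsLetterOn n l) (g : ℂ → ℂ) :
    ∏ i ∈ Finset.Icc 1 n, g (strandPoint l 1 i) = ∏ i ∈ Finset.Icc 1 n, g i := by
  have e := prod_strandPoint_swap hl g (s := 1) (l' := l) (t := 0)
  simp only [strandPoint_zero] at e
  refine e ?_ ?_ ?_
  · simp only [strandPoint]
    cases l.2 <;> simp [Complex.exp_neg, Complex.exp_pi_mul_I] <;> ring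
  · simp only [strandPoint]
    cases l.2 <;> simp [Complex.exp_neg, Complex.exp_pi_mul_I] <;> ring
  · intro i h1 h2
    simp [strandPoint, h1, h2]

/-- The rotations of `β` at time `1 - s` and of its inverse at time `s` differ by a half turn, which
exchanges the moving strands. It allows all geometry to be done for positive letters only. -/
theorem prod_strandPoint_false {n a : ℕ} {b : Bool} (hl : IsLetterOn n (a, b)) (g : ℂ → ℂ)
    (s : ℝ) : ∏ i ∈ Finset.Icc 1 n, g (strandPoint (a, !b) s i) =
      ∏ i ∈ Finset.Icc 1 n, g (strandPoint (a, b) (1 - s) i) := by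
  have e : ∀ c : Bool, Complex.exp ((if (!c) = true then 1 else -1) * Real.pi * s * Complex.I) =
      -Complex.exp ((if c = true then 1 else -1) * Real.pi * ((1 - s : ℝ) : ℂ) * Complex.I) := by
    intro c
    cases c
    · simp only [Bool.not_false, if_true, Bool.false_eq_true, if_false]
      rw [show (-1 * Real.pi * ((1 - s : ℝ) : ℂ) * Complex.I : ℂ) =
        1 * Real.pi * s * Complex.I - Real.pi * Complex.I by push_cast; ring, Complex.exp_sub,
        Complex.exp_pi_mul_I]
      ring
    · simp only [Bool.not_true, if_true, Bool.false_eq_true, if_false]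
      rw [show (1 * Real.pi * ((1 - s : ℝ) : ℂ) * Complex.I : ℂ) =
        -1 * Real.pi * s * Complex.I + Real.pi * Complex.I by push_cast; ring, Complex.exp_add,
        Complex.exp_pi_mul_I]
      ring
  refine prod_strandPoint_swap (l := (a, !b)) hl g ?_ ?_ ?_
  · simp only [strandPoint, e b]
    simp; ring
  · simp only [strandPoint, e b]
    simp; ring
  · intro i h1 h2
    simp only at h1 h2
    simp [strandPoint, h1, h2]

theorem strandPoly_zero (n : ℕ) (l : ℕ × Bool) : strandPoly n l 0 = pagePoly n := by
  funext z; simp [strandPoly, pagePoly, strandPoint_zero]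

theorem strandRoot_zero (n : ℕ) (l : ℕ × Bool) : strandRoot n l 0 = pageRoot n := by
  funext z; simp [strandRoot, pageRoot, strandPoint_zero]

theorem strandPoly_one {n : ℕ} {l : ℕ × Bool} (hl : IsLetterOn n l) :
    strandPoly n l 1 = pagePoly n := by
  funext z; exact prod_strandPoint_one hl fun q => z - q

theorem strandRoot_one {n : ℕ} {l : ℕ × Bool} (hl : IsLetterOn n l) :
    strandRoot n l 1 = pageRoot n := by
  funext z; exact prod_strandPoint_one hl fun q => sqrtDown (z - q)

theorem strandPoly_not {n a : ℕ} {b : Bool} (hl : IsLetterOn n (a, b)) (s : ℝ) :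
    strandPoly n (a, !b) s = strandPoly n (a, b) (1 - s) := by
  funext z; exact prod_strandPoint_false hl (fun q => z - q) s

theorem strandRoot_not {n a : ℕ} {b : Bool} (hl : IsLetterOn n (a, b)) (s : ℝ) :
    strandRoot n (a, !b) s = strandRoot n (a, b) (1 - s) := by
  funext z; exact prod_strandPoint_false hl (fun q => sqrtDown (z - q)) s

@[fun_prop]
theorem continuous_strandPoint (l : ℕ × Bool) (i : ℕ) : Continuous fun s => strandPoint l s i := by
  unfold strandPoint
  simp only
  split_ifs <;> fun_prop

theorem continuous_strandPoly (n : ℕ) (l : ℕ × Bool) :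
    Continuous fun q : ℂ × ℝ => strandPoly n l q.2 q.1 := by
  unfold strandPoly
  refine continuous_finsetProd _ fun i _ => continuous_fst.sub ?_
  exact (continuous_strandPoint l i).comp continuous_snd

/-! ## Labels of a circle-valued function on a page -/

/-- The double cover of the plane that is branched at the points `1, …, n`. -/
def pageCurve (n : ℕ) : Set (ℂ × ℂ) := {q | q.2 ^ 2 = pagePoly n q.1}

/-- The double cover of `ℂ × [0, 1]` that is branched along the strands during a letter. -/
def slabCurve (n : ℕ) (l : ℕ × Bool) : Set (ℂ × ℝ × ℂ) :=
  {q | q.2.1 ∈ Icc (0 : ℝ) 1 ∧ q.2.2 ^ 2 = strandPoly n l q.2.1 q.1}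

/-- The closed lower half plane. -/
def lowerHalf : Set ℂ := {z | z.im ≤ 0}

theorem starConvex_lowerHalf : StarConvex ℝ 0 lowerHalf :=
  (convex_halfSpace_im_le 0).starConvex (by simp)

theorem isPreconnected_lowerHalf : IsPreconnected lowerHalf :=
  (convex_halfSpace_im_le 0).isPreconnected

theorem continuousOn_pageRoot (n : ℕ) : ContinuousOn (pageRoot n) lowerHalf := by
  intro z hz
  refine ContinuousAt.continuousWithinAt ?_
  unfold pageRoot
  refine tendsto_finsetProd _ fun i _ => ?_
  exact ContinuousAt.comp (f := fun z : ℂ => z - i) (continuousAt_sqrtDown (Or.inr (by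
    simpa [lowerHalf] using hz))) (by fun_prop)

/-- The function `f` on the double branched cover of the plane has the label `A i` at the
branch point `i`: this is the difference at `i` of the logarithms of `f` on the two sheets over the
lower half plane which have the values `α` and `β` at the base point `r`. -/
def HasLabels (n : ℕ) (f : ℂ × ℂ → Circle) (r α β : ℝ) (A : ℕ → ℤ) : Prop :=
  ∃ g h : ℂ → ℝ, ContinuousOn g lowerHalf ∧ ContinuousOn h lowerHalf ∧
    (∀ z ∈ lowerHalf, turn (g z) = f (z, pageRoot n z)) ∧
    (∀ z ∈ lowerHalf, turn (h z) = f (z, -pageRoot n z)) ∧ g r = α ∧ h r = β ∧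
    ∀ i ∈ Icc 1 n, g i - h i = A i

theorem exists_lift_lowerHalf {n : ℕ} {f : ℂ × ℂ → Circle} (hf : ContinuousOn f (pageCurve n))
    {c : ℂ} (hc : c ^ 2 = 1) : ∃ g : ℂ → ℝ, ContinuousOn g lowerHalf ∧
      ∀ z ∈ lowerHalf, turn (g z) = f (z, c * pageRoot n z) := by
  refine exists_turn_lift starConvex_lowerHalf ?_
  refine hf.comp (continuousOn_id.prodMk (continuousOn_const.mul (continuousOn_pageRoot n))) ?_
  intro z _
  simp [pageCurve, mul_pow, hc, pageRoot_sq]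

theorem pageRoot_natCast {n i : ℕ} (hi : i ∈ Icc 1 n) : pageRoot n i = 0 :=
  Finset.prod_eq_zero (Finset.mem_Icc.2 hi) (by simp)

theorem natCast_mem_lowerHalf (i : ℕ) : (i : ℂ) ∈ lowerHalf := by simp [lowerHalf]

theorem ofReal_mem_lowerHalf (r : ℝ) : (r : ℂ) ∈ lowerHalf := by simp [lowerHalf]

/-- At a branch point the two sheets meet, so the two logarithms of the common value differ by an
integer. Each logarithm is determined up to an integer, which is spent on the prescribed value at
`r`. -/
theorem exists_hasLabels {n : ℕ} {f : ℂ × ℂ → Circle} (hf : ContinuousOn f (pageCurve n))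
    {r α β : ℝ} (hα : turn α = f (r, pageRoot n r)) (hβ : turn β = f (r, -pageRoot n r)) :
    ∃ A, HasLabels n f r α β A := by
  obtain ⟨g, hg, eg⟩ := exists_lift_lowerHalf hf (c := 1) (by simp)
  obtain ⟨h, hh, eh⟩ := exists_lift_lowerHalf hf (c := -1) (by simp)
  simp only [one_mul] at eg
  simp only [neg_one_mul] at eh
  obtain ⟨k, hk⟩ := turn_eq_turn_iff.1 ((eg r (ofReal_mem_lowerHalf r)).trans hα.symm)
  obtain ⟨m, hm⟩ := turn_eq_turn_iff.1 ((eh r (ofReal_mem_lowerHalf r)).trans hβ.symm)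
  have key : ∀ i ∈ Icc 1 n, ∃ a : ℤ, g i - k - (h i - m) = a := fun i hi => by
    have h1 := eg i (natCast_mem_lowerHalf i)
    have h2 := eh i (natCast_mem_lowerHalf i)
    rw [pageRoot_natCast hi] at h1 h2
    rw [neg_zero] at h2
    obtain ⟨a, ha⟩ := turn_eq_turn_iff.1 (h1.trans h2.symm)
    exact ⟨a - k + m, by rw [ha]; push_cast; ring⟩
  choose! A hA using key
  have e : ∀ (x : ℝ) (j : ℤ), turn (x - j) = turn x := fun x j => by
    have := turn_add_intCast x (-j)
    rwa [Int.cast_neg, ← sub_eq_add_neg] at this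
  refine ⟨A, fun z => g z - k, fun z => h z - m, hg.sub continuousOn_const,
    hh.sub continuousOn_const, fun z hz => ?_, fun z hz => ?_, by simp [hk], by simp [hm], hA⟩
  · rw [e, eg z hz]
  · rw [e, eh z hz]

/-- If the logarithms at the base point return after a period with different increments, the labels
are translated by the difference of the increments. This is where the condition `A + 1` originates.
-/
theorem HasLabels.shift {n : ℕ} {f : ℂ × ℂ → Circle} {r α β : ℝ} {A : ℕ → ℤ}
    (h : HasLabels n f r α β A) (p q : ℤ) :
    HasLabels n f r (α + p) (β + q) (fun i => A i + (p - q)) := by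
  obtain ⟨g, h, hg, hh, eg, eh, hα, hβ, hA⟩ := h
  refine ⟨fun z => g z + p, fun z => h z + q, hg.add continuousOn_const,
    hh.add continuousOn_const, fun z hz => ?_, fun z hz => ?_, by simp [hα], by simp [hβ],
    fun i hi => ?_⟩
  · rw [turn_add_intCast, eg z hz]
  · rw [turn_add_intCast, eh z hz]
  · push_cast; rw [← hA i hi]; ring

/-- The lower half plane is connected, so the values at the base point determine both logarithms
there. -/
theorem HasLabels.eqOn {n : ℕ} {f : ℂ × ℂ → Circle} {r α β : ℝ} {A A' : ℕ → ℤ}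
    (h : HasLabels n f r α β A) (h' : HasLabels n f r α β A') : EqOn A A' (Icc 1 n) := by
  obtain ⟨g, h, hg, hh, eg, eh, hα, hβ, hA⟩ := h
  obtain ⟨g', h', hg', hh', eg', eh', hα', hβ', hA'⟩ := h'
  obtain ⟨k, hk⟩ := isPreconnected_lowerHalf.exists_int_sub_eq hg hg' fun z hz => by
    rw [eg z hz, eg' z hz]
  obtain ⟨m, hm⟩ := isPreconnected_lowerHalf.exists_int_sub_eq hh hh' fun z hz => by
    rw [eh z hz, eh' z hz]
  have k0 := hk r (ofReal_mem_lowerHalf r)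
  have m0 := hm r (ofReal_mem_lowerHalf r)
  intro i hi
  have h1 := hk i (natCast_mem_lowerHalf i)
  have h2 := hm i (natCast_mem_lowerHalf i)
  have h3 := hA i hi
  have h4 := hA' i hi
  have : (A i : ℝ) = A' i := by linarith
  exact_mod_cast this

theorem HasLabels.congr {n : ℕ} {f : ℂ × ℂ → Circle} {r α β : ℝ} {A A' : ℕ → ℤ}
    (h : HasLabels n f r α β A) (e : EqOn A A' (Icc 1 n)) : HasLabels n f r α β A' := by
  obtain ⟨g, h, hg, hh, eg, eh, hα, hβ, hA⟩ := h
  exact ⟨g, h, hg, hh, eg, eh, hα, hβ, fun i hi => by rw [hA i hi, e hi]⟩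

/-! ## The region below the strands -/

/-- A function that is `1` on `[a, a + 1]` and `0` off `(a - 1, a + 2)`. -/
noncomputable def tent (a : ℕ) (x : ℝ) : ℝ := max 0 (min 1 (min (x - (a - 1)) (a + 2 - x)))

/-- The height of the lower one of the moving strands, cut off near the resting strands. -/
noncomputable def lowHeight (a : ℕ) (s x : ℝ) : ℝ := -(Real.sin (Real.pi * s) / 2) * tent a x

/-- The region below all strands during the letter `β_a`. -/
def lowRegion (a : ℕ) : Set (ℂ × ℝ) := {q | q.2 ∈ Icc (0 : ℝ) 1 ∧ q.1.im ≤ lowHeight a q.2 q.1.re}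

theorem tent_nonneg (a : ℕ) (x : ℝ) : 0 ≤ tent a x := le_max_left _ _

theorem tent_le_one (a : ℕ) (x : ℝ) : tent a x ≤ 1 := max_le zero_le_one (min_le_left _ _)

theorem tent_eq_one {a : ℕ} {x : ℝ} (h1 : a ≤ x) (h2 : x ≤ a + 1) : tent a x = 1 := by
  rw [tent, min_eq_left (le_min (by linarith) (by linarith)), max_eq_right zero_le_one]

theorem tent_eq_zero {a : ℕ} {x : ℝ} (h : x ≤ a - 1 ∨ a + 2 ≤ x) : tent a x = 0 := by
  rw [tent, max_eq_left]
  rcases h with h | h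
  · exact (min_le_right _ _).trans ((min_le_left _ _).trans (by linarith))
  · exact (min_le_right _ _).trans ((min_le_right _ _).trans (by linarith))

theorem sin_pi_mul_nonneg {s : ℝ} (hs : s ∈ Icc (0 : ℝ) 1) : 0 ≤ Real.sin (Real.pi * s) :=
  Real.sin_nonneg_of_nonneg_of_le_pi (mul_nonneg Real.pi_pos.le hs.1)
    (mul_le_of_le_one_right Real.pi_pos.le hs.2)

@[fun_prop]
theorem continuous_tent (a : ℕ) : Continuous (tent a) := by unfold tent; fun_prop

theorem continuous_lowHeight (a : ℕ) : Continuous fun q : ℝ × ℝ => lowHeight a q.1 q.2 := by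
  unfold lowHeight; fun_prop

theorem lowHeight_nonpos {a : ℕ} {s : ℝ} (hs : s ∈ Icc (0 : ℝ) 1) (x : ℝ) :
    lowHeight a s x ≤ 0 := by
  have := mul_nonneg (sin_pi_mul_nonneg hs) (tent_nonneg a x)
  unfold lowHeight; linarith

theorem le_lowHeight {a : ℕ} {s : ℝ} (hs : s ∈ Icc (0 : ℝ) 1) (x : ℝ) :
    -(Real.sin (Real.pi * s) / 2) ≤ lowHeight a s x := by
  have := mul_le_mul_of_nonneg_left (tent_le_one a x) (sin_pi_mul_nonneg hs)
  unfold lowHeight; linarith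

theorem strandPoint_left (a : ℕ) (s : ℝ) : strandPoint (a, true) s a =
    a + 1 / 2 - Complex.exp (Real.pi * s * Complex.I) / 2 := by simp [strandPoint]

theorem strandPoint_right (a : ℕ) (s : ℝ) : strandPoint (a, true) s (a + 1) =
    a + 1 / 2 + Complex.exp (Real.pi * s * Complex.I) / 2 := by simp [strandPoint]

theorem strandPoint_of_ne {a i : ℕ} (b : Bool) (s : ℝ) (h1 : i ≠ a) (h2 : i ≠ a + 1) :
    strandPoint (a, b) s i = i := by simp [strandPoint, h1, h2]

theorem exp_pi_mul_eq (s : ℝ) : Complex.exp (Real.pi * s * Complex.I) =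
    Real.cos (Real.pi * s) + Real.sin (Real.pi * s) * Complex.I := by
  rw [Complex.exp_mul_I]; push_cast; rfl

theorem strandPoint_left_re (a : ℕ) (s : ℝ) :
    (strandPoint (a, true) s a).re = a + 1 / 2 - Real.cos (Real.pi * s) / 2 := by
  rw [strandPoint_left, exp_pi_mul_eq]
  simp only [Complex.sub_re, Complex.add_re, Complex.div_ofNat_re, Complex.ofReal_re,
    Complex.mul_re, Complex.ofReal_im, Complex.I_re, Complex.I_im, Complex.natCast_re,
    Complex.one_re]
  ring

theorem strandPoint_left_im (a : ℕ) (s : ℝ) :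
    (strandPoint (a, true) s a).im = -(Real.sin (Real.pi * s) / 2) := by
  rw [strandPoint_left, exp_pi_mul_eq]
  simp only [Complex.sub_im, Complex.add_im, Complex.div_ofNat_im, Complex.ofReal_re,
    Complex.mul_im, Complex.ofReal_im, Complex.I_re, Complex.I_im, Complex.natCast_im,
    Complex.one_im]
  ring

theorem strandPoint_right_im (a : ℕ) (s : ℝ) :
    (strandPoint (a, true) s (a + 1)).im = Real.sin (Real.pi * s) / 2 := by
  rw [strandPoint_right, exp_pi_mul_eq]
  simp only [Complex.add_im, Complex.div_ofNat_im, Complex.ofReal_re,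
    Complex.mul_im, Complex.ofReal_im, Complex.I_re, Complex.I_im, Complex.natCast_im,
    Complex.one_im]
  ring

theorem strandPoint_left_re_mem (a : ℕ) (s : ℝ) :
    (a : ℝ) ≤ (strandPoint (a, true) s a).re ∧ (strandPoint (a, true) s a).re ≤ a + 1 := by
  rw [strandPoint_left_re]
  have h1 := Real.cos_le_one (Real.pi * s)
  have h2 := Real.neg_one_le_cos (Real.pi * s)
  constructor <;> linarith

/-- The upward cuts avoid the region: it passes below the lower moving strand, where the tent has
height 1, and stays in the lower half plane, which has no point strictly above any other strand. -/
theorem re_ne_zero_or_im_nonpos {a : ℕ} {q : ℂ × ℝ} (hq : q ∈ lowRegion a) (i : ℕ) :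
    (q.1 - strandPoint (a, true) q.2 i).re ≠ 0 ∨ (q.1 - strandPoint (a, true) q.2 i).im ≤ 0 := by
  obtain ⟨hs, hq⟩ := hq
  have h0 := lowHeight_nonpos (a := a) hs q.1.re
  by_cases h1 : i = a
  · subst h1
    refine or_iff_not_imp_left.2 fun h => ?_
    rw [not_not, Complex.sub_re, sub_eq_zero] at h
    obtain ⟨h1, h2⟩ := strandPoint_left_re_mem i q.2
    rw [Complex.sub_im, strandPoint_left_im]
    rw [lowHeight, tent_eq_one (h ▸ h1) (h ▸ h2)] at hq
    linarith
  by_cases h2 : i = a + 1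
  · subst h2
    right
    have := sin_pi_mul_nonneg hs
    rw [Complex.sub_im, strandPoint_right_im]
    linarith
  · right
    rw [strandPoint_of_ne _ _ h1 h2]
    simp; linarith

theorem continuousOn_strandRoot (n a : ℕ) :
    ContinuousOn (fun q : ℂ × ℝ => strandRoot n (a, true) q.2 q.1) (lowRegion a) := by
  intro q hq
  refine ContinuousAt.continuousWithinAt ?_
  unfold strandRoot
  refine tendsto_finsetProd _ fun i _ => ?_
  exact ContinuousAt.comp (f := fun q : ℂ × ℝ => q.1 - strandPoint (a, true) q.2 i)
    (continuousAt_sqrtDown (re_ne_zero_or_im_nonpos hq i))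
    (continuous_fst.sub ((continuous_strandPoint _ i).comp continuous_snd)).continuousAt

/-- A vertical shear, `up` with inverse `down`, identifies the region with the convex set `lowerHalf
×ˢ Icc 0 1`, and there logarithms exist. -/
theorem exists_lift_lowRegion {n a : ℕ} {F : ℂ × ℝ × ℂ → Circle}
    (hF : ContinuousOn F (slabCurve n (a, true))) {c : ℂ} (hc : c ^ 2 = 1) :
    ∃ g : ℂ × ℝ → ℝ, ContinuousOn g (lowRegion a) ∧
      ∀ q ∈ lowRegion a, turn (g q) = F (q.1, q.2, c * strandRoot n (a, true) q.2 q.1) := by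
  let K : Set (ℂ × ℝ) := lowerHalf ×ˢ Icc 0 1
  have hK : StarConvex ℝ ((0 : ℂ), (0 : ℝ)) K :=
    ((convex_halfSpace_im_le 0).prod (convex_Icc 0 1)).starConvex (by simp)
  let up : ℂ × ℝ → ℂ × ℝ := fun q => (q.1 + (lowHeight a q.2 q.1.re : ℂ) * Complex.I, q.2)
  let down : ℂ × ℝ → ℂ × ℝ := fun q => (q.1 - (lowHeight a q.2 q.1.re : ℂ) * Complex.I, q.2)
  have hup : Continuous up := by
    have := (continuous_lowHeight a).comp (g := fun q : ℝ × ℝ => lowHeight a q.1 q.2)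
      (f := fun q : ℂ × ℝ => (q.2, q.1.re)) (by fun_prop)
    simp only [Function.comp_def] at this
    fun_prop
  have hdown : Continuous down := by
    have := (continuous_lowHeight a).comp (g := fun q : ℝ × ℝ => lowHeight a q.1 q.2)
      (f := fun q : ℂ × ℝ => (q.2, q.1.re)) (by fun_prop)
    simp only [Function.comp_def] at this
    fun_prop
  have mup : MapsTo up K (lowRegion a) := by
    rintro ⟨z, s⟩ ⟨hz, hs⟩
    have hz : z.im ≤ 0 := hz
    exact ⟨hs, by simp [up, hz]⟩
  have mdown : MapsTo down (lowRegion a) K := by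
    rintro ⟨z, s⟩ ⟨hs, hz⟩
    exact ⟨by simpa [down, lowerHalf] using hz, hs⟩
  obtain ⟨g, hg, eg⟩ := exists_turn_lift hK (f := fun q =>
      F ((up q).1, (up q).2, c * strandRoot n (a, true) (up q).2 (up q).1)) (by
    refine ContinuousOn.comp (g := F) hF (t := slabCurve n (a, true))
      (f := fun q => ((up q).1, (up q).2, c * strandRoot n (a, true) (up q).2 (up q).1)) ?_ ?_
    · have := (continuousOn_strandRoot n a).comp hup.continuousOn mup
      simp only [Function.comp_def] at this
      fun_prop
    · intro q hq
      exact ⟨(mup hq).1, by simp [mul_pow, hc, strandRoot_sq]⟩)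
  refine ⟨fun q => g (down q), hg.comp hdown.continuousOn mdown, fun q hq => ?_⟩
  rw [eg _ (mdown hq)]
  have : up (down q) = q := by simp [up, down]
  rw [this]

/-! ## The effect of a letter on labels -/

theorem strandRoot_eq_mul {n a : ℕ} (hl : IsLetterOn n (a, true)) (s : ℝ) (z : ℂ) :
    strandRoot n (a, true) s z = sqrtDown (z - strandPoint (a, true) s a) *
      sqrtDown (z - strandPoint (a, true) s (a + 1)) *
        ∏ i ∈ ((Finset.Icc 1 n).erase a).erase (a + 1), sqrtDown (z - i) := by
  obtain ⟨h1, h2⟩ := hl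
  simp only at h1 h2
  rw [strandRoot, ← Finset.mul_prod_erase _ _ (Finset.mem_Icc.2 ⟨h1, by omega⟩),
    ← Finset.mul_prod_erase ((Finset.Icc 1 n).erase a) _
      (Finset.mem_erase.2 ⟨by omega, Finset.mem_Icc.2 ⟨by omega, h2⟩⟩), mul_assoc]
  congr 2
  refine Finset.prod_congr rfl fun i hi => ?_
  simp only [Finset.mem_erase] at hi
  rw [strandPoint_of_ne _ _ hi.2.1 hi.1]

theorem strandPoint_right_eq (a : ℕ) (s : ℝ) : strandPoint (a, true) s (a + 1) =
    strandPoint (a, true) s a + Complex.exp (Real.pi * s * Complex.I) := by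
  rw [strandPoint_left, strandPoint_right]; ring

/-- A continuous square root of `v ^ 2 - exp (π i s)` on the unit disk. -/
noncomputable def discRoot (v : ℂ) (s : ℝ) : ℂ :=
  -Complex.I * Complex.exp (Real.pi * (s / 2 : ℝ) * Complex.I) *
    sqrtDown (1 - v ^ 2 * Complex.exp (-(Real.pi * s * Complex.I)))

theorem discRoot_sq (v : ℂ) (s : ℝ) :
    discRoot v s ^ 2 = v ^ 2 - Complex.exp (Real.pi * s * Complex.I) := by
  have h : Complex.exp (Real.pi * (s / 2 : ℝ) * Complex.I) ^ 2 =
      Complex.exp (Real.pi * s * Complex.I) := by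
    rw [← Complex.exp_nat_mul]; congr 1; push_cast; ring
  have h' : Complex.exp (Real.pi * s * Complex.I) * Complex.exp (-(Real.pi * s * Complex.I)) = 1 := by
    rw [← Complex.exp_add]; simp
  rw [discRoot, mul_pow, mul_pow, sqrtDown_sq, h, neg_sq, Complex.I_sq]
  linear_combination v ^ 2 * h'

/-- A point of norm at most 1 has real part 1 only if it equals 1. Hence the argument of `sqrtDown`
in `discRoot` meets the imaginary axis only at 0, where the branch is still continuous. -/
theorem disc_arg {v : ℂ} (hv : ‖v‖ ≤ 1) (s : ℝ) :
    0 < (1 - v ^ 2 * Complex.exp (-(Real.pi * s * Complex.I))).re ∨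
      1 - v ^ 2 * Complex.exp (-(Real.pi * s * Complex.I)) = 0 := by
  set x := v ^ 2 * Complex.exp (-(Real.pi * s * Complex.I)) with hx
  have hn : ‖x‖ ≤ 1 := by
    rw [hx, norm_mul, norm_pow, show -(Real.pi * s * Complex.I : ℂ) =
      ((-(Real.pi * s) : ℝ) : ℂ) * Complex.I by push_cast; ring, Complex.norm_exp_ofReal_mul_I,
      mul_one]
    exact pow_le_one₀ (norm_nonneg _) hv
  have h1 : x.re ≤ 1 := (Complex.re_le_norm x).trans hn
  rcases h1.lt_or_eq with h | h
  · left; simp; exact h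
  · right
    have h2 : x.re ^ 2 + x.im ^ 2 ≤ 1 := by
      have := Complex.sq_norm x
      rw [Complex.normSq_apply] at this
      nlinarith [norm_nonneg x]
    have h3 : x.im = 0 := by rw [h] at h2; nlinarith [sq_nonneg x.im]
    rw [sub_eq_zero]; exact (Complex.ext (by simpa using h) (by simpa using h3)).symm

theorem continuousOn_discRoot :
    ContinuousOn (fun q : ℂ × ℝ => discRoot q.1 q.2) (Metric.closedBall 0 1 ×ˢ univ) := by
  rintro ⟨v, s⟩ ⟨hv, -⟩
  refine ContinuousAt.continuousWithinAt ?_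
  unfold discRoot
  refine ContinuousAt.mul (by fun_prop) ?_
  refine ContinuousAt.comp (g := sqrtDown)
    (f := fun q : ℂ × ℝ => 1 - q.1 ^ 2 * Complex.exp (-(Real.pi * q.2 * Complex.I))) ?_
    (by fun_prop)
  refine continuousAt_sqrtDown ?_
  rcases disc_arg (by simpa using hv) s with h | h
  · exact Or.inl h.ne'
  · right; simp only [h]; simp

theorem re_sub_im_sqrtDown (ζ : ℂ) : 0 ≤ (sqrtDown ζ).re - (sqrtDown ζ).im := by
  have h : 0 ≤ ((Complex.I * ζ) ^ (2⁻¹ : ℂ)).re := by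
    rw [show (2⁻¹ : ℂ) = (((2 : ℕ) : ℂ))⁻¹ by norm_num]
    by_cases h0 : Complex.I * ζ = 0
    · rw [h0]; simp
    rw [Complex.cpow_def_of_ne_zero h0, Complex.exp_re]
    refine mul_nonneg (Real.exp_pos _).le (Real.cos_nonneg_of_mem_Icc ?_)
    have : (Complex.log (Complex.I * ζ) * ((2 : ℕ) : ℂ)⁻¹).im = (Complex.I * ζ).arg / 2 := by
      rw [show (Complex.log (Complex.I * ζ) * ((2 : ℕ) : ℂ)⁻¹) =
        Complex.log (Complex.I * ζ) / 2 by push_cast; ring, Complex.div_ofNat_im, Complex.log_im]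
    rw [this]
    have h1 := Complex.neg_pi_lt_arg (Complex.I * ζ)
    have h2 := Complex.arg_le_pi (Complex.I * ζ)
    constructor <;> linarith
  have e : (sqrtDown ζ).re - (sqrtDown ζ).im = √2 * ((Complex.I * ζ) ^ (2⁻¹ : ℂ)).re := by
    rw [sqrtDown, exp_quarter]
    simp [Complex.mul_re, Complex.mul_im]
    ring
  rw [e]; positivity

/-- Both sides are square roots of the same number, whose imaginary part is at most 0. A root of
such a number lies in the second or the fourth quadrant. `discRoot` has real part at least its
imaginary part, so it lies in the fourth one, where `sqrtDown` takes its value. -/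
theorem sqrtDown_eq_discRoot {v : ℂ} (hv : ‖v‖ ≤ 1) (him : (v ^ 2).im ≤ 0) {s : ℝ}
    (hs : s ∈ Icc (0 : ℝ) 1) :
    sqrtDown (v ^ 2 - Complex.exp (Real.pi * s * Complex.I)) = discRoot v s := by
  set y := sqrtDown (1 - v ^ 2 * Complex.exp (-(Real.pi * s * Complex.I))) with hy
  have hy2 : 0 ≤ (y ^ 2).re := by
    rw [hy, sqrtDown_sq]
    rcases disc_arg hv s with h | h
    · exact h.le
    · rw [h]; simp
  have hy0 : 0 ≤ y.re - y.im := re_sub_im_sqrtDown _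
  have hy3 : 0 ≤ y.re + y.im := by
    by_contra h
    rw [sq, Complex.mul_re] at hy2
    have hneg := not_le.1 h
    have : (y.re - y.im) * (y.re + y.im) = 0 :=
      le_antisymm (mul_nonpos_of_nonneg_of_nonpos hy0 hneg.le) (by nlinarith)
    rcases mul_eq_zero.1 this with h1 | h1
    · have hyd : 0 < (1 - v ^ 2 * Complex.exp (-(Real.pi * s * Complex.I))).re ∨ y = 0 := by
        rcases disc_arg hv s with h | h
        · exact Or.inl h
        · exact Or.inr (by rw [hy, h, sqrtDown_zero])
      rcases hyd with h2 | h2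
      · rw [← sqrtDown_sq (1 - v ^ 2 * Complex.exp (-(Real.pi * s * Complex.I))), ← hy, sq,
          Complex.mul_re] at h2
        nlinarith
      · rw [h2] at hneg; simp at hneg
    · exact hneg.ne h1
  have hs2 : 0 ≤ Real.sin (Real.pi * (s / 2)) :=
    sin_pi_mul_nonneg ⟨by linarith [hs.1], by linarith [hs.2]⟩
  have hc2 : 0 ≤ Real.cos (Real.pi * (s / 2)) := by
    refine Real.cos_nonneg_of_mem_Icc ⟨?_, ?_⟩ <;> nlinarith [Real.pi_pos, hs.1, hs.2]
  have hw : discRoot v s = -Complex.I * (Real.cos (Real.pi * (s / 2)) +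
      Real.sin (Real.pi * (s / 2)) * Complex.I) * y := by
    rw [discRoot, ← hy, exp_pi_mul_eq]
  have hre : (discRoot v s).re =
      Real.sin (Real.pi * (s / 2)) * y.re + Real.cos (Real.pi * (s / 2)) * y.im := by
    rw [hw]
    simp only [Complex.mul_re, Complex.mul_im, Complex.neg_re, Complex.neg_im, Complex.I_re,
      Complex.I_im, Complex.add_re, Complex.add_im, Complex.ofReal_re, Complex.ofReal_im]
    ring
  have him' : (discRoot v s).im =
      Real.sin (Real.pi * (s / 2)) * y.im - Real.cos (Real.pi * (s / 2)) * y.re := by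
    rw [hw]
    simp only [Complex.mul_re, Complex.mul_im, Complex.neg_re, Complex.neg_im, Complex.I_re,
      Complex.I_im, Complex.add_re, Complex.add_im, Complex.ofReal_re, Complex.ofReal_im]
    ring
  have hd : 0 ≤ (discRoot v s).re - (discRoot v s).im := by
    rw [hre, him']
    nlinarith [mul_nonneg hs2 hy0, mul_nonneg hc2 hy3]
  have hxi : (discRoot v s).re * (discRoot v s).im ≤ 0 := by
    have : (discRoot v s ^ 2).im ≤ 0 := by
      rw [discRoot_sq, Complex.sub_im, exp_pi_mul_eq]
      have : ((Real.cos (Real.pi * s) : ℂ) + Real.sin (Real.pi * s) * Complex.I).im =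
          Real.sin (Real.pi * s) := by
        simp only [Complex.add_im, Complex.mul_im, Complex.ofReal_im, Complex.ofReal_re,
          Complex.I_re, Complex.I_im]; ring
      rw [this]
      have := sin_pi_mul_nonneg hs
      linarith
    rw [sq, Complex.mul_im] at this
    linarith
  rw [← discRoot_sq]
  refine sqrtDown_pow_two ?_ ?_ <;> by_contra hcon <;> rw [not_le] at hcon <;> nlinarith

/-- The product of the roots of the resting strands, on a disk about the lower moving strand. -/
theorem continuousOn_restRoot (n a : ℕ) :
    ContinuousOn (fun q : ℂ × ℝ => ∏ i ∈ ((Finset.Icc 1 n).erase a).erase (a + 1),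
      sqrtDown (strandPoint (a, true) q.2 a + q.1 ^ 2 - i)) (Metric.closedBall 0 1 ×ˢ univ) := by
  rintro ⟨v, s⟩ ⟨hv, -⟩
  refine ContinuousAt.continuousWithinAt ?_
  refine tendsto_finsetProd _ fun i hi => ?_
  simp only [Finset.mem_erase] at hi
  refine ContinuousAt.comp (g := sqrtDown)
    (f := fun q : ℂ × ℝ => strandPoint (a, true) q.2 a + q.1 ^ 2 - i) ?_ ?_
  · refine continuousAt_sqrtDown (or_iff_not_imp_left.2 fun h => ?_)
    rw [not_not] at h
    simp only [Complex.sub_re, Complex.add_re, Complex.natCast_re] at h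
    obtain ⟨h1, h2⟩ := strandPoint_left_re_mem a s
    have hn : ‖v ^ 2‖ ≤ 1 := by
      rw [norm_pow]; exact pow_le_one₀ (norm_nonneg _) (by simpa using hv)
    have hsq : (v ^ 2).re ^ 2 + (v ^ 2).im ^ 2 ≤ 1 := by
      have := Complex.sq_norm (v ^ 2)
      rw [Complex.normSq_apply] at this
      nlinarith [norm_nonneg (v ^ 2)]
    have h3 := abs_le.1 ((Complex.abs_re_le_norm (v ^ 2)).trans hn)
    have hcos := strandPoint_left_re a s
    -- A resting strand is at horizontal distance at least 1 from the lower moving strand. Vertical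
    -- alignment therefore forces `v²` to be `±1` and the moving strand to be at an end of its path,
    -- so the point is the resting strand itself and is not on the open cut.
    have hdisj : i + 1 ≤ a ∨ a + 2 ≤ i := by omega
    have him : (v ^ 2).im = 0 := by
      have : (v ^ 2).re ^ 2 = 1 := by
        rcases hdisj with h4 | h4
        · have h4' : (i : ℝ) + 1 ≤ a := by exact_mod_cast h4
          have : (v ^ 2).re = -1 := by linarith
          rw [this]; norm_num
        · have h4' : (a : ℝ) + 2 ≤ i := by exact_mod_cast h4
          have : (v ^ 2).re = 1 := by linarith
          rw [this]; norm_num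
      nlinarith [sq_nonneg (v ^ 2).im]
    have hsin : Real.sin (Real.pi * s) = 0 := by
      have : Real.cos (Real.pi * s) ^ 2 = 1 := by
        rcases hdisj with h4 | h4
        · have h4' : (i : ℝ) + 1 ≤ a := by exact_mod_cast h4
          have : Real.cos (Real.pi * s) = 1 := by
            have := Real.cos_le_one (Real.pi * s); linarith
          rw [this]; norm_num
        · have h4' : (a : ℝ) + 2 ≤ i := by exact_mod_cast h4
          have : Real.cos (Real.pi * s) = -1 := by
            have := Real.neg_one_le_cos (Real.pi * s); linarith
          rw [this]; norm_num
      have := Real.sin_sq_add_cos_sq (Real.pi * s)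
      nlinarith [sq_nonneg (Real.sin (Real.pi * s))]
    simp only [Complex.sub_im, Complex.add_im, Complex.natCast_im, strandPoint_left_im, him, hsin]
    simp
  · have := (continuous_strandPoint (a, true) a).comp (continuous_snd (X := ℂ) (Y := ℝ))
    simp only [Function.comp_def] at this
    fun_prop

/-- A chart of the double branched cover, near the lower one of the moving strands. -/
noncomputable def discChart (n a : ℕ) (q : ℂ × ℝ) : ℂ × ℝ × ℂ :=
  (strandPoint (a, true) q.2 a + q.1 ^ 2, q.2, q.1 * discRoot q.1 q.2 *
    ∏ i ∈ ((Finset.Icc 1 n).erase a).erase (a + 1),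
      sqrtDown (strandPoint (a, true) q.2 a + q.1 ^ 2 - i))

theorem discChart_mem {n a : ℕ} (hl : IsLetterOn n (a, true)) {q : ℂ × ℝ}
    (hq : q.2 ∈ Icc (0 : ℝ) 1) : discChart n a q ∈ slabCurve n (a, true) := by
  refine ⟨hq, ?_⟩
  simp only [discChart]
  rw [← strandRoot_sq, strandRoot_eq_mul hl, strandPoint_right_eq]
  simp only [mul_pow, sqrtDown_sq, discRoot_sq]
  ring

/-- The map `v ↦ v²` takes the fourth and the second quadrant to the lower half disk below the
moving strand. In the chart the fourth quadrant (`c = 1`) is the first sheet over it and the second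
quadrant (`c = -1`) is the second sheet. -/
theorem discChart_eq {n a : ℕ} (hl : IsLetterOn n (a, true)) {v : ℂ} {s c : ℝ} (hv : ‖v‖ ≤ 1)
    (hs : s ∈ Icc (0 : ℝ) 1) (hc : c ^ 2 = 1) (h1 : 0 ≤ c * v.re) (h2 : c * v.im ≤ 0) :
    discChart n a (v, s) = (strandPoint (a, true) s a + v ^ 2, s,
      c * strandRoot n (a, true) s (strandPoint (a, true) s a + v ^ 2)) := by
  have him : (v ^ 2).im ≤ 0 := by
    rw [sq, Complex.mul_im]
    nlinarith [mul_nonpos_of_nonneg_of_nonpos h1 h2]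
  have e1 : sqrtDown (v ^ 2) = c * v := by
    have hcc : (c : ℂ) ^ 2 = 1 := by rw [← Complex.ofReal_pow, hc]; simp
    rw [show v ^ 2 = (c * v) ^ 2 by rw [mul_pow, hcc, one_mul]]
    exact sqrtDown_pow_two (by simpa using h1) (by simpa using h2)
  have hcc : (c : ℂ) * c = 1 := by rw [← sq, ← Complex.ofReal_pow, hc]; simp
  simp only [discChart]
  rw [strandRoot_eq_mul hl, strandPoint_right_eq, add_sub_cancel_left,
    show strandPoint (a, true) s a + v ^ 2 - (strandPoint (a, true) s a +
      Complex.exp (Real.pi * s * Complex.I)) = v ^ 2 - Complex.exp (Real.pi * s * Complex.I) by ring,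
    sqrtDown_eq_discRoot hv him hs, e1]
  congr 2
  linear_combination (-(v * discRoot v s *
    ∏ i ∈ ((Finset.Icc 1 n).erase a).erase (a + 1),
      sqrtDown (strandPoint (a, true) s a + v ^ 2 - i))) * hcc

theorem add_mem_lowRegion {a : ℕ} {ζ : ℂ} {s : ℝ} (hs : s ∈ Icc (0 : ℝ) 1) (h : ζ.im ≤ 0) :
    (strandPoint (a, true) s a + ζ, s) ∈ lowRegion a := by
  refine ⟨hs, ?_⟩
  simp only [Complex.add_im, strandPoint_left_im]
  have := le_lowHeight (a := a) hs (strandPoint (a, true) s a + ζ).re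
  linarith

/-- The relation between the labels of the two moving strands. -/
theorem labels_of_disc {n a : ℕ} (hl : IsLetterOn n (a, true)) {F : ℂ × ℝ × ℂ → Circle}
    (hF : ContinuousOn F (slabCurve n (a, true))) {g h : ℂ × ℝ → ℝ}
    (hg : ContinuousOn g (lowRegion a)) (hh : ContinuousOn h (lowRegion a))
    (eg : ∀ q ∈ lowRegion a, turn (g q) = F (q.1, q.2, strandRoot n (a, true) q.2 q.1))
    (eh : ∀ q ∈ lowRegion a, turn (h q) = F (q.1, q.2, -strandRoot n (a, true) q.2 q.1)) :
    g ((a + 1 : ℕ), 1) - h ((a + 1 : ℕ), 1) = g (a, 0) - h (a, 0) ∧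
      g (a, 1) - h (a, 1) = 2 * (g (a, 0) - h (a, 0)) -
        (g ((a + 1 : ℕ), 0) - h ((a + 1 : ℕ), 0)) := by
  set B : Set (ℂ × ℝ) := Metric.closedBall 0 1 ×ˢ Icc 0 1 with hB
  have hBc : Convex ℝ B := (convex_closedBall 0 1).prod (convex_Icc 0 1)
  have hB0 : ((0 : ℂ), (0 : ℝ)) ∈ B := by simp [hB]
  have hBu : B ⊆ Metric.closedBall 0 1 ×ˢ univ := prod_mono le_rfl (subset_univ _)
  have cchart : ContinuousOn (discChart n a) B := by
    have h1 := continuousOn_discRoot.mono hBu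
    have h2 := (continuousOn_restRoot n a).mono hBu
    have h3 := (continuous_strandPoint (a, true) a).comp (continuous_snd (X := ℂ) (Y := ℝ))
    simp only [Function.comp_def] at h3
    unfold discChart
    exact (by fun_prop : Continuous _).continuousOn.prodMk (continuousOn_snd.prodMk
      ((continuousOn_fst.mul h1).mul h2))
  -- One logarithm `u` on the whole chart links the two sheets. On the fourth quadrant it is `g` up
  -- to an integer, on the second it is `h` up to an integer, and at `v = 0` both descriptions hold.
  -- So the label of the lower moving strand is constant in time.
  obtain ⟨u, hu, eu⟩ := exists_turn_lift (hBc.starConvex hB0) (f := fun q => F (discChart n a q))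
    (hF.comp cchart fun q hq => discChart_mem hl hq.2)
  have quadrant : ∀ (c : ℝ), c ^ 2 = 1 → ∀ k : ℂ × ℝ → ℝ, ContinuousOn k (lowRegion a) →
      (∀ q ∈ lowRegion a, turn (k q) = F (q.1, q.2, c * strandRoot n (a, true) q.2 q.1)) →
      ∃ m : ℤ, ∀ v : ℂ, ∀ s : ℝ, ‖v‖ ≤ 1 → s ∈ Icc (0 : ℝ) 1 → 0 ≤ c * v.re → c * v.im ≤ 0 →
        u (v, s) = k (strandPoint (a, true) s a + v ^ 2, s) + m := by
    intro c hc k hk ek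
    set Q : Set (ℂ × ℝ) := {q | q ∈ B ∧ 0 ≤ c * q.1.re ∧ c * q.1.im ≤ 0} with hQ
    have hQc : Convex ℝ Q := by
      have h1 : Convex ℝ {q : ℂ × ℝ | 0 ≤ c * q.1.re} :=
        convex_halfSpace_ge (f := fun q : ℂ × ℝ => c * q.1.re)
          ⟨fun x y => by simp [mul_add], fun r x => by simp; ring⟩ 0
      have h2 : Convex ℝ {q : ℂ × ℝ | c * q.1.im ≤ 0} :=
        convex_halfSpace_le (f := fun q : ℂ × ℝ => c * q.1.im)
          ⟨fun x y => by simp [mul_add], fun r x => by simp; ring⟩ 0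
      exact hBc.inter (h1.inter h2)
    have mapQ : MapsTo (fun q : ℂ × ℝ => (strandPoint (a, true) q.2 a + q.1 ^ 2, q.2)) Q
        (lowRegion a) := by
      rintro ⟨v, s⟩ ⟨⟨hv, hs⟩, h1, h2⟩
      refine add_mem_lowRegion hs ?_
      simp only at h1 h2 ⊢
      rw [sq, Complex.mul_im]
      nlinarith [mul_nonpos_of_nonneg_of_nonpos h1 h2]
    have h3 := (continuous_strandPoint (a, true) a).comp (continuous_snd (X := ℂ) (Y := ℝ))
    simp only [Function.comp_def] at h3
    obtain ⟨m, hm⟩ := hQc.isPreconnected.exists_int_sub_eq (hu.mono fun q hq => hq.1)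
      (hk.comp (f := fun q : ℂ × ℝ => (strandPoint (a, true) q.2 a + q.1 ^ 2, q.2))
        (by fun_prop) mapQ) (by
        rintro ⟨v, s⟩ hq
        obtain ⟨⟨hv, hs⟩, h1, h2⟩ := hq
        simp only [Function.comp_apply]
        rw [eu _ ⟨hv, hs⟩, ek _ (mapQ ⟨⟨hv, hs⟩, h1, h2⟩),
          discChart_eq hl (by simpa using hv) hs hc h1 h2])
    exact ⟨m, fun v s hv hs h1 h2 => hm (v, s) ⟨⟨by simpa using hv, hs⟩, h1, h2⟩⟩
  obtain ⟨p, hp⟩ := quadrant 1 (by simp) g hg (by simpa using eg)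
  obtain ⟨q, hq⟩ := quadrant (-1) (by simp) h hh (by simpa using eh)
  -- the other moving strand
  have norm_e : ∀ s : ℝ, ‖Complex.exp (Real.pi * s * Complex.I)‖ = 1 := fun s => by
    rw [show (Real.pi * s * Complex.I : ℂ) = ((Real.pi * s : ℝ) : ℂ) * Complex.I by push_cast; rfl]
    exact Complex.norm_exp_ofReal_mul_I _
  have memB : ∀ (c : ℂ), ‖c‖ = 1 → ∀ s ∈ Icc (0 : ℝ) 1,
      (c * Complex.exp (Real.pi * (s / 2 : ℝ) * Complex.I), s) ∈ B := fun c hc s hs =>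
    ⟨by rw [mem_closedBall_zero_iff, norm_mul, hc, norm_e (s / 2), one_mul], hs⟩
  have hroot : ∀ (c : ℂ), c ^ 2 = 1 → ∀ s : ℝ,
      discRoot (c * Complex.exp (Real.pi * (s / 2 : ℝ) * Complex.I)) s = 0 := by
    intro c hc s
    have h : Complex.exp (Real.pi * (s / 2 : ℝ) * Complex.I) ^ 2 =
        Complex.exp (Real.pi * s * Complex.I) := by
      rw [← Complex.exp_nat_mul]; congr 1; push_cast; ring
    have := discRoot_sq (c * Complex.exp (Real.pi * (s / 2 : ℝ) * Complex.I)) s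
    rw [mul_pow, hc, h] at this
    simpa using this
  -- The points `±exp (π i s / 2)` of the chart both lie over the upper moving strand, a branch
  -- point, so the values of `u` there differ by an integer that is constant in `s`.
  obtain ⟨d, hd⟩ := (isPreconnected_Icc (a := (0 : ℝ)) (b := 1)).exists_int_sub_eq
    (g := fun s => u (1 * Complex.exp (Real.pi * (s / 2 : ℝ) * Complex.I), s))
    (h := fun s => u (-1 * Complex.exp (Real.pi * (s / 2 : ℝ) * Complex.I), s))
    (hu.comp (by fun_prop) fun s hs => memB 1 (by simp) s hs)
    (hu.comp (by fun_prop) fun s hs => memB (-1) (by simp) s hs) (by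
      intro s hs
      rw [eu _ (memB 1 (by simp) s hs), eu _ (memB (-1) (by simp) s hs)]
      simp only [discChart, hroot 1 (by simp) s, hroot (-1) (by simp) s]
      simp)
  have d0 := hd 0 (by simp)
  have d1 := hd 1 (by simp)
  have e0 : Complex.exp (Real.pi * ((0 / 2 : ℝ) : ℂ) * Complex.I) = 1 := by simp
  have e1 : Complex.exp (Real.pi * ((1 / 2 : ℝ) : ℂ) * Complex.I) = Complex.I := by
    rw [show (Real.pi * ((1 / 2 : ℝ) : ℂ) * Complex.I : ℂ) = Real.pi / 2 * Complex.I by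
      push_cast; ring, Complex.exp_pi_div_two_mul_I]
  simp only [e0, e1, one_mul, neg_one_mul, mul_one] at d0 d1
  have i0 : (0 : ℝ) ∈ Icc (0 : ℝ) 1 := by simp
  have i1 : (1 : ℝ) ∈ Icc (0 : ℝ) 1 := by simp
  have l0 : strandPoint (a, true) 0 a = a := strandPoint_zero _ _
  have l1 : strandPoint (a, true) 1 a = a + 1 := by
    rw [strandPoint_left]; simp [Complex.exp_pi_mul_I]; ring
  have a1 := hp 0 0 (by simp) i0 (by simp) (by simp)
  have a2 := hq 0 0 (by simp) i0 (by simp) (by simp)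
  have a3 := hp 0 1 (by simp) i1 (by simp) (by simp)
  have a4 := hq 0 1 (by simp) i1 (by simp) (by simp)
  have a5 := hp 1 0 (by simp) i0 (by simp) (by simp)
  have a6 := hq (-1) 0 (by simp) i0 (by simp) (by simp)
  -- The point that starts at `1` in the fourth quadrant ends at `I`, in the second, and its
  -- opposite goes from `-1` to `-I`. The roles of the two sheets are exchanged, which reflects the
  -- label of the upper strand in the label of the lower one.
  have a7 := hp (-Complex.I) 1 (by simp) i1 (by simp) (by simp)
  have a8 := hq Complex.I 1 (by simp) i1 (by simp) (by simp)
  rw [l0] at a1 a2 a5 a6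
  rw [l1] at a3 a4 a7 a8
  simp only [neg_sq, Complex.I_sq, one_pow, add_neg_cancel_right, zero_pow, ne_eq,
    OfNat.ofNat_ne_zero, not_false_eq_true, add_zero] at a1 a2 a3 a4 a5 a6 a7 a8
  push_cast
  constructor <;> linarith

theorem labels_of_rest {n a i : ℕ} (hi : i ∈ Icc 1 n) (h1 : i ≠ a) (h2 : i ≠ a + 1)
    {F : ℂ × ℝ × ℂ → Circle} {g h : ℂ × ℝ → ℝ}
    (hg : ContinuousOn g (lowRegion a)) (hh : ContinuousOn h (lowRegion a))
    (eg : ∀ q ∈ lowRegion a, turn (g q) = F (q.1, q.2, strandRoot n (a, true) q.2 q.1))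
    (eh : ∀ q ∈ lowRegion a, turn (h q) = F (q.1, q.2, -strandRoot n (a, true) q.2 q.1)) :
    g (i, 1) - h (i, 1) = g (i, 0) - h (i, 0) := by
  have hmem : ∀ s ∈ Icc (0 : ℝ) 1, ((i : ℂ), s) ∈ lowRegion a := fun s hs => by
    refine ⟨hs, ?_⟩
    simp only [Complex.natCast_im, lowHeight, Complex.natCast_re]
    rw [tent_eq_zero]
    · simp
    · rcases (by omega : i + 1 ≤ a ∨ a + 2 ≤ i) with h | h
      · left; have : (i : ℝ) + 1 ≤ a := by exact_mod_cast h
        linarith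
      · right; exact_mod_cast h
  have hz : ∀ s : ℝ, strandRoot n (a, true) s i = 0 := fun s => by
    refine Finset.prod_eq_zero (Finset.mem_Icc.2 hi) ?_
    rw [strandPoint_of_ne _ _ h1 h2]; simp
  obtain ⟨d, hd⟩ := (isPreconnected_Icc (a := (0 : ℝ)) (b := 1)).exists_int_sub_eq
    (g := fun s => g (i, s)) (h := fun s => h (i, s))
    (hg.comp (by fun_prop) hmem) (hh.comp (by fun_prop) hmem) (fun s hs => by
      rw [eg _ (hmem s hs), eh _ (hmem s hs)]
      simp [hz])
  have d0 := hd 0 (by simp)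
  have d1 := hd 1 (by simp)
  linarith

theorem mem_lowRegion_of_far {n a : ℕ} (hl : a + 1 ≤ n) {r : ℝ} (hr : n + 2 ≤ r)
    {s : ℝ} (hs : s ∈ Icc (0 : ℝ) 1) : ((r : ℂ), s) ∈ lowRegion a := by
  refine ⟨hs, ?_⟩
  simp only [Complex.ofReal_im, lowHeight, Complex.ofReal_re]
  rw [tent_eq_zero]
  · simp
  · right
    have : (a : ℝ) + 1 ≤ n := by exact_mod_cast hl
    linarith

theorem mem_lowRegion_of_end {a : ℕ} {s : ℝ} (hs : s = 0 ∨ s = 1) {z : ℂ}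
    (hz : z ∈ lowerHalf) : (z, s) ∈ lowRegion a := by
  have : lowHeight a s z.re = 0 := by rcases hs with rfl | rfl <;> simp [lowHeight]
  refine ⟨by rcases hs with rfl | rfl <;> simp, ?_⟩
  simp only [this]
  exact hz

/-- The labels change by the action of the letter `β_a` during this letter. -/
theorem HasLabels.letter_true {n a : ℕ} (hl : IsLetterOn n (a, true)) {F : ℂ × ℝ × ℂ → Circle}
    (hF : ContinuousOn F (slabCurve n (a, true))) {r : ℝ} (hr : n + 2 ≤ r) {α β : ℝ → ℝ}
    (hα : ContinuousOn α (Icc 0 1)) (hβ : ContinuousOn β (Icc 0 1))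
    (eα : ∀ s ∈ Icc (0 : ℝ) 1, turn (α s) = F (r, s, strandRoot n (a, true) s r))
    (eβ : ∀ s ∈ Icc (0 : ℝ) 1, turn (β s) = F (r, s, -strandRoot n (a, true) s r)) {A : ℕ → ℤ}
    (hA : HasLabels n (fun q => F (q.1, 0, q.2)) r (α 0) (β 0) A) :
    HasLabels n (fun q => F (q.1, 1, q.2)) r (α 1) (β 1) (letterAct (a, true) A) := by
  have i0 : (0 : ℝ) ∈ Icc (0 : ℝ) 1 := by simp
  have i1 : (1 : ℝ) ∈ Icc (0 : ℝ) 1 := by simp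
  have hfar : ∀ s ∈ Icc (0 : ℝ) 1, ((r : ℂ), s) ∈ lowRegion a :=
    fun s hs => mem_lowRegion_of_far hl.2 hr hs
  have normalize : ∀ (c : ℂ), c ^ 2 = 1 → ∀ α : ℝ → ℝ, ContinuousOn α (Icc 0 1) →
      (∀ s ∈ Icc (0 : ℝ) 1, turn (α s) = F (r, s, c * strandRoot n (a, true) s r)) →
      ∃ g : ℂ × ℝ → ℝ, ContinuousOn g (lowRegion a) ∧
        (∀ q ∈ lowRegion a, turn (g q) = F (q.1, q.2, c * strandRoot n (a, true) q.2 q.1)) ∧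
        ∀ s ∈ Icc (0 : ℝ) 1, g (r, s) = α s := by
    intro c hc α hα eα
    obtain ⟨g, hg, eg⟩ := exists_lift_lowRegion hF hc
    obtain ⟨m, hm⟩ := (isPreconnected_Icc (a := (0 : ℝ)) (b := 1)).exists_int_sub_eq
      (g := fun s => g (r, s)) (h := α) (hg.comp (by fun_prop) hfar) hα (fun s hs => by
        rw [eg _ (hfar s hs), eα s hs])
    refine ⟨fun q => g q + (-m : ℤ), hg.add continuousOn_const, fun q hq => ?_, fun s hs => ?_⟩
    · rw [turn_add_intCast, eg q hq]
    · simp only [hm s hs]; push_cast; ring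
  obtain ⟨g, hg, eg, gα⟩ := normalize 1 (by simp) α hα (by simpa using eα)
  obtain ⟨h, hh, eh, hβ⟩ := normalize (-1) (by simp) β hβ (by simpa using eβ)
  simp only [one_mul, neg_one_mul] at eg eh
  have page : ∀ s : ℝ, (s = 0 ∨ s = 1) → ∀ C : ℕ → ℤ,
      (∀ i ∈ Icc 1 n, g (i, s) - h (i, s) = C i) →
      HasLabels n (fun q => F (q.1, s, q.2)) r (α s) (β s) C := by
    intro s hs C hC
    have his : s ∈ Icc (0 : ℝ) 1 := by rcases hs with rfl | rfl <;> simp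
    have hroot : strandRoot n (a, true) s = pageRoot n := by
      rcases hs with rfl | rfl
      · exact strandRoot_zero _ _
      · exact strandRoot_one hl
    refine ⟨fun z => g (z, s), fun z => h (z, s),
      hg.comp (by fun_prop) fun z hz => mem_lowRegion_of_end hs hz,
      hh.comp (by fun_prop) fun z hz => mem_lowRegion_of_end hs hz,
      fun z hz => ?_, fun z hz => ?_, gα s his, hβ s his, hC⟩
    · rw [eg _ (mem_lowRegion_of_end hs hz)]; simp only [hroot]
    · rw [eh _ (mem_lowRegion_of_end hs hz)]; simp only [hroot]
  have hint : ∀ i ∈ Icc 1 n, ∃ k : ℤ, g (i, 0) - h (i, 0) = k := by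
    intro i hi
    have m0 : ((i : ℂ), (0 : ℝ)) ∈ lowRegion a :=
      mem_lowRegion_of_end (Or.inl rfl) (natCast_mem_lowerHalf i)
    have h1 := eg _ m0
    have h2 := eh _ m0
    simp only [strandRoot_zero, pageRoot_natCast hi, neg_zero] at h1 h2
    obtain ⟨k, hk⟩ := turn_eq_turn_iff.1 (h1.trans h2.symm)
    exact ⟨k, by rw [hk]; ring⟩
  choose! C hC using hint
  have hCA : EqOn C A (Icc 1 n) := (page 0 (Or.inl rfl) C hC).eqOn hA
  have ha : a ∈ Icc 1 n := ⟨hl.1, by have := hl.2; simp at this; omega⟩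
  have ha' : a + 1 ∈ Icc 1 n := ⟨by omega, hl.2⟩
  obtain ⟨k1, k2⟩ := labels_of_disc hl hF hg hh eg eh
  refine (page 1 (Or.inr rfl) (letterAct (a, true) C) fun i hi => ?_).congr (letterAct_congr hl hCA)
  by_cases h1 : i = a
  · subst h1
    rw [k2, hC _ ha, hC _ ha']; simp [letterAct]
  by_cases h2 : i = a + 1
  · subst h2
    rw [k1, hC _ ha]; simp [letterAct]
  · rw [labels_of_rest hi h1 h2 hg hh eg eh, hC i hi, letterAct_of_ne _ _ h1 h2]

theorem slabCurve_not {n a : ℕ} {b : Bool} (hl : IsLetterOn n (a, b)) {z y : ℂ} {s : ℝ} :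
    (z, s, y) ∈ slabCurve n (a, !b) ↔ (z, 1 - s, y) ∈ slabCurve n (a, b) := by
  simp only [slabCurve, Set.mem_ofPred_eq, strandPoly_not hl, mem_Icc]
  constructor <;> rintro ⟨⟨h1, h2⟩, h3⟩ <;> exact ⟨⟨by linarith, by linarith⟩, h3⟩

/-- The labels change by the action of a letter during this letter. -/
theorem HasLabels.letter {n : ℕ} {l : ℕ × Bool} (hl : IsLetterOn n l) {F : ℂ × ℝ × ℂ → Circle}
    (hF : ContinuousOn F (slabCurve n l)) {r : ℝ} (hr : n + 2 ≤ r) {α β : ℝ → ℝ}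
    (hα : ContinuousOn α (Icc 0 1)) (hβ : ContinuousOn β (Icc 0 1))
    (eα : ∀ s ∈ Icc (0 : ℝ) 1, turn (α s) = F (r, s, strandRoot n l s r))
    (eβ : ∀ s ∈ Icc (0 : ℝ) 1, turn (β s) = F (r, s, -strandRoot n l s r)) {A : ℕ → ℤ}
    (hA : HasLabels n (fun q => F (q.1, 0, q.2)) r (α 0) (β 0) A) :
    HasLabels n (fun q => F (q.1, 1, q.2)) r (α 1) (β 1) (letterAct l A) := by
  obtain ⟨a, b⟩ := l
  cases b with
  | true => exact HasLabels.letter_true hl hF hr hα hβ eα eβ hA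
  | false =>
    have hl' : IsLetterOn n (a, true) := hl
    have cs : ContinuousOn (fun s : ℝ => 1 - s) (Icc 0 1) := by fun_prop
    have ms : MapsTo (fun s : ℝ => 1 - s) (Icc 0 1) (Icc 0 1) := fun s hs =>
      ⟨by simp only; linarith [hs.2], by simp only; linarith [hs.1]⟩
    have hF' : ContinuousOn (fun q : ℂ × ℝ × ℂ => F (q.1, 1 - q.2.1, q.2.2))
        (slabCurve n (a, true)) := by
      refine hF.comp (f := fun q : ℂ × ℝ × ℂ => (q.1, 1 - q.2.1, q.2.2)) (by fun_prop) ?_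
      rintro ⟨z, s, y⟩ hq
      exact (slabCurve_not (b := true) hl').2 (by simpa using hq)
    have e : ∀ s, strandRoot n (a, true) s = strandRoot n (a, false) (1 - s) := fun s =>
      strandRoot_not (b := false) hl s
    have m1 : (1 : ℝ) ∈ Icc (0 : ℝ) 1 := by simp
    have hpage : ContinuousOn (fun q : ℂ × ℂ => F (q.1, 1, q.2)) (pageCurve n) := by
      refine hF.comp (f := fun q : ℂ × ℂ => (q.1, (1 : ℝ), q.2)) (by fun_prop) fun q hq => ?_
      refine ⟨by simp, ?_⟩
      rw [strandPoly_one hl]; exact hq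
    have r1 : strandRoot n (a, false) 1 = pageRoot n := strandRoot_one hl
    -- For an inverse letter, time is reversed: labels `C` at the end are carried back by the
    -- positive letter to labels at the start. They must agree with `A`, and inverting the action
    -- recovers `C`.
    obtain ⟨C, hC⟩ := exists_hasLabels (r := r) (α := α 1) (β := β 1) hpage
      (by rw [eα 1 m1, r1]) (by rw [eβ 1 m1, r1])
    have := HasLabels.letter_true hl' hF' hr (α := fun s => α (1 - s)) (β := fun s => β (1 - s))
      (hα.comp cs ms) (hβ.comp cs ms) (fun s hs => by rw [eα _ (ms hs), e])
      (fun s hs => by rw [eβ _ (ms hs), e]) (A := C) (by simpa using hC)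
    simp only [sub_self] at this
    refine hC.congr ?_
    have h2 := letterAct_congr (l := (a, false)) hl (hA.eqOn this)
    intro i hi
    rw [h2 hi]
    exact (congrFun (letterAct_not (a, true) C) i).symm

/-! ## Functions with equal labels -/

/-- The closed upper half plane. -/
def upperHalf : Set ℂ := {z | 0 ≤ z.im}

theorem convex_upperHalf : Convex ℝ upperHalf := convex_halfSpace_im_ge 0

theorem ofReal_mem_upperHalf (r : ℝ) : (r : ℂ) ∈ upperHalf := by simp [upperHalf]

theorem continuousOn_pageRootUp (n : ℕ) : ContinuousOn (pageRootUp n) upperHalf := by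
  intro z hz
  refine ContinuousAt.continuousWithinAt ?_
  unfold pageRootUp
  refine tendsto_finsetProd _ fun i _ => ?_
  exact ContinuousAt.comp (f := fun z : ℂ => z - i) (continuousAt_sqrtUp (by
    simpa [upperHalf] using hz)) (by fun_prop)

theorem exists_lift_upperHalf {n : ℕ} {f : ℂ × ℂ → Circle} (hf : ContinuousOn f (pageCurve n))
    {c : ℂ} (hc : c ^ 2 = 1) : ∃ g : ℂ → ℝ, ContinuousOn g upperHalf ∧
      ∀ z ∈ upperHalf, turn (g z) = f (z, c * pageRootUp n z) := by
  refine exists_turn_lift (convex_upperHalf.starConvex (ofReal_mem_upperHalf 0)) ?_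
  refine hf.comp (continuousOn_id.prodMk (continuousOn_const.mul (continuousOn_pageRootUp n))) ?_
  intro z _
  simp [pageCurve, mul_pow, hc, pageRootUp_sq]

theorem pageRoot_eq_zero {n : ℕ} {z : ℂ} : pageRoot n z = 0 ↔ ∃ i ∈ Icc 1 n, z = (i : ℕ) := by
  simp [pageRoot, Finset.prod_eq_zero_iff, sqrtDown_eq_zero, sub_eq_zero, and_assoc]

/-- A circle-valued function on the double branched cover of the plane all of whose labels vanish
has a continuous logarithm. -/
theorem HasLabels.exists_lift {n : ℕ} {f : ℂ × ℂ → Circle} (hf : ContinuousOn f (pageCurve n))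
    {r α β : ℝ} (h0 : HasLabels n f r α β 0) :
    ∃ h : ℂ × ℂ → ℝ, ContinuousOn h (pageCurve n) ∧ (∀ q ∈ pageCurve n, turn (h q) = f q) ∧
      h (r, pageRoot n r) = α ∧ h (r, -pageRoot n r) = β := by
  classical
  obtain ⟨l, l', hl, hl', el, el', lα, lβ, hA⟩ := h0
  have eqZ : ∀ z, pageRoot n z = 0 → l z = l' z := fun z hz => by
    obtain ⟨i, hi, rfl⟩ := pageRoot_eq_zero.1 hz
    simpa [sub_eq_zero] using hA i hi
  -- Since the labels vanish, the logarithms on the two sheets agree at the branch points and glue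
  -- to one function on the curve over the lower half plane.
  set L : ℂ × ℂ → ℝ := fun q => if q.2 = pageRoot n q.1 then l q.1 else l' q.1 with hL
  have L1 : ∀ z, L (z, pageRoot n z) = l z := fun z => by simp [hL]
  have L2 : ∀ z, L (z, -pageRoot n z) = l' z := fun z => by
    simp only [hL]
    split_ifs with h
    · exact eqZ z (self_eq_neg.1 h.symm)
    · rfl
  have cases_low : ∀ q ∈ pageCurve n, q.2 = pageRoot n q.1 ∨ q.2 = -pageRoot n q.1 := fun q hq =>
    sq_eq_sq_iff_eq_or_eq_neg.1 (by rw [pageRoot_sq]; exact hq)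
  have cases_up : ∀ q ∈ pageCurve n, q.2 = 1 * pageRootUp n q.1 ∨ q.2 = -1 * pageRootUp n q.1 :=
    fun q hq => by
      simpa using sq_eq_sq_iff_eq_or_eq_neg.1 (show q.2 ^ 2 = _ by rw [pageRootUp_sq]; exact hq)
  have cfst : ∀ S : Set (ℂ × ℂ), ContinuousOn (fun q : ℂ × ℂ => q.1) S :=
    fun S => continuousOn_fst
  have closedGraph : ∀ (c : ℂ) (T : Set ℂ) (k : ℂ → ℂ), IsClosed T → ContinuousOn k T →
      IsClosed {q : ℂ × ℂ | q.1 ∈ T ∧ q.2 = c * k q.1} := by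
    intro c T k hT hk
    have h1 : IsClosed {q : ℂ × ℂ | q.1 ∈ T} := hT.preimage continuous_fst
    have h2 : ContinuousOn (fun q : ℂ × ℂ => q.2 - c * k q.1) {q : ℂ × ℂ | q.1 ∈ T} :=
      continuousOn_snd.sub (continuousOn_const.mul (hk.comp continuousOn_fst fun q hq => hq))
    convert h2.preimage_isClosed_of_isClosed h1 (isClosed_singleton (x := (0 : ℂ))) using 1
    ext q; simp [sub_eq_zero]
  have cl : IsClosed lowerHalf := isClosed_le Complex.continuous_im continuous_const
  have cu : IsClosed upperHalf := isClosed_le continuous_const Complex.continuous_im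
  have cL : ContinuousOn L ({q | q.1 ∈ lowerHalf ∧ q.2 = 1 * pageRoot n q.1} ∪
      {q | q.1 ∈ lowerHalf ∧ q.2 = -1 * pageRoot n q.1}) := by
    refine ContinuousOn.union_of_isClosed ?_ ?_ (closedGraph _ _ _ cl (continuousOn_pageRoot n))
      (closedGraph _ _ _ cl (continuousOn_pageRoot n))
    · refine (hl.comp (cfst _) fun q hq => hq.1).congr ?_
      rintro ⟨z, y⟩ ⟨_, e⟩
      simp only [one_mul] at e
      rw [e, L1]; rfl
    · refine (hl'.comp (cfst _) fun q hq => hq.1).congr ?_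
      rintro ⟨z, y⟩ ⟨_, e⟩
      simp only [neg_one_mul] at e
      rw [e, L2]; rfl
  have eL : ∀ q ∈ pageCurve n, q.1 ∈ lowerHalf → turn (L q) = f q := by
    rintro ⟨z, y⟩ hq hz
    rcases cases_low _ hq with h | h <;> simp only at h hz <;> subst h
    · rw [L1, el z hz]
    · rw [L2, el' z hz]
  have upper : ∀ c : ℂ, c ^ 2 = 1 → ∃ u : ℂ → ℝ, ContinuousOn u upperHalf ∧
      (∀ z ∈ upperHalf, turn (u z) = f (z, c * pageRootUp n z)) ∧
      ∀ x : ℝ, u x = L (x, c * pageRootUp n x) := by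
    intro c hc
    obtain ⟨u, hu, eu⟩ := exists_lift_upperHalf hf hc
    have mem : ∀ x : ℝ, ((x : ℂ), c * pageRootUp n x) ∈ pageCurve n := fun x => by
      simp [pageCurve, mul_pow, hc, pageRootUp_sq]
    have cont : Continuous fun x : ℝ => ((x : ℂ), c * pageRootUp n x) := by
      have := (continuousOn_pageRootUp n).comp_continuous Complex.continuous_ofReal
        ofReal_mem_upperHalf
      fun_prop
    -- The edge of an upper sheet alternates between the two lower sheets, but it is a connected
    -- line on which `L` is continuous. One integer therefore matches the upper logarithm with `L`
    -- along the entire real axis.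
    obtain ⟨k, hk⟩ := (isPreconnected_univ (α := ℝ)).exists_int_sub_eq
      (g := fun x : ℝ => u x) (h := fun x : ℝ => L (x, c * pageRootUp n x))
      (hu.comp_continuous Complex.continuous_ofReal ofReal_mem_upperHalf).continuousOn
      (cL.comp_continuous cont fun x => by
        rcases cases_low _ (mem x) with h | h
        · left; exact ⟨ofReal_mem_lowerHalf x, by simpa using h⟩
        · right; exact ⟨ofReal_mem_lowerHalf x, by simpa using h⟩).continuousOn
      fun x _ => by rw [eu _ (ofReal_mem_upperHalf x), eL _ (mem x) (ofReal_mem_lowerHalf x)]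
    refine ⟨fun z => u z + (-k : ℤ), hu.add continuousOn_const, fun z hz => ?_, fun x => ?_⟩
    · rw [turn_add_intCast, eu z hz]
    · have := hk x trivial
      simp only [this]; push_cast; ring
  obtain ⟨u, hu, eu, uL⟩ := upper 1 (by simp)
  obtain ⟨u', hu', eu', uL'⟩ := upper (-1) (by simp)
  have real_of_im : ∀ z : ℂ, z.im = 0 → ((z.re : ℝ) : ℂ) = z := fun z hz =>
    Complex.ext (by simp) (by simp [hz])
  have uu' : ∀ z : ℂ, z ∈ upperHalf → pageRootUp n z = 0 → u z = u' z := by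
    intro z hz h
    have h' : pageRoot n z = 0 := by
      have := pageRoot_sq n z
      rw [← pageRootUp_sq, h] at this
      simpa using this
    obtain ⟨i, hi, rfl⟩ := pageRoot_eq_zero.1 h'
    have := uL i; have h2 := uL' i
    push_cast at this h2
    rw [this, h2, h]; simp
  set h : ℂ × ℂ → ℝ := fun q => if q.1.im ≤ 0 then L q else
    if q.2 = pageRootUp n q.1 then u q.1 else u' q.1 with hh
  have h1 : ∀ z, z ∈ upperHalf → h (z, 1 * pageRootUp n z) = u z := fun z hz => by
    simp only [hh]
    split_ifs with h1 h2
    · have hz0 := real_of_im z (le_antisymm h1 hz)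
      rw [← hz0, uL]
    · rfl
    · simp at h2
  have h2 : ∀ z, z ∈ upperHalf → h (z, -1 * pageRootUp n z) = u' z := fun z hz => by
    simp only [hh]
    split_ifs with h1 h2
    · have hz0 := real_of_im z (le_antisymm h1 hz)
      rw [← hz0, uL']
    · exact uu' z hz (self_eq_neg.1 (by simpa using h2.symm))
    · rfl
  refine ⟨h, ?_, ?_, ?_, ?_⟩
  · have c1 := cL.congr (g := h) fun q hq => by
      have : q.1.im ≤ 0 := by rcases hq with hq | hq <;> exact hq.1
      simp [hh, this]
    have c2 : ContinuousOn h {q | q.1 ∈ upperHalf ∧ q.2 = 1 * pageRootUp n q.1} := by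
      refine (hu.comp (cfst _) fun q hq => hq.1).congr ?_
      rintro ⟨z, y⟩ ⟨hz, e⟩
      simp only at e
      rw [e]
      exact h1 z hz
    have c3 : ContinuousOn h {q | q.1 ∈ upperHalf ∧ q.2 = -1 * pageRootUp n q.1} := by
      refine (hu'.comp (cfst _) fun q hq => hq.1).congr ?_
      rintro ⟨z, y⟩ ⟨hz, e⟩
      simp only at e
      rw [e]
      exact h2 z hz
    have k2 := closedGraph 1 _ _ cu (continuousOn_pageRootUp n)
    have k3 := closedGraph (-1) _ _ cu (continuousOn_pageRootUp n)
    refine (c1.union_of_isClosed (c2.union_of_isClosed c3 k2 k3)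
      ((closedGraph _ _ _ cl (continuousOn_pageRoot n)).union
        (closedGraph _ _ _ cl (continuousOn_pageRoot n))) (k2.union k3)).mono fun q hq => ?_
    rcases le_total q.1.im 0 with him | him
    · left
      rcases cases_low q hq with h | h
      · left; exact ⟨him, by simpa using h⟩
      · right; exact ⟨him, by simpa using h⟩
    · right
      rcases cases_up q hq with h | h
      · left; exact ⟨him, h⟩
      · right; exact ⟨him, h⟩
  · rintro ⟨z, y⟩ hq
    rcases le_total z.im 0 with him | him
    · simp only [hh, if_pos him]
      exact eL _ hq him
    · rcases cases_up _ hq with h | h <;> simp only at h <;> subst h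
      · rw [h1 z him, eu z him]
      · rw [h2 z him, eu' z him]
  · simp only [hh, Complex.ofReal_im, le_refl, if_true, L1, lα]
  · simp only [hh, Complex.ofReal_im, le_refl, if_true, L2, lβ]

theorem HasLabels.div {n : ℕ} {f g : ℂ × ℂ → Circle} {r α β α' β' : ℝ} {A C : ℕ → ℤ}
    (hf : HasLabels n f r α β A) (hg : HasLabels n g r α' β' C) :
    HasLabels n (fun q => f q / g q) r (α - α') (β - β') (fun i => A i - C i) := by
  obtain ⟨l, k, hl, hk, el, ek, lα, kβ, hA⟩ := hf
  obtain ⟨l', k', hl', hk', el', ek', lα', kβ', hC⟩ := hg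
  refine ⟨fun z => l z - l' z, fun z => k z - k' z, hl.sub hl', hk.sub hk', fun z hz => ?_,
    fun z hz => ?_, by simp only [lα, lα'], by simp only [kβ, kβ'], fun i hi => ?_⟩
  · rw [turn_sub, el z hz, el' z hz]
  · rw [turn_sub, ek z hz, ek' z hz]
  · push_cast; rw [← hA i hi, ← hC i hi]; ring

theorem HasLabels.neg {n : ℕ} {f : ℂ × ℂ → Circle} {r α β : ℝ} {A : ℕ → ℤ}
    (hf : HasLabels n f r α β A) :
    HasLabels n (fun q => f (q.1, -q.2)) r β α (fun i => -A i) := by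
  obtain ⟨l, k, hl, hk, el, ek, lα, kβ, hA⟩ := hf
  refine ⟨k, l, hk, hl, fun z hz => ?_, fun z hz => ?_, kβ, lα, fun i hi => ?_⟩
  · rw [ek z hz]
  · rw [el z hz]; simp
  · push_cast; rw [← hA i hi]; ring

/-! ## The degree along a large circle -/

/-- Between `k` and `k + 1` there are `n - k` branch points to the right, and each contributes one
sign. -/
theorem pageRootUp_ofReal {n k : ℕ} (hk : k ≤ n) {x : ℝ} (h1 : k = 0 ∨ k ≤ x)
    (h2 : k = n ∨ x ≤ k + 1) : pageRootUp n x = (-1) ^ (n - k) * pageRoot n x := by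
  have hc : ∀ i ∈ Finset.Icc 1 n, sqrtUp ((x : ℂ) - i) =
      (if i ≤ k then 1 else -1) * sqrtDown ((x : ℂ) - i) := by
    intro i hi
    rw [Finset.mem_Icc] at hi
    have e : (x : ℂ) - i = ((x - i : ℝ) : ℂ) := by push_cast; rfl
    split_ifs with h
    · rw [e, sqrtUp_of_nonneg, one_mul]
      have : (i : ℝ) ≤ k := by exact_mod_cast h
      rcases h1 with rfl | h1
      · omega
      · linarith
    · rw [e, sqrtUp_of_nonpos, neg_one_mul]
      have : (k : ℝ) + 1 ≤ i := by exact_mod_cast (by omega : k + 1 ≤ i)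
      rcases h2 with rfl | h2
      · omega
      · linarith
  have hf : (Finset.Icc 1 n).filter (fun i => ¬ i ≤ k) = Finset.Icc (k + 1) n := by
    ext i; simp; omega
  rw [pageRootUp, Finset.prod_congr rfl hc, Finset.prod_mul_distrib, Finset.prod_ite, hf, pageRoot]
  simp

theorem pageRoot_ne_zero {n : ℕ} {z : ℂ} (hz : (n : ℝ) < ‖z‖) : pageRoot n z ≠ 0 := by
  intro h
  obtain ⟨i, hi, rfl⟩ := pageRoot_eq_zero.1 h
  rw [Complex.norm_natCast] at hz
  have : (i : ℝ) ≤ n := by exact_mod_cast hi.2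
  linarith

theorem norm_turn_mul (R : ℝ) (t : ℝ) : ‖(R : ℂ) * turn t‖ = |R| := by
  rw [norm_mul, Circle.norm_coe, Complex.norm_real, mul_one, Real.norm_eq_abs]

/-- The logarithms on a sheet over the upper and on a sheet over the lower half plane. -/
theorem upper_sub_lower {n : ℕ} (hn : Even n) {f : ℂ × ℂ → Circle} {l l' u : ℂ → ℝ}
    (hl : ContinuousOn l lowerHalf) (hl' : ContinuousOn l' lowerHalf)
    (hu : ContinuousOn u upperHalf) (el : ∀ z ∈ lowerHalf, turn (l z) = f (z, pageRoot n z))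
    (el' : ∀ z ∈ lowerHalf, turn (l' z) = f (z, -pageRoot n z))
    (eu : ∀ z ∈ upperHalf, turn (u z) = f (z, pageRootUp n z)) {A : ℕ → ℤ}
    (hA : ∀ i ∈ Icc 1 n, l i - l' i = A i) {R : ℝ} (hR : n < R) :
    (u R - l R) - (u (-R : ℝ) - l (-R : ℝ)) = altSum n A := by
  -- As `n` is even, over `[k, k + 1]` the upper sheet continues the first lower sheet for even `k`
  -- and the second one for odd `k`. Passing the branch point `k + 1` exchanges the lower sheets, so
  -- the integer offset `d` changes by `(-1) ^ k * A (k + 1)`.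
  have seg : ∀ k ≤ n, ∃ d : ℤ, ∀ x : ℝ, (k = 0 ∨ k ≤ x) → (k = n ∨ x ≤ k + 1) →
      u x = (if Even k then l x else l' x) + d := by
    intro k hk
    have hconv : Convex ℝ {x : ℝ | (k = 0 ∨ k ≤ x) ∧ (k = n ∨ x ≤ k + 1)} := by
      have a1 : Convex ℝ {x : ℝ | k = 0 ∨ k ≤ x} := by
        by_cases h : k = 0
        · simp [h, convex_univ]
        · simp only [h, false_or]; exact convex_Ici (k : ℝ)
      have a2 : Convex ℝ {x : ℝ | k = n ∨ x ≤ k + 1} := by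
        by_cases h : k = n
        · simp [h, convex_univ]
        · simp only [h, false_or]; exact convex_Iic (k + 1 : ℝ)
      exact a1.inter a2
    have cu := (hu.comp_continuous Complex.continuous_ofReal ofReal_mem_upperHalf)
    have cl := (hl.comp_continuous Complex.continuous_ofReal ofReal_mem_lowerHalf)
    have cl' := (hl'.comp_continuous Complex.continuous_ofReal ofReal_mem_lowerHalf)
    obtain ⟨d, hd⟩ := hconv.isPreconnected.exists_int_sub_eq (g := fun x : ℝ => u x)
      (h := fun x : ℝ => if Even k then l x else l' x) cu.continuousOn
      (by split_ifs; exacts [cl.continuousOn, cl'.continuousOn]) (by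
        rintro x ⟨h1, h2⟩
        rw [eu _ (ofReal_mem_upperHalf x), pageRootUp_ofReal hk h1 h2]
        split_ifs with he
        · rw [el _ (ofReal_mem_lowerHalf x), ((Nat.even_sub hk).2 (by simp [hn, he])).neg_one_pow,
            one_mul]
        · rw [el' _ (ofReal_mem_lowerHalf x), Odd.neg_one_pow, neg_one_mul]
          rw [← Nat.not_even_iff_odd, Nat.even_sub hk]
          simp [hn, he])
    exact ⟨d, fun x h1 h2 => hd x ⟨h1, h2⟩⟩
  choose! d hd using seg
  have step : ∀ k, k ≤ n → d k - d 0 = altSum k A := by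
    intro k
    induction k with
    | zero => intro _; simp [altSum]
    | succ k ih =>
      intro hk
      have h1 := hd k (by omega) (k + 1 : ℕ) (Or.inr (by simp)) (Or.inr (by simp))
      have h2 := hd (k + 1) hk (k + 1 : ℕ) (Or.inr le_rfl) (Or.inr (by simp))
      have h3 := hA (k + 1) ⟨by omega, hk⟩
      have h4 := ih (by omega)
      rw [altSum, ← h4]
      rw [h1] at h2
      push_cast at h2 h3
      have : (d (k + 1) : ℝ) = d k + (-1) ^ k * A (k + 1) := by
        by_cases he : Even k
        · simp only [he, if_true, Nat.even_add_one, not_true, if_false, he.neg_one_pow] at h2 ⊢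
          linarith
        · simp only [he, if_true, Nat.even_add_one, not_false_eq_true, if_false,
            (Nat.not_even_iff_odd.1 he).neg_one_pow] at h2 ⊢
          linarith
      have : d (k + 1) = d k + (-1) ^ k * A (k + 1) := by exact_mod_cast this
      rw [this]; ring
  have hR0 : (0 : ℝ) < R := lt_of_le_of_lt (Nat.cast_nonneg n) hR
  have e1 := hd n le_rfl R (Or.inr hR.le) (Or.inl rfl)
  have e2 := hd 0 (Nat.zero_le n) (-R) (Or.inl rfl) (Or.inr (by simp; linarith))
  simp only [hn, if_true, Even.zero] at e1 e2
  rw [e1, e2, ← step n le_rfl]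
  push_cast; ring

/-- The degree along a large circle of a function on the double branched cover of the plane. -/
theorem HasLabels.circle {n : ℕ} (hn : Even n) {f : ℂ × ℂ → Circle}
    (hf : ContinuousOn f (pageCurve n)) {r α β : ℝ} {A : ℕ → ℤ} (h : HasLabels n f r α β A)
    {R : ℝ} (hR : n < R) {Y : ℝ → ℂ} (hY : Continuous Y)
    (hY2 : ∀ t, Y t ^ 2 = pagePoly n (R * turn t)) (hY0 : Y 0 = pageRoot n R) {θ : ℝ → ℝ}
    (hθ : Continuous θ) (eθ : ∀ t, turn (θ t) = f (R * turn t, Y t)) :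
    θ 1 = θ 0 - altSum n A := by
  obtain ⟨l, l', hl, hl', el, el', lα, lβ, hA⟩ := h
  obtain ⟨u, hu, eu⟩ := exists_lift_upperHalf hf (c := 1) (by simp)
  simp only [one_mul] at eu
  have key := upper_sub_lower hn hl hl' hu el el' eu hA hR
  have hR0 : (0 : ℝ) < R := lt_of_le_of_lt (Nat.cast_nonneg n) hR
  have im_eq : ∀ t, ((R : ℂ) * turn t).im = R * Real.sin (2 * Real.pi * t) := fun t => by
    rw [coe_turn, Complex.im_ofReal_mul, show (2 * Real.pi * t * Complex.I : ℂ) =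
      ((2 * Real.pi * t : ℝ) : ℂ) * Complex.I by push_cast; rfl, Complex.exp_ofReal_mul_I_im]
  have hup : ∀ t ∈ Icc (0 : ℝ) (1 / 2), (R : ℂ) * turn t ∈ upperHalf := fun t ht => by
    show 0 ≤ ((R : ℂ) * turn t).im
    rw [im_eq]
    refine mul_nonneg hR0.le (Real.sin_nonneg_of_nonneg_of_le_pi ?_ ?_)
    · have := ht.1; positivity
    · nlinarith [ht.2, Real.pi_pos]
  have hdn : ∀ t ∈ Icc (1 / 2 : ℝ) 1, (R : ℂ) * turn t ∈ lowerHalf := fun t ht => by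
    show ((R : ℂ) * turn t).im ≤ 0
    rw [im_eq]
    refine mul_nonpos_of_nonneg_of_nonpos hR0.le ?_
    rw [← Real.sin_sub_two_pi]
    refine Real.sin_nonpos_of_nonpos_of_neg_pi_le ?_ ?_
    · nlinarith [ht.2, Real.pi_pos]
    · nlinarith [ht.1, Real.pi_pos]
  have hne : ∀ t, pagePoly n (R * turn t) ≠ 0 := fun t => by
    rw [← pageRoot_sq]
    exact pow_ne_zero _ (pageRoot_ne_zero (by rw [norm_turn_mul, abs_of_pos hR0]; exact hR))
  have t1 : turn 1 = 1 := by exact_mod_cast turn_intCast 1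
  have t2 : ((turn (1 / 2) : Circle) : ℂ) = -1 := by
    rw [coe_turn, show (2 * Real.pi * ((1 / 2 : ℝ) : ℂ) * Complex.I : ℂ) = Real.pi * Complex.I by
      push_cast; ring, Complex.exp_pi_mul_I]
  have cz : Continuous fun t : ℝ => (R : ℂ) * turn t := by fun_prop
  have m0 : (0 : ℝ) ∈ Icc (0 : ℝ) (1 / 2) := by constructor <;> norm_num
  have m1 : (1 / 2 : ℝ) ∈ Icc (0 : ℝ) (1 / 2) := by constructor <;> norm_num
  have m2 : (1 / 2 : ℝ) ∈ Icc (1 / 2 : ℝ) 1 := by constructor <;> norm_num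
  have m3 : (1 : ℝ) ∈ Icc (1 / 2 : ℝ) 1 := by constructor <;> norm_num
  have Yup : ∀ t ∈ Icc (0 : ℝ) (1 / 2), Y t = pageRootUp n (R * turn t) := by
    have up0 : pageRootUp n R = pageRoot n R := by
      rw [pageRootUp_ofReal le_rfl (Or.inr hR.le) (Or.inl rfl)]; simp
    refine isPreconnected_Icc.eq_of_sq_eq hY.continuousOn
      ((continuousOn_pageRootUp n).comp cz.continuousOn hup) ?_ ?_ m0 ?_
    · intro t _; simp [hY2, pageRootUp_sq]
    · intro t ht h
      exact hne t (by rw [← pageRootUp_sq, show pageRootUp n _ = 0 from h]; simp)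
    · simp [hY0, up0]
  -- To the left of all branch points the two roots differ by `(-1) ^ n = 1`, so the lower half of
  -- the circle returns on the first sheet.
  have Ydn : ∀ t ∈ Icc (1 / 2 : ℝ) 1, Y t = pageRoot n (R * turn t) := by
    refine isPreconnected_Icc.eq_of_sq_eq hY.continuousOn
      ((continuousOn_pageRoot n).comp cz.continuousOn hdn) ?_ ?_ m2 ?_
    · intro t _; simp [hY2, pageRoot_sq]
    · intro t ht h
      exact hne t (by rw [← pageRoot_sq, show pageRoot n _ = 0 from h]; simp)
    · rw [Yup _ m1]
      simp only [t2, mul_neg_one]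
      have := pageRootUp_ofReal (n := n) (k := 0) (x := -R) (Nat.zero_le n) (Or.inl rfl)
        (Or.inr (by simp; linarith))
      simpa [hn.neg_one_pow] using this
  obtain ⟨d, hd⟩ := isPreconnected_Icc.exists_int_sub_eq (hθ.continuousOn (s := Icc 0 (1 / 2)))
    (hu.comp cz.continuousOn hup) fun t ht => by
      rw [eθ, Function.comp_apply, eu _ (hup t ht), Yup t ht]
  obtain ⟨e, he⟩ := isPreconnected_Icc.exists_int_sub_eq (hθ.continuousOn (s := Icc (1 / 2) 1))
    (hl.comp cz.continuousOn hdn) fun t ht => by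
      rw [eθ, Function.comp_apply, el _ (hdn t ht), Ydn t ht]
  have d0 := hd 0 m0
  have d1 := hd _ m1
  have e0 := he _ m2
  have e1 := he 1 m3
  simp only [Function.comp_apply, t1, t2, turn_zero, Circle.coe_one, mul_one, mul_neg_one] at d0 d1 e0 e1
  push_cast at key
  linarith

/-! ## An isotopy that follows the strands -/

theorem norm_strandPoint_rot (b : Bool) (s : ℝ) :
    ‖Complex.exp ((if b then 1 else -1) * Real.pi * s * Complex.I)‖ = 1 := by
  have : ((if b then 1 else -1) * Real.pi * s * Complex.I : ℂ) =
      (((if b then 1 else -1) * Real.pi * s : ℝ) : ℂ) * Complex.I := by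
    cases b <;> simp
  rw [this, Complex.norm_exp_ofReal_mul_I]

theorem norm_strandPoint_sub_le (l : ℕ × Bool) (s : ℝ) (i : ℕ) :
    ‖strandPoint l s i - i‖ ≤ 1 := by
  have key := norm_strandPoint_rot l.2 s
  simp only [strandPoint]
  set e := Complex.exp ((if l.2 then 1 else -1) * Real.pi * s * Complex.I)
  have h2 : ‖1 / 2 - e / 2‖ ≤ 1 := by
    refine (norm_sub_le _ _).trans ?_
    rw [norm_div, norm_div, key]; norm_num
  by_cases h : i = l.1
  · rw [if_pos h, h]
    convert h2 using 2; ring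
  by_cases h' : i = l.1 + 1
  · rw [if_neg h, if_pos h', h']
    rw [← norm_neg]
    rwa [show -((l.1 : ℂ) + 1 / 2 + e / 2 - ((l.1 + 1 : ℕ) : ℂ)) = 1 / 2 - e / 2 by
      push_cast; ring]
  · rw [if_neg h, if_neg h']; simp

theorem norm_strandPoint_le {n : ℕ} (l : ℕ × Bool) (s : ℝ) {i : ℕ} (hi : i ∈ Finset.Icc 1 n) :
    ‖strandPoint l s i‖ ≤ n + 1 := by
  have h1 := norm_strandPoint_sub_le l s i
  have h2 : (i : ℝ) ≤ n := by exact_mod_cast (Finset.mem_Icc.1 hi).2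
  have h3 := norm_add_le (strandPoint l s i - i) (i : ℂ)
  rw [sub_add_cancel, Complex.norm_natCast] at h3
  linarith

theorem continuous_strandRoot_far {n : ℕ} (l : ℕ × Bool) {r : ℝ} (hr : (n : ℝ) + 2 ≤ r) :
    Continuous fun s => strandRoot n l s r := by
  unfold strandRoot
  refine continuous_finsetProd _ fun i hi => ?_
  have h1 := fun s => norm_strandPoint_le l s hi
  refine continuous_iff_continuousAt.2 fun s => ?_
  refine ContinuousAt.comp (f := fun s => (r : ℂ) - strandPoint l s i)
    (continuousAt_sqrtDown (Or.inl ?_)) (by fun_prop)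
  have h2 := (Complex.re_le_norm _).trans (h1 s)
  rw [Complex.sub_re, Complex.ofReal_re]
  linarith

theorem strandPoly_eq_mul {n : ℕ} {l : ℕ × Bool} (hl : IsLetterOn n l) (s : ℝ) (z : ℂ) :
    strandPoly n l s z = ((z - (l.1 + 1 / 2)) ^ 2 -
      Complex.exp ((if l.2 then 1 else -1) * Real.pi * s * Complex.I) ^ 2 / 4) *
        ∏ i ∈ ((Finset.Icc 1 n).erase l.1).erase (l.1 + 1), (z - i) := by
  obtain ⟨h1, h2⟩ := hl
  rw [strandPoly, ← Finset.mul_prod_erase _ _ (Finset.mem_Icc.2 ⟨h1, by omega⟩),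
    ← Finset.mul_prod_erase ((Finset.Icc 1 n).erase l.1) _
      (Finset.mem_erase.2 ⟨by omega, Finset.mem_Icc.2 ⟨by omega, h2⟩⟩), ← mul_assoc]
  congr 1
  · simp only [strandPoint, if_true, if_neg (Nat.succ_ne_self l.1)]
    ring
  · refine Finset.prod_congr rfl fun i hi => ?_
    simp only [Finset.mem_erase] at hi
    simp only [strandPoint, if_neg hi.1, if_neg hi.2.1]

theorem pagePoly_eq_mul {n : ℕ} {l : ℕ × Bool} (hl : IsLetterOn n l) (z : ℂ) :
    pagePoly n z = ((z - (l.1 + 1 / 2)) ^ 2 - 1 / 4) *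
        ∏ i ∈ ((Finset.Icc 1 n).erase l.1).erase (l.1 + 1), (z - i) := by
  rw [← strandPoly_zero n l, strandPoly_eq_mul hl]
  simp

/-- A nonvanishing continuous factor that compares the polynomials of the strands at the times
`s` and `0`, along an isotopy that rotates a disk around the moving strands. -/
theorem exists_isotopy {n : ℕ} {l : ℕ × Bool} (hl : IsLetterOn n l) :
    ∃ (ρ κ : ℂ × ℝ → ℂ), Continuous ρ ∧ Continuous κ ∧ (∀ q, κ q ≠ 0) ∧
      (∀ z s, pagePoly n (ρ (z, s)) = κ (z, s) * strandPoly n l s z) ∧ (∀ z, ρ (z, 0) = z) ∧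
      (∀ z, κ (z, 0) = 1) ∧ ∀ (r s : ℝ), (n : ℝ) + 2 ≤ r → ρ (r, s) = r := by
  classical
  set c : ℂ := l.1 + 1 / 2 with hc
  set ε : ℂ := if l.2 then 1 else -1 with hε
  set rest : Finset ℕ := ((Finset.Icc 1 n).erase l.1).erase (l.1 + 1) with hrest
  -- The rotation is full within radius `3/4` of the midpoint and stops at radius 1. The moving
  -- strands lie at radius `1/2` and the resting ones at radius at least `3/2`.
  set χ : ℂ → ℝ := fun z => max 0 (min 1 (4 * (1 - ‖z - c‖))) with hχ
  have cχ : Continuous χ := by rw [hχ]; fun_prop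
  set D : ℂ × ℝ → ℂ := fun q => Complex.exp (-(ε * Real.pi * q.2 * χ q.1 * Complex.I)) with hD
  have cD : Continuous D := by rw [hD]; fun_prop
  set E : ℝ → ℂ := fun s => Complex.exp (ε * Real.pi * s * Complex.I) with hE
  have cE : Continuous E := by rw [hE]; fun_prop
  set ρ : ℂ × ℝ → ℂ := fun q => c + (q.1 - c) * D q with hρ
  have cρ : Continuous ρ := by rw [hρ]; fun_prop
  have nD : ∀ q, ‖D q‖ = 1 := fun q => by
    have : (-(ε * Real.pi * q.2 * χ q.1 * Complex.I)) =
        ((-((if l.2 then 1 else -1) * Real.pi * q.2 * χ q.1) : ℝ) : ℂ) * Complex.I := by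
      rw [hε]; cases l.2 <;> simp
    rw [hD]; simp only [this, Complex.norm_exp_ofReal_mul_I]
  have nE : ∀ s, ‖E s‖ = 1 := norm_strandPoint_rot l.2
  have Dnear : ∀ q : ℂ × ℝ, ‖q.1 - c‖ ≤ 3 / 4 → D q * E q.2 = 1 := fun q hq => by
    have : χ q.1 = 1 := by
      rw [hχ]; simp only
      rw [min_eq_left (by linarith), max_eq_right zero_le_one]
    simp only [hD, hE, this]
    rw [← Complex.exp_add]; simp
  have Dfar : ∀ q : ℂ × ℝ, 1 ≤ ‖q.1 - c‖ → D q = 1 := fun q hq => by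
    have : χ q.1 = 0 := by
      rw [hχ]; simp only
      rw [max_eq_left (min_le_iff.2 (Or.inr (by linarith)))]
    simp [hD, this]
  have D0 : ∀ z, D (z, 0) = 1 := fun z => by simp [hD]
  have E0 : E 0 = 1 := by simp [hE]
  have nrho : ∀ q, ‖ρ q - c‖ = ‖q.1 - c‖ := fun q => by
    rw [hρ]; simp [nD]
  have restne : ∀ i ∈ rest, ∀ z : ℂ, ‖z - c‖ ≤ 1 → z - i ≠ 0 := by
    intro i hi z hz h
    rw [sub_eq_zero.1 h] at hz
    simp only [hrest, Finset.mem_erase] at hi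
    have h1 : ((i : ℂ) - c) = (((i : ℝ) - (l.1 + 1 / 2) : ℝ) : ℂ) := by rw [hc]; push_cast; ring
    rw [h1, Complex.norm_real, Real.norm_eq_abs, abs_le] at hz
    have h2 : (l.1 : ℝ) < i + 1 := by linarith
    have h3 : (i : ℝ) < l.1 + 2 := by linarith
    have h2' : l.1 < i + 1 := by exact_mod_cast h2
    have h3' : i < l.1 + 2 := by exact_mod_cast h3
    omega
  have crest : ∀ z : ℂ, z = c + (z - c) := fun z => by ring
  -- This is the quotient of the quadratic factors of the moving strands. It would be `0 / 0` at the
  -- strands, but in the rigidly rotated disk it equals `D ^ 2`, which serves as the definition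
  -- there.
  set q₁ : ℂ × ℝ → ℂ := fun q => if ‖q.1 - c‖ ≤ 3 / 4 then D q ^ 2 else
    ((q.1 - c) ^ 2 * D q ^ 2 - 1 / 4) / ((q.1 - c) ^ 2 - E q.2 ^ 2 / 4) with hq₁
  set q₂ : ℂ × ℝ → ℂ := fun q => if ‖q.1 - c‖ ≤ 1 then
    ∏ i ∈ rest, (ρ q - i) / (q.1 - i) else 1 with hq₂
  have big : ∀ (ζ d e : ℂ), 3 / 4 ≤ ‖ζ‖ → ‖d‖ = 1 → ‖e‖ = 1 → ζ ^ 2 * d ^ 2 - e ^ 2 / 4 ≠ 0 := by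
    intro ζ d e hζ hd he h
    have := congrArg norm (sub_eq_zero.1 h)
    simp only [norm_mul, norm_pow, norm_div, hd, he] at this
    norm_num at this
    nlinarith
  have den : ∀ q : ℂ × ℝ, 3 / 4 ≤ ‖q.1 - c‖ → (q.1 - c) ^ 2 - E q.2 ^ 2 / 4 ≠ 0 := fun q hq => by
    simpa using big (q.1 - c) 1 (E q.2) hq (by simp) (nE _)
  have num : ∀ q : ℂ × ℝ, 3 / 4 ≤ ‖q.1 - c‖ → (q.1 - c) ^ 2 * D q ^ 2 - 1 / 4 ≠ 0 := fun q hq => by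
    simpa using big (q.1 - c) (D q) 1 hq (nD _) (by simp)
  have near_eq : ∀ q : ℂ × ℝ, ‖q.1 - c‖ ≤ 3 / 4 →
      D q ^ 2 * ((q.1 - c) ^ 2 - E q.2 ^ 2 / 4) = (q.1 - c) ^ 2 * D q ^ 2 - 1 / 4 := fun q hq => by
    linear_combination (-(1 / 4) * (D q * E q.2 + 1)) * Dnear q hq
  have cq₁ : Continuous q₁ := by
    refine continuous_if_le (by fun_prop) (by fun_prop) (by fun_prop) ?_ ?_
    · exact ContinuousOn.div (by fun_prop) (by fun_prop) fun q hq => den q hq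
    · intro q hq
      rw [eq_div_iff (den q hq.ge), near_eq q hq.le]
  have cq₂ : Continuous q₂ := by
    refine continuous_if_le (by fun_prop) (by fun_prop) ?_ (by fun_prop) ?_
    · refine continuousOn_finsetProd _ fun i hi => ?_
      exact ContinuousOn.div (by fun_prop) (by fun_prop) fun q hq => restne i hi q.1 hq
    · intro q hq
      refine Finset.prod_eq_one fun i hi => ?_
      have : ρ q = q.1 := by rw [hρ]; simp [Dfar q hq.ge]
      rw [this, div_self (restne i hi q.1 hq.le)]
  refine ⟨ρ, fun q => q₁ q * q₂ q, cρ, cq₁.mul cq₂, fun q => mul_ne_zero ?_ ?_, ?_, ?_, ?_, ?_⟩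
  · simp only [hq₁]
    split_ifs with h
    · exact pow_ne_zero _ (norm_ne_zero_iff.1 (by rw [nD]; norm_num))
    · exact div_ne_zero (num q (not_le.1 h).le) (den q (not_le.1 h).le)
  · simp only [hq₂]
    split_ifs with h
    · refine Finset.prod_ne_zero_iff.2 fun i hi => div_ne_zero ?_ (restne i hi _ h)
      exact restne i hi _ ((nrho q).trans_le h)
    · exact one_ne_zero
  · intro z s
    rw [pagePoly_eq_mul hl, strandPoly_eq_mul hl]
    have h1 : q₁ (z, s) * ((z - c) ^ 2 - E s ^ 2 / 4) = (ρ (z, s) - c) ^ 2 - 1 / 4 := by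
      simp only [hq₁, hρ, add_sub_cancel_left, mul_pow]
      split_ifs with h
      · exact near_eq (z, s) h
      · exact div_mul_cancel₀ _ (den (z, s) (not_le.1 h).le)
    have h2 : q₂ (z, s) * ∏ i ∈ rest, (z - i) = ∏ i ∈ rest, (ρ (z, s) - i) := by
      simp only [hq₂]
      split_ifs with h
      · rw [← Finset.prod_mul_distrib]
        exact Finset.prod_congr rfl fun i hi => div_mul_cancel₀ _ (restne i hi _ h)
      · have : ρ (z, s) = z := by rw [hρ]; simp [Dfar (z, s) (not_le.1 h).le]
        rw [this, one_mul]
    calc _ = (q₁ (z, s) * ((z - c) ^ 2 - E s ^ 2 / 4)) * (q₂ (z, s) * ∏ i ∈ rest, (z - i)) := by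
          rw [h1, h2]
      _ = _ := by simp only [hE, hc]; ring
  · intro z; simp [hρ, D0]
  · intro z
    have h1 : q₁ (z, 0) = 1 := by
      simp only [hq₁, D0, E0]
      split_ifs with h
      · simp
      · have := den (z, 0) (not_le.1 h).le
        simp only [E0] at this
        rw [one_pow, mul_one]
        rw [one_pow] at this
        exact div_self this
    have h2 : q₂ (z, 0) = 1 := by
      simp only [hq₂]
      split_ifs with h
      · refine Finset.prod_eq_one fun i hi => ?_
        have : ρ (z, 0) = z := by simp [hρ, D0]
        rw [this, div_self (restne i hi _ h)]
      · rfl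
    simp [h1, h2]
  · intro r s hr
    have : D (r, s) = 1 := Dfar _ (by
      have h1 : ((r : ℂ) - c) = ((r - (l.1 + 1 / 2) : ℝ) : ℂ) := by rw [hc]; push_cast; ring
      have h2 : ((l.1 : ℝ) + 1) ≤ n := by exact_mod_cast hl.2
      simp only [h1, Complex.norm_real, Real.norm_eq_abs]
      exact le_trans (by linarith) (le_abs_self _))
    simp [hρ, this]

/-- The double branched cover of the plane at the time `s` of a letter, compared with that at the
time `0`. -/
theorem exists_transport {n : ℕ} {l : ℕ × Bool} (hl : IsLetterOn n l) :
    ∃ Θ : ℂ × ℝ × ℂ → ℂ × ℂ, Continuous Θ ∧ MapsTo Θ (slabCurve n l) (pageCurve n) ∧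
      (∀ z y, Θ (z, 0, y) = (z, y)) ∧ ∀ (r s : ℝ) (c : ℂ), (n : ℝ) + 2 ≤ r →
        Θ (r, s, c * strandRoot n l s r) = ((r : ℂ), c * pageRoot n r) := by
  obtain ⟨ρ, κ, cρ, cκ, κ0, hκ, ρ0, κ1, ρr⟩ := exists_isotopy hl
  obtain ⟨h, ch, eh⟩ := exists_log_lift (starConvex_univ ((0 : ℂ), (0 : ℝ))) (mem_univ _)
    cκ.continuousOn fun q _ => κ0 q
  have ch := continuousOn_univ.1 ch
  -- A continuous square root of `κ`, taken from a logarithm on the contractible space `ℂ × ℝ` and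
  -- normalised to be 1 at time 0. It lifts the isotopy to the double covers.
  set δ : ℂ × ℝ → ℂ := fun q => Complex.exp ((h q - h (q.1, 0)) / 2) with hδ
  have cδ : Continuous δ := by rw [hδ]; fun_prop
  have δ2 : ∀ q, δ q ^ 2 = κ q := fun q => by
    rw [hδ]; simp only
    rw [← Complex.exp_nat_mul, show ((2 : ℕ) : ℂ) * ((h q - h (q.1, 0)) / 2) = h q - h (q.1, 0) by
      push_cast; ring, Complex.exp_sub, eh q trivial, eh (q.1, 0) trivial, κ1, div_one]
  have δ0 : ∀ z, δ (z, 0) = 1 := fun z => by simp [hδ]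
  refine ⟨fun q => (ρ (q.1, q.2.1), δ (q.1, q.2.1) * q.2.2), by fun_prop, ?_, ?_, ?_⟩
  · rintro ⟨z, s, y⟩ ⟨hs, hy⟩
    simp only at hy
    simp only [pageCurve, Set.mem_ofPred_eq, mul_pow, δ2, hκ, hy]
  · intro z y; simp [ρ0, δ0]
  · intro r s c hr
    have key : δ (r, s) * strandRoot n l s r = pageRoot n r := by
      refine isPreconnected_univ.eq_of_sq_eq (f := fun s : ℝ => δ (r, s) * strandRoot n l s r)
        (g := fun _ => pageRoot n r) ?_ continuousOn_const ?_ ?_ (mem_univ (0 : ℝ)) ?_ (mem_univ s)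
      · exact ((cδ.comp (by fun_prop)).mul (continuous_strandRoot_far l hr)).continuousOn
      · intro s _
        simp only [Pi.pow_apply, mul_pow, δ2, strandRoot_sq, pageRoot_sq, ← hκ, ρr r s hr]
      · intro _ _
        refine pageRoot_ne_zero ?_
        rw [Complex.norm_real, Real.norm_eq_abs]
        exact lt_of_lt_of_le (by linarith) (le_abs_self r)
      · simp [δ0, strandRoot_zero]
    simp only [ρr r s hr, ← key]
    rw [mul_left_comm]

/-! ## The strands over the whole time line -/

section Loop

variable (n : ℕ) (L : ℤ → ℕ × Bool)

/-- The polynomial whose roots are the strands at the time `t`, where the letter `L j` is performed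
between the times `j` and `j + 1`. -/
noncomputable def loopPoly (t : ℝ) (z : ℂ) : ℂ := strandPoly n (L ⌊t⌋) (Int.fract t) z

/-- A square root of `loopPoly`, cut along the upward rays from the strands. -/
noncomputable def loopRoot (t : ℝ) (z : ℂ) : ℂ := strandRoot n (L ⌊t⌋) (Int.fract t) z

/-- The double cover of `ℂ × ℝ` that is branched along the strands. -/
def loopCurve : Set (ℂ × ℝ × ℂ) := {q | q.2.2 ^ 2 = loopPoly n L q.2.1 q.1}

variable {n L}

theorem loopRoot_sq (t : ℝ) (z : ℂ) : loopRoot n L t z ^ 2 = loopPoly n L t z := strandRoot_sq ..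

theorem floor_fract_cases {j : ℤ} {t : ℝ} (ht : t ∈ Icc (j : ℝ) (j + 1)) :
    (⌊t⌋ = j ∧ Int.fract t = t - j) ∨ (⌊t⌋ = j + 1 ∧ Int.fract t = 0 ∧ t - j = 1) := by
  rcases ht.2.lt_or_eq with h | h
  · left
    have : ⌊t⌋ = j := Int.floor_eq_iff.2 ⟨ht.1, h⟩
    exact ⟨this, by rw [Int.fract, this]⟩
  · right
    have : t = ((j + 1 : ℤ) : ℝ) := by rw [h]; push_cast; ring
    refine ⟨by rw [this, Int.floor_intCast], by rw [this, Int.fract_intCast], by rw [h]; ring⟩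

theorem loopPoly_eq (hL : ∀ j, IsLetterOn n (L j)) {j : ℤ} {t : ℝ} (ht : t ∈ Icc (j : ℝ) (j + 1)) :
    loopPoly n L t = strandPoly n (L j) (t - j) := by
  funext z
  rcases floor_fract_cases ht with ⟨h1, h2⟩ | ⟨h1, h2, h3⟩
  · rw [loopPoly, h1, h2]
  · rw [loopPoly, h1, h2, h3, strandPoly_zero, strandPoly_one (hL j)]

theorem loopRoot_eq (hL : ∀ j, IsLetterOn n (L j)) {j : ℤ} {t : ℝ} (ht : t ∈ Icc (j : ℝ) (j + 1)) :
    loopRoot n L t = strandRoot n (L j) (t - j) := by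
  funext z
  rcases floor_fract_cases ht with ⟨h1, h2⟩ | ⟨h1, h2, h3⟩
  · rw [loopRoot, h1, h2]
  · rw [loopRoot, h1, h2, h3, strandRoot_zero, strandRoot_one (hL j)]

theorem loopPoly_intCast (j : ℤ) : loopPoly n L j = pagePoly n := by
  funext z; simp [loopPoly, strandPoly_zero]

theorem loopRoot_intCast (j : ℤ) : loopRoot n L j = pageRoot n := by
  funext z; simp [loopRoot, strandRoot_zero]

theorem loopPoly_add {N : ℤ} (hN : ∀ j, L (j + N) = L j) (t : ℝ) :
    loopPoly n L (t + N) = loopPoly n L t := by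
  funext z; simp [loopPoly, hN]

/-- The closed slabs between consecutive integer times form a locally finite cover, so functions
given letter by letter may be checked on each closed slab separately. -/
theorem continuous_of_slabs {X Y : Type*} [TopologicalSpace X] [TopologicalSpace Y] {f : X → Y}
    {τ : X → ℝ} (hτ : Continuous τ)
    (h : ∀ j : ℤ, ContinuousOn f {x | τ x ∈ Icc (j : ℝ) (j + 1)}) : Continuous f := by
  have lf : LocallyFinite fun j : ℤ => {x | τ x ∈ Icc (j : ℝ) (j + 1)} := by
    intro x
    refine ⟨{y | τ y ∈ Ioo (τ x - 1) (τ x + 1)}, hτ.continuousAt.preimage_mem_nhds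
      (Ioo_mem_nhds (by linarith) (by linarith)), ?_⟩
    refine (Set.finite_Icc (⌊τ x⌋ - 2) (⌊τ x⌋ + 2)).subset ?_
    rintro j ⟨y, ⟨h1, h2⟩, h3, h4⟩
    have f1 := Int.floor_le (τ x)
    have f2 := Int.lt_floor_add_one (τ x)
    constructor
    · have : (⌊τ x⌋ : ℝ) < j + 2 := by linarith
      have : ⌊τ x⌋ < j + 2 := by exact_mod_cast this
      omega
    · have : (j : ℝ) < ⌊τ x⌋ + 2 := by linarith
      have : j < ⌊τ x⌋ + 2 := by exact_mod_cast this
      omega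
  refine lf.continuous ?_ (fun j => isClosed_Icc.preimage hτ) h
  refine eq_univ_of_forall fun x => mem_iUnion.2 ⟨⌊τ x⌋, Int.floor_le _, ?_⟩
  exact (Int.lt_floor_add_one _).le

theorem continuous_loopPoly (hL : ∀ j, IsLetterOn n (L j)) :
    Continuous fun q : ℂ × ℝ => loopPoly n L q.2 q.1 := by
  refine continuous_of_slabs continuous_snd fun j => ?_
  refine ((continuous_strandPoly n (L j)).comp (f := fun q : ℂ × ℝ => (q.1, q.2 - j))
    (by fun_prop)).continuousOn.congr fun q hq => ?_
  rw [loopPoly_eq hL hq]; rfl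

theorem isClosed_loopCurve (hL : ∀ j, IsLetterOn n (L j)) : IsClosed (loopCurve n L) := by
  have := (continuous_loopPoly hL).comp (f := fun q : ℂ × ℝ × ℂ => (q.1, q.2.1)) (by fun_prop)
  exact isClosed_eq (by fun_prop) this

theorem continuous_loopRoot_far (hL : ∀ j, IsLetterOn n (L j)) {r : ℝ} (hr : (n : ℝ) + 2 ≤ r) :
    Continuous fun t => loopRoot n L t r := by
  refine continuous_of_slabs continuous_id fun j => ?_
  refine ((continuous_strandRoot_far (L j) hr).comp (f := fun t : ℝ => t - j)
    (by fun_prop)).continuousOn.congr fun t ht => ?_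
  rw [loopRoot_eq hL ht]; rfl

theorem mem_loopCurve_iff (hL : ∀ j, IsLetterOn n (L j)) {j : ℤ} {s : ℝ}
    (hs : s ∈ Icc (0 : ℝ) 1) {z y : ℂ} :
    (z, j + s, y) ∈ loopCurve n L ↔ (z, s, y) ∈ slabCurve n (L j) := by
  have : (j + s : ℝ) ∈ Icc (j : ℝ) (j + 1) := ⟨by linarith [hs.1], by linarith [hs.2]⟩
  simp only [loopCurve, slabCurve, Set.mem_ofPred_eq, loopPoly_eq hL this, add_sub_cancel_left]
  exact ⟨fun h => ⟨hs, h⟩, fun h => h.2⟩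

/-- The labels at the times `0` and `k` differ by the action of the first `k` letters. -/
theorem HasLabels.word (hL : ∀ j, IsLetterOn n (L j)) {w : BraidWord}
    (hw : ∀ (k : ℕ) (hk : k < w.length), L k = w[k]) {F : ℂ × ℝ × ℂ → Circle}
    (hF : ContinuousOn F {q | q ∈ loopCurve n L ∧ q.2.1 ∈ Icc (0 : ℝ) w.length}) {r : ℝ}
    (hr : n + 2 ≤ r) {α β : ℝ → ℝ} (hα : Continuous α) (hβ : Continuous β)
    (eα : ∀ t ∈ Icc (0 : ℝ) w.length, turn (α t) = F (r, t, loopRoot n L t r))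
    (eβ : ∀ t ∈ Icc (0 : ℝ) w.length, turn (β t) = F (r, t, -loopRoot n L t r)) {A : ℕ → ℤ}
    (hA : HasLabels n (fun q => F (q.1, 0, q.2)) r (α 0) (β 0) A) :
    HasLabels n (fun q => F (q.1, w.length, q.2)) r (α w.length) (β w.length) (wordAct w A) := by
  have key : ∀ k ≤ w.length,
      HasLabels n (fun q => F (q.1, k, q.2)) r (α k) (β k) (wordAct (w.take k) A) := by
    intro k
    induction k with
    | zero => intro _; simpa using hA
    | succ k ih =>
      intro hk
      have ih := ih (by omega)
      have hkj : ∀ s ∈ Icc (0 : ℝ) 1, (k + s : ℝ) ∈ Icc ((k : ℤ) : ℝ) ((k : ℤ) + 1) := fun s hs =>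
        ⟨by push_cast; linarith [hs.1], by push_cast; linarith [hs.2]⟩
      have hkw : ∀ s ∈ Icc (0 : ℝ) 1, (k + s : ℝ) ∈ Icc (0 : ℝ) w.length := fun s hs => by
        have : (k : ℝ) + 1 ≤ w.length := by exact_mod_cast hk
        exact ⟨add_nonneg (Nat.cast_nonneg k) hs.1, by linarith [hs.2]⟩
      have := HasLabels.letter (hL k) (F := fun q => F (q.1, k + q.2.1, q.2.2))
        (hF.comp (by fun_prop) fun q hq => by
          have := (mem_loopCurve_iff hL (j := k) hq.1).2 hq
          exact ⟨by simpa using this, hkw _ hq.1⟩) hr (α := fun s => α (k + s)) (β := fun s => β (k + s))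
        (by fun_prop) (by fun_prop)
        (fun s hs => by rw [eα _ (hkw s hs), loopRoot_eq hL (hkj s hs)]; simp)
        (fun s hs => by rw [eβ _ (hkw s hs), loopRoot_eq hL (hkj s hs)]; simp)
        (A := wordAct (w.take k) A) (by simpa using ih)
      rw [List.take_succ_eq_append_getElem (by omega), wordAct_append, wordAct_cons, wordAct_nil,
        ← hw k (by omega)]
      push_cast
      exact this
  simpa using key w.length le_rfl

/-- The double branched cover of the plane at all times from `0` to `k`, compared with that at the
time `0`. -/
theorem exists_long_transport (hL : ∀ j, IsLetterOn n (L j)) (k : ℕ) :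
    ∃ Θ : ℂ × ℝ × ℂ → ℂ × ℂ, ContinuousOn Θ {q | q ∈ loopCurve n L ∧ q.2.1 ∈ Icc (0 : ℝ) k} ∧
      MapsTo Θ {q | q ∈ loopCurve n L ∧ q.2.1 ∈ Icc (0 : ℝ) k} (pageCurve n) ∧
      (∀ z y, Θ (z, 0, y) = (z, y)) ∧ ∀ (r t : ℝ) (c : ℂ), (n : ℝ) + 2 ≤ r →
        t ∈ Icc (0 : ℝ) k → c ^ 2 = 1 → Θ (r, t, c * loopRoot n L t r) = ((r : ℂ), c * pageRoot n r) := by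
  induction k with
  | zero =>
    refine ⟨fun q => (q.1, q.2.2), by fun_prop, ?_, fun _ _ => rfl, ?_⟩
    · rintro ⟨z, t, y⟩ ⟨h, h1, h2⟩
      obtain rfl : t = ((0 : ℤ) : ℝ) := by
        simp only [Nat.cast_zero] at h1 h2
        rw [Int.cast_zero]; exact le_antisymm h2 h1
      show y ^ 2 = pagePoly n z
      rw [← loopPoly_intCast (L := L) 0]; exact h
    · intro r t c _ ht _
      obtain rfl : t = ((0 : ℤ) : ℝ) := by
        simp only [Nat.cast_zero] at ht
        rw [Int.cast_zero]; exact le_antisymm ht.2 ht.1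
      simp only [loopRoot_intCast]
  | succ k ih =>
    obtain ⟨Θ, cΘ, mΘ, Θ0, Θr⟩ := ih
    obtain ⟨T, cT, mT, T0, Tr⟩ := exists_transport (hL k)
    have e : ∀ q : ℂ × ℝ × ℂ, q ∈ loopCurve n L → q.2.1 ∈ Icc (k : ℝ) (k + 1) →
        (q.1, q.2.1 - k, q.2.2) ∈ slabCurve n (L k) := by
      rintro ⟨z, t, y⟩ hq ht
      have := mem_loopCurve_iff (z := z) (y := y) hL (j := k) (s := t - k)
        ⟨by linarith [ht.1], by linarith [ht.2]⟩
      refine this.1 ?_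
      simpa using hq
    have atk : ∀ q : ℂ × ℂ, q ∈ pageCurve n → (q.1, (k : ℝ), q.2) ∈ loopCurve n L := by
      rintro q hq
      have := loopPoly_intCast (n := n) (L := L) k
      simp only [Int.cast_natCast] at this
      show q.2 ^ 2 = loopPoly n L k q.1
      rw [this]; exact hq
    -- The additional slab is pushed back onto the page at time `k` and the earlier times are left
    -- alone; the transport for `k` letters then applies.
    set G : ℂ × ℝ × ℂ → ℂ × ℝ × ℂ := fun q => if q.2.1 ≤ k then q else
      ((T (q.1, q.2.1 - k, q.2.2)).1, k, (T (q.1, q.2.1 - k, q.2.2)).2) with hG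
    have cG : Continuous G := by
      refine continuous_if_le (by fun_prop) continuous_const continuousOn_id
        (by fun_prop) ?_
      rintro ⟨z, t, y⟩ hq
      simp only at hq
      simp [hq, T0]
    have mG : MapsTo G {q | q ∈ loopCurve n L ∧ q.2.1 ∈ Icc (0 : ℝ) (k + 1 : ℕ)}
        {q | q ∈ loopCurve n L ∧ q.2.1 ∈ Icc (0 : ℝ) k} := by
      rintro q ⟨hq, h1, h2⟩
      simp only [hG]
      split_ifs with h
      · exact ⟨hq, h1, h⟩
      · refine ⟨atk _ (mT (e q hq ⟨(not_le.1 h).le, by exact_mod_cast h2⟩)), by simp⟩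
    refine ⟨fun q => Θ (G q), cΘ.comp cG.continuousOn mG, fun q hq => mΘ (mG hq), ?_, ?_⟩
    · intro z y
      simp [hG, Θ0]
    · intro r t c hr ht hc
      simp only [hG]
      split_ifs with h
      · exact Θr r t c hr ⟨ht.1, h⟩ hc
      · have ht' : t ∈ Icc (((k : ℕ) : ℤ) : ℝ) (((k : ℕ) : ℤ) + 1) :=
          ⟨by simpa using (not_le.1 h).le, by simpa using ht.2⟩
        have h3 := Tr r (t - k) c hr
        rw [show (strandRoot n (L k) (t - k) : ℂ → ℂ) = loopRoot n L t by
          rw [loopRoot_eq hL ht']; simp] at h3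
        rw [h3]
        have h4 := Θr r k c hr ⟨by simp, le_rfl⟩ hc
        have := loopRoot_intCast (n := n) (L := L) k
        simp only [Int.cast_natCast] at this
        rw [this] at h4
        exact h4

end Loop

/-! ## Functions with given labels -/

/-- There is a function on the double branched cover of the plane with arbitrary labels. -/
theorem exists_page_function (n : ℕ) (A : ℕ → ℤ) : ∃ f : ℂ × ℂ → Circle,
    ContinuousOn f (pageCurve n) ∧ ∀ r : ℝ, ∃ α β, HasLabels n f r α β A := by
  classical
  -- The logarithms are `Λ (Re z)` and `-Λ (Re z)` on the two sheets. At `Re z = i` they differ by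
  -- the integer `A i`, so the two circle values agree on the entire vertical line, including the
  -- cut where the names of the sheets are exchanged.
  set Λ : ℝ → ℝ := fun x => ∑ i ∈ Finset.Icc 1 n, (A i : ℝ) / 2 * max 0 (1 - |x - i|) with hΛ
  have cΛ : Continuous Λ := by rw [hΛ]; fun_prop
  have Λi : ∀ i ∈ Icc 1 n, Λ i = A i / 2 := by
    intro i hi
    rw [hΛ]
    simp only
    rw [Finset.sum_eq_single i]
    · simp
    · intro j _ hj
      rw [max_eq_left, mul_zero]
      have : (1 : ℝ) ≤ |(i : ℝ) - j| := by
        have : (1 : ℤ) ≤ |(i : ℤ) - j| := Int.one_le_abs (by omega)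
        exact_mod_cast this
      linarith
    · intro h; exact absurd (Finset.mem_Icc.2 hi) h
  set a : ℂ × ℂ → Circle := fun q => turn (Λ q.1.re) with ha
  set b : ℂ × ℂ → Circle := fun q => turn (-Λ q.1.re) with hb
  have ca : Continuous a := by rw [ha]; fun_prop
  have cb : Continuous b := by rw [hb]; fun_prop
  have ab : ∀ q : ℂ × ℂ, (∃ i ∈ Icc 1 n, q.1.re = (i : ℕ)) → a q = b q := by
    rintro q ⟨i, hi, h⟩
    simp only [ha, hb, h, Λi i hi]
    exact turn_eq_turn_iff.2 ⟨A i, by ring⟩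
  set f : ℂ × ℂ → Circle := fun q => if q.2 = pageRoot n q.1 then a q else b q with hf
  refine ⟨f, ?_, fun r => ⟨Λ r, -Λ r, fun z => Λ z.re, fun z => -Λ z.re, by fun_prop, by fun_prop,
    ?_, ?_, by simp, by simp, ?_⟩⟩
  · rintro ⟨z₀, y₀⟩ hq
    have hq : y₀ ^ 2 = pagePoly n z₀ := hq
    by_cases hz : ∃ i ∈ Icc 1 n, z₀.re = (i : ℕ)
    · have h0 : f (z₀, y₀) = a (z₀, y₀) := by
        simp only [hf]; rw [ab (z₀, y₀) hz]; simp
      refine ContinuousAt.continuousWithinAt ?_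
      rw [ContinuousAt, h0, tendsto_def]
      intro U hU
      have h1 := ca.continuousAt.preimage_mem_nhds hU
      have h2 := cb.continuousAt.preimage_mem_nhds (ab (z₀, y₀) hz ▸ hU)
      filter_upwards [h1, h2] with q h1 h2
      simp only [hf, mem_preimage]
      split_ifs
      exacts [h1, h2]
    · have cr : ContinuousAt (pageRoot n) z₀ := by
        unfold pageRoot
        refine tendsto_finsetProd _ fun i hi => ?_
        refine ContinuousAt.comp (f := fun z : ℂ => z - i) (continuousAt_sqrtDown (Or.inl ?_))
          (by fun_prop)
        intro h
        exact hz ⟨i, Finset.mem_Icc.1 hi, by simpa [sub_eq_zero] using h⟩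
      have r0 : pageRoot n z₀ ≠ 0 := by
        intro h
        obtain ⟨i, hi, rfl⟩ := pageRoot_eq_zero.1 h
        exact hz ⟨i, hi, by simp⟩
      have cr' : ContinuousAt (fun q : ℂ × ℂ => pageRoot n q.1) (z₀, y₀) :=
        ContinuousAt.comp (g := pageRoot n) (f := fun q : ℂ × ℂ => q.1) (x := (z₀, y₀)) cr continuousAt_fst
      have hcases : ∀ q ∈ pageCurve n, q.2 = pageRoot n q.1 ∨ q.2 = -pageRoot n q.1 := fun q hq =>
        sq_eq_sq_iff_eq_or_eq_neg.1 (by rw [pageRoot_sq]; exact hq)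
      by_cases hy : y₀ = pageRoot n z₀
      · refine (ca.continuousWithinAt (s := pageCurve n)).congr_of_eventuallyEq ?_
          (by simp [hf, hy])
        have : ∀ᶠ q : ℂ × ℂ in 𝓝 (z₀, y₀), q.2 + pageRoot n q.1 ≠ 0 :=
          (continuousAt_snd.add cr').eventually_ne (by
            show y₀ + pageRoot n z₀ ≠ 0
            rw [hy, ← two_mul]; exact mul_ne_zero two_ne_zero r0)
        filter_upwards [self_mem_nhdsWithin, mem_nhdsWithin_of_mem_nhds this] with q h1 h2
        rcases hcases q h1 with h | h
        · simp [hf, h]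
        · exact absurd (by rw [h]; ring) h2
      · refine (cb.continuousWithinAt (s := pageCurve n)).congr_of_eventuallyEq ?_
          (by simp [hf, hy])
        have : ∀ᶠ q : ℂ × ℂ in 𝓝 (z₀, y₀), q.2 - pageRoot n q.1 ≠ 0 :=
          (continuousAt_snd.sub cr').eventually_ne (by simpa [sub_eq_zero] using hy)
        filter_upwards [mem_nhdsWithin_of_mem_nhds this] with q h2
        simp only [hf]
        rw [if_neg (by simpa [sub_eq_zero] using h2)]
  · intro z _; simp [hf, ha]
  · intro z _
    simp only [hf]
    split_ifs with h
    · have h : -pageRoot n z = pageRoot n z := h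
      obtain ⟨i, hi, hz⟩ := pageRoot_eq_zero.1 (self_eq_neg.1 h.symm)
      exact (ab (z, -pageRoot n z) ⟨i, hi, by simp [hz]⟩).symm
    · rfl
  · intro i hi
    simp only [Complex.natCast_re, Λi i hi]; ring

/-! ### Closing up a function over one period -/

section Loop

variable {n : ℕ} {L : ℤ → ℕ × Bool}

theorem turn_add_one (t : ℝ) : turn (t + 1) = turn t := by exact_mod_cast turn_add_intCast t 1

/-- A function on the double cover of `ℂ × ℝ` over one period extends periodically if
its values at the ends agree. -/
theorem exists_periodic {N : ℕ} (hN : 0 < N)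
    (hp : ∀ j, L (j + N) = L j) {F : ℂ × ℝ × ℂ → Circle}
    (hF : ContinuousOn F {q | q ∈ loopCurve n L ∧ q.2.1 ∈ Icc (0 : ℝ) N})
    (h : ∀ q ∈ pageCurve n, F (q.1, N, q.2) = F (q.1, 0, q.2)) :
    ∃ G : ℂ × ℝ × ℂ → Circle, ContinuousOn G (loopCurve n L) ∧
      (∀ z t y, G (z, t + N, y) = G (z, t, y)) ∧
      ∀ q ∈ loopCurve n L, q.2.1 ∈ Icc (0 : ℝ) N → G q = F q := by
  have hN' : (0 : ℝ) < N := by exact_mod_cast hN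
  have hmul : ∀ (j : ℤ) (t : ℝ), loopPoly n L (t + N * j) = loopPoly n L t := by
    intro j t
    have h1 : ∀ i, L (i + N * j) = L i := by
      intro i
      induction j using Int.induction_on generalizing i with
      | zero => simp
      | succ j ih => rw [mul_add, mul_one, ← add_assoc, hp, ih]
      | pred j ih => rw [mul_sub, mul_one, ← hp, ← add_sub_assoc, sub_add_cancel, ih]
    have := loopPoly_add (n := n) h1 t
    push_cast at this
    exact this
  -- The fractional part jumps only at multiples of the period, and there the equality of the end
  -- values removes the jump.
  set G : ℂ × ℝ × ℂ → Circle := fun q => F (q.1, N * Int.fract (q.2.1 / N), q.2.2) with hG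
  have slab : ∀ (j : ℤ) (q : ℂ × ℝ × ℂ), q ∈ loopCurve n L → q.2.1 / N ∈ Icc (j : ℝ) (j + 1) →
      (q.1, q.2.1 - N * j, q.2.2) ∈ {q | q ∈ loopCurve n L ∧ q.2.1 ∈ Icc (0 : ℝ) N} ∧
      G q = F (q.1, q.2.1 - N * j, q.2.2) := by
    rintro j ⟨z, t, y⟩ hq ht
    simp only at ht
    have h1 := (le_div_iff₀ hN').1 ht.1
    have h2 := (div_le_iff₀ hN').1 ht.2
    have hm : (z, t - N * j, y) ∈ loopCurve n L := by
      show y ^ 2 = loopPoly n L (t - N * j) z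
      rw [← hmul j, sub_add_cancel]
      exact hq
    refine ⟨⟨hm, by simp only; linarith, by simp only; linarith⟩, ?_⟩
    simp only [hG]
    rcases floor_fract_cases ht with ⟨_, h4⟩ | ⟨_, h4, h5⟩
    · rw [h4, mul_sub, mul_div_cancel₀ _ hN'.ne']
    · have : t - N * j = N := by
        have := congrArg (fun x => (N : ℝ) * x) h5
        rw [mul_sub, mul_div_cancel₀ _ hN'.ne', mul_one] at this
        exact this
      rw [h4, this, mul_zero]
      rw [this] at hm
      refine (h (z, y) ?_).symm
      have e := loopPoly_intCast (n := n) (L := L) N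
      simp only [Int.cast_natCast] at e
      show y ^ 2 = pagePoly n z
      rw [← e]
      exact hm
  refine ⟨G, ?_, ?_, ?_⟩
  · rw [continuousOn_iff_continuous_domRestrict]
    refine continuous_of_slabs (τ := fun x : loopCurve n L => x.1.2.1 / N) (by fun_prop) fun j => ?_
    have h1 : ContinuousOn (fun q : loopCurve n L => F (q.1.1, q.1.2.1 - N * j, q.1.2.2))
        {x : loopCurve n L | x.1.2.1 / N ∈ Icc (j : ℝ) (j + 1)} :=
      hF.comp (by fun_prop) fun q hq => (slab j q.1 q.2 hq).1
    exact h1.congr fun q hq => (slab j q.1 q.2 hq).2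
  · intro z t y
    simp only [hG]
    rw [add_div, div_self hN'.ne', Int.fract_add_one]
  · rintro q hq ht
    have := (slab 0 q hq ⟨by simpa using div_nonneg ht.1 hN'.le, by
      simpa using (div_le_one hN').2 ht.2⟩).2
    simpa using this

/-- Labels that a braid word increases by `1` come from a function on the double cover of
`ℂ × ℝ` that has degree `1` and `0` over a period at infinity. -/
theorem exists_loop_function (hL : ∀ j, IsLetterOn n (L j)) {w : BraidWord}
    (hw : ∀ (k : ℕ) (hk : k < w.length), L k = w[k]) (hN : 0 < w.length)
    (hp : ∀ j, L (j + w.length) = L j) {A : ℕ → ℤ}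
    (hA : EqOn (wordAct w A) (fun i => A i + 1) (Icc 1 n)) {r : ℝ} (hr : (n : ℝ) + 2 ≤ r) :
    ∃ F : ℂ × ℝ × ℂ → Circle, ContinuousOn F (loopCurve n L) ∧
      (∀ z t y, F (z, t + w.length, y) = F (z, t, y)) ∧
      (∃ α : ℝ → ℝ, ContinuousOn α (Icc 0 w.length) ∧
        (∀ t ∈ Icc (0 : ℝ) w.length, turn (α t) = F (r, t, loopRoot n L t r)) ∧
        α w.length = α 0 + 1) ∧
      ∃ β : ℝ → ℝ, ContinuousOn β (Icc 0 w.length) ∧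
        (∀ t ∈ Icc (0 : ℝ) w.length, turn (β t) = F (r, t, -loopRoot n L t r)) ∧
        β w.length = β 0 := by
  set N := w.length
  have hN' : (0 : ℝ) < N := by exact_mod_cast hN
  have m0 : (0 : ℝ) ∈ Icc (0 : ℝ) N := ⟨le_rfl, hN'.le⟩
  have mN : (N : ℝ) ∈ Icc (0 : ℝ) N := ⟨hN'.le, le_rfl⟩
  obtain ⟨f, cf, hf⟩ := exists_page_function n A
  obtain ⟨α, β, hf⟩ := hf r
  obtain ⟨Θ, cΘ, mΘ, Θ0, Θr⟩ := exists_long_transport hL N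
  have R0 : loopRoot n L 0 = pageRoot n := by
    have := loopRoot_intCast (n := n) (L := L) 0
    simpa using this
  have RN : loopRoot n L N = pageRoot n := by
    have := loopRoot_intCast (n := n) (L := L) N
    simpa using this
  have PN : loopPoly n L N = pagePoly n := by
    have := loopPoly_intCast (n := n) (L := L) N
    simpa using this
  have memN : ∀ q : ℂ × ℂ, q ∈ pageCurve n → (q.1, (N : ℝ), q.2) ∈ loopCurve n L := fun q hq => by
    show q.2 ^ 2 = loopPoly n L N q.1
    rw [PN]; exact hq
  have cF₀ : ContinuousOn (fun q => f (Θ q)) {q | q ∈ loopCurve n L ∧ q.2.1 ∈ Icc (0 : ℝ) N} :=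
    cf.comp cΘ mΘ
  have fα : turn α = f (r, pageRoot n r) := by
    obtain ⟨g, h, _, _, eg, _, hg, _⟩ := hf
    rw [← hg, eg _ (ofReal_mem_lowerHalf r)]
  have fβ : turn β = f (r, -pageRoot n r) := by
    obtain ⟨g, h, _, _, _, eh, _, hh, _⟩ := hf
    rw [← hh, eh _ (ofReal_mem_lowerHalf r)]
  have Θα : ∀ t ∈ Icc (0 : ℝ) N, turn α = f (Θ (r, t, loopRoot n L t r)) := fun t ht => by
    have := Θr r t 1 hr ht (by simp)
    rw [one_mul, one_mul] at this
    rw [this, fα]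
  have Θβ : ∀ t ∈ Icc (0 : ℝ) N, turn β = f (Θ (r, t, -loopRoot n L t r)) := fun t ht => by
    have := Θr r t (-1) hr ht (by simp)
    rw [neg_one_mul, neg_one_mul] at this
    rw [this, fβ]
  have hend := HasLabels.word hL hw cF₀ hr (α := fun _ => α) (β := fun _ => β) continuous_const
    continuous_const Θα Θβ (A := A) (by simpa only [Θ0] using hf)
  -- The quotient of the end and the start of the period has all labels 1 for the values 0 at both
  -- base points. Raising the logarithm on the second sheet by 1 makes the labels vanish, so the
  -- quotient has a global logarithm `h`, with the values 0 and 1 at the base points.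
  have hratio := ((hend.congr hA).div hf).shift 0 1
  simp only [sub_self, Int.cast_zero, Int.cast_one, zero_add, add_sub_cancel_left, zero_sub,
    add_neg_cancel] at hratio
  have cend : ContinuousOn (fun q : ℂ × ℂ => f (Θ (q.1, N, q.2))) (pageCurve n) :=
    cF₀.comp (f := fun q : ℂ × ℂ => (q.1, (N : ℝ), q.2)) (by fun_prop)
      fun q hq => ⟨memN q hq, mN⟩
  obtain ⟨h, ch, eh, hα, hβ⟩ := HasLabels.exists_lift (cend.div' cf) hratio
  -- the correction between the ends of the period
  set S : Set (ℂ × ℝ × ℂ) := {q | q ∈ loopCurve n L ∧ (q.2.1 = 0 ∨ q.2.1 = N)} with hS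
  have cS : IsClosed S := by
    have c1 : IsClosed {q : ℂ × ℝ × ℂ | q.2.1 = 0} := isClosed_eq (by fun_prop) continuous_const
    have c2 : IsClosed {q : ℂ × ℝ × ℂ | q.2.1 = N} := isClosed_eq (by fun_prop) continuous_const
    exact (isClosed_loopCurve hL).inter (c1.union c2)
  set k₀ : ℂ × ℝ × ℂ → ℝ := fun q => if q.2.1 = 0 then 0 else h (q.1, q.2.2) with hk₀
  have ck₀ : ContinuousOn k₀ S := by
    have c1 : IsClosed {q : ℂ × ℝ × ℂ | q ∈ loopCurve n L ∧ q.2.1 = 0} :=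
      (isClosed_loopCurve hL).inter (isClosed_eq (by fun_prop) continuous_const)
    have c2 : IsClosed {q : ℂ × ℝ × ℂ | q ∈ loopCurve n L ∧ q.2.1 = N} :=
      (isClosed_loopCurve hL).inter (isClosed_eq (by fun_prop) continuous_const)
    have d1 : ContinuousOn k₀ {q : ℂ × ℝ × ℂ | q ∈ loopCurve n L ∧ q.2.1 = 0} :=
      (continuousOn_const (c := (0 : ℝ))).congr fun q hq => by simp [hk₀, hq.2]
    have d2 : ContinuousOn k₀ {q : ℂ × ℝ × ℂ | q ∈ loopCurve n L ∧ q.2.1 = N} := by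
      refine (ch.comp (f := fun q : ℂ × ℝ × ℂ => (q.1, q.2.2)) (by fun_prop) ?_).congr ?_
      · rintro ⟨z, t, y⟩ ⟨hq, ht⟩
        simp only at ht
        show y ^ 2 = pagePoly n z
        rw [← PN, ← ht]; exact hq
      · rintro q ⟨_, hq⟩
        simp [hk₀, hq, hN'.ne']
    refine (d1.union_of_isClosed d2 c1 c2).mono ?_
    rintro q ⟨h1, h2 | h2⟩
    exacts [Or.inl ⟨h1, h2⟩, Or.inr ⟨h1, h2⟩]
  -- Tietze extension: `k` is 0 on the initial page and `h` on the final one, so dividing by `turn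
  -- k` makes the function periodic.
  obtain ⟨k, hk⟩ := ContinuousMap.exists_restrict_eq cS
    ⟨S.domRestrict k₀, continuousOn_iff_continuous_domRestrict.1 ck₀⟩
  have kS : ∀ q ∈ S, k q = k₀ q := fun q hq => congrArg (fun f => f ⟨q, hq⟩) hk
  have P0 : loopPoly n L 0 = pagePoly n := by
    have := loopPoly_intCast (n := n) (L := L) 0
    simpa using this
  have k0 : ∀ q : ℂ × ℂ, q ∈ pageCurve n → k (q.1, 0, q.2) = 0 := fun q hq => by
    rw [kS _ ⟨by show q.2 ^ 2 = loopPoly n L 0 q.1; rw [P0]; exact hq, Or.inl rfl⟩]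
    simp [hk₀]
  have kN : ∀ q : ℂ × ℂ, q ∈ pageCurve n → k (q.1, N, q.2) = h q := fun q hq => by
    rw [kS _ ⟨memN q hq, Or.inr rfl⟩]
    simp [hk₀, hN'.ne']
  obtain ⟨G, cG, pG, eG⟩ := exists_periodic hN hp (F := fun q => f (Θ q) * turn (-k q))
    (cF₀.mul (by fun_prop)) (by
      intro q hq
      simp only [k0 q hq, kN q hq, Θ0, turn_neg, eh q hq, turn_zero]
      simp)
  have memr : ∀ (c : ℂ) (t : ℝ), c ^ 2 = 1 → ((r : ℂ), t, c * loopRoot n L t r) ∈ loopCurve n L :=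
    fun c t hc => by
      show (c * loopRoot n L t r) ^ 2 = _
      rw [mul_pow, hc, one_mul, loopRoot_sq]
  have pager : ∀ (c : ℂ), c ^ 2 = 1 → ((r : ℂ), c * pageRoot n r) ∈ pageCurve n := fun c hc => by
    show (c * pageRoot n r) ^ 2 = _
    rw [mul_pow, hc, one_mul, pageRoot_sq]
  have cr := continuous_loopRoot_far hL hr
  -- The correction leaves the increments 0 and -1 over a period on the two sheets; one extra turn
  -- per period makes them 1 and 0.
  refine ⟨fun q => G q * turn (q.2.1 / N), cG.mul (by fun_prop), ?_, ?_, ?_⟩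
  · intro z t y
    simp only
    rw [pG, add_div, div_self hN'.ne', turn_add_one]
  · refine ⟨fun t => α - k (r, t, loopRoot n L t r) + t / N, by fun_prop, fun t ht => ?_, ?_⟩
    · have := memr 1 t (by simp)
      rw [one_mul] at this
      simp only [turn_add, sub_eq_add_neg, eG _ this ht, Θα t ht]
    · have h1 := pager 1 (by simp)
      rw [one_mul] at h1
      simp only [R0, RN, k0 (_, _) h1, kN (_, _) h1, hα, div_self hN'.ne']
      simp
  · refine ⟨fun t => β - k (r, t, -loopRoot n L t r) + t / N, by fun_prop, fun t ht => ?_, ?_⟩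
    · have := memr (-1) t (by simp)
      rw [neg_one_mul] at this
      simp only [turn_add, sub_eq_add_neg, eG _ this ht, Θβ t ht]
    · have h1 := pager (-1) (by simp)
      rw [neg_one_mul] at h1
      simp only [R0, RN, k0 (_, _) h1, kN (_, _) h1, hβ, div_self hN'.ne']
      simp

end Loop

/-! ## Homogeneous coordinates -/

section Homogeneous

variable (n : ℕ) (L : ℤ → ℕ × Bool)

/-- The product of the values of a function at the strands at the time `t`. -/
noncomputable def loopProd (g : ℂ → ℂ) (t : ℝ) : ℂ :=
  ∏ i ∈ Finset.Icc 1 n, g (strandPoint (L ⌊t⌋) (Int.fract t) i)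

/-- The homogeneous polynomial whose roots are the strands. -/
noncomputable def homPoly (t : ℝ) (a : ℂ) (ρ : ℝ) : ℂ := loopProd n L (fun q => a - ρ * q) t

/-- A square root of `homPoly` for small `ρ`. -/
noncomputable def homRoot (m : ℕ) (L : ℤ → ℕ × Bool) (t : ℝ) (a : ℂ) (ρ : ℝ) : ℂ :=
  a ^ m * loopProd (2 * m) L (fun q => sqrtDown (1 - ρ * q / a)) t

variable {n L} {m : ℕ}

theorem loopProd_eq (hL : ∀ j, IsLetterOn n (L j)) {j : ℤ} {t : ℝ} (ht : t ∈ Icc (j : ℝ) (j + 1))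
    (g : ℂ → ℂ) : loopProd n L g t = ∏ i ∈ Finset.Icc 1 n, g (strandPoint (L j) (t - j) i) := by
  rcases floor_fract_cases ht with ⟨h1, h2⟩ | ⟨h1, h2, h3⟩
  · rw [loopProd, h1, h2]
  · rw [loopProd, h1, h2, h3, prod_strandPoint_one (hL j)]
    simp only [strandPoint_zero]

theorem continuousOn_loopProd (hL : ∀ j, IsLetterOn n (L j)) {X : Type*} [TopologicalSpace X]
    {S : Set X} {τ : X → ℝ} (hτ : ContinuousOn τ S) {g : X → ℂ → ℂ}
    (hg : ContinuousOn (fun p : X × ℂ => g p.1 p.2) (S ×ˢ Metric.closedBall 0 (n + 1))) :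
    ContinuousOn (fun x => loopProd n L (g x) (τ x)) S := by
  rw [continuousOn_iff_continuous_domRestrict]
  have hτ' : Continuous fun x : S => τ x := hτ.domRestrict
  refine continuous_of_slabs (τ := fun x : S => τ x) hτ' fun j => ?_
  have : ContinuousOn (fun x : S => ∏ i ∈ Finset.Icc 1 n, g x (strandPoint (L j) (τ x - j) i))
      {x : S | τ x ∈ Icc (j : ℝ) (j + 1)} := by
    refine continuousOn_finsetProd _ fun i hi => ?_
    refine hg.comp (f := fun x : S => ((x : X), strandPoint (L j) (τ x - j) i)) ?_ ?_
    · exact (continuous_subtype_val.prodMk ((continuous_strandPoint (L j) i).comp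
        (hτ'.sub continuous_const))).continuousOn
    · intro x _
      exact ⟨x.2, by simpa using norm_strandPoint_le (L j) (τ x - j) hi⟩
  exact this.congr fun x hx => loopProd_eq hL hx _

theorem loopProd_add {N : ℤ} (hN : ∀ j, L (j + N) = L j) (g : ℂ → ℂ) (t : ℝ) :
    loopProd n L g (t + N) = loopProd n L g t := by
  simp [loopProd, hN]

theorem homPoly_one (t : ℝ) (a : ℂ) : homPoly n L t a 1 = loopPoly n L t a := by
  simp [homPoly, loopProd, loopPoly, strandPoly]

theorem homPoly_zero (t : ℝ) (a : ℂ) : homPoly n L t a 0 = a ^ n := by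
  simp [homPoly, loopProd]

theorem homPoly_mul (t : ℝ) (a : ℂ) (ρ σ : ℝ) :
    homPoly n L t (σ * a) (σ * ρ) = σ ^ n * homPoly n L t a ρ := by
  have : ((σ : ℂ)) ^ n = ∏ i ∈ Finset.Icc 1 n, (σ : ℂ) := by simp
  rw [homPoly, homPoly, loopProd, loopProd, this, ← Finset.prod_mul_distrib]
  refine Finset.prod_congr rfl fun i _ => ?_
  push_cast; ring

theorem homRoot_zero (t : ℝ) (a : ℂ) : homRoot m L t a 0 = a ^ m := by
  have : sqrtDown 1 = 1 := by
    have := sqrtDown_of_pos (x := 1) zero_le_one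
    simpa using this
  simp [homRoot, loopProd, this]

theorem homRoot_mul (t : ℝ) (a : ℂ) (ρ : ℝ) {σ : ℝ} (hσ : σ ≠ 0) :
    homRoot m L t (σ * a) (σ * ρ) = σ ^ m * homRoot m L t a ρ := by
  have h : ∀ q : ℂ, ((σ * ρ : ℝ) : ℂ) * q / (σ * a) = ρ * q / a := fun q => by
    push_cast
    rw [mul_assoc, mul_div_mul_left]
    exact_mod_cast hσ
  simp only [homRoot, h, mul_pow, mul_assoc]

theorem homRoot_sq {a : ℂ} (ha : a ≠ 0) (t : ℝ) (ρ : ℝ) :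
    homRoot m L t a ρ ^ 2 = homPoly (2 * m) L t a ρ := by
  have : (a ^ m) ^ 2 = ∏ i ∈ Finset.Icc 1 (2 * m), a := by simp [← pow_mul, mul_comm]
  rw [homRoot, homPoly, loopProd, loopProd, mul_pow, this, ← Finset.prod_pow,
    ← Finset.prod_mul_distrib]
  refine Finset.prod_congr rfl fun i _ => ?_
  rw [sqrtDown_sq]
  field_simp

theorem homRoot_add {N : ℤ} (hN : ∀ j, L (j + N) = L j) (t : ℝ) (a : ℂ) (ρ : ℝ) :
    homRoot m L (t + N) a ρ = homRoot m L t a ρ := by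
  rw [homRoot, loopProd_add hN, homRoot]

theorem continuousOn_homPoly (hL : ∀ j, IsLetterOn n (L j)) :
    Continuous fun p : ℝ × ℂ × ℝ => homPoly n L p.1 p.2.1 p.2.2 := by
  rw [← continuousOn_univ]
  exact continuousOn_loopProd hL (g := fun (p : ℝ × ℂ × ℝ) (q : ℂ) => p.2.1 - p.2.2 * q)
    continuousOn_fst (by fun_prop)

theorem norm_div_lt_one {ρ : ℝ} {a q : ℂ} (h : (n + 1) * |ρ| < ‖a‖) (hq : ‖q‖ ≤ n + 1) :
    ‖ρ * q / a‖ < 1 := by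
  have ha : 0 < ‖a‖ := lt_of_le_of_lt (by positivity) h
  rw [norm_div, norm_mul, Complex.norm_real, Real.norm_eq_abs, div_lt_one ha]
  refine lt_of_le_of_lt ?_ h
  rw [mul_comm]
  exact mul_le_mul_of_nonneg_right hq (abs_nonneg _)

theorem homPoly_ne_zero (t : ℝ) {a : ℂ} {ρ : ℝ} (h : (n + 1) * |ρ| < ‖a‖) :
    homPoly n L t a ρ ≠ 0 := by
  have ha : a ≠ 0 := norm_pos_iff.1 (lt_of_le_of_lt (by positivity) h)
  rw [homPoly, loopProd, Finset.prod_ne_zero_iff]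
  intro i hi h0
  have := norm_div_lt_one h (norm_strandPoint_le (L ⌊t⌋) (Int.fract t) hi)
  rw [← sub_eq_zero.1 h0, div_self ha, norm_one] at this
  exact lt_irrefl _ this

theorem homRoot_ne_zero (t : ℝ) {a : ℂ} {ρ : ℝ} (h : (2 * m + 1) * |ρ| < ‖a‖) :
    homRoot m L t a ρ ≠ 0 := by
  have ha : a ≠ 0 := norm_pos_iff.1 (lt_of_le_of_lt (by positivity) h)
  intro h0
  have := homRoot_sq (m := m) (L := L) ha t ρ
  rw [h0] at this
  exact homPoly_ne_zero (n := 2 * m) (L := L) t (by push_cast; exact h) (by rw [← this]; simp)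

/-- If `‖a‖` exceeds the size of the scaled strands, then `1 - ρ q / a` has positive real part and
stays off the cut. Thus this form of the root stays continuous down to `ρ = 0`, that is, over the
axis. -/
theorem continuousOn_homRoot (hL : ∀ j, IsLetterOn (2 * m) (L j)) :
    ContinuousOn (fun p : ℝ × ℂ × ℝ => homRoot m L p.1 p.2.1 p.2.2)
      {p | (2 * m + 1) * |p.2.2| < ‖p.2.1‖} := by
  refine ContinuousOn.mul (by fun_prop) ?_
  refine continuousOn_loopProd hL (τ := fun p : ℝ × ℂ × ℝ => p.1)
    (g := fun (p : ℝ × ℂ × ℝ) (q : ℂ) => sqrtDown (1 - p.2.2 * q / p.2.1))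
    continuousOn_fst ?_
  rintro ⟨⟨t, a, ρ⟩, q⟩ ⟨h, hq⟩
  simp only [Set.mem_ofPred_eq] at h
  have ha : a ≠ 0 := norm_pos_iff.1 (lt_of_le_of_lt (by positivity) h)
  have hq : ‖q‖ ≤ ((2 * m : ℕ) : ℝ) + 1 := by simpa using hq
  have h1 := norm_div_lt_one (n := 2 * m) (by push_cast; exact h) hq
  refine ContinuousAt.continuousWithinAt ?_
  refine ContinuousAt.comp (g := sqrtDown)
    (f := fun p : (ℝ × ℂ × ℝ) × ℂ => 1 - p.1.2.2 * p.2 / p.1.2.1)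
    (continuousAt_sqrtDown (Or.inl ?_)) ?_
  · have := (Complex.re_le_norm (ρ * q / a)).trans_lt h1
    simp only [Complex.sub_re, Complex.one_re]
    exact (sub_pos.2 this).ne'
  · have : ContinuousAt (fun p : (ℝ × ℂ × ℝ) × ℂ => (p.1.2.2 : ℂ) * p.2) ((t, a, ρ), q) := by
      fun_prop
    exact continuousAt_const.sub (this.div (by fun_prop) ha)

/-- Both are continuous square roots along the far ray. Their signs agree at time 0, where both are
products of nonnegative reals. -/
theorem homRoot_ofReal (hL : ∀ j, IsLetterOn (2 * m) (L j)) {r : ℝ} (hr : 2 * m + 2 ≤ r) (t : ℝ) :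
    homRoot m L t r 1 = loopRoot (2 * m) L t r := by
  have hr0 : 0 < r := lt_of_lt_of_le (by positivity) hr
  have hrC : (r : ℂ) ≠ 0 := by exact_mod_cast hr0.ne'
  have hfar : ∀ t : ℝ, (t, (r : ℂ), (1 : ℝ)) ∈ {p : ℝ × ℂ × ℝ | (2 * m + 1) * |p.2.2| < ‖p.2.1‖} :=
    fun t => by
      simp only [Set.mem_ofPred_eq, abs_one, mul_one, Complex.norm_real, Real.norm_eq_abs]
      exact lt_of_lt_of_le (by linarith) (le_abs_self r)
  refine isPreconnected_univ.eq_of_sq_eq (f := fun t : ℝ => homRoot m L t r 1)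
    (g := fun t : ℝ => loopRoot (2 * m) L t r) ?_ ?_ ?_ ?_ (mem_univ (0 : ℝ)) ?_ (mem_univ t)
  · exact (continuousOn_homRoot hL).comp (by fun_prop) fun t _ => hfar t
  · exact (continuous_loopRoot_far hL (by push_cast; exact hr)).continuousOn
  · intro t _
    simp only [Pi.pow_apply]
    rw [homRoot_sq hrC, loopRoot_sq, homPoly_one]
  · intro t _ h
    have h2 := loopRoot_sq (n := 2 * m) (L := L) t r
    rw [h] at h2
    refine homPoly_ne_zero (n := 2 * m) (L := L) t (by push_cast; exact hfar t) ?_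
    rw [homPoly_one, ← h2]; simp
  · have e1 : loopRoot (2 * m) L 0 r = ((∏ i ∈ Finset.Icc 1 (2 * m), √(r - i) : ℝ) : ℂ) := by
      have := loopRoot_intCast (n := 2 * m) (L := L) 0
      rw [Int.cast_zero] at this
      rw [this, pageRoot]
      push_cast
      refine Finset.prod_congr rfl fun i hi => ?_
      have : (i : ℝ) ≤ 2 * m := by exact_mod_cast (Finset.mem_Icc.1 hi).2
      rw [← sqrtDown_of_pos (by linarith)]
      push_cast; rfl
    have e2 : homRoot m L 0 r 1 = ((r ^ m * ∏ i ∈ Finset.Icc 1 (2 * m), √(1 - i / r) : ℝ) : ℂ) := by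
      rw [homRoot, loopProd]
      push_cast
      congr 1
      refine Finset.prod_congr rfl fun i hi => ?_
      have : (i : ℝ) ≤ 2 * m := by exact_mod_cast (Finset.mem_Icc.1 hi).2
      rw [← sqrtDown_of_pos (sub_nonneg.2 ((div_le_one hr0).2 (by linarith)))]
      simp [strandPoint_zero]
    have h2 := loopRoot_sq (n := 2 * m) (L := L) 0 r
    have h3 := homRoot_sq (m := m) (L := L) hrC 0 1
    rw [homPoly_one, ← h2, e1, e2] at h3
    simp only [e1, e2]
    norm_cast at h3 ⊢
    refine (pow_left_inj₀ ?_ ?_ two_ne_zero).1 h3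
    · exact mul_nonneg (pow_nonneg hr0.le _) (Finset.prod_nonneg fun _ _ => Real.sqrt_nonneg _)
    · exact Finset.prod_nonneg fun _ _ => Real.sqrt_nonneg _

end Homogeneous

/-! ## The phase of a complex number -/

theorem turn_intCast_mul (k : ℤ) (t : ℝ) : turn (k * t) = turn t ^ k := by
  induction k using Int.induction_on with
  | zero => simp
  | succ k ih => rw [Int.cast_add, Int.cast_one, add_mul, one_mul, turn_add, ih, zpow_add_one]
  | pred k ih => rw [Int.cast_sub, Int.cast_one, sub_mul, one_mul, turn_sub, ih, zpow_sub_one,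
      div_eq_mul_inv]

/-- The phase of a nonzero complex number. -/
noncomputable def phase (z : ℂ) : Circle := turn (z.arg / (2 * Real.pi))

theorem phase_eq (z : ℂ) : phase z = Circle.exp z.arg := by
  rw [phase, turn]; congr 1; field_simp

theorem coe_phase {z : ℂ} (hz : z ≠ 0) : (phase z : ℂ) = z / ‖z‖ := by
  have h : (‖z‖ : ℂ) ≠ 0 := by simpa using hz
  rw [phase_eq, Circle.coe_exp, eq_div_iff h, mul_comm, Complex.norm_mul_exp_arg_mul_I]

theorem isEmbedding_circle_coe : Topology.IsEmbedding fun u : Circle => (u : ℂ) :=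
  Topology.IsEmbedding.subtypeVal

theorem continuousOn_phase : ContinuousOn phase {0}ᶜ := by
  rw [isEmbedding_circle_coe.continuousOn_iff]
  have : ContinuousOn (fun z : ℂ => z / ‖z‖) {0}ᶜ :=
    ContinuousOn.div (by fun_prop) (by fun_prop) fun z hz => by simpa using hz
  exact this.congr fun z hz => coe_phase hz

theorem phase_ofReal_mul {r : ℝ} (hr : 0 < r) (z : ℂ) : phase (r * z) = phase z := by
  rw [phase, phase, Complex.arg_real_mul _ hr]

theorem phase_turn (t : ℝ) : phase (turn t) = turn t := by
  refine Circle.ext ?_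
  rw [coe_phase (Circle.coe_ne_zero _), Circle.norm_coe]; simp

/-- A function of `w` with the period `2 π i` is a continuous function of `exp w`. -/
theorem continuousOn_comp_log {c : ℝ} {K : ℂ × ℝ → ℝ}
    (hK : ContinuousOn K {q | c < q.1.re})
    (hp : ∀ w t, c < w.re → K (w + 2 * Real.pi * Complex.I, t) = K (w, t)) :
    ContinuousOn (fun q : ℂ × ℝ => K (Complex.log q.1, q.2)) {q | Real.exp c < ‖q.1‖} := by
  have per : ∀ (j : ℤ) w t, c < w.re → K (w + j * (2 * Real.pi * Complex.I), t) = K (w, t) := by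
    intro j w t hw
    induction j using Int.induction_on with
    | zero => simp
    | succ j ih =>
      rw [Int.cast_add, Int.cast_one, add_mul, one_mul, ← add_assoc, hp, ih]
      simpa using hw
    | pred j ih =>
      rw [← ih, ← hp (w + ((-(j : ℤ) - 1 : ℤ) : ℂ) * (2 * Real.pi * Complex.I))]
      · congr 2; push_cast; ring
      · simpa using hw
  rintro ⟨z₀, t₀⟩ hz
  have hz : Real.exp c < ‖z₀‖ := hz
  have h0 : z₀ ≠ 0 := norm_pos_iff.1 ((Real.exp_pos c).trans hz)
  have hre : ∀ z : ℂ, Real.exp c < ‖z‖ → c < (Complex.log z).re := fun z hz => by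
    rw [Complex.log_re, Real.lt_log_iff_exp_lt ((Real.exp_pos c).trans hz)]; exact hz
  set ℓ : ℂ → ℂ := fun z => Complex.log z₀ + Complex.log (z / z₀) with hℓ
  have cℓ : ContinuousAt ℓ z₀ := by
    refine continuousAt_const.add (ContinuousAt.clog (by fun_prop) ?_)
    rw [div_self h0]; simp
  have ℓ0 : ℓ z₀ = Complex.log z₀ := by simp [hℓ, h0]
  have key : ∀ z : ℂ, Real.exp c < ‖z‖ → ∀ t, K (Complex.log z, t) = K (ℓ z, t) := by
    intro z hz t
    have hz0 : z ≠ 0 := norm_pos_iff.1 ((Real.exp_pos c).trans hz)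
    have : Complex.exp (ℓ z) = Complex.exp (Complex.log z) := by
      rw [hℓ]; simp only
      rw [Complex.exp_add, Complex.exp_log h0, Complex.exp_log (div_ne_zero hz0 h0),
        Complex.exp_log hz0, mul_div_cancel₀ _ h0]
    obtain ⟨j, hj⟩ := Complex.exp_eq_exp_iff_exists_int.1 this
    rw [hj, per _ _ _ (hre z hz)]
  have hopen : IsOpen {q : ℂ × ℝ | c < q.1.re} := isOpen_lt continuous_const (by fun_prop)
  have hat : ContinuousAt (fun q : ℂ × ℝ => K (ℓ q.1, q.2)) (z₀, t₀) := by
    have h1 : ContinuousAt K (ℓ z₀, t₀) := hK.continuousAt (hopen.mem_nhds (by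
      show c < (ℓ z₀).re
      rw [ℓ0]; exact hre z₀ hz))
    have h2 : ContinuousAt (fun q : ℂ × ℝ => (ℓ q.1, q.2)) (z₀, t₀) := by
      refine ContinuousAt.prodMk ?_ continuousAt_snd
      exact ContinuousAt.comp (g := ℓ) (f := fun q : ℂ × ℝ => q.1) (x := (z₀, t₀)) cℓ continuousAt_fst
    exact ContinuousAt.comp (g := K) (f := fun q : ℂ × ℝ => (ℓ q.1, q.2)) (x := (z₀, t₀)) h1 h2
  exact hat.continuousWithinAt.congr (fun q hq => key _ hq _) (key _ hz _)

/-! ### Normal form near infinity on the second sheet -/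

section Loop

variable {m : ℕ} {L : ℤ → ℕ × Bool}

/-- A function on the double cover of `ℂ × ℝ` that has degree `0` over a period at infinity on one
of the sheets is, up to homotopy, a power of the phase near infinity on this sheet. -/
theorem exists_phase_at_infinity (hL : ∀ j, IsLetterOn (2 * m) (L j)) {N : ℕ}
    (hp : ∀ j, L (j + N) = L j) {F : ℂ × ℝ × ℂ → Circle}
    (hF : ContinuousOn F (loopCurve (2 * m) L)) (pF : ∀ z t y, F (z, t + N, y) = F (z, t, y))
    {r : ℝ} (hr : 2 * m + 2 ≤ r) (hβ : ∃ β : ℝ → ℝ, ContinuousOn β (Icc 0 N) ∧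
        (∀ t ∈ Icc (0 : ℝ) N, turn (β t) = F (r, t, -loopRoot (2 * m) L t r)) ∧ β N = β 0) :
    ∃ (G : ℂ × ℝ × ℂ → Circle) (D : ℤ), ContinuousOn G (loopCurve (2 * m) L) ∧
      (∀ z t y, G (z, t + N, y) = G (z, t, y)) ∧
      (∀ z t, 2 * m + 3 ≤ ‖z‖ → G (z, t, -homRoot m L t z 1) = phase z ^ D) ∧
      ∀ t, G (r, t, loopRoot (2 * m) L t r) = F (r, t, loopRoot (2 * m) L t r) := by
  classical
  have hr0 : 0 < r := lt_of_lt_of_le (by positivity) hr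
  set c : ℝ := Real.log (2 * m + 1) with hc
  have expc : Real.exp c = 2 * m + 1 := Real.exp_log (by positivity)
  have ne_of_far : ∀ z : ℂ, (2 * m + 1 : ℝ) < ‖z‖ → z ≠ 0 := fun z hz =>
    norm_pos_iff.1 (lt_trans (by positivity) hz)
  have mem : ∀ z : ℂ, (2 * m + 1 : ℝ) < ‖z‖ → ∀ t,
      (z, t, -homRoot m L t z 1) ∈ loopCurve (2 * m) L := fun z hz t => by
    show (-homRoot m L t z 1) ^ 2 = _
    rw [neg_sq, homRoot_sq (ne_of_far z hz), homPoly_one]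
  have cS : ContinuousOn (fun q : ℂ × ℝ => homRoot m L q.2 q.1 1) {q | (2 * m + 1 : ℝ) < ‖q.1‖} :=
    (continuousOn_homRoot hL).comp (f := fun q : ℂ × ℝ => (q.2, q.1, (1 : ℝ))) (by fun_prop)
      fun q hq => by simpa using hq
  -- the logarithm on the sheet
  set W : Set (ℂ × ℝ) := {q | c < q.1.re} with hW
  have expW : ∀ q ∈ W, (2 * m + 1 : ℝ) < ‖Complex.exp q.1‖ := fun q hq => by
    rw [Complex.norm_exp, ← expc]; exact Real.exp_lt_exp.2 hq
  have cW : Convex ℝ W := by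
    have : Convex ℝ {w : ℂ | c < w.re} := convex_halfSpace_re_gt c
    have h2 : W = {w : ℂ | c < w.re} ×ˢ univ := by ext q; simp [hW]
    rw [h2]; exact this.prod convex_univ
  have cE : ContinuousOn (fun q : ℂ × ℝ => homRoot m L q.2 (Complex.exp q.1) 1) W :=
    cS.comp (f := fun q : ℂ × ℝ => (Complex.exp q.1, q.2)) (by fun_prop) expW
  obtain ⟨g, cg, eg⟩ := exists_turn_lift (cW.starConvex (x := (((c + 1 : ℝ) : ℂ), (0 : ℝ)))
      (by simp [hW])) (f := fun q : ℂ × ℝ =>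
      F (Complex.exp q.1, q.2, -homRoot m L q.2 (Complex.exp q.1) 1))
    (hF.comp (by fun_prop) fun q hq => mem _ (expW q hq) _)
  have sW1 : MapsTo (fun q : ℂ × ℝ => (q.1 + 2 * Real.pi * Complex.I, q.2)) W W := fun q hq => by
    simpa [hW] using hq
  have sW2 : MapsTo (fun q : ℂ × ℝ => (q.1, q.2 + N)) W W := fun q hq => hq
  -- In the coordinate `log z` the outer part of the sheet is convex, so the logarithm `g` exists
  -- there. Its monodromy consists of two integers: `D` for a turn of `z` and `e` for a period in
  -- time.
  obtain ⟨D, hD⟩ := cW.isPreconnected.exists_int_sub_eq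
    (cg.comp (f := fun q : ℂ × ℝ => (q.1 + 2 * Real.pi * Complex.I, q.2)) (by fun_prop) sW1) cg
    fun q hq => by
      rw [Function.comp_apply, eg _ (sW1 hq), eg _ hq]
      simp only [Complex.exp_periodic q.1]
  obtain ⟨e, he⟩ := cW.isPreconnected.exists_int_sub_eq
    (cg.comp (f := fun q : ℂ × ℝ => (q.1, q.2 + N)) (by fun_prop) sW2) cg
    fun q hq => by
      rw [Function.comp_apply, eg _ (sW2 hq), eg _ hq]
      have := homRoot_add (m := m) (N := N) hp q.2 (Complex.exp q.1) 1
      simp only [Int.cast_natCast] at this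
      simp only [pF, this]
  -- At the base point `g` differs from the given `β` by a constant, and `β` returns to its initial
  -- value after a period.
  have e0 : e = 0 := by
    obtain ⟨β, cβ, eβ, β0⟩ := hβ
    have hlog : ∀ t : ℝ, ((Real.log r : ℂ), t) ∈ W := fun t => by
      simp only [hW, Set.mem_ofPred_eq, Complex.ofReal_re, hc]
      exact Real.log_lt_log (by positivity) (by linarith)
    obtain ⟨d, hd⟩ := (isPreconnected_Icc (a := (0 : ℝ)) (b := N)).exists_int_sub_eq
      (cg.comp (f := fun t : ℝ => ((Real.log r : ℂ), t)) (by fun_prop) fun t _ => hlog t) cβ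
      fun t ht => by
        rw [Function.comp_apply, eg _ (hlog t), eβ t ht]
        simp only
        rw [← Complex.ofReal_exp, Real.exp_log hr0, homRoot_ofReal hL hr]
    have h1 := hd 0 ⟨le_rfl, Nat.cast_nonneg N⟩
    have h2 := hd N ⟨Nat.cast_nonneg N, le_rfl⟩
    have h3 := he _ (hlog 0)
    simp only [Function.comp_apply, zero_add] at h1 h2 h3
    have : (e : ℝ) = 0 := by linarith
    exact_mod_cast this
  -- After `D` times the angle is subtracted, nothing is left of the monodromy in `z`, so `K`
  -- descends to a function of `z` itself.
  set K : ℂ × ℝ → ℝ := fun q => g q - D * (q.1.im / (2 * Real.pi)) with hK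
  have cK : ContinuousOn K W := cg.sub (by fun_prop)
  have pK : ∀ w t, c < w.re → K (w + 2 * Real.pi * Complex.I, t) = K (w, t) := by
    intro w t hw
    have := hD (w, t) hw
    simp only [Function.comp_apply] at this
    simp only [hK, this]
    have : (w + 2 * Real.pi * Complex.I).im = w.im + 2 * Real.pi := by simp
    rw [this, add_div, div_self (by positivity)]
    ring
  set k : ℂ × ℝ → ℝ := fun q => K (Complex.log q.1, q.2) with hk
  have ck : ContinuousOn k {q | (2 * m + 1 : ℝ) < ‖q.1‖} := by
    rw [← expc]; exact continuousOn_comp_log cK pK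
  have logW : ∀ z : ℂ, (2 * m + 1 : ℝ) < ‖z‖ → ∀ t : ℝ, (Complex.log z, t) ∈ W := fun z hz t => by
    simp only [hW, Set.mem_ofPred_eq, Complex.log_re, hc]
    exact Real.log_lt_log (by positivity) hz
  have ek : ∀ z : ℂ, (2 * m + 1 : ℝ) < ‖z‖ → ∀ t,
      turn (k (z, t)) * phase z ^ D = F (z, t, -homRoot m L t z 1) := by
    intro z hz t
    have := eg _ (logW z hz t)
    simp only [Complex.exp_log (ne_of_far z hz)] at this
    rw [← this, hk, hK]
    simp only [turn_sub, turn_intCast_mul, Complex.log_im, phase]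
    rw [div_mul_cancel]
  have pk : ∀ z : ℂ, (2 * m + 1 : ℝ) < ‖z‖ → ∀ t, k (z, t + N) = k (z, t) := by
    intro z hz t
    have := he _ (logW z hz t)
    simp only [Function.comp_apply, e0, Int.cast_zero, add_zero] at this
    simp only [hk, hK, this]
  -- the homotopy
  set χ : ℂ → ℝ := fun z => max 0 (min 1 (‖z‖ - (2 * m + 2))) with hχ
  have cχ : Continuous χ := by rw [hχ]; fun_prop
  -- The deviation from a power of the phase is switched on gradually between the radii `2m + 2` and
  -- `2m + 3`, and only on the second sheet. Dividing it out leaves the first sheet near infinity,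
  -- and with it the meridian, untouched.
  set μ : ℂ × ℝ × ℂ → ℝ := fun q => if 2 * m + 2 ≤ ‖q.1‖ ∧ q.2.2 = -homRoot m L q.2.1 q.1 1 then
    χ q.1 * k (q.1, q.2.1) else 0 with hμ
  have rootne : ∀ z : ℂ, (2 * m + 1 : ℝ) < ‖z‖ → ∀ t, homRoot m L t z 1 ≠ 0 := fun z hz t =>
    homRoot_ne_zero t (by simpa using hz)
  have cμ : ContinuousOn μ (loopCurve (2 * m) L) := by
    have c0 : IsClosed {q : ℂ × ℝ × ℂ | 2 * m + 2 ≤ ‖q.1‖} := isClosed_le (by fun_prop) (by fun_prop)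
    have far : ∀ q ∈ {q : ℂ × ℝ × ℂ | 2 * m + 2 ≤ ‖q.1‖}, (2 * m + 1 : ℝ) < ‖q.1‖ := fun q hq =>
      lt_of_lt_of_le (by linarith) (show (2 * m + 2 : ℝ) ≤ ‖q.1‖ from hq)
    have cR : ContinuousOn (fun q : ℂ × ℝ × ℂ => homRoot m L q.2.1 q.1 1)
        {q : ℂ × ℝ × ℂ | 2 * m + 2 ≤ ‖q.1‖} :=
      cS.comp (f := fun q : ℂ × ℝ × ℂ => (q.1, q.2.1)) (by fun_prop) far
    have k1 : IsClosed {q : ℂ × ℝ × ℂ | ‖q.1‖ ≤ 2 * m + 2} := isClosed_le (by fun_prop) (by fun_prop)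
    have k2 : IsClosed {q : ℂ × ℝ × ℂ | 2 * m + 2 ≤ ‖q.1‖ ∧ q.2.2 = homRoot m L q.2.1 q.1 1} := by
      have h : ContinuousOn (fun q : ℂ × ℝ × ℂ => q.2.2 - homRoot m L q.2.1 q.1 1)
        {q : ℂ × ℝ × ℂ | 2 * m + 2 ≤ ‖q.1‖} := ContinuousOn.sub (by fun_prop) cR
      convert h.preimage_isClosed_of_isClosed c0 (isClosed_singleton (x := (0 : ℂ))) using 1
      ext q; simp [sub_eq_zero]
    have k3 : IsClosed {q : ℂ × ℝ × ℂ | 2 * m + 2 ≤ ‖q.1‖ ∧ q.2.2 = -homRoot m L q.2.1 q.1 1} := by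
      have h : ContinuousOn (fun q : ℂ × ℝ × ℂ => q.2.2 + homRoot m L q.2.1 q.1 1)
        {q : ℂ × ℝ × ℂ | 2 * m + 2 ≤ ‖q.1‖} := ContinuousOn.add (by fun_prop) cR
      convert h.preimage_isClosed_of_isClosed c0 (isClosed_singleton (x := (0 : ℂ))) using 1
      ext q; simp [eq_neg_iff_add_eq_zero]
    have d1 : ContinuousOn μ {q : ℂ × ℝ × ℂ | ‖q.1‖ ≤ 2 * m + 2} := by
      refine (continuousOn_const (c := (0 : ℝ))).congr fun q hq => ?_
      have hq : ‖q.1‖ ≤ 2 * m + 2 := hq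
      have : χ q.1 = 0 := by
        rw [hχ]; exact max_eq_left (min_le_iff.2 (Or.inr (by linarith)))
      simp [hμ, this]
    have d2 : ContinuousOn μ
        {q : ℂ × ℝ × ℂ | 2 * m + 2 ≤ ‖q.1‖ ∧ q.2.2 = homRoot m L q.2.1 q.1 1} := by
      refine (continuousOn_const (c := (0 : ℝ))).congr fun q hq => ?_
      simp only [hμ]
      rw [if_neg]
      rintro ⟨_, h⟩
      rw [hq.2] at h
      exact rootne _ (far q hq.1) _ (self_eq_neg.1 h)
    have d3 : ContinuousOn μ
        {q : ℂ × ℝ × ℂ | 2 * m + 2 ≤ ‖q.1‖ ∧ q.2.2 = -homRoot m L q.2.1 q.1 1} := by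
      refine ContinuousOn.congr (f := fun q : ℂ × ℝ × ℂ => χ q.1 * k (q.1, q.2.1)) ?_
        fun q hq => by simp only [hμ]; exact if_pos hq
      exact ContinuousOn.mul (by fun_prop) (ck.comp (f := fun q : ℂ × ℝ × ℂ => (q.1, q.2.1))
        (by fun_prop) fun q hq => far q hq.1)
    refine (d1.union_of_isClosed (d2.union_of_isClosed d3 k2 k3) k1 (k2.union k3)).mono ?_
    intro q hq
    rcases le_total ‖q.1‖ (2 * m + 2) with h | h
    · exact Or.inl h
    · right
      have hne := ne_of_far q.1 (far q h)
      have hq : q.2.2 ^ 2 = loopPoly (2 * m) L q.2.1 q.1 := hq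
      rw [← homPoly_one, ← homRoot_sq hne] at hq
      rcases sq_eq_sq_iff_eq_or_eq_neg.1 hq with h' | h'
      exacts [Or.inl ⟨h, h'⟩, Or.inr ⟨h, h'⟩]
  refine ⟨fun q => F q * turn (-μ q), D, hF.mul (by fun_prop), ?_, ?_, ?_⟩
  · intro z t y
    have h1 := homRoot_add (m := m) (N := N) hp t z 1
    simp only [Int.cast_natCast] at h1
    have h2 : μ (z, t + N, y) = μ (z, t, y) := by
      simp only [hμ, h1]
      split_ifs with h
      · rw [pk z (by linarith [h.1]) t]
      · rfl
    simp only [pF, h2]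
  · intro z t hz
    have h1 : χ z = 1 := by
      rw [hχ]; simp only
      rw [min_eq_left (by linarith), max_eq_right zero_le_one]
    have h2 : μ (z, t, -homRoot m L t z 1) = k (z, t) := by
      simp only [hμ, and_true]
      rw [if_pos (by linarith), h1, one_mul]
    simp only [h2, turn_neg, ← ek z (by linarith) t]
    rw [mul_right_comm, mul_inv_cancel, one_mul]
  · intro t
    have hfar : (2 * m + 1 : ℝ) < ‖(r : ℂ)‖ := by
      rw [Complex.norm_real, Real.norm_eq_abs]
      exact lt_of_lt_of_le (by linarith) (le_abs_self r)
    have h2 : μ (r, t, loopRoot (2 * m) L t r) = 0 := by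
      simp only [hμ]
      rw [if_neg]
      rintro ⟨_, h⟩
      rw [← homRoot_ofReal hL hr] at h
      exact rootne _ hfar _ (self_eq_neg.1 h)
    simp [h2]

end Loop

/-! ## Coordinates around the braid axis -/

section Periodic

variable {n m : ℕ} {L : ℤ → ℕ × Bool} {N : ℕ}

/-- The time at which the closed braid with `N` letters passes the direction of `b`. -/
noncomputable def timeOf (N : ℕ) (b : ℂ) : ℝ := N * (b.arg / (2 * Real.pi))

/-- The polynomial `homPoly` in coordinates of `ℂ²`. -/
noncomputable def braidPoly (n : ℕ) (L : ℤ → ℕ × Bool) (N : ℕ) (a b : ℂ) : ℂ :=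
  homPoly n L (timeOf N b) a ‖b‖

/-- The square root `homRoot` in coordinates of `ℂ²`. -/
noncomputable def braidRoot (m : ℕ) (L : ℤ → ℕ × Bool) (N : ℕ) (a b : ℂ) : ℂ :=
  homRoot m L (timeOf N b) a ‖b‖

theorem apply_add_int_mul {X : Type*} {f : ℝ → X} (h : ∀ t, f (t + N) = f t) (t : ℝ) (j : ℤ) :
    f (t + j * N) = f t := by
  have := (show Function.Periodic f (N : ℝ) from h).int_mul j t
  exact this

theorem homPoly_periodic (hp : ∀ j, L (j + N) = L j) (t : ℝ) (a : ℂ) (ρ : ℝ) :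
    homPoly n L (t + N) a ρ = homPoly n L t a ρ := by
  have := loopProd_add (n := n) (N := N) hp (fun q => a - ρ * q) t
  exact_mod_cast this

theorem homRoot_periodic (hp : ∀ j, L (j + N) = L j) (t : ℝ) (a : ℂ) (ρ : ℝ) :
    homRoot m L (t + N) a ρ = homRoot m L t a ρ := by
  have := homRoot_add (m := m) (N := N) hp t a ρ
  exact_mod_cast this

theorem exists_timeOf_eq (hN : 0 < N) {ρ : ℝ} (hρ : 0 < ρ) (t : ℝ) :
    ∃ j : ℤ, timeOf N (ρ * turn (t / N)) = t + j * N := by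
  have hN' : (N : ℝ) ≠ 0 := by exact_mod_cast hN.ne'
  have h : phase (ρ * turn (t / N)) = turn (t / N) := by rw [phase_ofReal_mul hρ, phase_turn]
  obtain ⟨j, hj⟩ := turn_eq_turn_iff.1 h
  refine ⟨j, ?_⟩
  rw [timeOf, hj]
  field_simp

theorem apply_timeOf {X : Type*} {f : ℝ → X} (h : ∀ t, f (t + N) = f t) (hN : 0 < N) {ρ : ℝ}
    (hρ : 0 < ρ) (t : ℝ) : f (timeOf N (ρ * turn (t / N))) = f t := by
  obtain ⟨j, hj⟩ := exists_timeOf_eq hN hρ t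
  rw [hj, apply_add_int_mul h]

theorem braidPoly_turn (hp : ∀ j, L (j + N) = L j) (hN : 0 < N) {ρ : ℝ} (hρ : 0 ≤ ρ) (t : ℝ)
    (a : ℂ) : braidPoly n L N a (ρ * turn (t / N)) = homPoly n L t a ρ := by
  rw [braidPoly, norm_turn_mul, abs_of_nonneg hρ]
  rcases hρ.eq_or_lt with rfl | hρ
  · rw [homPoly_zero, homPoly_zero]
  · exact apply_timeOf (f := fun t => homPoly n L t a ρ) (fun t => homPoly_periodic hp t a ρ) hN hρ t

theorem braidRoot_turn (hp : ∀ j, L (j + N) = L j) (hN : 0 < N) {ρ : ℝ} (hρ : 0 ≤ ρ) (t : ℝ)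
    (a : ℂ) : braidRoot m L N a (ρ * turn (t / N)) = homRoot m L t a ρ := by
  rw [braidRoot, norm_turn_mul, abs_of_nonneg hρ]
  rcases hρ.eq_or_lt with rfl | hρ
  · rw [homRoot_zero, homRoot_zero]
  · exact apply_timeOf (f := fun t => homRoot m L t a ρ) (fun t => homRoot_periodic hp t a ρ) hN hρ t

/-- A continuous choice of the time near a nonzero complex number. -/
theorem exists_local_time {b₀ : ℂ} (h0 : b₀ ≠ 0) : ∃ τ : ℂ → ℝ, ContinuousAt τ b₀ ∧
    ∀ b ≠ 0, ∃ j : ℤ, timeOf N b = τ b + j * N := by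
  refine ⟨fun b => N * ((b₀.arg + (b / b₀).arg) / (2 * Real.pi)), ?_, fun b hb => ?_⟩
  · have : ContinuousAt (fun b : ℂ => (b / b₀).arg) b₀ := by
      refine ContinuousAt.comp (f := fun b : ℂ => b / b₀) (Complex.continuousAt_arg ?_) (by fun_prop)
      rw [div_self h0]; simp
    fun_prop
  · have : phase b = turn ((b₀.arg + (b / b₀).arg) / (2 * Real.pi)) := by
      rw [add_div, turn_add]
      refine Circle.ext ?_
      show (phase b : ℂ) = ((phase b₀ * phase (b / b₀) : Circle) : ℂ)
      rw [Circle.coe_mul, coe_phase hb, coe_phase h0, coe_phase (div_ne_zero hb h0), norm_div]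
      have h1 : (‖b₀‖ : ℂ) ≠ 0 := by simpa using h0
      have h2 : (‖b‖ : ℂ) ≠ 0 := by simpa using hb
      push_cast
      field_simp
    obtain ⟨j, hj⟩ := turn_eq_turn_iff.1 this
    refine ⟨j, ?_⟩
    rw [timeOf, hj]; ring

/-- At the axis the argument of `b`, and with it the time, has no limit. The strands are bounded, so
every factor has the same limit however the time behaves. -/
theorem tendsto_loopProd {X : Type*} {l : Filter X} {g : X → ℂ → ℂ} {c : ℂ}
    (h : ∀ q : X → ℂ, (∀ x, ‖q x‖ ≤ n + 1) → Tendsto (fun x => g x (q x)) l (𝓝 c)) (τ : X → ℝ) :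
    Tendsto (fun x => loopProd n L (g x) (τ x)) l (𝓝 (c ^ n)) := by
  have : c ^ n = ∏ i ∈ Finset.Icc 1 n, c := by simp
  rw [this]
  exact tendsto_finsetProd _ fun i hi => h _ fun x => norm_strandPoint_le _ _ hi

theorem tendsto_norm_mul {q : ℂ × ℂ → ℂ} {C : ℝ} (hq : ∀ p, ‖q p‖ ≤ C) (a₀ : ℂ) :
    Tendsto (fun p : ℂ × ℂ => (‖p.2‖ : ℂ) * q p) (𝓝 (a₀, 0)) (𝓝 0) := by
  rw [tendsto_zero_iff_norm_tendsto_zero]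
  have h : Tendsto (fun p : ℂ × ℂ => ‖p.2‖ * C) (𝓝 (a₀, 0)) (𝓝 0) := by
    have : Continuous fun p : ℂ × ℂ => ‖p.2‖ * C := by fun_prop
    simpa using this.tendsto (a₀, 0)
  refine squeeze_zero (fun _ => norm_nonneg _) (fun p => ?_) h
  rw [norm_mul, Complex.norm_real, norm_norm]
  exact mul_le_mul_of_nonneg_left (hq p) (norm_nonneg _)

theorem continuous_braidPoly (hL : ∀ j, IsLetterOn n (L j)) (hp : ∀ j, L (j + N) = L j) :
    Continuous fun p : ℂ × ℂ => braidPoly n L N p.1 p.2 := by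
  refine continuous_iff_continuousAt.2 ?_
  rintro ⟨a₀, b₀⟩
  by_cases h0 : b₀ = 0
  · subst h0
    have e : braidPoly n L N a₀ 0 = a₀ ^ n := by rw [braidPoly, norm_zero, homPoly_zero]
    rw [ContinuousAt, e]
    refine tendsto_loopProd (g := fun (p : ℂ × ℂ) (q : ℂ) => p.1 - (‖p.2‖ : ℂ) * q) ?_ _
    intro q hq
    simpa using (continuous_fst.tendsto (a₀, (0 : ℂ))).sub (tendsto_norm_mul hq a₀)
  · obtain ⟨τ, cτ, eτ⟩ := exists_local_time (N := N) h0
    have h1 : ContinuousAt (fun p : ℂ × ℂ => homPoly n L (τ p.2) p.1 ‖p.2‖) (a₀, b₀) := by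
      refine ContinuousAt.comp (f := fun p : ℂ × ℂ => (τ p.2, p.1, ‖p.2‖))
        (continuousOn_homPoly hL).continuousAt ?_
      exact (ContinuousAt.comp (f := fun p : ℂ × ℂ => p.2) cτ continuousAt_snd).prodMk (by fun_prop)
    refine h1.congr ?_
    filter_upwards [continuousAt_snd.eventually_ne (x := (a₀, b₀)) h0] with p hp0
    obtain ⟨j, hj⟩ := eτ p.2 hp0
    rw [braidPoly, hj]
    exact (apply_add_int_mul (f := fun t => homPoly n L t p.1 ‖p.2‖)
      (fun t => homPoly_periodic hp t _ _) _ j).symm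

theorem continuousOn_braidRoot (hL : ∀ j, IsLetterOn (2 * m) (L j)) (hp : ∀ j, L (j + N) = L j) :
    ContinuousOn (fun p : ℂ × ℂ => braidRoot m L N p.1 p.2) {p | (2 * m + 1) * ‖p.2‖ < ‖p.1‖} := by
  rintro ⟨a₀, b₀⟩ hab
  have hab : (2 * m + 1) * ‖b₀‖ < ‖a₀‖ := hab
  have ha0 : a₀ ≠ 0 := norm_pos_iff.1 (lt_of_le_of_lt (by positivity) hab)
  refine ContinuousAt.continuousWithinAt ?_
  by_cases h0 : b₀ = 0
  · subst h0
    have s1 : sqrtDown 1 = 1 := by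
      have := sqrtDown_of_pos (x := 1) zero_le_one
      simpa using this
    have e : braidRoot m L N a₀ 0 = a₀ ^ m * 1 ^ (2 * m) := by
      rw [braidRoot, norm_zero, homRoot_zero]; simp
    rw [ContinuousAt, e]
    refine Tendsto.mul ((continuous_fst.pow m).tendsto (a₀, (0 : ℂ))) ?_
    refine tendsto_loopProd
      (g := fun (p : ℂ × ℂ) (q : ℂ) => sqrtDown (1 - (‖p.2‖ : ℂ) * q / p.1)) ?_ _
    intro q hq
    have h1 : Tendsto (fun p : ℂ × ℂ => 1 - (‖p.2‖ : ℂ) * q p / p.1) (𝓝 (a₀, 0)) (𝓝 1) := by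
      simpa using tendsto_const_nhds.sub
        ((tendsto_norm_mul hq a₀).div (continuous_fst.tendsto (a₀, (0 : ℂ))) ha0)
    have h2 : Tendsto sqrtDown (𝓝 1) (𝓝 1) := by
      have : ContinuousAt sqrtDown 1 := continuousAt_sqrtDown (Or.inl (by simp))
      rwa [ContinuousAt, s1] at this
    exact h2.comp h1
  · obtain ⟨τ, cτ, eτ⟩ := exists_local_time (N := N) h0
    have h1 : ContinuousAt (fun p : ℂ × ℂ => homRoot m L (τ p.2) p.1 ‖p.2‖) (a₀, b₀) := by
      have hopen : IsOpen {p : ℝ × ℂ × ℝ | (2 * m + 1) * |p.2.2| < ‖p.2.1‖} :=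
        isOpen_lt (by fun_prop) (by fun_prop)
      refine ContinuousAt.comp (f := fun p : ℂ × ℂ => (τ p.2, p.1, ‖p.2‖))
        (g := fun p : ℝ × ℂ × ℝ => homRoot m L p.1 p.2.1 p.2.2)
        ((continuousOn_homRoot hL).continuousAt (hopen.mem_nhds (by simpa using hab))) ?_
      exact (ContinuousAt.comp (f := fun p : ℂ × ℂ => p.2) cτ continuousAt_snd).prodMk (by fun_prop)
    refine h1.congr ?_
    filter_upwards [continuousAt_snd.eventually_ne (x := (a₀, b₀)) h0] with p hp0
    obtain ⟨j, hj⟩ := eτ p.2 hp0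
    rw [braidRoot, hj]
    exact (apply_add_int_mul (f := fun t => homRoot m L t p.1 ‖p.2‖)
      (fun t => homRoot_periodic hp t _ _) _ j).symm

theorem timeOf_mul {σ : ℝ} (hσ : 0 < σ) (b : ℂ) : timeOf N (σ * b) = timeOf N b := by
  rw [timeOf, timeOf, Complex.arg_real_mul _ hσ]

theorem braidPoly_mul {σ : ℝ} (hσ : 0 < σ) (a b : ℂ) :
    braidPoly n L N (σ * a) (σ * b) = σ ^ n * braidPoly n L N a b := by
  rw [braidPoly, timeOf_mul hσ, norm_mul, Complex.norm_real, Real.norm_eq_abs, abs_of_pos hσ,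
    homPoly_mul, braidPoly]

theorem braidRoot_mul {σ : ℝ} (hσ : 0 < σ) (a b : ℂ) :
    braidRoot m L N (σ * a) (σ * b) = σ ^ m * braidRoot m L N a b := by
  rw [braidRoot, timeOf_mul hσ, norm_mul, Complex.norm_real, Real.norm_eq_abs, abs_of_pos hσ,
    homRoot_mul _ _ _ hσ.ne', braidRoot]

theorem braidRoot_sq {a b : ℂ} (ha : a ≠ 0) :
    braidRoot m L N a b ^ 2 = braidPoly (2 * m) L N a b := homRoot_sq ha _ _

theorem braidRoot_ne_zero {a b : ℂ} (h : (2 * m + 1) * ‖b‖ < ‖a‖) : braidRoot m L N a b ≠ 0 :=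
  homRoot_ne_zero _ (by simpa using h)

theorem braidRoot_zero (a : ℂ) : braidRoot m L N a 0 = a ^ m := by
  rw [braidRoot, norm_zero, homRoot_zero]

theorem braidPoly_zero (a : ℂ) : braidPoly n L N a 0 = a ^ n := by
  rw [braidPoly, norm_zero, homPoly_zero]

end Periodic

/-! ## Points of the sphere and of its double cover in homogeneous coordinates -/

/-- The norm of the point `(a, b)` of `ℂ²`. -/
noncomputable def pairNorm (a b : ℂ) : ℝ := √(‖a‖ ^ 2 + ‖b‖ ^ 2)

theorem pairNorm_pos {a b : ℂ} (h : a ≠ 0 ∨ b ≠ 0) : 0 < pairNorm a b := by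
  refine Real.sqrt_pos.2 ?_
  rcases h with h | h
  · have := norm_pos_iff.2 h; positivity
  · have := norm_pos_iff.2 h; positivity

theorem norm_pair (a b : ℂ) : ‖(!₂[a, b] : EuclideanSpace ℂ (Fin 2))‖ = pairNorm a b := by
  rw [EuclideanSpace.norm_eq, pairNorm, Fin.sum_univ_two]; simp

theorem pairNorm_mul {σ : ℝ} (hσ : 0 < σ) (a b : ℂ) : pairNorm (σ * a) (σ * b) = σ * pairNorm a b := by
  rw [pairNorm, pairNorm, norm_mul, norm_mul, Complex.norm_real, Real.norm_eq_abs, abs_of_pos hσ,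
    mul_pow, mul_pow, ← mul_add, Real.sqrt_mul (by positivity), Real.sqrt_sq hσ.le]

theorem continuous_pairNorm : Continuous fun p : ℂ × ℂ => pairNorm p.1 p.2 := by
  unfold pairNorm; fun_prop

theorem pairNorm_coe (x : Sphere3) : pairNorm (x.1 0) (x.1 1) = 1 := by
  have h : ‖x.1‖ = 1 := by simp
  rw [EuclideanSpace.norm_eq, Fin.sum_univ_two] at h
  exact h

open Classical in
/-- The point of the sphere on the ray through the point `(a, b)` of `ℂ²`. -/
noncomputable def spherePoint (a b : ℂ) : Sphere3 :=
  if h : a ≠ 0 ∨ b ≠ 0 then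
    ⟨!₂[((pairNorm a b)⁻¹ : ℝ) * a, ((pairNorm a b)⁻¹ : ℝ) * b], by
      have h0 := pairNorm_pos h
      rw [mem_sphere_zero_iff_norm, norm_pair, pairNorm_mul (inv_pos.2 h0), inv_mul_cancel₀ h0.ne']⟩
  else ⟨!₂[1, 0], by rw [mem_sphere_zero_iff_norm, norm_pair]; simp [pairNorm]⟩

theorem spherePoint_zero {a b : ℂ} (h : a ≠ 0 ∨ b ≠ 0) :
    (spherePoint a b).1 0 = ((pairNorm a b)⁻¹ : ℝ) * a := by
  simp [spherePoint, h]

theorem spherePoint_one {a b : ℂ} (h : a ≠ 0 ∨ b ≠ 0) :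
    (spherePoint a b).1 1 = ((pairNorm a b)⁻¹ : ℝ) * b := by
  simp [spherePoint, h]

theorem sphere_ext {x y : Sphere3} (h0 : x.1 0 = y.1 0) (h1 : x.1 1 = y.1 1) : x = y := by
  refine Subtype.ext ?_
  ext i
  fin_cases i
  exacts [h0, h1]

theorem coe_ne_zero (x : Sphere3) : x.1 0 ≠ 0 ∨ x.1 1 ≠ 0 := by
  by_contra! h
  have := pairNorm_coe x
  rw [h.1, h.2] at this
  simp [pairNorm] at this

theorem spherePoint_coe (x : Sphere3) : spherePoint (x.1 0) (x.1 1) = x := by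
  have h := coe_ne_zero x
  refine sphere_ext ?_ ?_
  · rw [spherePoint_zero h, pairNorm_coe]; simp
  · rw [spherePoint_one h, pairNorm_coe]; simp

theorem continuousOn_spherePoint :
    ContinuousOn (fun p : ℂ × ℂ => spherePoint p.1 p.2) {p | p.1 ≠ 0 ∨ p.2 ≠ 0} := by
  rw [Topology.IsInducing.subtypeVal.continuousOn_iff]
  have h : ContinuousOn (fun p : ℂ × ℂ => (!₂[((pairNorm p.1 p.2)⁻¹ : ℝ) * p.1,
      ((pairNorm p.1 p.2)⁻¹ : ℝ) * p.2] : EuclideanSpace ℂ (Fin 2))) {p | p.1 ≠ 0 ∨ p.2 ≠ 0} := by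
    have h1 : ContinuousOn (fun p : ℂ × ℂ => (pairNorm p.1 p.2)⁻¹) {p | p.1 ≠ 0 ∨ p.2 ≠ 0} :=
      continuous_pairNorm.continuousOn.inv₀ fun p hp => (pairNorm_pos hp).ne'
    refine (PiLp.continuous_toLp 2 _).comp_continuousOn (continuousOn_pi.2 fun i => ?_)
    fin_cases i
    · exact (Complex.continuous_ofReal.comp_continuousOn h1).mul continuousOn_fst
    · exact (Complex.continuous_ofReal.comp_continuousOn h1).mul continuousOn_snd
  refine h.congr fun p hp => ?_
  have hp : p.1 ≠ 0 ∨ p.2 ≠ 0 := hp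
  simp [spherePoint, hp]

/-- A point over the sphere in homogeneous coordinates. -/
noncomputable def coverPoint (m : ℕ) (a b y : ℂ) : Sphere3 × ℂ :=
  (spherePoint a b, ((pairNorm a b)⁻¹ : ℝ) ^ m * y)

theorem coverPoint_mul {m : ℕ} {a b : ℂ} (h : a ≠ 0 ∨ b ≠ 0) {σ : ℝ} (hσ : 0 < σ) (y : ℂ) :
    coverPoint m (σ * a) (σ * b) (σ ^ m * y) = coverPoint m a b y := by
  have hσ' : (σ : ℂ) ≠ 0 := by exact_mod_cast hσ.ne'
  have h' : (σ * a : ℂ) ≠ 0 ∨ (σ * b : ℂ) ≠ 0 := h.imp (mul_ne_zero hσ') (mul_ne_zero hσ')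
  have e : ((σ * pairNorm a b)⁻¹ : ℝ) * σ = (pairNorm a b)⁻¹ := by
    rw [mul_inv, mul_right_comm, inv_mul_cancel₀ hσ.ne', one_mul]
  have e' : (((σ * pairNorm a b)⁻¹ : ℝ) : ℂ) * σ = ((pairNorm a b)⁻¹ : ℝ) := by exact_mod_cast e
  refine Prod.ext (sphere_ext ?_ ?_) ?_
  · simp only [coverPoint]
    rw [spherePoint_zero h', spherePoint_zero h, pairNorm_mul hσ, ← mul_assoc, e']
  · simp only [coverPoint]
    rw [spherePoint_one h', spherePoint_one h, pairNorm_mul hσ, ← mul_assoc, e']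
  · simp only [coverPoint]
    rw [pairNorm_mul hσ, ← mul_assoc, ← mul_pow, e']

theorem coverPoint_coe (m : ℕ) (v : Sphere3 × ℂ) :
    coverPoint m (v.1.1 0) (v.1.1 1) v.2 = v := by
  rw [coverPoint, spherePoint_coe, pairNorm_coe]; simp

theorem ContinuousOn.coverPoint {m : ℕ} {X : Type*} [TopologicalSpace X] {S : Set X}
    {a b y : X → ℂ} (ha : ContinuousOn a S) (hb : ContinuousOn b S) (hy : ContinuousOn y S)
    (h : ∀ x ∈ S, a x ≠ 0 ∨ b x ≠ 0) :
    ContinuousOn (fun x => coverPoint m (a x) (b x) (y x)) S := by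
  refine (continuousOn_spherePoint.comp (ha.prodMk hb) h).prodMk (ContinuousOn.mul ?_ hy)
  refine ContinuousOn.pow (Complex.continuous_ofReal.comp_continuousOn ?_) m
  exact (continuous_pairNorm.comp_continuousOn (ha.prodMk hb)).inv₀
    fun x hx => (pairNorm_pos (h x hx)).ne'

/-! ## The double branched cover of the sphere along a closed braid -/

/-- The double branched cover of the sphere along a closed braid. -/
def braidCover (m : ℕ) (L : ℤ → ℕ × Bool) (N : ℕ) : Set (Sphere3 × ℂ) :=
  {v | v.2 ^ 2 = braidPoly (2 * m) L N (v.1.1 0) (v.1.1 1)}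

/-- The lifts of the braid axis, for `c = 1` and `c = -1`. -/
def axisLift (m : ℕ) (c : ℂ) : Set (Sphere3 × ℂ) := {v | v.1.1 1 = 0 ∧ v.2 = c * v.1.1 0 ^ m}

section Cover

variable {m : ℕ} {L : ℤ → ℕ × Bool} {N : ℕ}

theorem coverPoint_mem_braidCover {a b y : ℂ} (h : a ≠ 0 ∨ b ≠ 0) :
    coverPoint m a b y ∈ braidCover m L N ↔ y ^ 2 = braidPoly (2 * m) L N a b := by
  have hp := inv_pos.2 (pairNorm_pos h)
  have hp' : ((((pairNorm a b)⁻¹ : ℝ) : ℂ) ^ (2 * m)) ≠ 0 := pow_ne_zero _ (by exact_mod_cast hp.ne')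
  simp only [braidCover, coverPoint, Set.mem_ofPred_eq, spherePoint_zero h, spherePoint_one h,
    braidPoly_mul hp, mul_pow, ← pow_mul]
  rw [mul_comm m 2]
  exact mul_right_inj' hp'

theorem coverPoint_mem_axisLift {a b y c : ℂ} (h : a ≠ 0 ∨ b ≠ 0) :
    coverPoint m a b y ∈ axisLift m c ↔ b = 0 ∧ y = c * a ^ m := by
  have hp := inv_pos.2 (pairNorm_pos h)
  have hp0 : (((pairNorm a b)⁻¹ : ℝ) : ℂ) ≠ 0 := by exact_mod_cast hp.ne'
  simp only [axisLift, coverPoint, Set.mem_ofPred_eq, spherePoint_zero h, spherePoint_one h,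
    mul_eq_zero, hp0, false_or, mul_pow]
  rw [mul_left_comm c, mul_right_inj' (pow_ne_zero m hp0)]

theorem loopPoly_periodic (hp : ∀ j, L (j + N) = L j) (t : ℝ) :
    loopPoly (2 * m) L (t + N) = loopPoly (2 * m) L t := by
  have := loopPoly_add (n := 2 * m) (N := N) hp t
  exact_mod_cast this

theorem mem_loopCurve_of_mem_braidCover {v : Sphere3 × ℂ} (hv : v ∈ braidCover m L N)
    (hb : v.1.1 1 ≠ 0) :
    (v.1.1 0 / ‖v.1.1 1‖, timeOf N (v.1.1 1), v.2 / ‖v.1.1 1‖ ^ m) ∈ loopCurve (2 * m) L := by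
  have h0 : 0 < ‖v.1.1 1‖ := norm_pos_iff.2 hb
  have h0' : (‖v.1.1 1‖ : ℂ) ≠ 0 := by exact_mod_cast h0.ne'
  have hv : v.2 ^ 2 = homPoly (2 * m) L (timeOf N (v.1.1 1)) (v.1.1 0) ‖v.1.1 1‖ := hv
  show (v.2 / (‖v.1.1 1‖ : ℂ) ^ m) ^ 2 = loopPoly _ _ _ (v.1.1 0 / (‖v.1.1 1‖ : ℂ))
  have := homPoly_mul (n := 2 * m) (L := L) (timeOf N (v.1.1 1)) (v.1.1 0 / (‖v.1.1 1‖ : ℂ)) 1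
    ‖v.1.1 1‖
  rw [mul_div_cancel₀ _ h0', mul_one, homPoly_one] at this
  rw [div_pow, hv, this, ← pow_mul, mul_comm m 2, mul_div_cancel_left₀ _ (pow_ne_zero _ h0')]

theorem continuous_coe_zero : Continuous fun v : Sphere3 × ℂ => v.1.1 0 := by fun_prop

theorem continuous_coe_one : Continuous fun v : Sphere3 × ℂ => v.1.1 1 := by fun_prop

/-- A periodic function on the double cover of `ℂ × ℝ` that is a power of the phase near infinity on
one sheet defines a function on the complement of a component of the preimage of the axis. -/
theorem exists_cover_function_of_loop (hL : ∀ j, IsLetterOn (2 * m) (L j)) (hN : 0 < N)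
    (hp : ∀ j, L (j + N) = L j) {G : ℂ × ℝ × ℂ → Circle} {D : ℤ}
    (hG : ContinuousOn G (loopCurve (2 * m) L)) (pG : ∀ z t y, G (z, t + N, y) = G (z, t, y))
    (iG : ∀ z t, 2 * m + 3 ≤ ‖z‖ → G (z, t, -homRoot m L t z 1) = phase z ^ D) :
    ∃ f : Sphere3 × ℂ → Circle, ContinuousOn f (braidCover m L N \ axisLift m 1) ∧
      ∀ z t y, f (coverPoint m z (turn (t / N)) y) = G (z, t, y) := by
  classical
  set f : Sphere3 × ℂ → Circle := fun v => if v.1.1 1 = 0 then phase (v.1.1 0) ^ D else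
    G (v.1.1 0 / ‖v.1.1 1‖, timeOf N (v.1.1 1), v.2 / ‖v.1.1 1‖ ^ m) with hf
  refine ⟨f, ?_, ?_⟩
  · rintro v₀ ⟨hv₀, hK⟩
    by_cases h0 : v₀.1.1 1 = 0
    · have ha0 : v₀.1.1 0 ≠ 0 := (coe_ne_zero v₀.1).resolve_right (by simpa using h0)
      -- A point over the axis outside `K₁` lies on `K₂`. All nearby points of the cover are then on
      -- the second sheet near infinity, where `G` is the power of the phase that defines `f` on the
      -- axis.
      have hy0 : v₀.2 = -v₀.1.1 0 ^ m := by
        have h1 : v₀.2 ^ 2 = (v₀.1.1 0 ^ m) ^ 2 := by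
          have : v₀.2 ^ 2 = braidPoly (2 * m) L N (v₀.1.1 0) (v₀.1.1 1) := hv₀
          rw [this, h0, braidPoly_zero, ← pow_mul, mul_comm m 2]
        rcases sq_eq_sq_iff_eq_or_eq_neg.1 h1 with h | h
        · exact absurd ⟨h0, by rw [one_mul]; exact h⟩ hK
        · exact h
      have cph : ContinuousAt (fun v : Sphere3 × ℂ => phase (v.1.1 0) ^ D) v₀ := by
        have : ContinuousAt phase (v₀.1.1 0) :=
          continuousOn_phase.continuousAt (isOpen_compl_singleton.mem_nhds ha0)
        exact (ContinuousAt.comp (g := phase) (f := fun v : Sphere3 × ℂ => v.1.1 0) this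
          continuous_coe_zero.continuousAt).zpow D
      refine cph.continuousWithinAt.congr_of_eventuallyEq ?_ (by simp [hf, h0])
      have e1 : ∀ᶠ v : Sphere3 × ℂ in 𝓝 v₀, (2 * m + 3) * ‖v.1.1 1‖ < ‖v.1.1 0‖ := by
        have o : IsOpen {v : Sphere3 × ℂ | (2 * m + 3) * ‖v.1.1 1‖ < ‖v.1.1 0‖} :=
          isOpen_lt (by fun_prop) (by fun_prop)
        exact o.mem_nhds (by simp [h0, ha0])
      have cR : ContinuousAt (fun v : Sphere3 × ℂ => braidRoot m L N (v.1.1 0) (v.1.1 1)) v₀ := by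
        have o : IsOpen {p : ℂ × ℂ | (2 * m + 1) * ‖p.2‖ < ‖p.1‖} :=
          isOpen_lt (by fun_prop) (by fun_prop)
        exact ContinuousAt.comp (g := fun p : ℂ × ℂ => braidRoot m L N p.1 p.2)
          (f := fun v : Sphere3 × ℂ => (v.1.1 0, v.1.1 1))
          ((continuousOn_braidRoot hL hp).continuousAt (o.mem_nhds (by simp [h0, ha0])))
          (by fun_prop)
      have e2 : ∀ᶠ v : Sphere3 × ℂ in 𝓝 v₀, v.2 - braidRoot m L N (v.1.1 0) (v.1.1 1) ≠ 0 := by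
        refine (continuousAt_snd.sub cR).eventually_ne ?_
        show v₀.2 - braidRoot m L N (v₀.1.1 0) (v₀.1.1 1) ≠ 0
        rw [h0, braidRoot_zero, hy0, ← neg_add', neg_ne_zero, ← two_mul]
        exact mul_ne_zero two_ne_zero (pow_ne_zero _ ha0)
      filter_upwards [mem_nhdsWithin_of_mem_nhds e1, mem_nhdsWithin_of_mem_nhds e2,
        self_mem_nhdsWithin] with v h1 h2 h3
      simp only [hf]
      split_ifs with hb
      · rfl
      · have hb0 : 0 < ‖v.1.1 1‖ := norm_pos_iff.2 hb
        have hb' : (‖v.1.1 1‖ : ℂ) ≠ 0 := by exact_mod_cast hb0.ne'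
        have ha : v.1.1 0 ≠ 0 := norm_pos_iff.1 (lt_of_le_of_lt (by positivity) h1)
        have hy : v.2 = -braidRoot m L N (v.1.1 0) (v.1.1 1) := by
          have : v.2 ^ 2 = braidPoly (2 * m) L N (v.1.1 0) (v.1.1 1) := h3.1
          rw [← braidRoot_sq ha] at this
          exact (sq_eq_sq_iff_eq_or_eq_neg.1 this).resolve_left (sub_ne_zero.1 h2)
        have hr := homRoot_mul (m := m) (L := L) (timeOf N (v.1.1 1))
          (v.1.1 0 / (‖v.1.1 1‖ : ℂ)) 1 hb0.ne'
        rw [mul_div_cancel₀ _ hb', mul_one] at hr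
        have hG' := iG (v.1.1 0 / (‖v.1.1 1‖ : ℂ)) (timeOf N (v.1.1 1)) (by
          rw [norm_div, Complex.norm_real, norm_norm, le_div_iff₀ hb0]; exact h1.le)
        rw [hy, braidRoot, hr, neg_div, mul_div_cancel_left₀ _ (pow_ne_zero _ hb'), hG']
        congr 1
        rw [div_eq_mul_inv, mul_comm, ← Complex.ofReal_inv, phase_ofReal_mul (inv_pos.2 hb0)]
    · obtain ⟨τ, cτ, eτ⟩ := exists_local_time (N := N) h0
      have o : {v : Sphere3 × ℂ | v.1.1 1 ≠ 0} ∈ 𝓝 v₀ :=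
        (isOpen_ne_fun continuous_coe_one continuous_const).mem_nhds h0
      have ev : ∀ᶠ v in 𝓝[braidCover m L N \ axisLift m 1] v₀,
          v ∈ braidCover m L N ∧ v.1.1 1 ≠ 0 :=
        (eventually_mem_nhdsWithin.mono fun v hv => hv.1).and (mem_nhdsWithin_of_mem_nhds o)
      have key : ∀ v : Sphere3 × ℂ, v ∈ braidCover m L N → v.1.1 1 ≠ 0 →
          (v.1.1 0 / (‖v.1.1 1‖ : ℂ), τ (v.1.1 1), v.2 / (‖v.1.1 1‖ : ℂ) ^ m) ∈ loopCurve (2 * m) L ∧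
          f v = G (v.1.1 0 / (‖v.1.1 1‖ : ℂ), τ (v.1.1 1), v.2 / (‖v.1.1 1‖ : ℂ) ^ m) := by
        intro v hv hb
        obtain ⟨j, hj⟩ := eτ _ hb
        have h1 := mem_loopCurve_of_mem_braidCover hv hb
        rw [hj] at h1
        constructor
        · have h1 : (v.2 / (‖v.1.1 1‖ : ℂ) ^ m) ^ 2 = loopPoly (2 * m) L (τ (v.1.1 1) + j * N) _ := h1
          rw [apply_add_int_mul (f := loopPoly (2 * m) L) (loopPoly_periodic hp)] at h1
          exact h1
        · simp only [hf, if_neg hb, hj]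
          exact apply_add_int_mul (f := fun t => G (_, t, _)) (fun t => pG _ t _) _ j
      have hcont : ContinuousWithinAt (fun v : Sphere3 × ℂ => G (v.1.1 0 / (‖v.1.1 1‖ : ℂ),
          τ (v.1.1 1), v.2 / (‖v.1.1 1‖ : ℂ) ^ m)) (braidCover m L N \ axisLift m 1) v₀ := by
        have hb' : (‖v₀.1.1 1‖ : ℂ) ≠ 0 := by simpa using h0
        have h1 := hG _ (key v₀ hv₀ h0).1
        rw [ContinuousWithinAt] at h1 ⊢
        refine h1.comp (tendsto_nhdsWithin_iff.2 ⟨?_, ev.mono fun v hv => (key v hv.1 hv.2).1⟩)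
        refine Tendsto.mono_left ?_ nhdsWithin_le_nhds
        refine ContinuousAt.tendsto (f := fun v : Sphere3 × ℂ => (v.1.1 0 / (‖v.1.1 1‖ : ℂ),
          τ (v.1.1 1), v.2 / (‖v.1.1 1‖ : ℂ) ^ m)) ?_
        refine ContinuousAt.prodMk (ContinuousAt.div (by fun_prop) (by fun_prop) hb')
          (ContinuousAt.prodMk ?_ (ContinuousAt.div (by fun_prop) (by fun_prop) (pow_ne_zero _ hb')))
        exact ContinuousAt.comp (g := τ) (f := fun v : Sphere3 × ℂ => v.1.1 1) cτ
          continuous_coe_one.continuousAt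
      exact hcont.congr_of_eventuallyEq (ev.mono fun v hv => (key v hv.1 hv.2).2) (key v₀ hv₀ h0).2
  · intro z t y
    have hne : z ≠ 0 ∨ (turn (t / N) : ℂ) ≠ 0 := Or.inr (Circle.coe_ne_zero _)
    set σ : ℝ := (pairNorm z (turn (t / N)))⁻¹ with hσ
    have hσ0 : 0 < σ := inv_pos.2 (pairNorm_pos hne)
    have hσ' : (σ : ℂ) ≠ 0 := by exact_mod_cast hσ0.ne'
    have e1 : (coverPoint m z (turn (t / N)) y).1.1 1 = σ * turn (t / N) := spherePoint_one hne
    have e0 : (coverPoint m z (turn (t / N)) y).1.1 0 = σ * z := spherePoint_zero hne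
    have e2 : (coverPoint m z (turn (t / N)) y).2 = σ ^ m * y := rfl
    simp only [hf, e0, e1, e2]
    rw [if_neg (mul_ne_zero hσ' (Circle.coe_ne_zero _)), norm_turn_mul, abs_of_pos hσ0,
      mul_div_cancel_left₀ _ hσ', mul_div_cancel_left₀ _ (pow_ne_zero _ hσ')]
    exact apply_timeOf (f := fun t => G (z, t, y)) (fun t => pG _ t _) hN hσ0 t

/-- The existence of a function of degree `1` on the meridian. -/
theorem exists_cover_function (hL : ∀ j, IsLetterOn (2 * m) (L j)) {w : BraidWord}
    (hw : ∀ (k : ℕ) (hk : k < w.length), L k = w[k]) (hN : 0 < w.length)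
    (hp : ∀ j, L (j + w.length) = L j) {A : ℕ → ℤ}
    (hA : EqOn (wordAct w A) (fun i => A i + 1) (Icc 1 (2 * m))) {r : ℝ} (hr : 2 * m + 2 ≤ r) :
    ∃ f : Sphere3 × ℂ → Circle, ContinuousOn f (braidCover m L w.length \ axisLift m 1) ∧
      HasDegree (fun u => f (coverPoint m r u (braidRoot m L w.length r u))) 1 := by
  set N := w.length
  have hN' : (N : ℝ) ≠ 0 := by exact_mod_cast hN.ne'
  obtain ⟨F, cF, pF, ⟨α, cα, eα, hα⟩, hβ⟩ := exists_loop_function hL hw hN hp hA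
    (r := r) (by push_cast; exact hr)
  obtain ⟨G, D, cG, pG, iG, GF⟩ := exists_phase_at_infinity hL hp cF pF hr hβ
  obtain ⟨f, cf, ef⟩ := exists_cover_function_of_loop hL hN hp cG pG iG
  refine ⟨f, cf, ?_⟩
  have eμ : ∀ t, f (coverPoint m r (turn (t / N)) (braidRoot m L N r (turn (t / N)))) =
      F (r, t, loopRoot (2 * m) L t r) := by
    intro t
    have := braidRoot_turn (m := m) hp hN zero_le_one t r
    rw [Complex.ofReal_one, one_mul] at this
    rw [ef, this, homRoot_ofReal hL hr, GF]
  have cμ : Continuous fun t : ℝ => F (r, t, loopRoot (2 * m) L t r) := by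
    have := continuous_loopRoot_far hL (r := r) (by push_cast; exact hr)
    exact cF.comp_continuous (f := fun t : ℝ => ((r : ℂ), t, loopRoot (2 * m) L t r)) (by fun_prop)
      fun t => loopRoot_sq t r
  obtain ⟨θ, cθ, eθ⟩ := exists_turn_lift (starConvex_univ (0 : ℝ)) cμ.continuousOn
  obtain ⟨d, hd⟩ := isPreconnected_Icc.exists_int_sub_eq (cθ.mono (subset_univ (Icc (0 : ℝ) N))) cα
    fun t ht => by rw [eθ t trivial, eα t ht]
  refine hasDegree_iff.2 ⟨fun t => θ (N * t), (continuousOn_univ.1 cθ).comp (by fun_prop),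
    fun t => ?_, ?_⟩
  · have := eμ (N * t)
    rw [mul_div_cancel_left₀ _ hN'] at this
    rw [this, eθ _ trivial]
  · have h0 := hd 0 ⟨le_rfl, Nat.cast_nonneg N⟩
    have h1 := hd N ⟨Nat.cast_nonneg N, le_rfl⟩
    simp only [mul_one, mul_zero, h0, h1]
    push_cast; linarith

end Cover

/-! ## The degree of a function on the double cover along the other lift of the axis -/

theorem altSum_neg (n : ℕ) (A : ℕ → ℤ) : altSum n (fun i => -A i) = -altSum n A := by
  induction n with
  | zero => rfl
  | succ n ih => simp only [altSum, ih]; ring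

section Cover

variable {m : ℕ} {L : ℤ → ℕ × Bool}

theorem continuousOn_homRoot_one (hL : ∀ j, IsLetterOn (2 * m) (L j)) {r : ℝ} (hr : 2 * m + 2 ≤ r) :
    ContinuousOn (fun q : ℝ × ℝ × ℂ => homRoot m L q.2.1 q.2.2 q.1)
      {q | q.1 ∈ Icc 0 r⁻¹ ∧ ‖q.2.2‖ = 1} := by
  have hr0 : 0 < r := lt_of_lt_of_le (by positivity) hr
  refine (continuousOn_homRoot hL).comp (f := fun q : ℝ × ℝ × ℂ => (q.2.1, q.2.2, q.1))
    (by fun_prop) ?_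
  rintro ⟨ρ, t, a⟩ ⟨⟨h1, h2⟩, h3⟩
  simp only at h1 h2 h3
  simp only [Set.mem_ofPred_eq, h3, abs_of_nonneg h1]
  calc (2 * m + 1) * ρ ≤ (2 * m + 1) * r⁻¹ := mul_le_mul_of_nonneg_left h2 (by positivity)
    _ < 1 := by rw [← div_eq_mul_inv, div_lt_one hr0]; linarith

/-- Every function on the complement of the first lift of the axis that has degree `1` on the
meridian has the same degree on the second lift. -/
theorem hasDegree_of_meridian (hL : ∀ j, IsLetterOn (2 * m) (L j)) {w : BraidWord}
    (hw : ∀ (k : ℕ) (hk : k < w.length), L k = w[k]) (hwl : ∀ l ∈ w, IsLetterOn (2 * m) l)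
    (hN : 0 < w.length) (hp : ∀ j, L (j + w.length) = L j) {A : ℕ → ℤ}
    (hA : EqOn (wordAct w A) (fun i => A i + 1) (Icc 1 (2 * m))) {r : ℝ} (hr : 2 * m + 2 ≤ r)
    {f : Sphere3 × ℂ → Circle} (hf : ContinuousOn f (braidCover m L w.length \ axisLift m 1))
    (hμ : HasDegree (fun u => f (coverPoint m r u (braidRoot m L w.length r u))) 1) :
    HasDegree (fun u => f (coverPoint m u 0 (-(u : ℂ) ^ m))) (altSum (2 * m) A) := by
  set N := w.length
  have hN' : (N : ℝ) ≠ 0 := by exact_mod_cast hN.ne'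
  have hr0 : 0 < r := lt_of_lt_of_le (by positivity) hr
  have hri : 0 < r⁻¹ := inv_pos.2 hr0
  have hrC : (r : ℂ) ≠ 0 := by exact_mod_cast hr0.ne'
  have tne : ∀ t, (turn t : ℂ) ≠ 0 := fun t => Circle.coe_ne_zero _
  set F : ℂ × ℝ × ℂ → Circle := fun q => f (coverPoint m q.1 (turn (q.2.1 / N)) q.2.2) with hF
  have cturn : Continuous fun t : ℝ => (turn t : ℂ) :=
    isEmbedding_circle_coe.continuous.comp continuous_turn
  have cF : ContinuousOn F (loopCurve (2 * m) L) := by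
    refine hf.comp (ContinuousOn.coverPoint (by fun_prop) ?_ (by fun_prop) fun q _ =>
      Or.inr (tne _)) ?_
    · exact (cturn.comp (by fun_prop)).continuousOn
    · rintro ⟨z, t, y⟩ hq
      have hq : y ^ 2 = loopPoly (2 * m) L t z := hq
      refine ⟨(coverPoint_mem_braidCover (Or.inr (tne _))).2 ?_, fun h =>
        tne _ ((coverPoint_mem_axisLift (Or.inr (tne _))).1 h).1⟩
      have := braidPoly_turn (n := 2 * m) hp hN zero_le_one t z
      rw [Complex.ofReal_one, one_mul, homPoly_one] at this
      rw [this]; exact hq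
  have pF : ∀ z t y, F (z, t + N, y) = F (z, t, y) := fun z t y => by
    simp only [hF]
    rw [add_div, div_self hN', turn_add_one]
  obtain ⟨θ, cθ, eθ, hθ⟩ := hasDegree_iff.1 hμ
  have hα : ∀ t, turn (θ (t / N)) = F (r, t, loopRoot (2 * m) L t r) := fun t => by
    have := braidRoot_turn (m := m) hp hN zero_le_one t r
    rw [Complex.ofReal_one, one_mul, homRoot_ofReal hL hr] at this
    rw [← eθ, this]
  -- points near the second lift
  have inner : ∀ (a : ℝ × ℝ → ℂ) (b : ℝ × ℝ → ℂ) (t : ℝ × ℝ → ℝ), Continuous a → Continuous b →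
      Continuous t → (∀ q, ‖a q‖ = 1) → (∀ q, b q = q.1 * turn (t q / N)) →
      ∃ g : ℝ × ℝ → ℝ, ContinuousOn g (Icc 0 r⁻¹ ×ˢ univ) ∧ ∀ q ∈ Icc 0 r⁻¹ ×ˢ univ,
        turn (g q) = f (coverPoint m (a q) (b q) (-homRoot m L (t q) (a q) q.1)) := by
    intro a b t ca cb ct na eb
    have conv : Convex ℝ (Icc 0 r⁻¹ ×ˢ (univ : Set ℝ)) := (convex_Icc _ _).prod convex_univ
    have ane : ∀ q, a q ≠ 0 := fun q => norm_pos_iff.1 (by rw [na]; exact one_pos)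
    refine exists_turn_lift (conv.starConvex (x := ((0 : ℝ), (0 : ℝ))) ⟨⟨le_rfl, hri.le⟩, trivial⟩) ?_
    refine hf.comp (ContinuousOn.coverPoint ca.continuousOn cb.continuousOn (ContinuousOn.neg ?_)
      fun q _ => Or.inl (ane q)) ?_
    · exact (continuousOn_homRoot_one hL hr).comp (f := fun q : ℝ × ℝ => (q.1, t q, a q))
        (by fun_prop) fun q hq => ⟨hq.1, na q⟩
    · rintro q ⟨hq, -⟩
      refine ⟨(coverPoint_mem_braidCover (Or.inl (ane q))).2 ?_, fun h => ?_⟩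
      · rw [neg_sq, homRoot_sq (ane q), eb, braidPoly_turn hp hN hq.1]
      · obtain ⟨h1, h2⟩ := (coverPoint_mem_axisLift (Or.inl (ane q))).1 h
        rw [eb, mul_eq_zero, or_iff_left (tne _), Complex.ofReal_eq_zero] at h1
        rw [h1, homRoot_zero, one_mul] at h2
        exact pow_ne_zero m (ane q) (self_eq_neg.1 h2.symm)
  have scale : ∀ (t : ℝ) (u : ℂ), ‖u‖ = 1 → ∀ a : ℂ, coverPoint m a ((r⁻¹ : ℝ) * u)
      (-homRoot m L t a r⁻¹) = coverPoint m (r * a) u (-homRoot m L t (r * a) 1) := by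
    intro t u hu a
    have hu0 : u ≠ 0 := norm_pos_iff.1 (by rw [hu]; exact one_pos)
    have h1 := coverPoint_mul (m := m) (a := r * a) (b := u) (Or.inr hu0) hri
      (-homRoot m L t (r * a) 1)
    have h2 := homRoot_mul (m := m) (L := L) t (r * a) 1 hri.ne'
    have h3 : ((r⁻¹ : ℝ) : ℂ) * (r * a) = a := by
      rw [Complex.ofReal_inv, inv_mul_cancel_left₀ hrC]
    rw [h3, mul_one] at h2
    rw [h3, mul_neg, ← h2] at h1
    exact h1
  have m0 : ∀ s : ℝ, ((0 : ℝ), s) ∈ Icc 0 r⁻¹ ×ˢ (univ : Set ℝ) := fun s => ⟨⟨le_rfl, hri.le⟩, trivial⟩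
  have m1 : ∀ s : ℝ, (r⁻¹, s) ∈ Icc 0 r⁻¹ ×ˢ (univ : Set ℝ) := fun s => ⟨⟨hri.le, le_rfl⟩, trivial⟩
  have pre : IsPreconnected (Icc 0 r⁻¹ ×ˢ (univ : Set ℝ)) :=
    ((convex_Icc _ _).prod convex_univ).isPreconnected
  -- the degree over a period on the second sheet
  have hβ : ∃ β : ℝ → ℝ, Continuous β ∧
      (∀ t, turn (β t) = F (r, t, -loopRoot (2 * m) L t r)) ∧ β N = β 0 := by
    obtain ⟨g, cg, eg⟩ := inner (fun _ => 1) (fun q => q.1 * turn (q.2 / N)) (fun q => q.2)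
      continuous_const ((by fun_prop : Continuous fun q : ℝ × ℝ => (q.1 : ℂ)).mul
        (cturn.comp (by fun_prop))) continuous_snd (fun _ => by simp) (fun _ => rfl)
    obtain ⟨d, hd⟩ := pre.exists_int_sub_eq
      (cg.comp (f := fun q : ℝ × ℝ => (q.1, q.2 + N)) (by fun_prop) fun q hq => hq) cg
      fun q hq => by
        have : q ∈ Icc 0 r⁻¹ ×ˢ (univ : Set ℝ) := hq
        rw [Function.comp_apply, eg _ this, eg _ (show (q.1, q.2 + N) ∈ _ from hq)]
        simp only
        rw [homRoot_periodic hp, add_div, div_self hN', turn_add_one]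
    obtain ⟨e, he⟩ := (isPreconnected_univ (α := ℝ)).exists_int_sub_eq
      (cg.comp (f := fun t : ℝ => ((0 : ℝ), t)) (by fun_prop) fun t _ => m0 t)
      (continuousOn_const (c := g (0, 0))) fun t _ => by
        rw [Function.comp_apply, eg _ (m0 t), eg _ (m0 0)]
        simp [homRoot_zero]
    have d0 := hd _ (m0 0)
    have e0 := he 0 trivial
    have e1 := he N trivial
    simp only [Function.comp_apply, zero_add] at d0 e0 e1
    have hd0 : (d : ℝ) = 0 := by linarith
    refine ⟨fun t => g (r⁻¹, t), cg.comp_continuous (by fun_prop) m1, fun t => ?_, ?_⟩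
    · rw [eg _ (m1 t), scale t _ (Circle.norm_coe _), mul_one, homRoot_ofReal hL hr]
    · have := hd _ (m1 0)
      simp only [Function.comp_apply, zero_add, hd0, add_zero] at this
      exact this
  obtain ⟨β, cβ, eβ, hβN⟩ := hβ
  -- the labels
  have R0 : loopRoot (2 * m) L 0 = pageRoot (2 * m) := by
    have := loopRoot_intCast (n := 2 * m) (L := L) 0
    simpa using this
  have P0 : loopPoly (2 * m) L 0 = pagePoly (2 * m) := by
    have := loopPoly_intCast (n := 2 * m) (L := L) 0
    simpa using this
  have cpage : ContinuousOn (fun q : ℂ × ℂ => F (q.1, 0, q.2)) (pageCurve (2 * m)) := by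
    refine cF.comp (f := fun q : ℂ × ℂ => (q.1, (0 : ℝ), q.2)) (by fun_prop) fun q hq => ?_
    show q.2 ^ 2 = loopPoly (2 * m) L 0 q.1
    rw [P0]; exact hq
  have hα0 := hα 0
  have hβ0 := eβ 0
  rw [R0] at hα0 hβ0
  obtain ⟨C, hC⟩ := exists_hasLabels (r := r) cpage hα0 hβ0
  have hend := HasLabels.word hL hw (cF.mono fun q hq => hq.1) (by push_cast; exact hr)
    (α := fun t => θ (t / N)) (β := β) (by fun_prop) cβ (fun t _ => hα t) (fun t _ => eβ t) hC
  -- After a period the function on the page is the same, while the logarithms at the base point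
  -- have grown by 1 and 0. The two descriptions of its labels give the equation that `A` satisfies
  -- too.
  have hC1 : EqOn (wordAct w C) (fun i => C i + 1) (Icc 1 (2 * m)) := by
    have h1 := hC.shift 1 0
    simp only [zero_div, Int.cast_one, Int.cast_zero, add_zero, sub_zero] at h1
    have h2 : HasLabels (2 * m) (fun q => F (q.1, 0, q.2)) r (θ 0 + 1) (β 0) (wordAct w C) := by
      have e : (fun q : ℂ × ℂ => F (q.1, (w.length : ℝ), q.2)) = fun q => F (q.1, 0, q.2) := by
        funext q
        have := pF q.1 0 q.2
        rwa [zero_add] at this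
      have e2 : θ ((w.length : ℝ) / N) = θ 0 + 1 := by
        rw [div_self hN', hθ]; simp
      rw [e] at hend
      simp only [e2] at hend
      rw [show β (w.length : ℝ) = β 0 from hβN] at hend
      exact hend
    exact h2.eqOn h1
  rw [altSum_eq_of_wordAct_eq_add_one hwl hA hC1]
  -- the degree along the circles
  obtain ⟨h, ch, eh⟩ := inner (fun q => turn q.2) (fun q => q.1) (fun _ => 0)
    (cturn.comp continuous_snd) (by fun_prop) continuous_const (fun q => Circle.norm_coe _)
    (fun q => by simp)
  obtain ⟨d, hd⟩ := pre.exists_int_sub_eq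
    (ch.comp (f := fun q : ℝ × ℝ => (q.1, q.2 + 1)) (by fun_prop) fun q hq => hq) ch
    fun q hq => by
      rw [Function.comp_apply, eh _ (show (q.1, q.2 + 1) ∈ Icc 0 r⁻¹ ×ˢ (univ : Set ℝ) from hq),
        eh _ hq]
      simp only [turn_add_one]
  -- The circle runs on the second sheet, hence the sheets are exchanged and the labels negated.
  -- This cancels the minus sign of the degree along a large circle.
  have hcircle := hC.neg.circle (even_two_mul m) (R := r) (θ := fun s => h (r⁻¹, s))
    (Y := fun s => homRoot m L 0 (r * turn s) 1) (cpage.comp (by fun_prop) fun q hq => by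
      show (-q.2) ^ 2 = _
      rw [neg_sq]; exact hq) (by push_cast; linarith) (by
      have : ContinuousOn (fun s : ℝ => homRoot m L 0 (r * turn s) 1) univ := by
        refine (continuousOn_homRoot hL).comp (f := fun s : ℝ => ((0 : ℝ), (r * turn s : ℂ), (1 : ℝ)))
          (by fun_prop) fun s _ => ?_
        simp only [Set.mem_ofPred_eq, norm_turn_mul, abs_of_pos hr0, abs_one, mul_one]
        linarith
      exact continuousOn_univ.1 this) (fun s => by
      rw [homRoot_sq (mul_ne_zero hrC (tne _)), homPoly_one, P0]) (by
      rw [turn_zero, Circle.coe_one, mul_one, homRoot_ofReal hL hr, R0])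
    (ch.comp_continuous (by fun_prop) m1) (fun s => by
      rw [eh _ (m1 s)]
      have := scale 0 1 (by simp) (turn s)
      rw [mul_one] at this
      simp only [hF, this, zero_div, turn_zero, Circle.coe_one]
      rfl)
  rw [altSum_neg] at hcircle
  refine hasDegree_iff.2 ⟨fun s => h (0, s), ch.comp_continuous (by fun_prop) m0, fun s => ?_, ?_⟩
  · rw [eh _ (m0 s)]
    simp only [homRoot_zero, Complex.ofReal_zero]
  -- The increment `d` over a turn does not depend on `ρ`, so the large circle at `ρ = r⁻¹` and the
  -- lift `K₂` at `ρ = 0` have the same degree.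
  · have h0 := hd _ (m0 0)
    have h1 := hd _ (m1 0)
    simp only [Function.comp_apply, zero_add] at h0 h1
    push_cast at hcircle
    linarith

end Cover

/-! ## A meridian and the lifts of the axis -/

section Cover

variable {m : ℕ} {L : ℤ → ℕ × Bool} {N : ℕ}

theorem continuous_coe_turn : Continuous fun u : Circle => (u : ℂ) :=
  isEmbedding_circle_coe.continuous

/-- The point of the double cover with the homogeneous coordinates `(1, c)` near the first lift of
the axis. -/
theorem exists_meridian_chart (hL : ∀ j, IsLetterOn (2 * m) (L j)) (hp : ∀ j, L (j + N) = L j) :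
    ∃ r : ℝ, 2 * m + 2 ≤ r ∧ ∃ φ : ℂ × ℝ → braidCover m L N, Topology.IsOpenEmbedding φ ∧
      φ ⁻¹' {v | v.1 ∈ axisLift m 1} = {q | q.1 = 0} ∧
      ∀ u : Circle, (φ ((u : ℂ), 0)).1 = coverPoint m r u (braidRoot m L N r u) := by
  have κ0 : (0 : ℝ) < (2 * m + 2) := by positivity
  -- This bound on `‖b‖ / ‖a‖` keeps the chart in the domain where the root `braidRoot` is
  -- continuous and nonzero.
  set κ : ℝ := (2 * m + 2)⁻¹ with hκ
  have hκ0 : 0 < κ := inv_pos.2 κ0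
  have κC : (κ : ℂ) ≠ 0 := by exact_mod_cast hκ0.ne'
  have hκ1 : (2 * m + 1) * κ < 1 := by
    rw [hκ, ← div_eq_mul_inv, div_lt_one κ0]; linarith
  set c : ℂ → ℂ := fun ζ => κ * OpenPartialHomeomorph.univUnitBall ζ with hc
  have cc : Continuous c := by
    have := OpenPartialHomeomorph.univUnitBall (E := ℂ) |>.continuousOn
    rw [OpenPartialHomeomorph.univUnitBall_source, continuousOn_univ] at this
    exact continuous_const.mul this
  have nc : ∀ ζ, ‖c ζ‖ < κ := fun ζ => by
    have : OpenPartialHomeomorph.univUnitBall ζ ∈ Metric.ball (0 : ℂ) 1 :=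
      OpenPartialHomeomorph.univUnitBall.map_source (mem_univ ζ)
    rw [mem_ball_zero_iff] at this
    rw [hc]; simp only
    rw [norm_mul, Complex.norm_real, Real.norm_eq_abs, abs_of_pos hκ0]
    nlinarith
  -- In homogeneous coordinates the axis is parametrised by the slope `im / re` on the arc with
  -- positive real part; the transverse coordinate is `b / a`, squeezed from ℂ into a disk.
  set a : ℝ → ℂ := fun s => 1 + s * Complex.I with ha
  have are : ∀ s, (a s).re = 1 := fun s => by simp [ha]
  have aim : ∀ s, (a s).im = s := fun s => by simp [ha]
  have a0 : ∀ s, a s ≠ 0 := fun s h => by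
    have := are s
    rw [h] at this; simp at this
  have ca : Continuous a := by rw [ha]; fun_prop
  have near : ∀ x y : ℂ, ‖y‖ < κ * ‖x‖ → (2 * m + 1) * ‖y‖ < ‖x‖ := fun x y h => by
    have hx : 0 < ‖x‖ := by
      by_contra hx
      have : ‖x‖ = 0 := le_antisymm (not_lt.1 hx) (norm_nonneg _)
      rw [this, mul_zero] at h
      exact absurd h (not_lt.2 (norm_nonneg _))
    calc (2 * m + 1) * ‖y‖ ≤ (2 * m + 1) * (κ * ‖x‖) :=
          mul_le_mul_of_nonneg_left h.le (by positivity)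
      _ < ‖x‖ := by rw [← mul_assoc]; nlinarith
  have nb : ∀ q : ℂ × ℝ, ‖a q.2 * c q.1‖ < κ * ‖a q.2‖ := fun q => by
    rw [norm_mul, mul_comm]
    exact mul_lt_mul_of_pos_right (nc _) (norm_pos_iff.2 (a0 _))
  have scale : ∀ σ x y : ℂ, σ ≠ 0 → ‖y‖ < κ * ‖x‖ → ‖σ * y‖ < κ * ‖σ * x‖ := fun σ x y hσ h => by
    rw [norm_mul, norm_mul, mul_left_comm]
    exact mul_lt_mul_of_pos_left h (norm_pos_iff.2 hσ)
  have hmem : ∀ q : ℂ × ℝ, coverPoint m (a q.2) (a q.2 * c q.1)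
      (braidRoot m L N (a q.2) (a q.2 * c q.1)) ∈ braidCover m L N := fun q =>
    (coverPoint_mem_braidCover (Or.inl (a0 _))).2 (braidRoot_sq (a0 _))
  have copen : IsOpen
      {v : braidCover m L N | 0 < (v.1.1.1 0).re ∧ ‖v.1.1.1 1‖ < κ * ‖v.1.1.1 0‖} :=
    have h1 : IsOpen {v : braidCover m L N | 0 < (v.1.1.1 0).re} :=
      isOpen_lt (by fun_prop) (by fun_prop)
    have h2 : IsOpen {v : braidCover m L N | ‖v.1.1.1 1‖ < κ * ‖v.1.1.1 0‖} :=
      isOpen_lt (by fun_prop) (by fun_prop)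
    h1.inter h2
  have croot : ContinuousOn (fun v : braidCover m L N =>
      v.1.2 + braidRoot m L N (v.1.1.1 0) (v.1.1.1 1))
      {v : braidCover m L N | 0 < (v.1.1.1 0).re ∧ ‖v.1.1.1 1‖ < κ * ‖v.1.1.1 0‖} := by
    refine ContinuousOn.add (by fun_prop) ?_
    exact (continuousOn_braidRoot hL hp).comp
      (f := fun v : braidCover m L N => (v.1.1.1 0, v.1.1.1 1)) (by fun_prop)
      fun v hv => near _ _ hv.2
  have re0 : ∀ z : ℂ, 0 < z.re → z ≠ 0 := fun z hz h => by rw [h] at hz; simp at hz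
  have inball : ∀ x y : ℂ, 0 < x.re → ‖y‖ < κ * ‖x‖ → y / x / κ ∈ Metric.ball (0 : ℂ) 1 := by
    intro x y hx hy
    have hx0 := norm_pos_iff.2 (re0 x hx)
    rw [mem_ball_zero_iff, norm_div, norm_div, Complex.norm_real, Real.norm_eq_abs, abs_of_pos hκ0,
      div_lt_one hκ0, div_lt_iff₀ hx0]
    exact hy
  let Φ : OpenPartialHomeomorph (ℂ × ℝ) (braidCover m L N) :=
    { toFun := fun q => ⟨_, hmem q⟩
      invFun := fun v => (OpenPartialHomeomorph.univUnitBall.symm (v.1.1.1 1 / v.1.1.1 0 / κ),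
        (v.1.1.1 0).im / (v.1.1.1 0).re)
      source := univ
      target := {v | 0 < (v.1.1.1 0).re ∧ ‖v.1.1.1 1‖ < κ * ‖v.1.1.1 0‖} ∩
        (fun v : braidCover m L N => v.1.2 + braidRoot m L N (v.1.1.1 0) (v.1.1.1 1)) ⁻¹' {0}ᶜ
      map_source' := by
        intro q _
        have h : a q.2 ≠ 0 ∨ a q.2 * c q.1 ≠ 0 := Or.inl (a0 _)
        have hσ := inv_pos.2 (pairNorm_pos h)
        have hσC : (((pairNorm (a q.2) (a q.2 * c q.1))⁻¹ : ℝ) : ℂ) ≠ 0 := by exact_mod_cast hσ.ne'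
        simp only [coverPoint, mem_inter_iff, Set.mem_ofPred_eq, mem_preimage, mem_compl_iff,
          mem_singleton_iff, spherePoint_zero h, spherePoint_one h, braidRoot_mul hσ]
        refine ⟨⟨?_, ?_⟩, ?_⟩
        · rw [Complex.re_ofReal_mul, are, mul_one]; exact hσ
        · exact scale _ _ _ hσC (nb q)
        · rw [← two_mul]
          exact mul_ne_zero two_ne_zero (mul_ne_zero (pow_ne_zero _ hσC)
            (braidRoot_ne_zero (near _ _ (nb q))))
      map_target' := fun _ _ => mem_univ _
      left_inv' := by
        rintro ⟨ζ, s⟩ _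
        have h : a s ≠ 0 ∨ a s * c ζ ≠ 0 := Or.inl (a0 _)
        have hσ := inv_pos.2 (pairNorm_pos h)
        have hσC : (((pairNorm (a s) (a s * c ζ))⁻¹ : ℝ) : ℂ) ≠ 0 := by exact_mod_cast hσ.ne'
        simp only [coverPoint, spherePoint_zero h, spherePoint_one h]
        rw [mul_div_mul_left _ _ hσC, mul_div_cancel_left₀ _ (a0 s), hc]
        simp only
        rw [mul_div_cancel_left₀ _ κC, OpenPartialHomeomorph.left_inv _ (mem_univ ζ),
          Complex.re_ofReal_mul, Complex.im_ofReal_mul, are, aim, mul_one,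
          mul_div_cancel_left₀ _ hσ.ne']
      right_inv' := by
        rintro v ⟨⟨hre, hb⟩, hy⟩
        have hx0 := re0 _ hre
        have hreC : (((v.1.1.1 0).re : ℝ) : ℂ) ≠ 0 := by exact_mod_cast hre.ne'
        have h1 : OpenPartialHomeomorph.univUnitBall (OpenPartialHomeomorph.univUnitBall.symm
            (v.1.1.1 1 / v.1.1.1 0 / κ)) = v.1.1.1 1 / v.1.1.1 0 / κ :=
          OpenPartialHomeomorph.right_inv _ (inball _ _ hre hb)
        have h2 : a ((v.1.1.1 0).im / (v.1.1.1 0).re) = (((v.1.1.1 0).re⁻¹ : ℝ) : ℂ) * v.1.1.1 0 := by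
          refine Complex.ext ?_ ?_
          · rw [are, Complex.re_ofReal_mul, inv_mul_cancel₀ hre.ne']
          · rw [aim, Complex.im_ofReal_mul, div_eq_inv_mul]
        have h3 : a ((v.1.1.1 0).im / (v.1.1.1 0).re) * c (OpenPartialHomeomorph.univUnitBall.symm
            (v.1.1.1 1 / v.1.1.1 0 / κ)) = (((v.1.1.1 0).re⁻¹ : ℝ) : ℂ) * v.1.1.1 1 := by
          rw [hc]; simp only
          rw [h1, mul_div_cancel₀ _ κC, h2, mul_assoc, mul_div_cancel₀ _ hx0]
        refine Subtype.ext ?_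
        simp only [h3]
        rw [h2, braidRoot_mul (inv_pos.2 hre), coverPoint_mul (Or.inl hx0) (inv_pos.2 hre)]
        have h4 : v.1.2 = braidRoot m L N (v.1.1.1 0) (v.1.1.1 1) := by
          have h5 : v.1.2 ^ 2 = braidPoly (2 * m) L N (v.1.1.1 0) (v.1.1.1 1) := v.2
          rw [← braidRoot_sq hx0] at h5
          exact (sq_eq_sq_iff_eq_or_eq_neg.1 h5).resolve_right fun h => hy (by
            show _ + _ = (0 : ℂ)
            rw [h, neg_add_cancel])
        rw [← h4, coverPoint_coe]
      open_source := isOpen_univ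
      open_target := croot.isOpen_inter_preimage copen isOpen_compl_singleton
      continuousOn_toFun := by
        refine Continuous.continuousOn (Continuous.subtype_mk ?_ _)
        rw [← continuousOn_univ]
        have h1 : Continuous fun q : ℂ × ℝ => a q.2 := by fun_prop
        have h2 : Continuous fun q : ℂ × ℝ => a q.2 * c q.1 := by fun_prop
        refine ContinuousOn.coverPoint h1.continuousOn h2.continuousOn ?_ fun q _ => Or.inl (a0 _)
        exact (continuousOn_braidRoot hL hp).comp
          (f := fun q : ℂ × ℝ => (a q.2, a q.2 * c q.1)) (by fun_prop) fun q _ => near _ _ (nb q)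
      continuousOn_invFun := by
        have h1 : ContinuousOn (fun v : braidCover m L N => v.1.1.1 1 / v.1.1.1 0 / (κ : ℂ))
            {v | 0 < (v.1.1.1 0).re ∧ ‖v.1.1.1 1‖ < κ * ‖v.1.1.1 0‖} :=
          (ContinuousOn.div (by fun_prop) (by fun_prop) fun v hv => re0 _ hv.1).div_const _
        have h2 : ContinuousOn (fun v : braidCover m L N => (v.1.1.1 0).im / (v.1.1.1 0).re)
            {v | 0 < (v.1.1.1 0).re ∧ ‖v.1.1.1 1‖ < κ * ‖v.1.1.1 0‖} :=
          ContinuousOn.div (by fun_prop) (by fun_prop) fun v hv => hv.1.ne'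
        have h3 := OpenPartialHomeomorph.univUnitBall (E := ℂ) |>.symm.continuousOn
        exact ((h3.comp h1 fun v hv => inball _ _ hv.1 hv.2).prodMk h2).mono inter_subset_left }
  have hφ : ∀ q, (Φ q).1 = coverPoint m (a q.2) (a q.2 * c q.1)
      (braidRoot m L N (a q.2) (a q.2 * c q.1)) := fun q => rfl
  have hs2 : 0 < √(2 : ℝ) := Real.sqrt_pos.2 two_pos
  -- `univUnitBall` sends the unit circle to radius `1 / √2`, so the meridian of the chart is `b / a
  -- = u / r` with `r = √2 * (2 * m + 2)`.
  have hr : 2 * m + 2 ≤ √2 * (2 * m + 2) := by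
    have : 1 ≤ √(2 : ℝ) := Real.one_le_sqrt.2 one_le_two
    nlinarith
  refine ⟨√2 * (2 * m + 2), hr, Φ, Φ.isOpenEmbedding rfl, ?_, ?_⟩
  · ext q
    simp only [mem_preimage, Set.mem_ofPred_eq, hφ, coverPoint_mem_axisLift (Or.inl (a0 _)), one_mul]
    have h0 : c q.1 = 0 ↔ q.1 = 0 := by
      rw [hc]; simp only
      rw [mul_eq_zero, or_iff_right κC, OpenPartialHomeomorph.univUnitBall_apply, smul_eq_zero,
        or_iff_right]
      positivity
    constructor
    · rintro ⟨h, -⟩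
      exact h0.1 ((mul_eq_zero.1 h).resolve_left (a0 _))
    · intro h
      rw [h0.2 h, mul_zero]
      exact ⟨rfl, braidRoot_zero _⟩
  · intro u
    have hr0 : 0 < √2 * (2 * m + 2 : ℝ) := by positivity
    have e1 : a 0 = (((√2 * (2 * m + 2))⁻¹ : ℝ) : ℂ) * (√2 * (2 * m + 2) : ℝ) := by
      rw [← Complex.ofReal_mul, inv_mul_cancel₀ hr0.ne']; simp [ha]
    have e2 : a 0 * c u = (((√2 * (2 * m + 2))⁻¹ : ℝ) : ℂ) * u := by
      have : a 0 = 1 := by simp [ha]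
      rw [this, one_mul, hc]
      simp only [OpenPartialHomeomorph.univUnitBall_apply, Circle.norm_coe, Complex.real_smul]
      rw [← mul_assoc, ← Complex.ofReal_mul, hκ, mul_inv, mul_comm (√2)⁻¹]
      norm_num
    rw [hφ]
    simp only [e2]
    rw [e1, braidRoot_mul (inv_pos.2 hr0), coverPoint_mul (Or.inr (Circle.coe_ne_zero u))
      (inv_pos.2 hr0)]

/-- The lift of the axis as a loop. -/
theorem exists_axis_loop {c : ℂ} (hc : c ^ 2 = 1) : ∃ γ : Circle → braidCover m L N,
    Topology.IsEmbedding γ ∧ range γ = {v | v.1 ∈ axisLift m c} ∧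
      ∀ u, (γ u).1 = coverPoint m u 0 (c * (u : ℂ) ^ m) := by
  have u0 : ∀ u : Circle, (u : ℂ) ≠ 0 ∨ (0 : ℂ) ≠ 0 := fun u => Or.inl (Circle.coe_ne_zero u)
  have hmem : ∀ u : Circle, coverPoint m u 0 (c * (u : ℂ) ^ m) ∈ braidCover m L N := fun u => by
    rw [coverPoint_mem_braidCover (u0 u), braidPoly_zero, mul_pow, hc, one_mul, ← pow_mul,
      mul_comm m 2]
  have hpn : ∀ u : Circle, pairNorm u 0 = 1 := fun u => by simp [pairNorm, Circle.norm_coe]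
  have cont : Continuous fun u : Circle => (⟨_, hmem u⟩ : braidCover m L N) := by
    refine Continuous.subtype_mk ?_ _
    rw [← continuousOn_univ]
    have := continuous_coe_turn
    exact ContinuousOn.coverPoint this.continuousOn continuousOn_const (by fun_prop) fun u _ => u0 u
  have coord : ∀ u : Circle, (coverPoint m u 0 (c * (u : ℂ) ^ m)).1.1 0 = u := fun u => by
    simp only [coverPoint]
    rw [spherePoint_zero (u0 u), hpn]; simp
  refine ⟨_, (cont.isClosedEmbedding fun u v h => ?_).isEmbedding, ?_, fun u => rfl⟩
  · refine Circle.ext ?_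
    have := congrArg (fun v : braidCover m L N => v.1.1.1 0) h
    simpa only [coord] using this
  · ext v
    constructor
    · rintro ⟨u, rfl⟩
      exact (coverPoint_mem_axisLift (u0 u)).2 ⟨rfl, rfl⟩
    · rintro ⟨h1, h2⟩
      have hn : ‖v.1.1.1 0‖ = 1 := by
        have := pairNorm_coe v.1.1
        rw [pairNorm, h1] at this
        simpa using this
      refine ⟨⟨v.1.1.1 0, mem_sphere_zero_iff_norm.2 hn⟩, Subtype.ext ?_⟩
      have := coverPoint_coe m v.1
      rw [h1, h2] at this
      exact this

end Cover

/-! ## The closed braid as the zero set of a polynomial -/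

/-- The letters of a braid word, repeated periodically. -/
def cyclicLetter (w : BraidWord) (j : ℤ) : ℕ × Bool := w.getD (j % w.length).toNat (1, true)

theorem cyclicLetter_natCast {w : BraidWord} (k : ℕ) (hk : k < w.length) :
    cyclicLetter w k = w[k] := by
  have : ((k : ℤ) % w.length).toNat = k := by
    rw [Int.emod_eq_of_lt (by positivity) (by exact_mod_cast hk)]; simp
  rw [cyclicLetter, this, List.getD_eq_getElem _ _ hk]

theorem cyclicLetter_add (w : BraidWord) (j : ℤ) :
    cyclicLetter w (j + w.length) = cyclicLetter w j := by
  rw [cyclicLetter, Int.add_emod_right, cyclicLetter]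

theorem isLetterOn_cyclicLetter {n : ℕ} {w : BraidWord} (hN : 0 < w.length)
    (h : ∀ l ∈ w, IsLetterOn n l) (j : ℤ) : IsLetterOn n (cyclicLetter w j) := by
  have h1 := Int.emod_nonneg j (b := w.length) (by omega)
  have h2 := Int.emod_lt_of_pos j (b := w.length) (by omega)
  rw [cyclicLetter, List.getD_eq_getElem _ _ (by omega)]
  exact h _ (List.getElem_mem _)

theorem closedBraid_eq {n : ℕ} {w : BraidWord} (hN : 0 < w.length) (h : ∀ l ∈ w, IsLetterOn n l) :
    closedBraid n w = {x | braidPoly n (cyclicLetter w) w.length (x.1 0) (x.1 1) = 0} := by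
  have hL := isLetterOn_cyclicLetter hN h
  have hN' : (0 : ℝ) < w.length := by exact_mod_cast hN
  ext x
  constructor
  · rintro ⟨j, s, hs, q, hq, ρ, hρ, h0, h1⟩
    have e : x.1 1 = ρ * turn ((j + s) / w.length) := by
      rw [h1, coe_turn]; push_cast; rfl
    have hj : ((j : ℕ) : ℝ) = (((j : ℕ) : ℤ) : ℝ) := by simp
    rw [Set.mem_ofPred_eq, e, braidPoly_turn (cyclicLetter_add w) hN hρ.le, homPoly, hj,
      loopProd_eq hL (j := (j : ℕ)) ⟨by linarith [hs.1], by linarith [hs.2]⟩]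
    refine Finset.prod_eq_zero hq ?_
    rw [h0, cyclicLetter_natCast _ j.2, add_sub_cancel_left, List.get_eq_getElem, sub_self]
  · intro hx
    rw [Set.mem_ofPred_eq] at hx
    have hb : x.1 1 ≠ 0 := fun hb => by
      rw [hb, braidPoly_zero] at hx
      exact (coe_ne_zero x).elim (fun h => h (eq_zero_of_pow_eq_zero hx)) fun h => h hb
    set t : ℝ := w.length * Int.fract ((x.1 1).arg / (2 * Real.pi)) with ht
    have e : x.1 1 = (‖x.1 1‖ : ℝ) * turn (t / w.length) := by
      rw [ht, mul_div_cancel_left₀ _ hN'.ne', Int.fract, turn_sub, turn_intCast, div_one, coe_turn]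
      conv_lhs => rw [← Complex.norm_mul_exp_arg_mul_I (x.1 1)]
      congr 2
      push_cast
      field_simp
    have ht0 : 0 ≤ t := mul_nonneg hN'.le (Int.fract_nonneg _)
    have ht1 : t < w.length := by
      rw [ht]; nlinarith [Int.fract_lt_one ((x.1 1).arg / (2 * Real.pi))]
    obtain ⟨j, hj⟩ := Int.eq_ofNat_of_zero_le (Int.floor_nonneg.2 ht0)
    have hjN : j < w.length := by
      have : ⌊t⌋ < w.length := Int.floor_lt.2 (by exact_mod_cast ht1)
      omega
    rw [e, braidPoly_turn (cyclicLetter_add w) hN (norm_nonneg _), homPoly, loopProd,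
      Finset.prod_eq_zero_iff] at hx
    obtain ⟨q, hq, h0⟩ := hx
    have hjt : (j : ℝ) + Int.fract t = t := by
      rw [← Int.floor_add_fract t, hj]; simp
    refine ⟨⟨j, hjN⟩, Int.fract t, ⟨Int.fract_nonneg t, (Int.fract_lt_one t).le⟩, q, hq, _,
      norm_pos_iff.2 hb, ?_, ?_⟩
    · rw [hj, cyclicLetter_natCast _ hjN] at h0
      rw [List.get_eq_getElem]
      exact sub_eq_zero.1 h0
    · conv_lhs => rw [e]
      rw [coe_turn]
      have : (t : ℂ) = j + Int.fract t := by exact_mod_cast hjt.symm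
      push_cast
      rw [this]

/-- The moving strands are opposite points at distance `1/2` from the midpoint, and all resting
strands are farther away. The zeros of the polynomial on a page are therefore simple. -/
theorem strandPoint_injective (l : ℕ × Bool) (s : ℝ) : Function.Injective (strandPoint l s) := by
  set rot : ℂ := Complex.exp ((if l.2 then 1 else -1) * Real.pi * s * Complex.I) with hrot
  have n1 : ‖rot‖ = 1 := by
    have : (((if l.2 then 1 else -1) * Real.pi * s : ℝ) : ℂ) =
        (if l.2 then 1 else -1) * Real.pi * s := by push_cast; split_ifs <;> simp
    rw [hrot, ← this, Complex.norm_exp_ofReal_mul_I]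
  have rot0 : rot ≠ 0 := norm_pos_iff.1 (by rw [n1]; exact one_pos)
  have e : ∀ i, strandPoint l s i = if i = l.1 then (l.1 : ℂ) + 1 / 2 - rot / 2
    else if i = l.1 + 1 then (l.1 : ℂ) + 1 / 2 + rot / 2 else (i : ℂ) := fun i => rfl
  have far : ∀ i : ℕ, i ≠ l.1 → i ≠ l.1 + 1 → ∀ v : ℂ, ‖v‖ = 1 →
      (l.1 : ℂ) + 1 / 2 + v / 2 ≠ i := by
    intro i h1 h2 v hv h
    have h3 : v = ((2 * (i : ℤ) - 2 * l.1 - 1 : ℤ) : ℂ) := by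
      push_cast
      rw [← h]; ring
    rw [h3, Complex.norm_intCast] at hv
    have h4 : |2 * (i : ℤ) - 2 * l.1 - 1| = 1 := by exact_mod_cast hv
    rcases (abs_eq one_pos.le).1 h4 with h | h <;> omega
  have far' : ∀ i : ℕ, i ≠ l.1 → i ≠ l.1 + 1 → (l.1 : ℂ) + 1 / 2 - rot / 2 ≠ i := by
    intro i h1 h2
    have := far i h1 h2 (-rot) (by rw [norm_neg, n1])
    rwa [neg_div, ← sub_eq_add_neg] at this
  have two : (l.1 : ℂ) + 1 / 2 - rot / 2 ≠ (l.1 : ℂ) + 1 / 2 + rot / 2 := fun h =>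
    rot0 (by linear_combination -h)
  intro i k h
  rw [e, e] at h
  by_cases i1 : i = l.1 <;> by_cases k1 : k = l.1
  · rw [i1, k1]
  · rw [if_pos i1, if_neg k1] at h
    split_ifs at h with k2
    · exact absurd h two
    · exact absurd h (far' k k1 k2)
  · rw [if_pos k1, if_neg i1] at h
    split_ifs at h with i2
    · exact absurd h.symm two
    · exact absurd h.symm (far' i i1 i2)
  · rw [if_neg i1, if_neg k1] at h
    split_ifs at h with i2 k2 k2
    · rw [i2, k2]
    · exact absurd h (far k k1 k2 _ n1)
    · exact absurd h.symm (far i i1 i2 _ n1)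
    · exact_mod_cast h

/-- Along the circle a square root is `±exp (π i t)` with a constant sign, which has opposite values
at `t = 0` and `t = 1`. -/
theorem not_exists_continuous_sqrt_circle (g : Circle → ℂ) (hg : Continuous g)
    (h : ∀ u, g u ^ 2 = u) : False := by
  have key := IsPreconnected.eq_or_eq_neg_of_sq_eq (S := univ) isPreconnected_univ
    (f := fun t : ℝ => g (turn t)) (g := fun t : ℝ => Complex.exp (Real.pi * t * Complex.I))
    (by fun_prop) (by fun_prop)
    (fun t _ => by
      simp only [Pi.pow_apply]
      rw [h, coe_turn, ← Complex.exp_nat_mul]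
      congr 1; push_cast; ring) fun _ => Complex.exp_ne_zero _
  have e0 : turn 0 = turn 1 := by
    have := turn_intCast 1
    rw [turn_zero]; exact_mod_cast this.symm
  have e1 : Complex.exp (Real.pi * (1 : ℝ) * Complex.I) = -1 := by simp
  have e2 : Complex.exp (Real.pi * (0 : ℝ) * Complex.I) = 1 := by simp
  rcases key with key | key
  · have h0 := key (mem_univ 0)
    have h1 := key (mem_univ 1)
    simp only [e0, e1, e2] at h0 h1
    rw [h0] at h1; norm_num at h1
  · have h0 := key (mem_univ 0)
    have h1 := key (mem_univ 1)
    simp only [Pi.neg_apply, e0, e1, e2] at h0 h1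
    rw [h0] at h1; norm_num at h1

/-- A function with a simple zero has no continuous square root on a small circle around it. -/
theorem not_exists_continuous_sqrt_of_simple_zero {R S : ℂ → ℂ} {a₀ : ℂ}
    (hR : Continuous R) (h0 : R a₀ ≠ 0) {O : Set ℂ} (hO : O ∈ 𝓝 a₀)
    (hS : ContinuousOn S {a | a ∈ O ∧ a ≠ a₀ ∧ R a ≠ 0})
    (h : ∀ a ∈ O, a ≠ a₀ → R a ≠ 0 → S a ^ 2 = (a - a₀) * R a) : False := by
  have h1 : ∀ᶠ a in 𝓝 a₀, a ∈ O ∧ R a / R a₀ ∈ Complex.slitPlane := by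
    refine (eventually_mem_set.2 hO).and ?_
    refine (hR.div_const _).continuousAt.eventually (Complex.isOpen_slitPlane.mem_nhds ?_)
    simp only [div_self h0]; exact Complex.one_mem_slitPlane
  obtain ⟨ε, hε, hball⟩ := Metric.nhds_basis_closedBall.eventually_iff.1 h1
  have hεC : (ε : ℂ) ≠ 0 := by exact_mod_cast hε.ne'
  have mem : ∀ u : Circle, a₀ + ε * u ∈ O ∧ R (a₀ + ε * u) / R a₀ ∈ Complex.slitPlane := fun u =>
    hball (by simp [Circle.norm_coe, abs_of_pos hε])
  have ne : ∀ u : Circle, a₀ + ε * u ≠ a₀ := fun u hu =>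
    mul_ne_zero hεC (Circle.coe_ne_zero u) (by simpa using hu)
  have Rne : ∀ u : Circle, R (a₀ + ε * u) ≠ 0 := fun u hu => by
    have := (mem u).2
    rw [hu, zero_div] at this
    exact Complex.zero_notMem_slitPlane this
  obtain ⟨r, hr⟩ := IsAlgClosed.exists_pow_nat_eq (R a₀ * ε) two_pos
  have r0 : r ≠ 0 := fun hr0 => mul_ne_zero h0 hεC (by rw [← hr, hr0]; simp)
  refine not_exists_continuous_sqrt_circle (fun u => S (a₀ + ε * u) /
    (r * Complex.exp (Complex.log (R (a₀ + ε * u) / R a₀) / 2))) ?_ fun u => ?_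
  · have c1 : Continuous fun u : Circle => a₀ + ε * (u : ℂ) := by
      have := continuous_coe_turn; fun_prop
    refine Continuous.div ?_ ?_ fun u => mul_ne_zero r0 (Complex.exp_ne_zero _)
    · exact hS.comp_continuous c1 fun u => ⟨(mem u).1, ne u, Rne u⟩
    · refine continuous_const.mul (Complex.continuous_exp.comp (Continuous.div_const ?_ _))
      exact Continuous.clog ((hR.comp c1).div_const _) fun u => (mem u).2
  · rw [div_pow, h _ (mem u).1 (ne u) (Rne u), mul_pow, hr, ← Complex.exp_nat_mul,
      show ((2 : ℕ) : ℂ) * (Complex.log (R (a₀ + ε * u) / R a₀) / 2) =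
        Complex.log (R (a₀ + ε * u) / R a₀) by push_cast; ring,
      Complex.exp_log (div_ne_zero (Rne u) h0)]
    have := Rne u
    field_simp
    ring

/-- On the slice through the point with fixed `b`, the polynomial has a simple zero up to a positive
factor. This rules out an even winding number around the braid. -/
theorem not_exists_sqrt_braidPoly {n : ℕ} {w : BraidWord} (hN : 0 < w.length)
    {x : Sphere3} (hx : x ∈ closedBraid n w) (hw : ∀ l ∈ w, IsLetterOn n l) {U : Set Sphere3}
    (hU : U ∈ 𝓝 x) {g : Sphere3 → ℂ} (hg : ContinuousOn g (U \ closedBraid n w))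
    (h : ∀ y ∈ U \ closedBraid n w,
      g y ^ 2 = braidPoly n (cyclicLetter w) w.length (y.1 0) (y.1 1)) : False := by
  have hL := isLetterOn_cyclicLetter hN hw
  have hB := closedBraid_eq hN hw
  obtain ⟨j, s, hs, q, hq, ρ, hρ, h0, h1⟩ := hx
  have hρC : (ρ : ℂ) ≠ 0 := by exact_mod_cast hρ.ne'
  have e : x.1 1 = ρ * turn ((j + s) / w.length) := by
    rw [h1, coe_turn]; push_cast; rfl
  have b0 : x.1 1 ≠ 0 := by
    rw [e]; exact mul_ne_zero hρC (Circle.coe_ne_zero _)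
  have hb : ∀ a : ℂ, a ≠ 0 ∨ x.1 1 ≠ 0 := fun a => Or.inr b0
  set z : ℕ → ℂ := strandPoint (w.get j) s with hz
  have hQ : ∀ a, braidPoly n (cyclicLetter w) w.length a (x.1 1) =
      (a - x.1 0) * ∏ i ∈ (Finset.Icc 1 n).erase q, (a - ρ * z i) := fun a => by
    have hj : ((j : ℕ) : ℝ) = (((j : ℕ) : ℤ) : ℝ) := by simp
    rw [e, braidPoly_turn (cyclicLetter_add w) hN hρ.le, homPoly, hj,
      loopProd_eq hL (j := (j : ℕ)) ⟨by linarith [hs.1], by linarith [hs.2]⟩,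
      cyclicLetter_natCast _ j.2, add_sub_cancel_left, ← Finset.mul_prod_erase _ _ hq, h0]
    rfl
  set R : ℂ → ℂ := fun a => ∏ i ∈ (Finset.Icc 1 n).erase q, (a - ρ * z i) with hR
  have cR : Continuous R := continuous_finsetProd _ fun i _ => by fun_prop
  have R0 : R (x.1 0) ≠ 0 := by
    rw [hR]
    refine Finset.prod_ne_zero_iff.2 fun i hi hi0 => ?_
    rw [h0, ← mul_sub] at hi0
    exact (Finset.mem_erase.1 hi).1
      (strandPoint_injective _ _ (sub_eq_zero.1 ((mul_eq_zero.1 hi0).resolve_left hρC))).symm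
  set P : ℂ → Sphere3 := fun a => spherePoint a (x.1 1) with hP
  have cP : Continuous P := by
    rw [← continuousOn_univ]
    have := ContinuousOn.coverPoint (m := 0) (X := ℂ) (S := univ) (a := fun a => a)
      (b := fun _ => x.1 1) (y := fun _ => 0) continuousOn_id continuousOn_const continuousOn_const
      fun a _ => hb a
    exact continuous_fst.comp_continuousOn this
  have Px : P (x.1 0) = x := congrArg Prod.fst (coverPoint_coe 0 (x, (0 : ℂ)))
  have hσ : ∀ a, 0 < (pairNorm a (x.1 1))⁻¹ := fun a => inv_pos.2 (pairNorm_pos (hb a))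
  have QP : ∀ a, braidPoly n (cyclicLetter w) w.length ((P a).1 0) ((P a).1 1) =
      (((pairNorm a (x.1 1))⁻¹ : ℝ) : ℂ) ^ n * ((a - x.1 0) * R a) := fun a => by
    rw [hP]
    simp only
    rw [spherePoint_zero (hb a), spherePoint_one (hb a), braidPoly_mul (hσ a), hQ]
  have hPU : ∀ a ∈ P ⁻¹' U, a ≠ x.1 0 → R a ≠ 0 → P a ∈ U \ closedBraid n w := by
    refine fun a ha h1 h2 => ⟨ha, fun h3 => ?_⟩
    rw [hB, Set.mem_ofPred_eq, QP] at h3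
    exact mul_ne_zero (pow_ne_zero _ (by exact_mod_cast (hσ a).ne'))
      (mul_ne_zero (sub_ne_zero.2 h1) h2) h3
  have cn : Continuous fun a => pairNorm a (x.1 1) := by unfold pairNorm; fun_prop
  refine not_exists_continuous_sqrt_of_simple_zero cR R0
    (O := P ⁻¹' U) (S := fun a => g (P a) * ((√(pairNorm a (x.1 1) ^ n) : ℝ) : ℂ))
    (cP.continuousAt.preimage_mem_nhds (by rwa [Px])) ?_ ?_
  · refine ContinuousOn.mul ?_ (by fun_prop)
    exact hg.comp cP.continuousOn fun a ha => hPU a ha.1 ha.2.1 ha.2.2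
  · intro a ha h1 h2
    have h3 : (pairNorm a (x.1 1)) ≠ 0 := (pairNorm_pos (hb a)).ne'
    rw [mul_pow, h _ (hPU a ha h1 h2), QP, ← Complex.ofReal_pow, ← Complex.ofReal_pow,
      Real.sq_sqrt (pow_nonneg (pairNorm_pos (hb a)).le _), mul_right_comm, ← Complex.ofReal_mul,
      ← mul_pow, inv_mul_cancel₀ h3]
    simp

/-! ## Square roots on a double branched cover -/

section Signs

variable {M N : Type*} [TopologicalSpace N] {p : M → N}

/-- Near `x`, the function `Y'` is `ε` times `Y`. -/
def SignNear (p : M → N) (Y Y' : M → ℂ) (x : N) (ε : ℤˣ) : Prop :=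
  ∀ᶠ x' in 𝓝 x, ∀ v, p v = x' → Y' v = ((ε : ℤ) : ℂ) * Y v

theorem units_mul_self (ε : ℤˣ) : ((ε : ℤ) : ℂ) * ((ε : ℤ) : ℂ) = 1 := by
  rcases Int.units_eq_one_or ε with rfl | rfl <;> simp

theorem exists_sign_of_sq_eq {a b : ℂ} (h : a ^ 2 = b ^ 2) : ∃ ε : ℤˣ, a = ((ε : ℤ) : ℂ) * b := by
  rcases sq_eq_sq_iff_eq_or_eq_neg.1 h with h | h
  · exact ⟨1, by simp [h]⟩
  · exact ⟨-1, by simp [h]⟩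

theorem SignNear.trans {Y Y' Y'' : M → ℂ} {x : N} {ε ε' : ℤˣ} (h : SignNear p Y Y' x ε)
    (h' : SignNear p Y' Y'' x ε') : SignNear p Y Y'' x (ε' * ε) := by
  filter_upwards [h, h'] with x' h1 h2 v hv
  rw [h2 v hv, h1 v hv]; push_cast; ring

theorem SignNear.apply {Y Y' : M → ℂ} {ε : ℤˣ} {v : M} (h : SignNear p Y Y' (p v) ε) :
    Y' v = ((ε : ℤ) : ℂ) * Y v := h.self_of_nhds v rfl

end Signs

section Roots

variable {M N : Type*} [TopologicalSpace M] [TopologicalSpace N] {p : M → N} {B : Set N}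
  {Q : N → ℂ}

/-- `Y` is a square root of `Q ∘ p` over `U` that separates the points of the fibres of `p`. -/
structure IsRootOver (p : M → N) (Q : N → ℂ) (U : Set N) (Y : M → ℂ) : Prop where
  continuousOn : ContinuousOn Y (p ⁻¹' U)
  sq : ∀ v, p v ∈ U → Y v ^ 2 = Q (p v)
  inj : ∀ u v, p u ∈ U → p u = p v → Y u = Y v → u = v

theorem IsDoubleBranchedCover.exists_sheets (hp : IsDoubleBranchedCover p B) {x : N} (hx : x ∉ B) :
    ∃ W : Set N, IsOpen W ∧ x ∈ W ∧ ∃ (s₀ s₁ : N → M) (c : M → ℂ), ContinuousOn s₀ W ∧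
      ContinuousOn s₁ W ∧ ContinuousOn c (p ⁻¹' W) ∧ (∀ x' ∈ W, p (s₀ x') = x' ∧ c (s₀ x') = 1) ∧
      (∀ x' ∈ W, p (s₁ x') = x' ∧ c (s₁ x') = -1) ∧
      ∀ v, p v ∈ W → v = s₀ (p v) ∨ v = s₁ (p v) := by
  classical
  obtain ⟨-, W, hxW, oW, oW', H, hH⟩ := hp.covering x hx
  have pH : ∀ q, p (H.symm q).1 = q.1 := fun q => by rw [← hH, H.apply_symm_apply]
  set s : Fin 2 → N → M := fun i x' => if h : x' ∈ W then (H.symm (⟨x', h⟩, i)).1 else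
    (H.symm (⟨x, hxW⟩, i)).1 with hs
  have es : ∀ i (x' : W), s i x' = (H.symm (x', i)).1 := fun i x' => by simp [hs]
  set c : M → ℂ := fun v => if h : p v ∈ W then (if (H ⟨v, h⟩).2 = 0 then 1 else -1) else 0 with hc
  have ec : ∀ v : p ⁻¹' W, c v = if (H v).2 = 0 then 1 else -1 := fun v => by
    have : p v ∈ W := v.2
    simp [hc, this]
  have cs : ∀ i, ContinuousOn (s i) W := fun i => by
    rw [continuousOn_iff_continuous_domRestrict]
    have : W.domRestrict (s i) = fun x' => (H.symm (x', i)).1 := funext (es i)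
    rw [this]; fun_prop
  have ps : ∀ i, ∀ x' ∈ W, p (s i x') = x' := fun i x' hx' => by
    rw [es i ⟨x', hx'⟩, pH]
  have csv : ∀ i, ∀ x' ∈ W, c (s i x') = if i = 0 then 1 else -1 := fun i x' hx' => by
    have : s i x' = ((H.symm (⟨x', hx'⟩, i) : p ⁻¹' W) : M) := es i ⟨x', hx'⟩
    rw [this, ec, H.apply_symm_apply]
  refine ⟨W, oW, hxW, s 0, s 1, c, cs 0, cs 1, ?_, fun x' h => ⟨ps 0 x' h, by simp [csv 0 x' h]⟩,
    fun x' h => ⟨ps 1 x' h, by simp [csv 1 x' h]⟩, fun v hv => ?_⟩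
  · rw [continuousOn_iff_continuous_domRestrict]
    have : (p ⁻¹' W).domRestrict c = (fun i : Fin 2 => if i = 0 then (1 : ℂ) else -1) ∘
        fun v => (H v).2 := funext ec
    rw [this]
    exact continuous_of_discreteTopology.comp (by fun_prop)
  · have key : v = s (H ⟨v, hv⟩).2 (p v) := by
      rw [es _ ⟨p v, hv⟩]
      have : (⟨⟨p v, hv⟩, (H ⟨v, hv⟩).2⟩ : W × Fin 2) = H ⟨v, hv⟩ :=
        Prod.ext (Subtype.ext (hH ⟨v, hv⟩).symm) rfl
      rw [this, H.symm_apply_apply]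
    have two : ∀ i : Fin 2, i = 0 ∨ i = 1 := by decide
    rcases two (H ⟨v, hv⟩).2 with h | h
    · left; rw [h] at key; exact key
    · right; rw [h] at key; exact key

theorem IsDoubleBranchedCover.surjective (hp : IsDoubleBranchedCover p B) :
    Function.Surjective p := fun x => by
  by_cases hx : x ∈ B
  · obtain ⟨φ, ψ, -, -, h0, -, -, h⟩ := hp.branched x hx
    exact ⟨ψ (0, 0), by rw [h, ← h0, zero_pow two_ne_zero]⟩
  · obtain ⟨W, -, hxW, s₀, s₁, c, -, -, -, h, -⟩ := hp.exists_sheets hx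
    exact ⟨s₀ x, (h x hxW).1⟩

theorem IsDoubleBranchedCover.frequently_notMem (hp : IsDoubleBranchedCover p B) (x : N) :
    ∃ᶠ x' in 𝓝 x, x' ∉ B := by
  by_cases hx : x ∈ B
  · obtain ⟨φ, ψ, hφ, -, h0, hφB, -, -⟩ := hp.branched x hx
    have h1 : Tendsto (fun z : ℂ => φ (z, 0)) (𝓝[≠] 0) (𝓝 x) := by
      rw [← h0]
      exact (hφ.continuous.comp (Continuous.prodMk_left 0)).continuousAt.mono_left
        nhdsWithin_le_nhds
    refine h1.frequently (Eventually.frequently ?_)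
    filter_upwards [self_mem_nhdsWithin] with z hz hzB
    have : (z, (0 : ℝ)) ∈ φ ⁻¹' B := hzB
    rw [hφB] at this
    exact hz this
  · exact fun h => h.self_of_nhds hx

/-- Arbitrarily close to every point there are points off the branch set. There the root does not
vanish, and the quotient determines the sign. -/
theorem SignNear.unique (hp : IsDoubleBranchedCover p B) (hB : ∀ x, x ∈ B ↔ Q x = 0)
    {Y Y' : M → ℂ} {U : Set N} (hU : IsOpen U) (hY : IsRootOver p Q U Y) {x : N} (hx : x ∈ U)
    {ε ε' : ℤˣ} (h : SignNear p Y Y' x ε) (h' : SignNear p Y Y' x ε') : ε = ε' := by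
  obtain ⟨x', hx'B, h1, h2, hU'⟩ :=
    ((hp.frequently_notMem x).and_eventually (h.and (h'.and (hU.mem_nhds hx)))).exists
  obtain ⟨v, hv⟩ := hp.surjective x'
  have hYv : Y v ≠ 0 := fun h0 => hx'B ((hB x').2 (by rw [← hv, ← hY.sq v (hv ▸ hU'), h0]; simp))
  have := (h1 v hv).symm.trans (h2 v hv)
  have := mul_right_cancel₀ hYv this
  exact Units.ext (by exact_mod_cast this)

theorem isPreconnected_punctured_cylinder (δ η : ℝ) :
    IsPreconnected {q : ℂ × ℝ | q.1 ≠ 0 ∧ ‖q.1‖ < δ ∧ |q.2| < η} := by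
  have h : {q : ℂ × ℝ | q.1 ≠ 0 ∧ ‖q.1‖ < δ ∧ |q.2| < η} =
      (fun q : ℂ × ℝ => (Complex.exp q.1, q.2)) ''
        ({ξ : ℂ | Real.exp ξ.re < δ} ×ˢ {t : ℝ | |t| < η}) := by
    ext ⟨z, t⟩
    constructor
    · rintro ⟨h1, h2, h3⟩
      refine ⟨(Complex.log z, t), ⟨?_, h3⟩, ?_⟩
      · simpa [Complex.exp_log h1, ← Complex.norm_exp] using h2
      · simp [Complex.exp_log h1]
    · rintro ⟨⟨ξ, t'⟩, ⟨h1, h2⟩, h⟩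
      obtain ⟨rfl, rfl⟩ := Prod.ext_iff.1 h
      exact ⟨Complex.exp_ne_zero _, by simpa [Complex.norm_exp] using h1, h2⟩
  rw [h]
  refine (IsPreconnected.prod (Convex.isPreconnected ?_) (Convex.isPreconnected ?_)).image _
    (by fun_prop)
  · have h : IsLowerSet {y : ℝ | Real.exp y < δ} := fun x y hyx hx =>
      lt_of_le_of_lt (Real.exp_le_exp.2 hyx) hx
    exact h.ordConnected.convex.linear_preimage Complex.reLm
  · have : {t : ℝ | |t| < η} = Ioo (-η) η := by ext; simp [abs_lt]
    rw [this]
    exact convex_Ioo _ _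

/-- Off the branch set both roots change their sign between the two sheets, since they separate
them; the quotient is therefore a locally constant function downstairs. At a branch point the
punctured chart upstairs is connected, so the sign is constant there, and on the branch curve both
roots vanish. -/
theorem exists_signNear (hp : IsDoubleBranchedCover p B) (hB : ∀ x, x ∈ B ↔ Q x = 0)
    {Y Y' : M → ℂ} {U U' : Set N} (hU : IsOpen U) (hU' : IsOpen U') (hY : IsRootOver p Q U Y)
    (hY' : IsRootOver p Q U' Y') {x : N} (hx : x ∈ U) (hx' : x ∈ U') :
    ∃ ε, SignNear p Y Y' x ε := by
  by_cases hxB : x ∈ B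
  · obtain ⟨φ, ψ, hφ, hψ, h0, hφB, hr, hpψ⟩ := hp.branched x hxB
    have hmem : φ ⁻¹' (U ∩ U') ∈ 𝓝 ((0 : ℂ), (0 : ℝ)) :=
      hφ.continuous.continuousAt.preimage_mem_nhds
        (by rw [h0]; exact (hU.inter hU').mem_nhds ⟨hx, hx'⟩)
    obtain ⟨δ, hδ, hball⟩ := Metric.mem_nhds_iff.1 hmem
    obtain ⟨r, hr0, hrδ⟩ : ∃ r : ℝ, 0 < r ∧ r ^ 2 = δ := ⟨√δ, Real.sqrt_pos.2 hδ, Real.sq_sqrt hδ.le⟩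
    have hin : ∀ (z : ℂ) (t : ℝ), ‖z‖ < r → |t| < δ → p (ψ (z, t)) ∈ U ∩ U' := fun z t hz ht => by
      rw [hpψ]
      refine hball ?_
      rw [Metric.mem_ball, Prod.dist_eq, max_lt_iff, dist_zero_right, dist_zero_right, norm_pow,
        ← hrδ]
      exact ⟨pow_lt_pow_left₀ hz (norm_nonneg _) two_ne_zero, by rw [hrδ]; exact ht⟩
    have hQ0 : ∀ (z : ℂ) (t : ℝ), p (ψ (z, t)) ∈ B ↔ z = 0 := fun z t => by
      rw [hpψ]
      have : ((z ^ 2, t) : ℂ × ℝ) ∈ φ ⁻¹' B ↔ z ^ 2 = 0 := by rw [hφB]; rfl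
      exact this.trans (pow_eq_zero_iff two_ne_zero)
    have key : ∃ ε : ℤˣ, ∀ q ∈ {q : ℂ × ℝ | q.1 ≠ 0 ∧ ‖q.1‖ < r ∧ |q.2| < δ},
        Y' (ψ q) = ((ε : ℤ) : ℂ) * Y (ψ q) := by
      rcases (isPreconnected_punctured_cylinder r δ).eq_or_eq_neg_of_sq
        (g := fun q => Y' (ψ q)) (h := fun q => Y (ψ q))
        (hY'.continuousOn.comp hψ.continuous.continuousOn fun q hq => (hin _ _ hq.2.1 hq.2.2).2)
        (hY.continuousOn.comp hψ.continuous.continuousOn fun q hq => (hin _ _ hq.2.1 hq.2.2).1)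
        (fun q hq => by
          rw [hY'.sq _ (hin _ _ hq.2.1 hq.2.2).2, hY.sq _ (hin _ _ hq.2.1 hq.2.2).1])
        (fun q hq h0 => hq.1 ((hQ0 q.1 q.2).1 ((hB _).2 (by
          rw [← hY.sq _ (hin _ _ hq.2.1 hq.2.2).1, h0]; simp)))) with h | h
      · exact ⟨1, fun q hq => by simp [h q hq]⟩
      · exact ⟨-1, fun q hq => by simp [h q hq]⟩
    obtain ⟨ε, hε⟩ := key
    refine ⟨ε, ?_⟩
    have hO : φ '' (Metric.ball 0 δ) ∈ 𝓝 x :=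
      (hφ.isOpenMap _ Metric.isOpen_ball).mem_nhds ⟨(0, 0), Metric.mem_ball_self hδ, h0⟩
    filter_upwards [hO]
    rintro _ ⟨q, hq, rfl⟩ v hv
    have : v ∈ range ψ := by rw [hr]; exact ⟨q, hv.symm⟩
    obtain ⟨⟨z, t⟩, rfl⟩ := this
    rw [hpψ] at hv
    obtain rfl := hφ.injective hv
    rw [Metric.mem_ball, Prod.dist_eq, max_lt_iff] at hq
    have hz : ‖z‖ < r := by
      have h1 := hq.1
      simp only [Prod.fst_zero, dist_zero_right, norm_pow] at h1
      rw [← hrδ] at h1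
      exact lt_of_pow_lt_pow_left₀ 2 hr0.le h1
    have ht : |t| < δ := by
      have h1 := hq.2
      simpa using h1
    by_cases hz0 : z = 0
    · have h1 : Q (p (ψ (z, t))) = 0 := (hB _).1 ((hQ0 z t).2 hz0)
      have h2 := hY.sq _ (hin z t hz ht).1
      have h3 := hY'.sq _ (hin z t hz ht).2
      rw [h1] at h2 h3
      rw [eq_zero_of_pow_eq_zero h2, eq_zero_of_pow_eq_zero h3, mul_zero]
    · exact hε (z, t) ⟨hz0, hz, ht⟩
  · obtain ⟨W, oW, hxW, s₀, s₁, c, cs₀, cs₁, -, h0, h1, hs⟩ := hp.exists_sheets hxB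
    have pY : ∀ x' ∈ W, x' ∈ U → x' ∈ U' → x' ∉ B → Y (s₀ x') ≠ 0 ∧ Y' (s₀ x') ^ 2 = Y (s₀ x') ^ 2 ∧
        Y (s₁ x') = -Y (s₀ x') ∧ Y' (s₁ x') = -Y' (s₀ x') := by
      intro x' hW hxU hxU' hx'B
      have e0 := (h0 x' hW).1
      have e1 := (h1 x' hW).1
      have ne : s₁ x' ≠ s₀ x' := fun h => by
        have h2 := (h1 x' hW).2
        rw [h, (h0 x' hW).2] at h2
        norm_num at h2
      have a0 : Y (s₀ x') ^ 2 = Q x' := by rw [hY.sq _ (by rwa [e0]), e0]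
      have a1 : Y (s₁ x') ^ 2 = Q x' := by rw [hY.sq _ (by rwa [e1]), e1]
      have b0 : Y' (s₀ x') ^ 2 = Q x' := by rw [hY'.sq _ (by rwa [e0]), e0]
      have b1 : Y' (s₁ x') ^ 2 = Q x' := by rw [hY'.sq _ (by rwa [e1]), e1]
      refine ⟨fun h => hx'B ((hB _).2 (by rw [← a0, h]; simp)), by rw [a0, b0],
        (sq_eq_sq_iff_eq_or_eq_neg.1 (a1.trans a0.symm)).resolve_left fun h =>
          ne (hY.inj _ _ (by rwa [e1]) (e1.trans e0.symm) h),
        (sq_eq_sq_iff_eq_or_eq_neg.1 (b1.trans b0.symm)).resolve_left fun h =>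
          ne (hY'.inj _ _ (by rwa [e1]) (e1.trans e0.symm) h)⟩
    obtain ⟨n0, sq0, -, -⟩ := pY x hxW hx hx' hxB
    obtain ⟨ε, hε⟩ := exists_sign_of_sq_eq sq0
    refine ⟨ε, ?_⟩
    have cont : ∀ {Y : M → ℂ} {U : Set N}, IsOpen U → x ∈ U → IsRootOver p Q U Y →
        ContinuousAt (fun x' => Y (s₀ x')) x := fun hU hx hY => by
      refine ((hY.continuousOn.comp (t := p ⁻¹' _) (cs₀.mono inter_subset_left)
        fun x' hx' => ?_).continuousAt ((oW.inter hU).mem_nhds ⟨hxW, hx⟩))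
      rw [mem_preimage, (h0 x' hx'.1).1]; exact hx'.2
    have c1 : ContinuousAt (fun x' => Y' (s₀ x') + ((ε : ℤ) : ℂ) * Y (s₀ x')) x :=
      (cont hU' hx' hY').add (continuousAt_const.mul (cont hU hx hY))
    have ne : Y' (s₀ x) + ((ε : ℤ) : ℂ) * Y (s₀ x) ≠ 0 := by
      rw [hε, ← two_mul]
      refine mul_ne_zero two_ne_zero (mul_ne_zero (fun h => ?_) n0)
      have := units_mul_self ε
      rw [h] at this; simp at this
    have c2 : ∀ᶠ x' in 𝓝 x, x' ∉ B := by
      have : ∀ᶠ x' in 𝓝 x, Y (s₀ x') ≠ 0 := (cont hU hx hY).eventually_ne n0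
      filter_upwards [this, oW.mem_nhds hxW, hU.mem_nhds hx] with x' h hW hUx hB'
      refine h (eq_zero_of_pow_eq_zero (n := 2) ?_)
      rw [hY.sq _ (by rwa [(h0 x' hW).1]), (h0 x' hW).1]
      exact (hB _).1 hB'
    filter_upwards [c1.eventually_ne ne, c2, oW.mem_nhds hxW, hU.mem_nhds hx, hU'.mem_nhds hx']
      with x' hne hx'B hW hUx hUx' v hv
    obtain ⟨-, sq, o, o'⟩ := pY x' hW hUx hUx' hx'B
    have e : Y' (s₀ x') = ((ε : ℤ) : ℂ) * Y (s₀ x') := by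
      have h2 := units_mul_self ε
      have : (Y' (s₀ x') - ((ε : ℤ) : ℂ) * Y (s₀ x')) * (Y' (s₀ x') + ((ε : ℤ) : ℂ) * Y (s₀ x')) = 0 := by
        linear_combination sq - Y (s₀ x') ^ 2 * h2
      exact sub_eq_zero.1 ((mul_eq_zero.1 this).resolve_right hne)
    rcases hs v (by rwa [hv]) with h | h
    · rw [h, hv, e]
    · rw [h, hv, o, o', e]; ring

end Roots

/-! ## Local existence of square roots on a double branched cover -/

/-- A function that factors through the exponential map in its first argument. -/
theorem exists_factor_exp {F : ℂ × ℝ → ℂ} (hF : Continuous F)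
    (h : ∀ ξ ξ' t, Complex.exp ξ = Complex.exp ξ' → F (ξ, t) = F (ξ', t)) :
    ∃ G : ℂ × ℝ → ℂ, ContinuousOn G {q | q.1 ≠ 0} ∧ ∀ ξ t, G (Complex.exp ξ, t) = F (ξ, t) := by
  refine ⟨fun q => F (Complex.log q.1, q.2), fun q₀ hq₀ => ?_, fun ξ t => h _ _ _
    (Complex.exp_log (Complex.exp_ne_zero _))⟩
  have hq₀ : q₀.1 ≠ 0 := hq₀
  have h1 : ContinuousAt (fun q : ℂ × ℝ => F (Complex.log (q.1 / q₀.1) + Complex.log q₀.1, q.2)) q₀ := by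
    refine hF.continuousAt.comp (f := fun q : ℂ × ℝ =>
      (Complex.log (q.1 / q₀.1) + Complex.log q₀.1, q.2)) (ContinuousAt.prodMk ?_ continuousAt_snd)
    refine ContinuousAt.add (ContinuousAt.clog (continuousAt_fst.div_const _) ?_) continuousAt_const
    rw [div_self hq₀]; exact Complex.one_mem_slitPlane
  refine h1.continuousWithinAt.congr (fun q hq => h _ _ _ ?_) (h _ _ _ ?_)
  · have hq : q.1 ≠ 0 := hq
    rw [Complex.exp_add, Complex.exp_log hq, Complex.exp_log hq₀, Complex.exp_log (div_ne_zero hq hq₀),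
      div_mul_cancel₀ _ hq₀]
  · rw [div_self hq₀, Complex.log_one, zero_add]

/-- The increment of the logarithm `H` over one turn is an integer multiple of `2 π i`, constant by
connectedness. This `d` is the winding number around the branch curve. -/
theorem exists_winding {H : ℂ × ℝ → ℂ} (hH : Continuous H)
    (h : ∀ ξ t, Complex.exp (H (ξ + 2 * Real.pi * Complex.I, t)) = Complex.exp (H (ξ, t))) :
    ∃ d : ℤ, ∀ ξ t (k : ℤ), H (ξ + k * (2 * Real.pi * Complex.I), t) =
      H (ξ, t) + (k * d : ℤ) * (2 * Real.pi * Complex.I) := by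
  have hI : (2 * Real.pi * Complex.I : ℂ) ≠ 0 := Complex.two_pi_I_ne_zero
  set D : ℂ × ℝ → ℝ := fun q =>
    ((H (q.1 + 2 * Real.pi * Complex.I, q.2) - H q) / (2 * Real.pi * Complex.I)).re with hD
  have key : ∀ q : ℂ × ℝ, ∃ n : ℤ, H (q.1 + 2 * Real.pi * Complex.I, q.2) =
      H q + n * (2 * Real.pi * Complex.I) := fun q => Complex.exp_eq_exp_iff_exists_int.1 (h q.1 q.2)
  obtain ⟨d, hd⟩ := IsPreconnected.exists_int_eq (K := (univ : Set (ℂ × ℝ))) isPreconnected_univ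
    (h := D) (by rw [hD]; fun_prop) fun q _ => by
      obtain ⟨n, hn⟩ := key q
      refine ⟨n, ?_⟩
      rw [hD]; simp only
      rw [hn, add_sub_cancel_left, mul_div_cancel_right₀ _ hI, Complex.intCast_re]
  have step : ∀ ξ t, H (ξ + 2 * Real.pi * Complex.I, t) = H (ξ, t) + d * (2 * Real.pi * Complex.I) := by
    intro ξ t
    obtain ⟨n, hn⟩ := key (ξ, t)
    have h1 := hd (ξ, t) (mem_univ _)
    rw [hD] at h1
    simp only at h1 hn
    rw [hn, add_sub_cancel_left, mul_div_cancel_right₀ _ hI, Complex.intCast_re] at h1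
    have : n = d := by exact_mod_cast h1
    rw [hn, this]
  refine ⟨d, fun ξ t k => ?_⟩
  induction k with
  | zero => simp
  | succ k ih =>
    have e : ξ + ((k + 1 : ℤ) : ℂ) * (2 * Real.pi * Complex.I) =
        ξ + (k : ℤ) * (2 * Real.pi * Complex.I) + 2 * Real.pi * Complex.I := by push_cast; ring
    rw [e, step, ih]; push_cast; ring
  | pred k ih =>
    have h1 := step (ξ + ((-k - 1 : ℤ) : ℂ) * (2 * Real.pi * Complex.I)) t
    have e : ξ + ((-k - 1 : ℤ) : ℂ) * (2 * Real.pi * Complex.I) + 2 * Real.pi * Complex.I =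
        ξ + (-k : ℤ) * (2 * Real.pi * Complex.I) := by push_cast; ring
    rw [e, ih] at h1
    push_cast at h1 ⊢
    linear_combination -h1

theorem exp_int_mul_pi (d : ℤ) : Complex.exp (d * (Real.pi * Complex.I)) = (-1) ^ d := by
  rw [Complex.exp_int_mul, Complex.exp_pi_mul_I]

section Roots

variable {M N : Type*} [TopologicalSpace M] [TopologicalSpace N] {p : M → N} {B : Set N}
  {Q : N → ℂ}

theorem exists_local_root_of_notMem (hp : IsDoubleBranchedCover p B) (hB : ∀ x, x ∈ B ↔ Q x = 0)
    (hQ : Continuous Q) {x : N} (hx : x ∉ B) :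
    ∃ (U : Set N) (Y : M → ℂ), IsOpen U ∧ x ∈ U ∧ IsRootOver p Q U Y := by
  obtain ⟨W, oW, hxW, s₀, s₁, c, -, -, cc, h0, h1, hs⟩ := hp.exists_sheets hx
  have hQx : Q x ≠ 0 := fun h => hx ((hB x).2 h)
  have oS : IsOpen {x' | Q x' / Q x ∈ Complex.slitPlane} :=
    Complex.isOpen_slitPlane.preimage (hQ.div_const _)
  obtain ⟨r, hr⟩ := IsAlgClosed.exists_pow_nat_eq (Q x) two_pos
  have ne : ∀ x', Q x' / Q x ∈ Complex.slitPlane → Q x' ≠ 0 := fun x' h h0 => by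
    rw [h0, zero_div] at h; exact Complex.zero_notMem_slitPlane h
  set S : N → ℂ := fun x' => r * Complex.exp (Complex.log (Q x' / Q x) / 2) with hS
  have S2 : ∀ x', Q x' / Q x ∈ Complex.slitPlane → S x' ^ 2 = Q x' := fun x' h => by
    rw [hS]; simp only
    rw [mul_pow, hr, ← Complex.exp_nat_mul, show ((2 : ℕ) : ℂ) * (Complex.log (Q x' / Q x) / 2) =
      Complex.log (Q x' / Q x) by push_cast; ring, Complex.exp_log (div_ne_zero (ne x' h) hQx),
      mul_div_cancel₀ _ hQx]
  have cS : ContinuousOn S {x' | Q x' / Q x ∈ Complex.slitPlane} :=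
    continuousOn_const.mul (Complex.continuous_exp.comp_continuousOn
      ((ContinuousOn.clog (hQ.div_const _).continuousOn fun _ h => h).div_const _))
  have c2 : ∀ v, p v ∈ W → c v ^ 2 = 1 := fun v hv => by
    rcases hs v hv with h | h
    · rw [h, (h0 _ hv).2]; norm_num
    · rw [h, (h1 _ hv).2]; norm_num
  refine ⟨W ∩ {x' | Q x' / Q x ∈ Complex.slitPlane}, fun v => c v * S (p v), oW.inter oS,
    ⟨hxW, by rw [Set.mem_ofPred_eq, div_self hQx]; exact Complex.one_mem_slitPlane⟩, ?_, ?_, ?_⟩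
  · exact (cc.mono fun v hv => hv.1).mul (cS.comp hp.continuous.continuousOn fun v hv => hv.2)
  · intro v hv
    rw [mul_pow, c2 v hv.1, S2 _ hv.2, one_mul]
  · intro u v hu huv h
    have hv : p v ∈ W := huv ▸ hu.1
    have hS0 : S (p v) ≠ 0 := fun h => by
      have := S2 (p v) (huv ▸ hu.2)
      rw [h] at this
      exact ne _ (huv ▸ hu.2) (by rw [← this]; simp)
    rw [huv] at h
    have hc := mul_right_cancel₀ hS0 h
    rcases hs u hu.1 with hu' | hu' <;> rcases hs v hv with hv' | hv'
    · rw [hu', hv', huv]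
    · rw [hu', hv', (h0 _ hu.1).2, (h1 _ hv).2] at hc; norm_num at hc
    · rw [hu', hv', (h1 _ hu.1).2, (h0 _ hv).2] at hc; norm_num at hc
    · rw [hu', hv', huv]

/-- If the winding number `d` of `Q` around the branch curve were even, `Q` would have a square root
downstairs. Upstairs, after `z ↦ z²`, the winding number is `2d`, so a root exists. It is odd in `z`
because `d` is odd, and hence it separates the two sheets. -/
theorem exists_local_root_of_mem (hp : IsDoubleBranchedCover p B) (hB : ∀ x, x ∈ B ↔ Q x = 0)
    (hQ : Continuous Q) {b : N} (hb : b ∈ B)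
    (hsq : ∀ U ∈ 𝓝 b, ∀ g : N → ℂ, ContinuousOn g (U \ B) → ¬ ∀ y ∈ U \ B, g y ^ 2 = Q y) :
    ∃ (U : Set N) (Y : M → ℂ), IsOpen U ∧ b ∈ U ∧ IsRootOver p Q U Y := by
  obtain ⟨φ, ψ, hφ, hψ, h0, hφB, hr, hpψ⟩ := hp.branched b hb
  have hφB' : ∀ q, φ q ∈ B ↔ q.1 = 0 := fun q => by
    have : q ∈ φ ⁻¹' B ↔ q.1 = 0 := by rw [hφB]; rfl
    exact this
  obtain ⟨H, cH, eH⟩ := exists_log_lift (starConvex_univ ((0 : ℂ), (0 : ℝ))) (mem_univ _)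
    (f := fun q : ℂ × ℝ => Q (φ (Complex.exp q.1, q.2)))
    (hQ.comp (hφ.continuous.comp (by fun_prop))).continuousOn
    fun q _ h => Complex.exp_ne_zero q.1 ((hφB' _).1 ((hB _).2 h))
  have cH := continuousOn_univ.1 cH
  have eH : ∀ ξ t, Complex.exp (H (ξ, t)) = Q (φ (Complex.exp ξ, t)) := fun ξ t => eH _ (mem_univ _)
  obtain ⟨d, hd⟩ := exists_winding cH fun ξ t => by
    rw [eH, eH, Complex.exp_add, Complex.exp_two_pi_mul_I, mul_one]
  have half : ∀ z : ℂ, Complex.exp (z / 2) ^ 2 = Complex.exp z := fun z => by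
    rw [← Complex.exp_nat_mul]; congr 1; push_cast; ring
  have shift : ∀ (z : ℂ) (n : ℤ), Complex.exp ((z + n * (2 * Real.pi * Complex.I)) / 2) =
      (-1) ^ n * Complex.exp (z / 2) := fun z n => by
    rw [show (z + n * (2 * Real.pi * Complex.I)) / 2 = n * (Real.pi * Complex.I) + z / 2 by ring,
      Complex.exp_add, exp_int_mul_pi]
  obtain ⟨φ', hφ'⟩ : ∃ φ' : N → ℂ × ℝ, ∀ q, φ' (φ q) = q :=
    ⟨_, Function.leftInverse_invFun hφ.injective⟩
  obtain ⟨ψ', hψ'⟩ : ∃ ψ' : M → ℂ × ℝ, ∀ q, ψ' (ψ q) = q :=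
    ⟨_, Function.leftInverse_invFun hψ.injective⟩
  have d_odd : Odd d := by
    by_contra hdo
    have hde := Int.not_odd_iff_even.1 hdo
    obtain ⟨G, cG, eG⟩ := exists_factor_exp (F := fun q => Complex.exp (H q / 2)) (by fun_prop)
      fun ξ ξ' t h => by
        obtain ⟨k, rfl⟩ := Complex.exp_eq_exp_iff_exists_int.1 h
        rw [hd, shift, (hde.mul_left k).neg_one_zpow, one_mul]
    refine hsq (range φ) (hφ.isOpen_range.mem_nhds ⟨_, h0⟩) (fun x => G (φ' x)) ?_ ?_
    · rintro _ ⟨⟨q, rfl⟩, hq⟩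
      refine ContinuousAt.continuousWithinAt ?_
      rw [← hφ.continuousAt_iff (f := φ)]
      have : (fun x => G (φ' x)) ∘ φ = G := funext fun q => by simp [hφ']
      rw [this]
      exact cG.continuousAt ((isOpen_ne_fun continuous_fst continuous_const).mem_nhds
        fun h => hq ((hφB' q).2 h))
    · rintro _ ⟨⟨⟨z, t⟩, rfl⟩, hq⟩
      have hz : z ≠ 0 := fun h => hq ((hφB' (z, t)).2 h)
      simp only [hφ']
      rw [← Complex.exp_log hz, eG, half, eH]
  obtain ⟨G, cG, eG⟩ := exists_factor_exp (F := fun q => Complex.exp (H (2 * q.1, q.2) / 2))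
    (by fun_prop) fun ξ ξ' t h => by
      obtain ⟨k, rfl⟩ := Complex.exp_eq_exp_iff_exists_int.1 h
      simp only
      rw [show 2 * (ξ' + k * (2 * Real.pi * Complex.I)) =
        2 * ξ' + ((2 * k : ℤ) : ℂ) * (2 * Real.pi * Complex.I) by push_cast; ring, hd, shift,
        ((even_two_mul k).mul_right d).neg_one_zpow, one_mul]
  have G2 : ∀ z t, z ≠ 0 → G (z, t) ^ 2 = Q (φ (z ^ 2, t)) := fun z t hz => by
    rw [← Complex.exp_log hz, eG]
    simp only
    rw [half, eH, ← Complex.exp_nat_mul]; push_cast; rfl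
  have Gneg : ∀ z t, z ≠ 0 → G (-z, t) = -G (z, t) := fun z t hz => by
    have : -z = Complex.exp (Complex.log z + Real.pi * Complex.I) := by
      rw [Complex.exp_add, Complex.exp_log hz, Complex.exp_pi_mul_I]; ring
    rw [this, eG]
    conv_rhs => rw [← Complex.exp_log hz, eG]
    simp only
    rw [show 2 * (Complex.log z + Real.pi * Complex.I) =
      2 * Complex.log z + ((1 : ℤ) : ℂ) * (2 * Real.pi * Complex.I) by push_cast; ring, hd, shift,
      one_mul, d_odd.neg_one_zpow, neg_one_mul]
  classical
  set K : ℂ × ℝ → ℂ := fun q => if q.1 = 0 then 0 else G q with hK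
  have K2 : ∀ q : ℂ × ℝ, K q ^ 2 = Q (φ (q.1 ^ 2, q.2)) := fun q => by
    rw [hK]; simp only
    split_ifs with h
    · rw [(hB _).1 ((hφB' (q.1 ^ 2, q.2)).2 (by rw [h]; simp))]; simp
    · exact G2 q.1 q.2 h
  have cK : Continuous K := by
    rw [continuous_iff_continuousAt]
    intro q
    by_cases hq : q.1 = 0
    · have hKq : K q = 0 := by simp [hK, hq]
      rw [ContinuousAt, hKq, tendsto_zero_iff_norm_tendsto_zero]
      have e : (fun q => ‖K q‖) = fun q => √‖Q (φ (q.1 ^ 2, q.2))‖ := funext fun q => by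
        rw [← K2, norm_pow, Real.sqrt_sq (norm_nonneg _)]
      have c : Continuous fun q => ‖K q‖ := by
        rw [e]
        exact (hQ.comp (hφ.continuous.comp (by fun_prop))).norm.sqrt
      have := c.tendsto q
      rwa [hKq, norm_zero] at this
    · have hO : {q : ℂ × ℝ | q.1 ≠ 0} ∈ 𝓝 q :=
        (isOpen_ne_fun continuous_fst continuous_const).mem_nhds hq
      refine (cG.continuousAt hO).congr ?_
      filter_upwards [hO] with q' hq'
      simp only [hK]
      rw [if_neg hq']
  have hmem : ∀ v, p v ∈ range φ → ∃ q, ψ q = v := fun v hv => by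
    have : v ∈ range ψ := by rw [hr]; exact hv
    exact this
  refine ⟨range φ, fun v => K (ψ' v), hφ.isOpen_range, ⟨_, h0⟩, ?_, ?_, ?_⟩
  · intro v hv
    obtain ⟨q, rfl⟩ := hmem v hv
    refine ContinuousAt.continuousWithinAt ?_
    rw [← hψ.continuousAt_iff (f := ψ)]
    have : (fun v => K (ψ' v)) ∘ ψ = K := funext fun q => by simp [hψ']
    rw [this]
    exact cK.continuousAt
  · intro v hv
    obtain ⟨⟨z, t⟩, rfl⟩ := hmem v hv
    simp only [hψ']
    rw [K2, hpψ]
  · intro u v hu huv h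
    obtain ⟨⟨z, t⟩, rfl⟩ := hmem u hu
    obtain ⟨⟨z', t'⟩, rfl⟩ := hmem v (huv ▸ hu)
    rw [hpψ, hpψ] at huv
    obtain ⟨h1, h2⟩ := Prod.ext_iff.1 (hφ.injective huv)
    simp only at h1 h2
    subst h2
    rcases sq_eq_sq_iff_eq_or_eq_neg.1 h1 with rfl | rfl
    · rfl
    · by_cases hz : z' = 0
      · rw [hz, neg_zero]
      · exfalso
        simp only [hψ', hK, neg_eq_zero, if_neg hz] at h
        rw [Gneg _ _ hz] at h
        have : G (z', t) = 0 := by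
          have h3 : (2 : ℂ) * G (z', t) = 0 := by linear_combination -h
          exact (mul_eq_zero.1 h3).resolve_left two_ne_zero
        have h4 := G2 z' t hz
        rw [this] at h4
        exact pow_ne_zero 2 hz ((hφB' _).1 ((hB _).2 (by rw [← h4]; simp)))

end Roots

/-! ## Sections of a sign cocycle over a vector space -/

section Cocycle

variable {ι X : Type*} [TopologicalSpace X]

/-- The two-sheeted bundle of a sign cocycle. -/
def signCore (U : ι → Set X) (hU : ∀ i, IsOpen (U i)) (at' : X → ι) (hat : ∀ x, x ∈ U (at' x))
    (ε : ι → ι → X → ℤˣ) (cε : ∀ i j, ContinuousOn (ε i j) (U i ∩ U j))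
    (hε : ∀ i j k x, x ∈ U i → x ∈ U j → x ∈ U k → ε j k x * ε i j x = ε i k x) :
    FiberBundleCore ι X ℤˣ where
  baseSet := U
  isOpen_baseSet := hU
  indexAt := at'
  mem_baseSet_at := hat
  coordChange i j x v := ε i j x * v
  coordChange_self i x hx v := by
    have := hε i i i x hx hx hx
    rw [mul_eq_left] at this
    rw [this, one_mul]
  continuousOn_coordChange i j :=
    ((cε i j).comp continuousOn_fst fun _ h => h.1).mul continuousOn_snd
  coordChange_comp i j k x hx v := by
    rw [← mul_assoc, hε i j k x hx.1.1 hx.1.2 hx.2]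

/-- The signs are the transition functions of a two-sheeted covering. A map from a vector space
lifts to it, and the lift read in the local trivialisations gives signs that are matched by the
cocycle. -/
theorem exists_sign_section {V : Type*} [AddCommGroup V] [Module ℝ V] [TopologicalSpace V]
    [IsTopologicalAddGroup V] [ContinuousSMul ℝ V] {f : V → X} (hf : Continuous f)
    {U : ι → Set X} (hU : ∀ i, IsOpen (U i)) (hcov : ∀ x, ∃ i, x ∈ U i)
    {ε : ι → ι → X → ℤˣ} (cε : ∀ i j, ContinuousOn (ε i j) (U i ∩ U j))
    (hε : ∀ i j k x, x ∈ U i → x ∈ U j → x ∈ U k → ε j k x * ε i j x = ε i k x) :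
    ∃ σ : ι → V → ℤˣ, (∀ i, ContinuousOn (σ i) (f ⁻¹' U i)) ∧
      ∀ i j v, f v ∈ U i → f v ∈ U j → σ j v = ε i j (f v) * σ i v := by
  choose at' hat using hcov
  set Z := signCore U hU at' hat ε cε hε with hZ
  have hcover : IsCoveringMap (Bundle.TotalSpace.proj : Bundle.TotalSpace ℤˣ Z.Fiber → X) :=
    FiberBundle.isCoveringMap
  obtain ⟨g, cg, hg⟩ := hcover.exists_lift_of_starConvex (starConvex_univ (0 : V)) hf.continuousOn
    (e₀ := ⟨f 0, (1 : ℤˣ)⟩) rfl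
  have cg := continuousOn_univ.1 cg
  have hg : ∀ v, (g v).proj = f v := fun v => hg v (mem_univ v)
  have loc : ∀ v, ∃ s : ℤˣ, ∀ i, (Z.localTriv i (g v)).2 = ε (at' (f v)) i (f v) * s := fun v =>
    ⟨(g v).snd, fun i => by rw [FiberBundleCore.localTriv_apply, ← hg v]; rfl⟩
  refine ⟨fun i v => (Z.localTriv i (g v)).2, fun i => ?_, fun i j v hi hj => ?_⟩
  · refine continuous_snd.comp_continuousOn
      ((Z.localTriv i).continuousOn_toFun.comp cg.continuousOn fun v hv => ?_)
    have : g v ∈ (Z.localTriv i).source ↔ (g v).proj ∈ U i := Z.mem_localTriv_source i (g v)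
    refine this.2 ?_
    rw [hg]; exact hv
  · obtain ⟨s, hs⟩ := loc v
    simp only [hs]
    rw [← mul_assoc, hε _ i j _ (hat _) hi hj]

end Cocycle

/-! ## Global square roots over the sphere -/

section Sphere

variable {M : Type*} [TopologicalSpace M] {p : M → Sphere3} {B : Set Sphere3} {Q : Sphere3 → ℂ}

/-- The sphere without a point is a vector space by stereographic projection, so the signs between
local roots can be corrected consistently. -/
theorem exists_root_over_compl (hp : IsDoubleBranchedCover p B) (hB : ∀ x, x ∈ B ↔ Q x = 0)
    (hloc : ∀ x, ∃ (U : Set Sphere3) (Y : M → ℂ), IsOpen U ∧ x ∈ U ∧ IsRootOver p Q U Y)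
    (v : Sphere3) : ∃ Y : M → ℂ, IsRootOver p Q {v}ᶜ Y := by
  choose U Y hU hxU hY using hloc
  have hex : ∀ i j x, ∃ ε : ℤˣ, x ∈ U i → x ∈ U j → SignNear p (Y i) (Y j) x ε := fun i j x => by
    by_cases hi : x ∈ U i
    · by_cases hj : x ∈ U j
      · obtain ⟨ε, h⟩ := exists_signNear hp hB (hU i) (hU j) (hY i) (hY j) hi hj
        exact ⟨ε, fun _ _ => h⟩
      · exact ⟨1, fun _ h => absurd h hj⟩
    · exact ⟨1, fun h => absurd h hi⟩
  choose ε hε using hex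
  have cε : ∀ i j, ContinuousOn (ε i j) (U i ∩ U j) := fun i j x hx => by
    refine ContinuousAt.continuousWithinAt (ContinuousAt.congr (f := fun _ => ε i j x)
      continuousAt_const ?_)
    filter_upwards [eventually_eventually_nhds.2 (hε i j x hx.1 hx.2), (hU i).mem_nhds hx.1,
      (hU j).mem_nhds hx.2] with x' h hi hj
    exact SignNear.unique hp hB (hU i) (hY i) hi h (hε i j x' hi hj)
  have hv : ‖v.1‖ = 1 := mem_sphere_zero_iff_norm.1 v.2
  set S := stereographic hv with hS
  have Ssrc : S.source = {v}ᶜ := rfl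
  have cS : Continuous S.symm := by
    have := S.symm.continuousOn
    rwa [S.symm_source, stereographic_target, continuousOn_univ] at this
  have SS : ∀ x, x ≠ v → S.symm (S x) = x := fun x hx => S.left_inv (by rw [Ssrc]; exact hx)
  obtain ⟨σ, cσ, hσ⟩ := exists_sign_section cS hU (fun x => ⟨x, hxU x⟩) cε
    fun i j k x hi hj hk => SignNear.unique hp hB (hU i) (hY i) hi
      ((hε i j x hi hj).trans (hε j k x hj hk)) (hε i k x hi hk)
  set Y' : M → ℂ := fun w => ((σ (p w) (S (p w)) : ℤ) : ℂ) * Y (p w) w with hY'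
  have eY : ∀ i w, p w ≠ v → p w ∈ U i → Y' w = ((σ i (S (p w)) : ℤ) : ℂ) * Y i w := by
    intro i w hw hi
    have h1 := hσ i (p w) (S (p w)) (by rw [SS _ hw]; exact hi) (by rw [SS _ hw]; exact hxU _)
    rw [SS _ hw] at h1
    have h2 := (hε i (p w) (p w) hi (hxU _)).apply
    rw [hY']; simp only
    rw [h1, h2]
    push_cast
    linear_combination ((σ i (S (p w)) : ℤ) : ℂ) * Y i w * units_mul_self (ε i (p w) (p w))
  refine ⟨Y', fun w hw => ?_, fun w hw => ?_, fun u w hu huw h => ?_⟩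
  · have hw : p w ≠ v := hw
    have hO : p ⁻¹' (U (p w) ∩ {v}ᶜ) ∈ 𝓝 w := hp.continuous.continuousAt.preimage_mem_nhds
      (((hU _).inter isOpen_compl_singleton).mem_nhds ⟨hxU _, hw⟩)
    refine ContinuousAt.continuousWithinAt (ContinuousAt.congr
      (f := fun w' => ((σ (p w) (S (p w')) : ℤ) : ℂ) * Y (p w) w') (ContinuousAt.mul ?_ ?_) ?_)
    · have h1 : ContinuousAt (fun w' => σ (p w) (S (p w'))) w := by
        refine ContinuousAt.comp (f := fun w' => S (p w')) (g := σ (p w)) ?_ ?_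
        · exact (cσ (p w)).continuousAt
            (((hU _).preimage cS).mem_nhds (by rw [mem_preimage, SS _ hw]; exact hxU _))
        · exact ContinuousAt.comp (f := p) (g := S)
            (S.continuousAt (by rw [Ssrc]; exact hw)) hp.continuous.continuousAt
      exact ContinuousAt.comp (g := fun e : ℤˣ => ((e : ℤ) : ℂ))
        continuous_of_discreteTopology.continuousAt h1
    · exact (hY _).continuousOn.continuousAt (mem_of_superset hO fun w' h => h.1)
    · filter_upwards [hO] with w' h
      exact (eY _ _ h.2 h.1).symm
  · rw [hY']; simp only
    rw [mul_pow, sq, units_mul_self, one_mul, (hY _).sq _ (hxU _)]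
  · rw [hY'] at h; simp only at h
    rw [← huw] at h
    refine (hY _).inj _ _ (hxU _) huw (mul_left_cancel₀ (fun h0 => ?_) h)
    have := units_mul_self (σ (p u) (S (p u)))
    rw [h0] at this; simp at this

theorem isPreconnected_compl_pair (v v' : Sphere3) : IsPreconnected ({v}ᶜ ∩ {v'}ᶜ) := by
  have hv : ‖v.1‖ = 1 := mem_sphere_zero_iff_norm.1 v.2
  set S := stereographic hv with hS
  have Ssrc : S.source = {v}ᶜ := rfl
  have Stgt : S.target = univ := rfl
  have cS : Continuous S.symm := by
    have := S.symm.continuousOn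
    rwa [S.symm_source, Stgt, continuousOn_univ] at this
  have hf : Module.finrank ℝ (EuclideanSpace ℂ (Fin 2)) = 3 + 1 := by
    rw [← Module.finrank_mul_finrank ℝ ℂ (EuclideanSpace ℂ (Fin 2)), Complex.finrank_real_complex]
    simp
  have := Fact.mk hf
  have hr : 1 < Module.rank ℝ (ℝ ∙ v.1)ᗮ := by
    have h3 : Module.finrank ℝ (ℝ ∙ v.1)ᗮ = 3 :=
      Submodule.finrank_orthogonal_span_singleton (norm_pos_iff.1 (by rw [hv]; exact one_pos))
    have := Module.lt_rank_of_lt_finrank (R := ℝ) (M := (ℝ ∙ v.1)ᗮ) (n := 1) (by rw [h3]; norm_num)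
    exact_mod_cast this
  by_cases h : v' = v
  · have : {v}ᶜ ∩ {v'}ᶜ = S.symm '' univ := by
      rw [h, inter_self, ← Stgt, S.symm_image_target_eq_source]; rfl
    rw [this]
    exact isPreconnected_univ.image _ cS.continuousOn
  · have : {v}ᶜ ∩ {v'}ᶜ = S.symm '' {S v'}ᶜ := by
      ext x
      constructor
      · rintro ⟨h1, h2⟩
        refine ⟨S x, fun h3 => h2 (S.injOn ?_ ?_ h3), S.left_inv h1⟩
        · exact h1
        · exact h
      · rintro ⟨y, hy, rfl⟩
        have h1 : S.symm y ∈ S.source := S.map_target (by rw [Stgt]; exact mem_univ _)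
        refine ⟨h1, fun h2 => hy ?_⟩
        rw [mem_singleton_iff] at h2
        rw [mem_singleton_iff, ← h2, S.right_inv (by rw [Stgt]; exact mem_univ _)]
    rw [this]
    exact (isConnected_compl_singleton_of_one_lt_rank hr _).isPreconnected.image _ cS.continuousOn

/-- Two roots, over the complements of antipodal points, cover the sphere. The overlap is connected,
so a single sign makes them agree. -/
theorem exists_root (hp : IsDoubleBranchedCover p B) (hB : ∀ x, x ∈ B ↔ Q x = 0)
    (hloc : ∀ x, ∃ (U : Set Sphere3) (Y : M → ℂ), IsOpen U ∧ x ∈ U ∧ IsRootOver p Q U Y) :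
    ∃ Y : M → ℂ, IsRootOver p Q univ Y := by
  classical
  set v : Sphere3 := ⟨EuclideanSpace.single 0 1, by simp⟩ with hv
  obtain ⟨Y₁, h₁⟩ := exists_root_over_compl hp hB hloc v
  obtain ⟨Y₂, h₂⟩ := exists_root_over_compl hp hB hloc (-v)
  have hne : v ≠ -v := fun h => by
    have := congrArg (fun x : Sphere3 => x.1 0) h
    simp [hv] at this
    norm_num [self_eq_neg] at this
  have o : ∀ x : Sphere3, IsOpen ({x}ᶜ : Set Sphere3) := fun x => isOpen_compl_singleton
  have hex : ∀ x ∈ ({v}ᶜ ∩ {-v}ᶜ : Set Sphere3), ∃ ε : ℤˣ, SignNear p Y₂ Y₁ x ε := fun x hx =>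
    exists_signNear hp hB (o _) (o _) h₂ h₁ hx.2 hx.1
  obtain ⟨ε, hε⟩ : ∃ ε : ℤˣ, ∀ x ∈ ({v}ᶜ ∩ {-v}ᶜ : Set Sphere3), SignNear p Y₂ Y₁ x ε := by
    choose! ε hε using hex
    rcases ({v}ᶜ ∩ {-v}ᶜ : Set Sphere3).eq_empty_or_nonempty with h | ⟨x₀, hx₀⟩
    · exact ⟨1, by simp [h]⟩
    refine ⟨ε x₀, fun x hx => ?_⟩
    have cε : ContinuousOn ε ({v}ᶜ ∩ {-v}ᶜ) := fun x hx => by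
      refine ContinuousAt.continuousWithinAt (ContinuousAt.congr (f := fun _ => ε x)
        continuousAt_const ?_)
      filter_upwards [eventually_eventually_nhds.2 (hε x hx), ((o v).inter (o (-v))).mem_nhds hx]
        with x' h hx'
      exact SignNear.unique hp hB (o _) h₂ hx'.2 h (hε x' hx')
    rw [(isPreconnected_compl_pair v (-v)).constant cε hx₀ hx]
    exact hε x hx
  set Y : M → ℂ := fun w => if p w = v then ((ε : ℤ) : ℂ) * Y₂ w else Y₁ w with hY
  have e₁ : ∀ w, p w ≠ v → Y w = Y₁ w := fun w h => by simp [hY, h]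
  have e₂ : ∀ w, p w ≠ -v → Y w = ((ε : ℤ) : ℂ) * Y₂ w := fun w h => by
    by_cases hw : p w = v
    · simp [hY, hw]
    · rw [e₁ w hw]
      exact (hε _ ⟨hw, h⟩).apply
  have ε0 : ((ε : ℤ) : ℂ) ≠ 0 := fun h => by
    have := units_mul_self ε
    rw [h] at this; simp at this
  have cases' : ∀ w, p w ≠ v ∨ p w ≠ -v := fun w => by
    by_cases hw : p w = v
    · right; rw [hw]; exact hne
    · exact Or.inl hw
  refine ⟨Y, fun w _ => ContinuousAt.continuousWithinAt ?_, fun w _ => ?_, fun u w _ huw h => ?_⟩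
  · rcases cases' w with hw | hw
    · have hO : p ⁻¹' {v}ᶜ ∈ 𝓝 w := hp.continuous.continuousAt.preimage_mem_nhds ((o _).mem_nhds hw)
      refine (h₁.continuousOn.continuousAt hO).congr ?_
      filter_upwards [hO] with w' hw' using (e₁ w' hw').symm
    · have hO : p ⁻¹' {-v}ᶜ ∈ 𝓝 w := hp.continuous.continuousAt.preimage_mem_nhds ((o _).mem_nhds hw)
      refine ContinuousAt.congr (f := fun w => ((ε : ℤ) : ℂ) * Y₂ w)
        (continuousAt_const.mul (h₂.continuousOn.continuousAt hO)) ?_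
      filter_upwards [hO] with w' hw' using (e₂ w' hw').symm
  · rcases cases' w with hw | hw
    · rw [e₁ w hw, h₁.sq w hw]
    · rw [e₂ w hw, mul_pow, sq, units_mul_self, one_mul, h₂.sq w hw]
  · rcases cases' u with hu | hu
    · rw [e₁ u hu, e₁ w (huw ▸ hu)] at h
      exact h₁.inj u w hu huw h
    · rw [e₂ u hu, e₂ w (huw ▸ hu)] at h
      exact h₂.inj u w hu huw (mul_left_cancel₀ ε0 h)

/-- Compact neighbourhoods in charts have compact preimages, and finitely many of them cover the
sphere. Compactness turns the continuous bijection onto the surface `y² = Q` into a homeomorphism.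
-/
theorem IsDoubleBranchedCover.compactSpace (hp : IsDoubleBranchedCover p B) : CompactSpace M := by
  have key : ∀ x : Sphere3, ∃ K ∈ 𝓝 x, IsCompact (p ⁻¹' K) := by
    intro x
    by_cases hx : x ∈ B
    · obtain ⟨φ, ψ, hφ, hψ, h0, -, hr, hpψ⟩ := hp.branched x hx
      have hC : φ '' Metric.ball 0 1 ∈ 𝓝 x :=
        (hφ.isOpenMap _ Metric.isOpen_ball).mem_nhds ⟨(0, 0), Metric.mem_ball_self one_pos, h0⟩
      refine ⟨φ '' Metric.closedBall 0 1,
        mem_of_superset hC (image_mono Metric.ball_subset_closedBall), ?_⟩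
      have : p ⁻¹' (φ '' Metric.closedBall 0 1) = ψ '' Metric.closedBall 0 1 := by
        have e : ∀ (z : ℂ) (t : ℝ), ((z ^ 2, t) : ℂ × ℝ) ∈ Metric.closedBall (0 : ℂ × ℝ) 1 ↔
            (z, t) ∈ Metric.closedBall (0 : ℂ × ℝ) 1 := fun z t => by
          simp only [mem_closedBall_zero_iff, Prod.norm_def, max_le_iff, norm_pow]
          rw [sq_le_one_iff₀ (norm_nonneg z)]
        ext v
        constructor
        · rintro ⟨q, hq, hv⟩
          have : v ∈ range ψ := by rw [hr]; exact ⟨q, hv⟩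
          obtain ⟨⟨z, t⟩, rfl⟩ := this
          rw [hpψ] at hv
          rw [hφ.injective hv] at hq
          exact ⟨_, (e z t).1 hq, rfl⟩
        · rintro ⟨⟨z, t⟩, hq, rfl⟩
          rw [mem_preimage, hpψ]
          exact ⟨_, (e z t).2 hq, rfl⟩
      rw [this]
      exact (isCompact_closedBall _ _).image hψ.continuous
    · obtain ⟨W, oW, hxW, s₀, s₁, c, cs₀, cs₁, -, h0, h1, hs⟩ := hp.exists_sheets hx
      obtain ⟨K, hK, hKW, cK⟩ := local_compact_nhds (oW.mem_nhds hxW)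
      refine ⟨K, hK, ?_⟩
      have : p ⁻¹' K = s₀ '' K ∪ s₁ '' K := by
        ext v
        constructor
        · intro hv
          rcases hs v (hKW hv) with h | h
          · exact Or.inl ⟨p v, hv, h.symm⟩
          · exact Or.inr ⟨p v, hv, h.symm⟩
        · rintro (⟨x', hx', rfl⟩ | ⟨x', hx', rfl⟩)
          · rw [mem_preimage, (h0 x' (hKW hx')).1]; exact hx'
          · rw [mem_preimage, (h1 x' (hKW hx')).1]; exact hx'
      rw [this]
      exact (cK.image_of_continuousOn (cs₀.mono hKW)).union
        (cK.image_of_continuousOn (cs₁.mono hKW))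
  choose K hK cK using key
  obtain ⟨T, -, hT⟩ := isCompact_univ.elim_nhds_subcover K fun x _ => hK x
  refine ⟨?_⟩
  have : (univ : Set M) = ⋃ x ∈ T, p ⁻¹' K x := by
    ext w
    simpa using hT (mem_univ (p w))
  rw [this]
  exact T.isCompact_biUnion fun x _ => cK x

/-- The double cover of the sphere branched along the zero set of `Q` is the surface `y ^ 2 = Q`. -/
theorem IsDoubleBranchedCover.exists_homeomorph (hp : IsDoubleBranchedCover p B)
    (hB : ∀ x, x ∈ B ↔ Q x = 0) (hQ : Continuous Q)
    (hsq : ∀ b ∈ B, ∀ U ∈ 𝓝 b, ∀ g : Sphere3 → ℂ, ContinuousOn g (U \ B) →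
      ¬ ∀ y ∈ U \ B, g y ^ 2 = Q y) :
    ∃ e : M ≃ₜ {v : Sphere3 × ℂ | v.2 ^ 2 = Q v.1}, ∀ w, (e w).1.1 = p w := by
  obtain ⟨Y, hY⟩ := exists_root hp hB fun x => by
    by_cases hx : x ∈ B
    · exact exists_local_root_of_mem hp hB hQ hx (hsq x hx)
    · exact exists_local_root_of_notMem hp hB hQ hx
  have := hp.compactSpace
  have cY : Continuous Y := by
    have := hY.continuousOn
    rwa [preimage_univ, continuousOn_univ] at this
  let F : M → {v : Sphere3 × ℂ | v.2 ^ 2 = Q v.1} := fun w => ⟨(p w, Y w), hY.sq w (mem_univ _)⟩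
  have cF : Continuous F := (hp.continuous.prodMk cY).subtype_mk _
  have hF : Function.Bijective F := by
    constructor
    · intro u w h
      have h := Prod.ext_iff.1 (Subtype.ext_iff.1 h)
      exact hY.inj u w (mem_univ _) h.1 h.2
    · rintro ⟨⟨x, y⟩, h⟩
      have h : y ^ 2 = Q x := h
      by_cases hx : x ∈ B
      · obtain ⟨w, hw⟩ := hp.surjective x
        refine ⟨w, Subtype.ext (Prod.ext hw ?_)⟩
        have h1 := hY.sq w (mem_univ _)
        rw [hw, (hB x).1 hx] at h1
        rw [(hB x).1 hx] at h
        exact (eq_zero_of_pow_eq_zero h1).trans (eq_zero_of_pow_eq_zero h).symm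
      · obtain ⟨W, -, hxW, s₀, s₁, c, -, -, -, h0, h1, -⟩ := hp.exists_sheets hx
        have ne : s₁ x ≠ s₀ x := fun h => by
          have h2 := (h1 x hxW).2
          rw [h, (h0 x hxW).2] at h2
          norm_num at h2
        have a0 := hY.sq (s₀ x) (mem_univ _)
        have a1 := hY.sq (s₁ x) (mem_univ _)
        rw [(h0 x hxW).1] at a0
        rw [(h1 x hxW).1] at a1
        have opp : Y (s₁ x) = -Y (s₀ x) :=
          (sq_eq_sq_iff_eq_or_eq_neg.1 (a1.trans a0.symm)).resolve_left fun h =>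
            ne (hY.inj _ _ (mem_univ _) ((h1 x hxW).1.trans (h0 x hxW).1.symm) h)
        rcases sq_eq_sq_iff_eq_or_eq_neg.1 (h.trans a0.symm) with h2 | h2
        · exact ⟨s₀ x, Subtype.ext (Prod.ext (h0 x hxW).1 h2.symm)⟩
        · exact ⟨s₁ x, Subtype.ext (Prod.ext (h1 x hxW).1 (opp.trans h2.symm))⟩
  exact ⟨Continuous.homeoOfEquivCompactToT2 (f := Equiv.ofBijective F hF) cF, fun w => rfl⟩

end Sphere

/-! ## The linking number of the lifts of the axis -/

/-- The value is `m (2k - 3)² + (132k² - 150k + 36)`. The second summand is negative only for real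
`k` strictly between 0 and 1. -/
theorem linking_formula_pos (m k : ℕ) (hm : 2 ≤ m) :
    (0 : ℤ) < (4 * m + 132) * k ^ 2 - (12 * m + 150) * k + (9 * m + 36) := by
  have hm' : (2 : ℤ) ≤ m := by exact_mod_cast hm
  rcases Nat.lt_or_ge k 2 with hk | hk
  · interval_cases k <;> push_cast <;> linarith
  · have hk' : (2 : ℤ) ≤ k := by exact_mod_cast hk
    nlinarith [mul_nonneg (sub_nonneg.2 hm') (sq_nonneg (2 * (k : ℤ) - 3)), sq_nonneg ((k : ℤ) - 2)]

section Transfer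

variable {M : Type*} [TopologicalSpace M] {m : ℕ} {L : ℤ → ℕ × Bool} {w : BraidWord} {A : ℕ → ℤ}

theorem exists_linking_axis_lifts (e : M ≃ₜ braidCover m L w.length)
    (hL : ∀ j, IsLetterOn (2 * m) (L j))
    (hw : ∀ (k : ℕ) (hk : k < w.length), L k = w[k]) (hwl : ∀ l ∈ w, IsLetterOn (2 * m) l)
    (hN : 0 < w.length) (hp : ∀ j, L (j + w.length) = L j)
    (hA : EqOn (wordAct w A) (fun i => A i + 1) (Icc 1 (2 * m))) :
    ∃ γ₁ γ₂ : Circle → M, Topology.IsEmbedding γ₁ ∧ Topology.IsEmbedding γ₂ ∧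
      Disjoint (range γ₁) (range γ₂) ∧ {v | (e v).1.1.1 1 = 0} = range γ₁ ∪ range γ₂ ∧
      HasLinkingNumber (range γ₁) γ₂ (altSum (2 * m) A) := by
  classical
  obtain ⟨g₁, i₁, r₁, e₁⟩ := exists_axis_loop (m := m) (L := L) (N := w.length) (one_pow 2)
  obtain ⟨g₂, i₂, r₂, e₂⟩ := exists_axis_loop (m := m) (L := L) (N := w.length)
    (show (-1 : ℂ) ^ 2 = 1 by norm_num)
  obtain ⟨r, hr, φ, hφ, hφK, hφμ⟩ := exists_meridian_chart hL hp
  have hrange : ∀ g : Circle → braidCover m L w.length,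
      range (fun u => e.symm (g u)) = e ⁻¹' range g := fun g => by
    ext v
    exact ⟨fun ⟨u, hu⟩ => ⟨u, by rw [← hu, e.apply_symm_apply]⟩,
      fun ⟨u, hu⟩ => ⟨u, by simp only [hu, e.symm_apply_apply]⟩⟩
  have hR₁ : ∀ v, v ∈ range (fun u => e.symm (g₁ u)) ↔ (e v).1 ∈ axisLift m 1 := fun v => by
    rw [hrange, r₁]; rfl
  have hR₂ : ∀ v, v ∈ range (fun u => e.symm (g₂ u)) ↔ (e v).1 ∈ axisLift m (-1) := fun v => by
    rw [hrange, r₂]; rfl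
  have hdisj : Disjoint (axisLift m 1) (axisLift m (-1)) := by
    rw [Set.disjoint_left]
    rintro v ⟨h1, h2⟩ ⟨-, h3⟩
    rw [h2, one_mul, neg_one_mul, self_eq_neg] at h3
    exact pow_ne_zero m ((coe_ne_zero v.1).resolve_right fun h => h h1) h3
  refine ⟨fun u => e.symm (g₁ u), fun u => e.symm (g₂ u), e.symm.isEmbedding.comp i₁,
    e.symm.isEmbedding.comp i₂, ?_, ?_, ?_, fun u => e.symm (φ ((u : ℂ), 0)), ?_, ?_, ?_⟩
  · rw [Set.disjoint_left]
    exact fun v h1 h2 => Set.disjoint_left.1 hdisj ((hR₁ v).1 h1) ((hR₂ v).1 h2)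
  · ext v
    rw [mem_union, hR₁, hR₂]
    constructor
    · intro h
      have h0 : (e v).1.1.1 1 = 0 := h
      have h1 : (e v).1.2 ^ 2 = braidPoly (2 * m) L w.length ((e v).1.1.1 0) ((e v).1.1.1 1) :=
        (e v).2
      rw [h0, braidPoly_zero, mul_comm 2 m, pow_mul] at h1
      rcases sq_eq_sq_iff_eq_or_eq_neg.1 h1 with h2 | h2
      · exact Or.inl ⟨h0, by rw [h2, one_mul]⟩
      · exact Or.inr ⟨h0, by rw [h2, neg_one_mul]⟩
    · rintro (h | h) <;> exact h.1
  · intro u hu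
    exact Set.disjoint_left.1 hdisj ((hR₁ _).1 hu) ((hR₂ _).1 ⟨u, rfl⟩)
  · refine ⟨fun q => e.symm (φ q), e.symm.isOpenEmbedding.comp hφ, ?_, fun u => rfl⟩
    rw [← hφK]
    ext q
    rw [mem_preimage, hR₁, e.apply_symm_apply]
    rfl
  · obtain ⟨f, cf, hf⟩ := exists_cover_function hL hw hN hp hA hr
    refine ⟨fun v => f (e v).1, ?_, ?_⟩
    · exact cf.comp (continuous_subtype_val.comp e.continuous).continuousOn fun v hv =>
        ⟨(e v).2, fun h => hv ((hR₁ v).2 h)⟩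
    · simpa only [Function.comp_def, e.apply_symm_apply, hφμ] using hf
  · intro f cf hf
    -- A function on `M` becomes one on the ambient space; the value 1 off the surface is
    -- irrelevant, since continuity is only required within the surface.
    set f' : Sphere3 × ℂ → Circle := fun v =>
      if h : v ∈ braidCover m L w.length then f (e.symm ⟨v, h⟩) else 1 with hf'
    have ef : ∀ v : braidCover m L w.length, f' v.1 = f (e.symm v) := fun v => by simp [hf']
    have key := hasDegree_of_meridian (f := f') hL hw hwl hN hp hA hr ?_ ?_
    · simpa only [Function.comp_def, ← ef, e₂, neg_one_mul] using key
    · have h1 : ContinuousOn (fun v : braidCover m L w.length => f (e.symm v))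
          {v | v.1 ∉ axisLift m 1} := cf.comp e.symm.continuous.continuousOn fun v hv h =>
        hv (by have := (hR₁ _).1 h; rwa [e.apply_symm_apply] at this)
      rintro v ⟨hv, hK⟩
      have h2 := h1 ⟨v, hv⟩ hK
      have h3 : Tendsto f' (𝓝[braidCover m L w.length \ axisLift m 1] v) (𝓝 (f' v)) := by
        have e3 : 𝓝[braidCover m L w.length \ axisLift m 1] v =
            map Subtype.val (𝓝[{v : braidCover m L w.length | v.1 ∉ axisLift m 1}] ⟨v, hv⟩) := by
          rw [Topology.IsInducing.subtypeVal.map_nhdsWithin_eq]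
          congr 1
          ext y
          constructor
          · rintro ⟨h4, h5⟩; exact ⟨⟨y, h4⟩, h5, rfl⟩
          · rintro ⟨y, h4, rfl⟩; exact ⟨y.2, h4⟩
        rw [e3, tendsto_map'_iff]
        have : f' ∘ Subtype.val = fun v : braidCover m L w.length => f (e.symm v) := funext ef
        rw [this, show f' v = f (e.symm ⟨v, hv⟩) from ef ⟨v, hv⟩]
        exact h2
      exact h3
    · simpa only [Function.comp_def, ← ef, hφμ] using hf

end Transfer

theorem mainTheorem5 {M : Type*} [TopologicalSpace M] (m k : ℕ) (hm : 2 ≤ m)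
    (p : M → Sphere3)
    (hp : IsDoubleBranchedCover p (closedBraid (2 * m) (birmanMenascoWord (2 * m) k))) :
    ∃ γ₁ γ₂ : Circle → M,
      Topology.IsEmbedding γ₁ ∧ Topology.IsEmbedding γ₂ ∧
      Disjoint (Set.range γ₁) (Set.range γ₂) ∧
      p ⁻¹' braidAxis = Set.range γ₁ ∪ Set.range γ₂ ∧
      ∃ n : ℤ, HasLinkingNumber (Set.range γ₁) γ₂ n ∧ n ≠ 0 ∧
        |n| = (4 * m + 132) * k ^ 2 - (12 * m + 150) * k + (9 * m + 36) := by
  obtain ⟨A, hA, hn⟩ := exists_wordAct_birmanMenascoWord m k hm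
  have hwl : ∀ l ∈ birmanMenascoWord (2 * m) k, IsLetterOn (2 * m) l := by
    obtain ⟨j, hj⟩ : ∃ j, 2 * m = j + 4 := ⟨2 * m - 4, by omega⟩
    rw [hj]; exact isLetterOn_birmanMenascoWord j k
  have hN : 0 < (birmanMenascoWord (2 * m) k).length := by simp [birmanMenascoWord]
  generalize birmanMenascoWord (2 * m) k = w at *
  have hL := isLetterOn_cyclicLetter hN hwl
  have hper := cyclicLetter_add w
  have hB := closedBraid_eq hN hwl
  have hQ : Continuous fun x : Sphere3 =>
      braidPoly (2 * m) (cyclicLetter w) w.length (x.1 0) (x.1 1) :=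
    (continuous_braidPoly hL hper).comp
      (f := fun x : Sphere3 => ((x.1 0, x.1 1) : ℂ × ℂ)) (by fun_prop)
  -- The only input about the branch set is that `Q` vanishes exactly there and has no local square
  -- root around any of its points.
  obtain ⟨e, he⟩ := hp.exists_homeomorph (fun x => by rw [hB]; rfl) hQ
    fun b hb U hU g hg h => not_exists_sqrt_braidPoly hN hb hwl hU hg h
  obtain ⟨γ₁, γ₂, i₁, i₂, hd, hu, hl⟩ := exists_linking_axis_lifts (L := cyclicLetter w) e hL
    (fun k hk => cyclicLetter_natCast k hk) hwl hN hper hA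
  have hpos := linking_formula_pos m k hm
  refine ⟨γ₁, γ₂, i₁, i₂, hd, ?_, altSum (2 * m) A, hl, ?_, ?_⟩
  · rw [← hu]
    ext v
    exact Iff.of_eq (congrArg (fun x : Sphere3 => x.1 1 = 0) (he v).symm)
  · rw [hn]; exact hpos.ne'
  · rw [hn, abs_of_pos hpos]
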